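/- **Setting.** Let $\{X(t):t\in[0,1]\}$ be a jointly measurable process with mean $\mu(t)=\mathrm E X(t)$, fluctuation $\Phi=X-\mu$ and covariance $\gamma(s,t)=\mathrm{Cov}\{X(s),X(t)\}$. Block $k\ge 1$ contains $n_k\ge1$ subjects, the $i$-th with $m_{ki}\ge1$ measurements $Y_{kij}=X_{ki}(T_{kij})+\varepsilon_{kij}$, where the $X_{ki}$ are i.i.d. copies of $X$, the $T_{kij}$ are i.i.d. with density $f$ on $[0,1]$, the $\varepsilon_{kij}$ are i.i.d. with mean $0$ and variance $\sigma^2$, and these three families are independent. Put $$s_{k,j}=\sum_{i=1}^{n_k}m_{ki}(m_{ki}-1)\cdots(m_{ki}-j+1),\quad S_{K,j}=\sum_{k=1}^Ks_{k,j},\quad N_K=\sum_{k=1}^Kn_k,\quad \overline m_{\mu,K}=\frac{S_{K,1}}{N_K},\ \overline m_{\gamma,K}=\frac{S_{K,2}}{N_K},\ \overline m_{j,K}=\frac{S_{K,j}}{N_K}\ (j\ge3).$$ Let $W$ be a kernel, $W_h(u)=W(u/h)/h$, $T_{kij}(t)=(1,T_{kij}-t)^{\mathrm T}$, and $$P_k(t;h)=\sum_{i=1}^{n_k}\sum_{j=1}^{m_{ki}}W_h(T_{kij}-t)T_{kij}(t)T_{kij}(t)^{\mathrm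 T},\qquad q_k(t;h)=\sum_{i=1}^{n_k}\sum_{j=1}^{m_{ki}}W_h(T_{kij}-t)T_{kij}(t)Y_{kij}.$$ **Online estimate.** At each block $K\ge1$ there are $L\ge1$ deterministic candidate bandwidths $\widetilde h_\mu^{(K)}=\eta_1^{(K)}>\cdots>\eta_L^{(K)}>0$. With $\omega_k^{(K)}=s_{k,1}/S_{K,1}$, $\phi_l^{(0)}=0$, $\widetilde P^{(0)}_l=0$, $\widetilde q^{(0)}_l=0$, define recursively, for $1\le l\le L$, $$j_l^{(K)}\in\operatorname*{argmin}_{1\le i\le L}\big|\eta_l^{(K)}-\phi_i^{(K-1)}\big|,\qquad \phi_l^{(K)}=(1-\omega_K^{(K)})\,\phi^{(K-1)}_{j_l^{(K)}}+\omega_K^{(K)}\eta_l^{(K)},$$ $$\widetilde P_l^{(K)}(t)=P_K(t;\eta_l^{(K)})+\widetilde P^{(K-1)}_{j_l^{(K)}}(t),\qquad \widetilde q_l^{(K)}(t)=q_K(t;\eta_l^{(K)})+\widetilde q^{(K-1)}_{j_l^{(K)}}(t)$$ (ties broken arbitrarily). The online local-linear mean estimate is $\widetilde\mu^{(K)}(t)=(1,0)\{\widetilde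 P_1^{(K)}(t)\}^{-1}\widetilde q_1^{(K)}(t)$. Let $\widetilde\eta_k^{(K)}$ be the candidate bandwidth of block $k$ that is used in $\widetilde P_1^{(K)}$, and $\rho_{\mu,r}^{(K)}=\sum_{k=1}^K\omega_k^{(K)}(\widetilde\eta_k^{(K)})^r$ for $r\in\mathbb Z$. **Assumptions.** (i) $f$ is bounded away from $0$ and has a bounded second derivative. (ii) $\mu$ has a bounded continuous second derivative, and $\gamma$ has bounded continuous derivatives of second and fourth order. (iii) $\sup_{t\in[0,1]}\mathrm E|\Phi(t)|^3<\infty$ and $\mathrm E|\varepsilon|^3<\infty$. (iv) $\limsup_K\overline m_{\gamma,K}/\overline m_{\mu,K}^2<\infty$, $\limsup_K\overline m_{\mu,K}\overline m_{3,K}/\overline m_{\gamma,K}^2<\infty$, $\limsup_K\overline m_{4,K}/\overline m_{\gamma,K}^2<\infty$ (with $0/0=0$). (v) $W$ is a symmetric probability density on $[-1,1]$, Lipschitz on $[0,1]$. (vi) $\widetilde h_\mu^{(K)}/S_{K,1}^{-1/5}$ converges to a limit in $(0,\infty)$, and there is $c>0$ with $\eta_L^{(K)}\ge c\,\widetilde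 h_\mu^{(K)}$ for all $K$. **Theorem 1.** Let $R(W)=\int W(x)^2dx$, $\alpha(W)=\int x^2W(x)dx$, let $t\in(0,1)$, and put $$\Gamma_{0}(t)=R(W)\frac{\gamma(t,t)+\sigma^2}{f(t)},\qquad \Gamma_\mu^{(K)}(t)=\Gamma_0(t)+\gamma(t,t)\frac{S_{K,2}}{S_{K,1}\rho_{\mu,-1}^{(K)}}.$$ There are random variables $R_K=o_p(\rho_{\mu,2}^{(K)})$ such that, as $K\to\infty$, $$Z_K=\Big\{\frac{S_{K,1}}{\rho_{\mu,-1}^{(K)}}\Big\}^{1/2}\Big\{\widetilde\mu^{(K)}(t)-\mu(t)-\tfrac12\alpha(W)\mu''(t)\rho_{\mu,2}^{(K)}+R_K\Big\}$$ is asymptotically $N(0,\Gamma_\mu^{(K)}(t))$: if $\gamma(t,t)+\sigma^2>0$ then $Z_K/\{\Gamma_\mu^{(K)}(t)\}^{1/2}\to N(0,1)$ in distribution, and if $\gamma(t,t)+\sigma^2=0$ then $Z_K\to0$ in distribution. Moreover: 1. (sparse) if $\overline m_{\mu,K}/N_K^{1/4}\to0$, then $\Gamma_\mu^{(K)}(t)\to\Gamma_0(t)$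 and $Z_K\to N(0,\Gamma_0(t))$ in distribution; 2. (moderately dense) if $\overline m_{\mu,K}/N_K^{1/4}\to C\in(0,\infty)$, then $S_{K,2}/\{S_{K,1}\rho_{\mu,-1}^{(K)}\}$ is eventually bounded and bounded away from $0$; if it converges to a limit $C_1$, then $C_1>0$, $\Gamma_\mu^{(K)}(t)\to\Gamma_0(t)+C_1\gamma(t,t)$ and $Z_K\to N\big(0,\Gamma_0(t)+C_1\gamma(t,t)\big)$ in distribution; 3. (ultra dense) if $\overline m_{\mu,K}/N_K^{1/4}\to\infty$, then $S_{K,1}^2/S_{K,2}$ is of exact order $N_K$ and, in distribution, $$\Big\{\frac{S_{K,1}^2}{S_{K,2}}\Big\}^{1/2}\big\{\widetilde\mu^{(K)}(t)-\mu(t)\big\}\to N\big(0,\gamma(t,t)\big).$$ -/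

import Mathlib

open MeasureTheory ProbabilityTheory Filter Set Topology Asymptotics
open scoped Matrix

noncomputable section

namespace OnlineFDA

/-! ### Sample sizes

Blocks are numbered `1, 2, 3, …`; block `k` has `n k` subjects, numbered `0, …, n k - 1`, and
subject `i` of block `k` has `m k i` measurements, numbered `0, …, m k i - 1`. -/

/-- `s_{k,j} = ∑_i m_{ki} (m_{ki} - 1) ⋯ (m_{ki} - j + 1)`. -/
def blockSize (n : ℕ → ℕ) (m : ℕ → ℕ → ℕ) (j k : ℕ) : ℝ :=
  ∑ i ∈ Finset.range (n k), ((m k i).descFactorial j : ℝ)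

/-- `S_{K,j} = ∑_{k ≤ K} s_{k,j}`. -/
def totalSize (n : ℕ → ℕ) (m : ℕ → ℕ → ℕ) (j K : ℕ) : ℝ :=
  ∑ k ∈ Finset.Icc 1 K, blockSize n m j k

/-- `N_K`, the number of subjects in the first `K` blocks. -/
def numSubjects (n : ℕ → ℕ) (K : ℕ) : ℝ :=
  ∑ k ∈ Finset.Icc 1 K, (n k : ℝ)

/-- `S_{K,j} / N_K`; it is `m̄_{μ,K}` for `j = 1`, `m̄_{γ,K}` for `j = 2`, `m̄_{j,K}` for `j ≥ 3`. -/
def avgSize (n : ℕ → ℕ) (m : ℕ → ℕ → ℕ) (j K : ℕ) : ℝ :=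
  totalSize n m j K / numSubjects n K

/-- The weight `ω_k^{(K)} = s_{k,1} / S_{K,1}`. -/
def weight (n : ℕ → ℕ) (m : ℕ → ℕ → ℕ) (k K : ℕ) : ℝ :=
  blockSize n m 1 k / totalSize n m 1 K

/-- Conditions on the numbers of subjects and of measurements. -/
structure SizeCond (n : ℕ → ℕ) (m : ℕ → ℕ → ℕ) : Prop where
  subjects_pos : ∀ k, 1 ≤ k → 1 ≤ n k
  measurements_pos : ∀ k, 1 ≤ k → ∀ i < n k, 1 ≤ m k i
  limsup_two : IsBoundedUnder (· ≤ ·) atTop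
    (fun K => avgSize n m 2 K / avgSize n m 1 K ^ 2)
  limsup_three : IsBoundedUnder (· ≤ ·) atTop
    (fun K => avgSize n m 1 K * avgSize n m 3 K / avgSize n m 2 K ^ 2)
  limsup_four : IsBoundedUnder (· ≤ ·) atTop
    (fun K => avgSize n m 4 K / avgSize n m 2 K ^ 2)

/-! ### Kernel -/

/-- `W` is a symmetric probability density on `[-1, 1]`, Lipschitz on `[0, 1]`. -/
structure KernelCond (W : ℝ → ℝ) : Prop where
  nonneg : ∀ u, 0 ≤ W u
  symm : ∀ u, W (-u) = W u
  support : ∀ u, 1 < |u| → W u = 0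
  integral_eq_one : ∫ u, W u = 1
  lipschitz : ∃ C : NNReal, LipschitzOnWith C W (Icc 0 1)

/-- `W_h(u) = W(u / h) / h`. -/
def scaledKernel (W : ℝ → ℝ) (h u : ℝ) : ℝ := W (u / h) / h

/-- `R(W) = ∫ W²`. -/
def kernelR (W : ℝ → ℝ) : ℝ := ∫ u, W u ^ 2

/-- `α(W) = ∫ u² W(u) du`. -/
def kernelAlpha (W : ℝ → ℝ) : ℝ := ∫ u, u ^ 2 * W u

/-! ### The functional data

The process `X` lives on a probability space `(E, Q)`; its i.i.d. copies are
`X_{ki}(s) = X s (ζ_{ki})` with `ζ_{ki}` i.i.d. of law `Q`. -/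

section Model

variable {Ω E : Type*} [MeasurableSpace Ω] [MeasurableSpace E]

/-- The mean function `μ(s) = E X(s)`. -/
def meanFn (Q : Measure E) (X : ℝ → E → ℝ) (s : ℝ) : ℝ := ∫ x, X s x ∂Q

/-- The covariance function `γ(s, u) = Cov(X(s), X(u))`. -/
def covFn (Q : Measure E) (X : ℝ → E → ℝ) (s u : ℝ) : ℝ := cov[X s, X u; Q]

/-- Conditions on the process: it is jointly measurable, its mean function has a bounded and
continuous second derivative, its covariance function has bounded and continuous derivatives up to
the fourth order, and the third absolute moments of `Φ = X - μ` are bounded. -/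
structure ProcessCond (Q : Measure E) (X : ℝ → E → ℝ) : Prop where
  measurable : Measurable (Function.uncurry X)
  moment : ∃ M : ℝ, ∀ s ∈ Icc (0 : ℝ) 1,
    MemLp (X s) 3 Q ∧ ∫ x, |X s x - meanFn Q X s| ^ 3 ∂Q ≤ M
  mean_smooth : ContDiffOn ℝ 2 (meanFn Q X) (Ioo 0 1)
  mean_bdd : ∃ M : ℝ, ∀ s ∈ Ioo (0 : ℝ) 1, |iteratedDeriv 2 (meanFn Q X) s| ≤ M
  cov_smooth : ContDiffOn ℝ 4 (fun p : ℝ × ℝ => covFn Q X p.1 p.2) (Ioo 0 1 ×ˢ Ioo 0 1)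
  cov_bdd : ∃ M : ℝ, ∀ p ∈ Ioo (0 : ℝ) 1 ×ˢ Ioo (0 : ℝ) 1,
    ‖iteratedFDeriv ℝ 2 (fun p : ℝ × ℝ => covFn Q X p.1 p.2) p‖ ≤ M ∧
    ‖iteratedFDeriv ℝ 4 (fun p : ℝ × ℝ => covFn Q X p.1 p.2) p‖ ≤ M

/-- Conditions on the density `f` of the observation times on `[0, 1]`: it is bounded away from `0`
and twice differentiable with bounded second derivative. -/
structure DensityCond (f : ℝ → ℝ) : Prop where
  bdd_below : ∃ c : ℝ, 0 < c ∧ ∀ x ∈ Ioo (0 : ℝ) 1, c ≤ f x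
  differentiable : DifferentiableOn ℝ f (Ioo 0 1)
  differentiable_deriv : DifferentiableOn ℝ (deriv f) (Ioo 0 1)
  bdd_deriv_two : ∃ M : ℝ, ∀ x ∈ Ioo (0 : ℝ) 1, |deriv (deriv f) x| ≤ M

/-- Conditions on the law `ν` of the noise: it is centred with a finite third absolute moment. -/
structure NoiseCond (ν : Measure ℝ) : Prop where
  mean_zero : ∫ x, x ∂ν = 0
  moment : MemLp id 3 ν

/-- The random inputs: trajectories `ζ_{ki}` i.i.d. of law `Q`, observation times `T_{kij}` i.i.d.
with density `f` on `[0, 1]`, noises `ε_{kij}` i.i.d. of law `ν`, and these three families are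
independent of each other. -/
structure SamplingCond (P : Measure Ω) (Q : Measure E) (f : ℝ → ℝ) (ν : Measure ℝ)
    (ζ : ℕ → ℕ → Ω → E) (T ε : ℕ → ℕ → ℕ → Ω → ℝ) : Prop where
  measurable_traj : ∀ k i, Measurable (ζ k i)
  measurable_time : ∀ k i j, Measurable (T k i j)
  measurable_noise : ∀ k i j, Measurable (ε k i j)
  law_traj : ∀ k i, P.map (ζ k i) = Q
  law_time : ∀ k i j, P.map (T k i j) =
    (volume.restrict (Icc (0 : ℝ) 1)).withDensity (fun x => ENNReal.ofReal (f x))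
  law_noise : ∀ k i j, P.map (ε k i j) = ν
  indep_traj : iIndepFun (fun (p : ℕ × ℕ) ω => ζ p.1 p.2 ω) P
  indep_time : iIndepFun (fun (p : ℕ × ℕ × ℕ) ω => T p.1 p.2.1 p.2.2 ω) P
  indep_noise : iIndepFun (fun (p : ℕ × ℕ × ℕ) ω => ε p.1 p.2.1 p.2.2 ω) P
  indep_traj_time : IndepFun (fun ω (p : ℕ × ℕ) => ζ p.1 p.2 ω)
    (fun ω (p : ℕ × ℕ × ℕ) => T p.1 p.2.1 p.2.2 ω) P
  indep_noise_rest : IndepFun (fun ω (p : ℕ × ℕ × ℕ) => ε p.1 p.2.1 p.2.2 ω)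
    (fun ω => ((fun (p : ℕ × ℕ) => ζ p.1 p.2 ω),
      (fun (p : ℕ × ℕ × ℕ) => T p.1 p.2.1 p.2.2 ω))) P

/-- The observations `Y_{kij} = X_{ki}(T_{kij}) + ε_{kij}`. -/
def observation (X : ℝ → E → ℝ) (ζ : ℕ → ℕ → Ω → E) (T ε : ℕ → ℕ → ℕ → Ω → ℝ)
    (k i j : ℕ) (ω : Ω) : ℝ :=
  X (T k i j ω) (ζ k i ω) + ε k i j ω

end Model

/-! ### Candidate bandwidths

`η K l` is the `l`-th candidate bandwidth at block `K`; the index `0 : Fin L` is the first one. The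
stored statistic with index `J K l` of block `K - 1` is the one that the `l`-th statistic of block
`K` updates. -/

section Bandwidth

variable {L : ℕ}

/-- The centroids `φ_l^{(K)}`. -/
def centroid (n : ℕ → ℕ) (m : ℕ → ℕ → ℕ) (η : ℕ → Fin L → ℝ) (J : ℕ → Fin L → Fin L) :
    ℕ → Fin L → ℝ
  | 0, _ => 0
  | K + 1, l => (1 - weight n m (K + 1) (K + 1)) * centroid n m η J K (J (K + 1) l)
      + weight n m (K + 1) (K + 1) * η (K + 1) l

/-- `J` selects the closest centroid (with an arbitrary choice in case of ties). -/
def IsClosestSelection (n : ℕ → ℕ) (m : ℕ → ℕ → ℕ) (η : ℕ → Fin L → ℝ)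
    (J : ℕ → Fin L → Fin L) : Prop :=
  ∀ (K : ℕ) (l i : Fin L),
    |η (K + 1) l - centroid n m η J K (J (K + 1) l)| ≤ |η (K + 1) l - centroid n m η J K i|

/-- The candidate bandwidth of block `k` that is used in the `l`-th statistic at block `K`. -/
def chainBandwidth (η : ℕ → Fin L → ℝ) (J : ℕ → Fin L → Fin L) : ℕ → Fin L → ℕ → ℝ
  | 0, _, _ => 0
  | K + 1, l, k => if k = K + 1 then η (K + 1) l else chainBandwidth η J K (J (K + 1) l) k

/-- `ρ_r^{(K)} = ∑_{k ≤ K} ω_k^{(K)} (η̃_k^{(K)})^r` for `r ∈ ℤ`, where `η̃_k^{(K)}` is the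
pseudo-bandwidth chain at block `K`. -/
def rho [NeZero L] (n : ℕ → ℕ) (m : ℕ → ℕ → ℕ) (η : ℕ → Fin L → ℝ) (J : ℕ → Fin L → Fin L)
    (r : ℤ) (K : ℕ) : ℝ :=
  ∑ k ∈ Finset.Icc 1 K, weight n m k K * chainBandwidth η J K 0 k ^ r

end Bandwidth

/-! ### The online estimate -/

section Estimate

variable {Ω : Type*} {L : ℕ}

/-- The vector `T_{kij}(t) = (1, T_{kij} - t)`. -/
def designVec (x t : ℝ) : Fin 2 → ℝ := ![1, x - t]

/-- `P_k(t; h)`. -/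
def blockP (n : ℕ → ℕ) (m : ℕ → ℕ → ℕ) (W : ℝ → ℝ) (T : ℕ → ℕ → ℕ → Ω → ℝ)
    (t : ℝ) (k : ℕ) (h : ℝ) (ω : Ω) : Matrix (Fin 2) (Fin 2) ℝ :=
  ∑ i ∈ Finset.range (n k), ∑ j ∈ Finset.range (m k i),
    scaledKernel W h (T k i j ω - t) •
      Matrix.vecMulVec (designVec (T k i j ω) t) (designVec (T k i j ω) t)

/-- `q_k(t; h)`. -/
def blockQ (n : ℕ → ℕ) (m : ℕ → ℕ → ℕ) (W : ℝ → ℝ) (T Y : ℕ → ℕ → ℕ → Ω → ℝ)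
    (t : ℝ) (k : ℕ) (h : ℝ) (ω : Ω) : Fin 2 → ℝ :=
  ∑ i ∈ Finset.range (n k), ∑ j ∈ Finset.range (m k i),
    (scaledKernel W h (T k i j ω - t) * Y k i j ω) • designVec (T k i j ω) t

/-- The pseudo-sufficient statistics `P̃_l^{(K)}(t)`. -/
def onlineP (n : ℕ → ℕ) (m : ℕ → ℕ → ℕ) (W : ℝ → ℝ) (T : ℕ → ℕ → ℕ → Ω → ℝ)
    (η : ℕ → Fin L → ℝ) (J : ℕ → Fin L → Fin L) (t : ℝ) :
    ℕ → Fin L → Ω → Matrix (Fin 2) (Fin 2) ℝ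
  | 0, _, _ => 0
  | K + 1, l, ω => blockP n m W T t (K + 1) (η (K + 1) l) ω
      + onlineP n m W T η J t K (J (K + 1) l) ω

/-- The pseudo-sufficient statistics `q̃_l^{(K)}(t)`. -/
def onlineQ (n : ℕ → ℕ) (m : ℕ → ℕ → ℕ) (W : ℝ → ℝ) (T Y : ℕ → ℕ → ℕ → Ω → ℝ)
    (η : ℕ → Fin L → ℝ) (J : ℕ → Fin L → Fin L) (t : ℝ) :
    ℕ → Fin L → Ω → Fin 2 → ℝ
  | 0, _, _ => 0
  | K + 1, l, ω => blockQ n m W T Y t (K + 1) (η (K + 1) l) ω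
      + onlineQ n m W T Y η J t K (J (K + 1) l) ω

/-- The online mean estimate `μ̃^{(K)}(t)`: the first entry of `P̃_1^{-1} q̃_1`. -/
def onlineMean [NeZero L] (n : ℕ → ℕ) (m : ℕ → ℕ → ℕ) (W : ℝ → ℝ)
    (T Y : ℕ → ℕ → ℕ → Ω → ℝ) (η : ℕ → Fin L → ℝ) (J : ℕ → Fin L → Fin L) (t : ℝ)
    (K : ℕ) (ω : Ω) : ℝ :=
  ((onlineP n m W T η J t K 0 ω)⁻¹ *ᵥ onlineQ n m W T Y η J t K 0 ω) 0

end Estimate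

end OnlineFDA

end

open OnlineFDA

open OnlineFDA
noncomputable section
namespace OnlineFDA
set_option linter.unusedSectionVars false

section

/-! ### Lyapunov's central limit theorem -/

/-! Unrolling the recursion turns the online estimate into one local-linear estimate from all the
data, in which block `k` is smoothed with its own bandwidth `b_k`. This bandwidth is one of the
candidates of block `k`, so it is of exact order `S_k^{-1/5}` (`exists_bandwidthBound`). Write `u =
S_K^{1/5}`. A Riemann-sum comparison then gives the order of every weighted sum needed: `∑ s_k
b_k^2` has order `u^3` and `∑ s_k / b_k` has order `u^6`.

A local-linear fit reproduces affine functions. Hence only the Taylor remainder of `μ`, the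
fluctuations and the noise enter the error, and the error is a ratio of kernel sums
(`estimate_sub_mean`). Three facts control this ratio. (1) The design moments concentrate. The
zeroth one is about `f(t) S_K`, the second about `f(t) α(W) ∑ s_k b_k^2`, and the first is of the
same order as the second. The Taylor remainder produces the bias `α(W) μ''(t) ρ_2 / 2`. (2) The
fluctuation may be frozen at `t`. Replacing `Φ(T)` by `Φ(t)` costs `o_p(ρ_2)`, and so do the terms
with an extra factor `T - t`. The delicate part is the dependence within subjects: it contributes
`s_{k,2} E(∫ W_b(s - t) (Φ(s) - Φ(t)) f(s) ds)^2`, and this expectation has to be `O(b^4)`. No path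
of `Φ` need be smooth. Symmetry of the kernel produces second differences of `Φ`, whose mean square
is `O(a^4)` because the covariance has four derivatives. Then `∑ s_{k,2} b_k^4 = o(u^6)`, since
`S_{K,2} = o(S_{K,1}^2)`. (3) What remains is the noise sum of `W_{b_k}(T_{kij} - t) (Φ_{ki}(t) +
ε_{kij})`. Its variance is asymptotic to `f(t) R(W) (γ(t,t) + σ^2) ∑ s_k / b_k + γ(t,t) f(t)^2
S_{K,2}`, where the first part comes from single measurements and the second from pairs within a
subject. Facts (1) and (2) are combined in `exists_expansion`.

For (3), Lyapunov's theorem is applied to the independent sums over subjects. The third moment of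
such a sum splits according to coincidences among three measurements, which yields the sizes
`s_{k,1}`, `s_{k,2}`, `s_{k,3}`; the size conditions make all three parts negligible. This needs
`γ(t,t) > 0`, so that the variance dominates `S_{K,2}`. If `γ(t,t) = 0`, then `Φ(t)` vanishes almost
surely and the single measurements are independent summands. Slutsky's theorem restores the random
coefficient, which tends to `1 / f(t)`.

The regimes are governed by the ratio of `S_{K,2}` to `∑ s_k / b_k`. From above it is bounded
through the condition on `S_{K,2}`, from below through Cauchy-Schwarz. Up to a vanishing term both
bounds are multiples of `u^4 / N_K`, the power `4/5` of the quotient that defines the regimes. -/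

theorem norm_exp_mul_I_sub_taylor_le (y : ℝ) :
    ‖Complex.exp (y * Complex.I) - (1 + y * Complex.I - y ^ 2 / 2)‖ ≤ 4 * |y| ^ 3 := by
  rcases le_or_gt |y| 1 with hy | hy
  · have hx : ‖(y * Complex.I : ℂ)‖ ≤ 1 := by simpa using hy
    have h := Complex.exp_bound hx (n := 3) (by norm_num)
    have e : ∑ m ∈ Finset.range 3, (y * Complex.I : ℂ) ^ m / (m.factorial : ℂ)
        = 1 + y * Complex.I - y ^ 2 / 2 := by
      simp only [Finset.sum_range_succ, Finset.sum_range_zero, Nat.factorial, mul_pow,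
        Complex.I_sq]
      push_cast
      ring
    rw [e] at h
    refine h.trans ?_
    have : ‖(y * Complex.I : ℂ)‖ = |y| := by simp
    rw [this]
    norm_num [Nat.factorial]
    nlinarith [pow_nonneg (abs_nonneg y) 3]
  · have h1 : ‖Complex.exp (y * Complex.I)‖ = 1 := Complex.norm_exp_ofReal_mul_I y
    have h2 : ‖(1 + y * Complex.I - y ^ 2 / 2 : ℂ)‖ ≤ 1 + |y| + |y| ^ 2 / 2 := by
      refine (norm_sub_le _ _).trans (add_le_add ((norm_add_le _ _).trans ?_) ?_)
      · simp
      · simp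
    refine (norm_sub_le _ _).trans ?_
    rw [h1]
    nlinarith [mul_pos (sub_pos.2 hy) (sub_pos.2 hy), pow_pos (lt_trans one_pos hy) 2,
      mul_pos (pow_pos (lt_trans one_pos hy) 2) (sub_pos.2 hy)]

/-- The exponent `3/2` turns a variance into a cubed standard deviation, which a third absolute
moment dominates. For `x ≤ 1` the error is at most `x ^ 2`; for larger `x` it is at most `x`. -/
theorem abs_exp_neg_sub_taylor_le {x : ℝ} (hx : 0 ≤ x) :
    |Real.exp (-x) - (1 - x)| ≤ x ^ (3 / 2 : ℝ) := by
  have h0 : 0 ≤ Real.exp (-x) - (1 - x) := by linarith [Real.add_one_le_exp (-x)]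
  rw [abs_of_nonneg h0]
  rcases le_or_gt x 1 with h | h
  · have h1 := Real.abs_exp_sub_one_sub_id_le (x := -x) (by rwa [abs_neg, abs_of_nonneg hx])
    have h2 : x ^ (2 : ℝ) ≤ x ^ (3 / 2 : ℝ) := by
      rcases hx.eq_or_lt with rfl | hx'
      · norm_num
      · exact Real.rpow_le_rpow_of_exponent_ge hx' h (by norm_num)
    have h3 : Real.exp (-x) - (1 - x) ≤ x ^ 2 := by
      have := (le_abs_self _).trans h1
      nlinarith
    rw [Real.rpow_two] at h2
    linarith
  · have h1 : Real.exp (-x) ≤ 1 := Real.exp_le_one_iff.2 (by linarith)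
    have h2 : x ^ (1 : ℝ) ≤ x ^ (3 / 2 : ℝ) :=
      Real.rpow_le_rpow_of_exponent_le h.le (by norm_num)
    rw [Real.rpow_one] at h2
    linarith

/-- Telescoping: factors are exchanged one at a time, and the remaining factors have modulus at most
one. -/
theorem norm_prod_sub_prod_le_sum {ι : Type*} (s : Finset ι) (a b : ι → ℂ)
    (ha : ∀ i ∈ s, ‖a i‖ ≤ 1) (hb : ∀ i ∈ s, ‖b i‖ ≤ 1) :
    ‖∏ i ∈ s, a i - ∏ i ∈ s, b i‖ ≤ ∑ i ∈ s, ‖a i - b i‖ := by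
  classical
  induction s using Finset.induction_on with
  | empty => simp
  | insert i s his ih =>
    rw [Finset.prod_insert his, Finset.prod_insert his, Finset.sum_insert his]
    have h1 : ‖∏ i ∈ s, b i‖ ≤ 1 := by
      rw [norm_prod]
      exact Finset.prod_le_one (fun _ _ => norm_nonneg _)
        fun j hj => hb j (Finset.mem_insert_of_mem hj)
    have h2 := ih (fun j hj => ha j (Finset.mem_insert_of_mem hj))
      (fun j hj => hb j (Finset.mem_insert_of_mem hj))
    have e : a i * ∏ i ∈ s, a i - b i * ∏ i ∈ s, b i
        = (a i - b i) * ∏ i ∈ s, b i + a i * (∏ i ∈ s, a i - ∏ i ∈ s, b i) := by ring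
    rw [e]
    refine (norm_add_le _ _).trans (add_le_add ?_ ?_)
    · rw [norm_mul]
      exact mul_le_of_le_one_right (norm_nonneg _) h1
    · rw [norm_mul]
      exact (mul_le_of_le_one_left (norm_nonneg _) (ha i (Finset.mem_insert_self _ _))).trans h2

section CLT

variable {Ω : Type*} [MeasurableSpace Ω] {P : Measure Ω} [IsProbabilityMeasure P]

/-- Jensen's inequality for the convex function `x ^ (3/2)` applied to `ξ ^ 2`. -/
theorem rpow_integral_sq_le_integral_abs_cube {ξ : Ω → ℝ} (hξ : MemLp ξ 3 P) :
    (∫ ω, ξ ω ^ 2 ∂P) ^ (3 / 2 : ℝ) ≤ ∫ ω, |ξ ω| ^ 3 ∂P := by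
  have h2 : MemLp ξ 2 P := hξ.mono_exponent (by norm_num)
  have hconv := convexOn_rpow (p := 3 / 2) (by norm_num)
  have e : ∀ ω, (ξ ω ^ 2) ^ (3 / 2 : ℝ) = |ξ ω| ^ 3 := by
    intro ω
    rw [← sq_abs, ← Real.rpow_natCast, ← Real.rpow_mul (abs_nonneg _), ← Real.rpow_natCast]
    norm_num
  have i3 : Integrable (fun ω => |ξ ω| ^ 3) P := by
    simpa using hξ.integrable_norm_pow (p := 3) (by norm_num)
  have := hconv.map_integral_le (μ := P) (f := fun ω => ξ ω ^ 2)
    (Real.continuous_rpow_const (by norm_num)).continuousOn isClosed_Ici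
    (Eventually.of_forall fun ω => mem_Ici.2 (sq_nonneg (ξ ω))) h2.integrable_sq
    (by simpa only [Function.comp_def, e] using i3)
  simpa only [e] using this

theorem norm_charFun_map_sub_le {ξ : Ω → ℝ} (hξ : MemLp ξ 3 P) (h0 : ∫ ω, ξ ω ∂P = 0) (u : ℝ) :
    ‖charFun (P.map ξ) u - (1 - (u : ℂ) ^ 2 * ((∫ ω, ξ ω ^ 2 ∂P : ℝ) : ℂ) / 2)‖
      ≤ 4 * |u| ^ 3 * ∫ ω, |ξ ω| ^ 3 ∂P := by
  have h2 : MemLp ξ 2 P := hξ.mono_exponent (by norm_num)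
  have h1 : Integrable ξ P := (hξ.mono_exponent (q := 3) (p := 1) (by norm_num)).integrable le_rfl
  have i3 : Integrable (fun ω => |ξ ω| ^ 3) P := by
    simpa using hξ.integrable_norm_pow (p := 3) (by norm_num)
  have hm : AEMeasurable ξ P := hξ.aestronglyMeasurable.aemeasurable
  have iexp : Integrable (fun ω => Complex.exp ((u * ξ ω : ℝ) * Complex.I)) P := by
    refine Integrable.of_bound (C := 1) ?_ (Eventually.of_forall fun ω => ?_)
    · have : AEMeasurable (fun ω => Complex.exp ((u * ξ ω : ℝ) * Complex.I)) P := by fun_prop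
      exact this.aestronglyMeasurable
    · rw [Complex.norm_exp_ofReal_mul_I]
  have ipoly : Integrable (fun ω => (1 + (u * ξ ω : ℝ) * Complex.I
      - ((u * ξ ω : ℝ) : ℂ) ^ 2 / 2 : ℂ)) P := by
    refine ((integrable_const _).add ((h1.const_mul u).ofReal.mul_const _)).sub ?_
    have : Integrable (fun ω => (((u * ξ ω) ^ 2 : ℝ) : ℂ) / 2) P := by
      refine Integrable.div_const (Integrable.ofReal ?_) _
      exact (h2.integrable_sq.const_mul (u ^ 2)).congr
        (Eventually.of_forall fun ω => (mul_pow _ _ _).symm)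
    simpa only [Complex.ofReal_pow] using this
  have e : charFun (P.map ξ) u - (1 - (u : ℂ) ^ 2 * ((∫ ω, ξ ω ^ 2 ∂P : ℝ) : ℂ) / 2)
      = ∫ ω, (Complex.exp ((u * ξ ω : ℝ) * Complex.I) - (1 + (u * ξ ω : ℝ) * Complex.I
      - ((u * ξ ω : ℝ) : ℂ) ^ 2 / 2)) ∂P := by
    rw [integral_sub iexp ipoly, charFun_apply_real, integral_map hm (by fun_prop)]
    congr 1
    · simp
    · have a1 : ∫ ω, ((u * ξ ω : ℝ) : ℂ) * Complex.I ∂P = 0 := by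
        rw [integral_mul_const, integral_complex_ofReal, integral_const_mul, h0]
        simp
      have a2 : ∫ ω, ((u * ξ ω : ℝ) : ℂ) ^ 2 / 2 ∂P
          = (u : ℂ) ^ 2 * ((∫ ω, ξ ω ^ 2 ∂P : ℝ) : ℂ) / 2 := by
        rw [integral_div]
        congr 1
        rw [← integral_complex_ofReal, ← integral_const_mul]
        refine integral_congr_ae (Eventually.of_forall fun ω => ?_)
        simp [mul_pow]
      have i1 : Integrable (fun ω => ((u * ξ ω : ℝ) : ℂ) * Complex.I) P :=
        (h1.const_mul u).ofReal.mul_const _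
      have i2 : Integrable (fun ω => (1 : ℂ) + ((u * ξ ω : ℝ) : ℂ) * Complex.I) P :=
        (integrable_const _).add i1
      have i4 : Integrable (fun ω => ((u * ξ ω : ℝ) : ℂ) ^ 2 / 2) P := by
        have := i2.sub ipoly
        refine this.congr (Eventually.of_forall fun ω => ?_)
        simp
      rw [integral_sub i2 i4, integral_add (integrable_const _) i1, a1, a2]
      simp
  rw [e]
  refine (norm_integral_le_integral_norm _).trans ?_
  rw [← integral_const_mul]
  refine integral_mono (iexp.sub ipoly).norm (i3.const_mul _) fun ω => ?_
  refine (norm_exp_mul_I_sub_taylor_le (u * ξ ω)).trans (le_of_eq ?_)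
  rw [abs_mul, mul_pow]
  ring

/-- **Lyapunov's central limit theorem** with third moments, for triangular arrays. -/
theorem tendstoInDistribution_sum_of_lyapunov {ι : Type*} (s : ℕ → Finset ι)
    (ξ : ℕ → ι → Ω → ℝ) (hind : ∀ᶠ K in atTop, iIndepFun (ξ K) P)
    (hmeas : ∀ K i, AEMeasurable (ξ K i) P)
    (hL : ∀ᶠ K in atTop, ∀ i ∈ s K, MemLp (ξ K i) 3 P)
    (h0 : ∀ᶠ K in atTop, ∀ i ∈ s K, ∫ ω, ξ K i ω ∂P = 0) {v : NNReal}
    (hvar : Tendsto (fun K => ∑ i ∈ s K, ∫ ω, ξ K i ω ^ 2 ∂P) atTop (𝓝 v))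
    (hthree : Tendsto (fun K => ∑ i ∈ s K, ∫ ω, |ξ K i ω| ^ 3 ∂P) atTop (𝓝 0)) :
    TendstoInDistribution (fun K ω => ∑ i ∈ s K, ξ K i ω) atTop id (fun _ => P)
      (gaussianReal 0 v) where
  forall_aemeasurable K := Finset.aemeasurable_fun_sum _ fun i _ => hmeas K i
  tendsto := by
    refine ProbabilityMeasure.tendsto_iff_tendsto_charFun.2 fun u => ?_
    have hlim : Tendsto (fun K => Complex.exp
        ((-(u ^ 2 * (∑ i ∈ s K, ∫ ω, ξ K i ω ^ 2 ∂P) / 2) : ℝ) : ℂ)) atTop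
        (𝓝 (Complex.exp ((-(u ^ 2 * v / 2) : ℝ) : ℂ))) := by
      refine (Complex.continuous_exp.tendsto _).comp ?_
      refine (Complex.continuous_ofReal.tendsto _).comp ?_
      exact ((hvar.const_mul (u ^ 2)).div_const 2).neg
    have hgoal : charFun (Measure.map id (gaussianReal 0 v)) u
        = Complex.exp ((-(u ^ 2 * v / 2) : ℝ) : ℂ) := by
      rw [Measure.map_id, charFun_gaussianReal]
      congr 1
      push_cast
      ring
    simp only [ProbabilityMeasure.coe_mk]
    rw [hgoal]
    -- The comparison is with the centred Gaussian that has the exact variance of row `K`; its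
    -- characteristic function converges by `hvar`. The constant 5 is 4 from the Taylor bound for
    -- the characteristic functions plus 1 from the one for `exp (-x)`.
    refine tendsto_of_tendsto_of_dist hlim ?_
    refine squeeze_zero' (Eventually.of_forall fun _ => dist_nonneg) ?_
      (by simpa using hthree.const_mul (5 * |u| ^ 3))
    filter_upwards [hind, hL, h0] with K hind hL h0
    rw [dist_comm, dist_eq_norm, (hind.precomp
      Subtype.val_injective).charFun_map_fun_finsetSum_eq_prod (fun i _ => hmeas K i)]
    have e : Complex.exp ((-(u ^ 2 * (∑ i ∈ s K, ∫ ω, ξ K i ω ^ 2 ∂P) / 2) : ℝ) : ℂ)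
        = ∏ i ∈ s K, Complex.exp ((-(u ^ 2 * (∫ ω, ξ K i ω ^ 2 ∂P) / 2) : ℝ) : ℂ) := by
      rw [← Complex.exp_sum, ← Complex.ofReal_sum]
      congr 2
      rw [Finset.sum_neg_distrib, ← Finset.sum_div, ← Finset.mul_sum]
    rw [e]
    simp only [Finset.prod_apply]
    refine (norm_prod_sub_prod_le_sum _ _ _ (fun i hi => ?_) (fun i hi => ?_)).trans ?_
    · have : IsProbabilityMeasure (P.map (ξ K i)) := Measure.isProbabilityMeasure_map (hmeas K i)
      exact norm_charFun_le_one u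
    · rw [← Complex.ofReal_exp, Complex.norm_real, Real.norm_eq_abs, Real.abs_exp]
      refine Real.exp_le_one_iff.2 (neg_nonpos.2 ?_)
      have : 0 ≤ ∫ ω, ξ K i ω ^ 2 ∂P := integral_nonneg fun _ => sq_nonneg _
      positivity
    · rw [Finset.mul_sum]
      refine Finset.sum_le_sum fun i hi => ?_
      set σ := ∫ ω, ξ K i ω ^ 2 ∂P with hσ
      have hσ0 : 0 ≤ σ := integral_nonneg fun _ => sq_nonneg _
      have b1 := norm_charFun_map_sub_le (hL i hi) (h0 i hi) u
      have b2 := abs_exp_neg_sub_taylor_le (x := u ^ 2 * σ / 2) (by positivity)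
      have b3 : (u ^ 2 * σ / 2) ^ (3 / 2 : ℝ) ≤ |u| ^ 3 * ∫ ω, |ξ K i ω| ^ 3 ∂P := by
        have c1 : (u ^ 2 * σ / 2) ^ (3 / 2 : ℝ) ≤ (|u| ^ 2 * σ) ^ (3 / 2 : ℝ) := by
          refine Real.rpow_le_rpow (by positivity) ?_ (by norm_num)
          rw [sq_abs]
          have : 0 ≤ u ^ 2 * σ := by positivity
          linarith
        have c2 : (|u| ^ 2 * σ) ^ (3 / 2 : ℝ) = |u| ^ 3 * σ ^ (3 / 2 : ℝ) := by
          rw [Real.mul_rpow (by positivity) hσ0]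
          congr 1
          rw [← Real.rpow_natCast, ← Real.rpow_mul (abs_nonneg _), ← Real.rpow_natCast]
          norm_num
        rw [c2] at c1
        exact c1.trans (mul_le_mul_of_nonneg_left
          (rpow_integral_sq_le_integral_abs_cube (hL i hi)) (by positivity))
      have e2 : ‖Complex.exp ((-(u ^ 2 * σ / 2) : ℝ) : ℂ) - (1 - u ^ 2 * (σ : ℂ) / 2)‖
          = |Real.exp (-(u ^ 2 * σ / 2)) - (1 - u ^ 2 * σ / 2)| := by
        rw [← Complex.ofReal_exp, ← Real.norm_eq_abs, ← Complex.norm_real]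
        push_cast
        rfl
      calc _ ≤ ‖charFun (P.map (ξ K i)) u - (1 - u ^ 2 * (σ : ℂ) / 2)‖
            + ‖Complex.exp ((-(u ^ 2 * σ / 2) : ℝ) : ℂ) - (1 - u ^ 2 * (σ : ℂ) / 2)‖ := by
            refine le_trans (le_of_eq ?_) (norm_sub_le _ _)
            congr 1
            ring
        _ ≤ 4 * |u| ^ 3 * (∫ ω, |ξ K i ω| ^ 3 ∂P) + |u| ^ 3 * ∫ ω, |ξ K i ω| ^ 3 ∂P := by
            rw [e2]
            exact add_le_add b1 (b2.trans b3)
        _ = _ := by ring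

end CLT

end

section

/-! ### Convergence in probability and in distribution -/

section Convergence

variable {Ω : Type*} [MeasurableSpace Ω] {P : Measure Ω}

/-- A union bound over finitely many bad events. `Y` need not be a fixed function of the `X i`: it
may depend on `K`, as long as closeness is uniform for large `K`. This flexibility is what the
expansion of the estimate requires. -/
theorem tendstoInMeasure_of_forall_close {ι : Type*} [Fintype ι] {X : ι → ℕ → Ω → ℝ} {c : ι → ℝ}
    (hX : ∀ i, TendstoInMeasure P (X i) atTop (fun _ => c i)) {Y : ℕ → Ω → ℝ} {y : ℝ}
    (hY : ∀ ε > 0, ∃ δ > 0, ∀ᶠ K in atTop, ∀ ω, (∀ i, |X i K ω - c i| < δ) → |Y K ω - y| < ε) :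
    TendstoInMeasure P Y atTop (fun _ => y) := by
  rw [tendstoInMeasure_iff_norm]
  intro ε hε
  obtain ⟨δ, hδ, hK⟩ := hY ε hε
  have hsum : Tendsto (fun K => ∑ i, P {ω | δ ≤ ‖X i K ω - c i‖}) atTop (𝓝 0) := by
    rw [show (0 : ENNReal) = ∑ _i : ι, 0 by simp]
    exact tendsto_finsetSum _ fun i _ => tendstoInMeasure_iff_norm.1 (hX i) δ hδ
  refine tendsto_of_tendsto_of_tendsto_of_le_of_le' tendsto_const_nhds hsum
    (Eventually.of_forall fun _ => zero_le) ?_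
  filter_upwards [hK] with K hK
  calc P {ω | ε ≤ ‖Y K ω - y‖} ≤ P (⋃ i ∈ (Finset.univ : Finset ι), {ω | δ ≤ ‖X i K ω - c i‖}) := by
        refine measure_mono fun ω hω => ?_
        by_contra hcon
        simp only [Finset.mem_univ, iUnion_true, mem_iUnion, mem_ofPred_eq, not_exists,
          not_le] at hcon
        exact absurd (hK ω hcon) (not_lt.2 hω)
    _ ≤ _ := measure_biUnion_finset_le _ _

theorem tendstoInMeasure_of_continuousAt {ι : Type*} [Fintype ι] {X : ι → ℕ → Ω → ℝ} {c : ι → ℝ}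
    (hX : ∀ i, TendstoInMeasure P (X i) atTop (fun _ => c i)) {F : (ι → ℝ) → ℝ}
    (hF : ContinuousAt F c) :
    TendstoInMeasure P (fun K ω => F (fun i => X i K ω)) atTop (fun _ => F c) := by
  refine tendstoInMeasure_of_forall_close hX fun ε hε => ?_
  obtain ⟨δ, hδ, h⟩ := Metric.continuousAt_iff.1 hF ε hε
  refine ⟨δ, hδ, Eventually.of_forall fun K ω hω => ?_⟩
  rw [← Real.dist_eq]
  refine h ((dist_pi_lt_iff hδ).2 fun i => ?_)
  rw [Real.dist_eq]
  exact hω i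

theorem tendstoInMeasure_zero_of_close {X Y : ℕ → Ω → ℝ}
    (hX : TendstoInMeasure P X atTop (fun _ => 0))
    (C : ℝ) (hY : ∀ᶠ K in atTop, ∀ ω, |Y K ω| ≤ C * |X K ω|) :
    TendstoInMeasure P Y atTop (fun _ => 0) := by
  refine tendstoInMeasure_of_forall_close (ι := Unit) (X := fun _ => X) (c := fun _ => 0)
    (fun _ => hX) fun ε hε => ⟨ε / (|C| + 1), by positivity, ?_⟩
  filter_upwards [hY] with K hK ω hω
  have h1 := hω ()
  rw [sub_zero, lt_div_iff₀ (by positivity)] at h1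
  rw [sub_zero]
  have h2 := hK ω
  have h3 : C * |X K ω| ≤ |C| * |X K ω| := by gcongr; exact le_abs_self C
  nlinarith [abs_nonneg (X K ω)]

theorem tendstoInMeasure_add {X Y : ℕ → Ω → ℝ} {a b : ℝ}
    (hX : TendstoInMeasure P X atTop (fun _ => a)) (hY : TendstoInMeasure P Y atTop (fun _ => b)) :
    TendstoInMeasure P (fun K ω => X K ω + Y K ω) atTop (fun _ => a + b) := by
  have := tendstoInMeasure_of_continuousAt (P := P) (ι := Fin 2) (X := ![X, Y]) (c := ![a, b])
    (by simpa [Fin.forall_fin_two] using ⟨hX, hY⟩) (F := fun v => v 0 + v 1)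
    (by fun_prop)
  simpa using this

theorem tendstoInMeasure_mul {X Y : ℕ → Ω → ℝ} {a b : ℝ}
    (hX : TendstoInMeasure P X atTop (fun _ => a)) (hY : TendstoInMeasure P Y atTop (fun _ => b)) :
    TendstoInMeasure P (fun K ω => X K ω * Y K ω) atTop (fun _ => a * b) := by
  have := tendstoInMeasure_of_continuousAt (P := P) (ι := Fin 2) (X := ![X, Y]) (c := ![a, b])
    (by simpa [Fin.forall_fin_two] using ⟨hX, hY⟩) (F := fun v => v 0 * v 1)
    (by fun_prop)
  simpa using this

theorem tendstoInMeasure_of_tendsto {a : ℕ → ℝ} {c : ℝ} (h : Tendsto a atTop (𝓝 c)) :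
    TendstoInMeasure P (fun K _ => a K) atTop (fun _ => c) := by
  refine tendstoInMeasure_of_forall_close (ι := Empty) (X := fun _ => fun _ _ => 0)
    (c := fun _ => 0) (fun i => i.elim) fun ε hε => ⟨1, one_pos, ?_⟩
  filter_upwards [Metric.tendsto_nhds.1 h ε hε] with K hK ω _
  rwa [← Real.dist_eq]

variable [IsProbabilityMeasure P]

theorem tendstoInMeasure_of_integral_sq {Y : ℕ → Ω → ℝ} (hL : ∀ᶠ K in atTop, MemLp (Y K) 2 P)
    (h : Tendsto (fun K => ∫ ω, Y K ω ^ 2 ∂P) atTop (𝓝 0)) :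
    TendstoInMeasure P Y atTop (fun _ => 0) := by
  rw [tendstoInMeasure_iff_measureReal_norm]
  intro ε hε
  refine squeeze_zero' (Eventually.of_forall fun _ => measureReal_nonneg) ?_
    (by simpa using h.div_const (ε ^ 2))
  filter_upwards [hL] with K hK
  rw [le_div_iff₀ (by positivity), mul_comm]
  refine le_trans ?_ (mul_meas_ge_le_integral_of_nonneg
    (Eventually.of_forall fun ω => sq_nonneg (Y K ω)) hK.integrable_sq (ε ^ 2))
  refine mul_le_mul_of_nonneg_left (measureReal_mono fun ω hω => ?_) (by positivity)
  simp only [sub_zero, mem_ofPred_eq, Real.norm_eq_abs] at hω ⊢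
  rw [← sq_abs (Y K ω)]
  gcongr

/-- Convergence in distribution depends only on laws. So the limit variable may be replaced by
another one with the same law, for instance a multiple of a Gaussian by the identity under a
rescaled Gaussian, and the sequence may be changed on null sets. -/
theorem tendstoInDistribution_congr_law {Ω₁ Ω₂ : Type*} [MeasurableSpace Ω₁] [MeasurableSpace Ω₂]
    {μ₁ : Measure Ω₁} {μ₂ : Measure Ω₂} [IsProbabilityMeasure μ₁] [IsProbabilityMeasure μ₂]
    {X Y : ℕ → Ω → ℝ} {Z₁ : Ω₁ → ℝ} {Z₂ : Ω₂ → ℝ}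
    (h : TendstoInDistribution X atTop Z₁ (fun _ => P) μ₁) (hZ₂ : AEMeasurable Z₂ μ₂)
    (hlaw : μ₁.map Z₁ = μ₂.map Z₂) (hY : ∀ K, AEMeasurable (Y K) P)
    (hXY : ∀ᶠ K in atTop, X K =ᵐ[P] Y K) :
    TendstoInDistribution Y atTop Z₂ (fun _ => P) μ₂ where
  forall_aemeasurable := hY
  aemeasurable_limit := hZ₂
  tendsto := by
    have h1 := h.tendsto
    have e : (⟨μ₁.map Z₁, Measure.isProbabilityMeasure_map h.aemeasurable_limit⟩ :
        ProbabilityMeasure ℝ) = ⟨μ₂.map Z₂, Measure.isProbabilityMeasure_map hZ₂⟩ :=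
      Subtype.ext hlaw
    rw [e] at h1
    refine h1.congr' ?_
    filter_upwards [hXY] with K hK
    exact Subtype.ext (Measure.map_congr hK)

/-- Slutsky's theorem for a product, with a centred Gaussian limit. -/
theorem tendstoInDistribution_mul_gaussian {X c Y : ℕ → Ω → ℝ} {v a : ℝ} (hv : 0 ≤ v)
    (hX : TendstoInDistribution X atTop id (fun _ => P) (gaussianReal 0 v.toNNReal))
    (hc : TendstoInMeasure P c atTop (fun _ => a)) (hcm : ∀ K, AEMeasurable (c K) P)
    (hY : ∀ K, AEMeasurable (Y K) P) (hXY : ∀ᶠ K in atTop, ∀ᵐ ω ∂P, Y K ω = c K ω * X K ω) :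
    TendstoInDistribution Y atTop id (fun _ => P) (gaussianReal 0 (a ^ 2 * v).toNNReal) := by
  have h := hX.continuous_comp_prodMk_of_tendstoInMeasure_const (g := fun x : ℝ × ℝ => x.2 * x.1)
    (by fun_prop) hc hcm
  refine tendstoInDistribution_congr_law h aemeasurable_id ?_ hY ?_
  · rw [Measure.map_id]
    have := gaussianReal_map_const_mul (μ := 0) (v := v.toNNReal) a
    simp only [id]
    rw [this, mul_zero]
    congr 1
    ext
    rw [NNReal.coe_mul, Real.coe_toNNReal _ hv, Real.coe_toNNReal _ (by positivity)]
    simp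
  · filter_upwards [hXY] with K hK
    filter_upwards [hK] with ω hω
    exact hω.symm

theorem tendstoInDistribution_add_zero {X R Y : ℕ → Ω → ℝ} {v : NNReal}
    (hX : TendstoInDistribution X atTop id (fun _ => P) (gaussianReal 0 v))
    (hR : TendstoInMeasure P R atTop (fun _ => 0)) (hY : ∀ K, AEMeasurable (Y K) P)
    (hXY : ∀ᶠ K in atTop, ∀ᵐ ω ∂P, Y K ω = X K ω + R K ω) :
    TendstoInDistribution Y atTop id (fun _ => P) (gaussianReal 0 v) := by
  refine tendstoInDistribution_of_tendstoInMeasure_sub Y id hX ?_ hY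
  refine TendstoInMeasure.congr' ?_ (EventuallyEq.refl _ _) hR
  filter_upwards [hXY] with K hK
  filter_upwards [hK] with ω hω
  simp [hω]

end Convergence

/-! ### Independence -/

section Independence

variable {Ω : Type*} [MeasurableSpace Ω] {P : Measure Ω}

/-- Pairing two independent families of independent variables. -/
theorem iIndepFun_prodMk {ι : Type*} {α β : ι → Type*} [∀ i, MeasurableSpace (α i)]
    [∀ i, MeasurableSpace (β i)] {X : ∀ i, Ω → α i} {Y : ∀ i, Ω → β i}
    [IsProbabilityMeasure P]
    (hXm : ∀ i, Measurable (X i)) (hYm : ∀ i, Measurable (Y i))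
    (hX : iIndepFun X P) (hY : iIndepFun Y P)
    (hXY : IndepFun (fun ω i => X i ω) (fun ω i => Y i ω) P) :
    iIndepFun (fun i ω => (X i ω, Y i ω)) P := by
  -- The rectangles form a π-system that generates the σ-algebra of the pair. On rectangles the
  -- product formula follows from independence between the two families and within each of them.
  set π : ∀ i, Set (Set Ω) := fun i =>
    {s | ∃ A B, MeasurableSet A ∧ MeasurableSet B ∧ s = X i ⁻¹' A ∩ Y i ⁻¹' B} with hπ
  rw [iIndepFun_iff_iIndep]
  refine iIndepSets.iIndep (fun i => ?_) π (fun i => ?_) (fun i => ?_) ?_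
  · exact ((hXm i).prodMk (hYm i)).comap_le
  · rintro s ⟨A, B, hA, hB, rfl⟩ t ⟨A', B', hA', hB', rfl⟩ -
    refine ⟨A ∩ A', B ∩ B', hA.inter hA', hB.inter hB', ?_⟩
    ext ω
    simp only [mem_inter_iff, mem_preimage]
    tauto
  · have h1 := generateFrom_prod (α := α i) (β := β i)
    rw [← h1, MeasurableSpace.comap_generateFrom]
    congr 1
    ext s
    constructor
    · rintro ⟨u, ⟨A, hA, B, hB, rfl⟩, rfl⟩
      exact ⟨A, B, hA, hB, rfl⟩
    · rintro ⟨A, B, hA, hB, rfl⟩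
      exact ⟨A ×ˢ B, ⟨A, hA, B, hB, rfl⟩, rfl⟩
  · rw [iIndepSets_iff]
    intro S f hf
    choose! A B hA hB hAB using hf
    have e1 : ⋂ i ∈ S, f i = (⋂ i ∈ S, X i ⁻¹' A i) ∩ ⋂ i ∈ S, Y i ⁻¹' B i := by
      ext ω
      simp only [mem_iInter, mem_inter_iff]
      constructor
      · intro h
        exact ⟨fun i hi => ((hAB i hi).subset (h i hi)).1,
          fun i hi => ((hAB i hi).subset (h i hi)).2⟩
      · intro h i hi
        rw [hAB i hi]
        exact ⟨h.1 i hi, h.2 i hi⟩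
    have e2 : P (⋂ i ∈ S, f i) = P (⋂ i ∈ S, X i ⁻¹' A i) * P (⋂ i ∈ S, Y i ⁻¹' B i) := by
      rw [e1]
      have := hXY.measure_inter_preimage_eq_mul (⋂ i ∈ S, (fun x => x i) ⁻¹' A i)
        (⋂ i ∈ S, (fun x => x i) ⁻¹' B i)
        (Finset.measurableSet_biInter _ fun i hi => measurable_pi_apply i (hA i hi))
        (Finset.measurableSet_biInter _ fun i hi => measurable_pi_apply i (hB i hi))
      simp only [preimage_iInter] at this
      exact this
    rw [e2, hX.measure_inter_preimage_eq_mul S hA, hY.measure_inter_preimage_eq_mul S hB,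
      ← Finset.prod_mul_distrib]
    refine Finset.prod_congr rfl fun i hi => ?_
    rw [hAB i hi]
    refine (IndepFun.measure_inter_preimage_eq_mul ?_ _ _ (hA i hi) (hB i hi)).symm
    exact hXY.comp (measurable_pi_apply i) (measurable_pi_apply i)

/-- Grouping an independent family indexed by pairs. -/
theorem iIndepFun_curry {ι κ : Type*} {α : Type*} [MeasurableSpace α] [IsProbabilityMeasure P]
    {X : ι → κ → Ω → α} (hXm : ∀ i j, Measurable (X i j))
    (hX : iIndepFun (fun (p : (_ : ι) × κ) => X p.1 p.2) P) :
    iIndepFun (fun i ω j => X i j ω) P := by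
  have h1 : ∀ i j, IsProbabilityMeasure (P.map (X i j)) :=
    fun i j => Measure.isProbabilityMeasure_map (hXm i j).aemeasurable
  have h2 : ∀ i, iIndepFun (X i) P := fun i =>
    hX.precomp (g := fun j => (⟨i, j⟩ : (_ : ι) × κ)) (fun a b hab => by simpa using hab)
  -- Independence says that the joint law is a product measure; currying turns a product over pairs
  -- into a product of products.
  rw [iIndepFun_iff_map_fun_eq_infinitePi_map (fun i => measurable_pi_lambda _ (hXm i))]
  have e : (fun ω i j => X i j ω)
      = (MeasurableEquiv.piCurry (fun (_ : ι) (_ : κ) => α)) ∘ fun ω p => X p.1 p.2 ω := rfl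
  rw [e, ← Measure.map_map (by fun_prop)
    (measurable_pi_lambda _ fun (p : (_ : ι) × κ) => hXm p.1 p.2),
    (iIndepFun_iff_map_fun_eq_infinitePi_map
      (X := fun (p : (_ : ι) × κ) => X p.1 p.2) fun p => hXm p.1 p.2).1 hX,
    Measure.infinitePi_map_piCurry (fun i j => P.map (X i j))]
  congr 1
  ext1 i
  rw [(iIndepFun_iff_map_fun_eq_infinitePi_map (hXm i)).1 (h2 i)]

end Independence

end

section

/-! ### Moments of the contribution of one subject -/

theorem descFactorial_two_succ (m : ℕ) :
    (m + 1).descFactorial 2 = m.descFactorial 2 + 2 * m := by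
  rw [Nat.succ_descFactorial_succ, Nat.descFactorial_one]
  rcases m with _ | m
  · simp
  · rw [Nat.succ_descFactorial_succ, Nat.descFactorial_one]
    ring

section Subject

variable {Ω E α : Type*} [MeasurableSpace Ω] [MeasurableSpace E] [MeasurableSpace α]

/-- A trajectory `Z` of law `Q` and independent inputs `U 0, U 1, …` of law `lam`. -/
structure SubjectSample (P : Measure Ω) (Q : Measure E) (lam : Measure α)
    (Z : Ω → E) (U : ℕ → Ω → α) : Prop where
  measurable_left : Measurable Z
  measurable_right : ∀ j, Measurable (U j)
  law_left : P.map Z = Q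
  law_right : ∀ j, P.map (U j) = lam
  indep_right : iIndepFun U P
  indep : IndepFun Z (fun ω j => U j ω) P

variable {P : Measure Ω} [IsProbabilityMeasure P] {Q : Measure E} {lam : Measure α}
  {Z : Ω → E} {U : ℕ → Ω → α}

namespace SubjectSample

theorem map_pair (h : SubjectSample P Q lam Z U) (j : ℕ) : P.map (fun ω => (Z ω, U j ω)) = Q.prod lam := by
  have h1 := h.measurable_right
  have h2 := h.measurable_left
  have hi : IndepFun Z (U j) P := h.indep.comp measurable_id (measurable_pi_apply j)
  rw [hi.map_prod_eq_prod_map_map (by fun_prop) (by fun_prop), h.law_left, h.law_right]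

theorem map_triple (h : SubjectSample P Q lam Z U) {j l : ℕ} (hjl : j ≠ l) :
    P.map (fun ω => (Z ω, U j ω, U l ω)) = Q.prod (lam.prod lam) := by
  have h1 := h.measurable_right
  have h2 := h.measurable_left
  have hi : IndepFun Z (fun ω => (U j ω, U l ω)) P :=
    h.indep.comp (ψ := fun u : ℕ → α => (u j, u l)) measurable_id (by fun_prop)
  rw [hi.map_prod_eq_prod_map_map (by fun_prop) (by fun_prop), h.law_left,
    (h.indep_right.indepFun hjl).map_prod_eq_prod_map_map (by fun_prop) (by fun_prop),
    h.law_right, h.law_right]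

theorem map_quadruple (h : SubjectSample P Q lam Z U) {j l p : ℕ} (hjl : j ≠ l) (hjp : j ≠ p) (hlp : l ≠ p) :
    P.map (fun ω => (Z ω, U j ω, U l ω, U p ω)) = Q.prod (lam.prod (lam.prod lam)) := by
  have h1 := h.measurable_right
  have h2 := h.measurable_left
  have hi : IndepFun Z (fun ω => (U j ω, U l ω, U p ω)) P :=
    h.indep.comp (ψ := fun u : ℕ → α => (u j, u l, u p)) measurable_id (by fun_prop)
  have hi2 : IndepFun (U j) (fun ω => (U l ω, U p ω)) P :=
    (h.indep_right.indepFun_prodMk h1 l p j hjl.symm hjp.symm).symm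
  rw [hi.map_prod_eq_prod_map_map (by fun_prop) (by fun_prop), h.law_left,
    hi2.map_prod_eq_prod_map_map (by fun_prop) (by fun_prop),
    (h.indep_right.indepFun hlp).map_prod_eq_prod_map_map (by fun_prop) (by fun_prop),
    h.law_right, h.law_right, h.law_right]

theorem measurePreserving (h : SubjectSample P Q lam Z U) (j : ℕ) :
    MeasurePreserving (fun ω => (Z ω, U j ω)) P (Q.prod lam) :=
  ⟨h.measurable_left.prodMk (h.measurable_right j), h.map_pair j⟩

variable [IsProbabilityMeasure Q] [IsProbabilityMeasure lam]

/-- Given the trajectory, the two measurements are independent with the same law, so the conditional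
mean of the product is a square. This is the source of the covariance within subjects. -/
theorem integral_mul_of_ne (h : SubjectSample P Q lam Z U) {g : E × α → ℝ} (hg : MemLp g 2 (Q.prod lam))
    (hgm : Measurable g) {j l : ℕ} (hjl : j ≠ l) :
    ∫ ω, g (Z ω, U j ω) * g (Z ω, U l ω) ∂P = ∫ x, (∫ u, g (x, u) ∂lam) ^ 2 ∂Q := by
  have h1 := h.measurable_right
  have h2 := h.measurable_left
  have m : Measurable (fun z : E × α × α => g (z.1, z.2.1) * g (z.1, z.2.2)) := by fun_prop
  have i1 : Integrable (fun ω => g (Z ω, U j ω) * g (Z ω, U l ω)) P :=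
    (hg.comp_measurePreserving (h.measurePreserving j)).integrable_mul
      (hg.comp_measurePreserving (h.measurePreserving l))
  have i2 : Integrable (fun z : E × α × α => g (z.1, z.2.1) * g (z.1, z.2.2))
      (Q.prod (lam.prod lam)) := by
    rw [← h.map_triple hjl]
    exact (integrable_map_measure m.aestronglyMeasurable (by fun_prop)).2 i1
  have e := integral_map (μ := P) (φ := fun ω => (Z ω, U j ω, U l ω)) (by fun_prop)
    m.aestronglyMeasurable
  rw [h.map_triple hjl] at e
  rw [← e, integral_prod _ i2]
  refine integral_congr_ae (Eventually.of_forall fun x => ?_)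
  simp only
  rw [integral_prod_mul (fun u => g (x, u)) (fun u => g (x, u)), sq]

/-- The square has `m` diagonal terms and `m (m - 1)` terms with two distinct measurements; these
counts are the falling factorials. -/
theorem integral_sum_sq (h : SubjectSample P Q lam Z U) {g : E × α → ℝ} (hg : MemLp g 2 (Q.prod lam))
    (hgm : Measurable g) (m : ℕ) :
    ∫ ω, (∑ j ∈ Finset.range m, g (Z ω, U j ω)) ^ 2 ∂P
      = (m.descFactorial 1 : ℝ) * ∫ z, g z ^ 2 ∂(Q.prod lam)
        + (m.descFactorial 2 : ℝ) * ∫ x, (∫ u, g (x, u) ∂lam) ^ 2 ∂Q := by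
  have hL : ∀ j, MemLp (fun ω => g (Z ω, U j ω)) 2 P := fun j =>
    hg.comp_measurePreserving (h.measurePreserving j)
  have hd : ∀ j, ∫ ω, g (Z ω, U j ω) * g (Z ω, U j ω) ∂P = ∫ z, g z ^ 2 ∂(Q.prod lam) := by
    intro j
    rw [← h.map_pair j, integral_map (h.measurePreserving j).measurable.aemeasurable
      (by fun_prop)]
    exact integral_congr_ae (Eventually.of_forall fun ω => (sq _).symm)
  have hii : ∀ j l, Integrable (fun ω => g (Z ω, U j ω) * g (Z ω, U l ω)) P :=
    fun j l => (hL j).integrable_mul (hL l)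
  induction m with
  | zero => simp
  | succ m ih =>
    have e : ∀ ω, (∑ j ∈ Finset.range (m + 1), g (Z ω, U j ω)) ^ 2
        = (∑ j ∈ Finset.range m, g (Z ω, U j ω)) ^ 2
          + (2 * ∑ j ∈ Finset.range m, g (Z ω, U j ω) * g (Z ω, U m ω)
          + g (Z ω, U m ω) * g (Z ω, U m ω)) := by
      intro ω
      rw [Finset.sum_range_succ, ← Finset.sum_mul]
      ring
    have i1 : Integrable (fun ω => (∑ j ∈ Finset.range m, g (Z ω, U j ω)) ^ 2) P :=
      (memLp_finsetSum _ fun j _ => hL j).integrable_sq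
    have i2 : Integrable (fun ω => ∑ j ∈ Finset.range m, g (Z ω, U j ω) * g (Z ω, U m ω)) P :=
      integrable_finsetSum _ fun j _ => hii j m
    simp only [e]
    have i3 : Integrable (fun ω => 2 * ∑ j ∈ Finset.range m, g (Z ω, U j ω) * g (Z ω, U m ω)
        + g (Z ω, U m ω) * g (Z ω, U m ω)) P := (i2.const_mul 2).add (hii m m)
    rw [integral_add i1 i3, integral_add (i2.const_mul 2) (hii m m),
      integral_const_mul, integral_finsetSum _ fun j _ => hii j m, ih, hd]
    rw [Finset.sum_congr rfl fun j hj =>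
      h.integral_mul_of_ne hg hgm (Finset.mem_range.1 hj).ne, Finset.sum_const, Finset.card_range]
    have e2 : ((m + 1).descFactorial 2 : ℝ) = m.descFactorial 2 + 2 * m := by
      exact_mod_cast descFactorial_two_succ m
    rw [e2]
    simp only [Nat.descFactorial_one, nsmul_eq_mul]
    push_cast
    ring

end SubjectSample

open scoped ENNReal in
/-- Third moment of a sum of nonnegative variables in terms of mixed third moments. -/
theorem lintegral_sum_cube_le {a : ℕ → Ω → ℝ≥0∞} (ha : ∀ j, Measurable (a j))
    {b₁ b₂ b₃ : ℝ≥0∞}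
    (h1 : ∀ j, ∫⁻ ω, a j ω ^ 3 ∂P ≤ b₁)
    (h2 : ∀ j l, j ≠ l → ∫⁻ ω, a j ω ^ 2 * a l ω ∂P ≤ b₂)
    (h3 : ∀ j l p, j ≠ l → j ≠ p → l ≠ p → ∫⁻ ω, a j ω * a l ω * a p ω ∂P ≤ b₃) (m : ℕ) :
    ∫⁻ ω, (∑ j ∈ Finset.range m, a j ω) ^ 3 ∂P
      ≤ (m.descFactorial 1 : ℝ≥0∞) * b₁ + 3 * (m.descFactorial 2 : ℝ≥0∞) * b₂
        + (m.descFactorial 3 : ℝ≥0∞) * b₃ := by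
  have hs : ∀ m, Measurable (fun ω => ∑ j ∈ Finset.range m, a j ω) := fun m =>
    Finset.measurable_fun_sum _ fun j _ => ha j
  -- The cube is expanded by adding one measurement at a time. `A`, `B` and `C` bound mixed moments
  -- of the sum of the first `m` variables with variables of index at least `m`, so that the indices
  -- are distinct where `h2` and `h3` need it.
  have A : ∀ m l p, m ≤ l → m ≤ p → l ≠ p →
      ∫⁻ ω, (∑ j ∈ Finset.range m, a j ω) * a l ω * a p ω ∂P ≤ m * b₃ := by
    intro m l p hl hp hlp
    simp only [Finset.sum_mul]
    rw [lintegral_finsetSum _ fun j _ => by fun_prop]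
    refine (Finset.sum_le_sum fun j hj => h3 j l p ?_ ?_ hlp).trans ?_
    · exact ((Finset.mem_range.1 hj).trans_le hl).ne
    · exact ((Finset.mem_range.1 hj).trans_le hp).ne
    · simp
  have B : ∀ m p, m ≤ p → ∫⁻ ω, (∑ j ∈ Finset.range m, a j ω) * a p ω ^ 2 ∂P ≤ m * b₂ := by
    intro m p hp
    simp only [Finset.sum_mul]
    rw [lintegral_finsetSum _ fun j _ => by fun_prop]
    refine (Finset.sum_le_sum fun j hj => ?_).trans (b := ∑ j ∈ Finset.range m, b₂) ?_
    · simp only [mul_comm (a j _)]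
      exact h2 p j ((Finset.mem_range.1 hj).trans_le hp).ne'
    · simp
  have C : ∀ m p, m ≤ p → ∫⁻ ω, (∑ j ∈ Finset.range m, a j ω) ^ 2 * a p ω ∂P
      ≤ m * b₂ + (m.descFactorial 2 : ℝ≥0∞) * b₃ := by
    intro m
    induction m with
    | zero => intro p _; simp
    | succ m ih =>
      intro p hp
      have e : ∀ ω, (∑ j ∈ Finset.range (m + 1), a j ω) ^ 2 * a p ω
          = (∑ j ∈ Finset.range m, a j ω) ^ 2 * a p ω
            + (2 * ((∑ j ∈ Finset.range m, a j ω) * a m ω * a p ω) + a m ω ^ 2 * a p ω) := by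
        intro ω
        rw [Finset.sum_range_succ]
        ring
      simp only [e]
      rw [lintegral_add_left (by fun_prop), lintegral_add_left (by fun_prop),
        lintegral_const_mul _ (by fun_prop)]
      have q1 := ih p (by omega)
      have q2 := A m m p le_rfl (by omega) (by omega)
      have q3 := h2 m p (by omega)
      have e2 := descFactorial_two_succ m
      rw [e2]
      calc _ ≤ (m * b₂ + (m.descFactorial 2 : ℝ≥0∞) * b₃) + (2 * (m * b₃) + b₂) := by gcongr
        _ = _ := by push_cast; ring
  induction m with
  | zero => simp
  | succ m ih =>
    have e : ∀ ω, (∑ j ∈ Finset.range (m + 1), a j ω) ^ 3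
        = (∑ j ∈ Finset.range m, a j ω) ^ 3
          + (3 * ((∑ j ∈ Finset.range m, a j ω) ^ 2 * a m ω)
          + (3 * ((∑ j ∈ Finset.range m, a j ω) * a m ω ^ 2) + a m ω ^ 3)) := by
      intro ω
      rw [Finset.sum_range_succ]
      ring
    simp only [e]
    rw [lintegral_add_left (by fun_prop), lintegral_add_left (by fun_prop),
      lintegral_const_mul _ (by fun_prop), lintegral_add_left (by fun_prop),
      lintegral_const_mul _ (by fun_prop)]
    have q1 := C m m le_rfl
    have q2 := B m m le_rfl
    have q3 := h1 m
    have e2 := descFactorial_two_succ m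
    have e3 : (m + 1).descFactorial 3 = m.descFactorial 3 + 3 * m.descFactorial 2 := by
      rcases m with _ | _ | m
      · simp [Nat.descFactorial]
      · simp [Nat.descFactorial]
      · simp only [Nat.succ_descFactorial_succ, Nat.descFactorial_zero, Nat.descFactorial_one]
        ring
    rw [e2, e3]
    calc _ ≤ ((m.descFactorial 1 : ℝ≥0∞) * b₁ + 3 * (m.descFactorial 2 : ℝ≥0∞) * b₂
        + (m.descFactorial 3 : ℝ≥0∞) * b₃) + (3 * (m * b₂ + (m.descFactorial 2 : ℝ≥0∞) * b₃)
        + (3 * (m * b₂) + b₁)) := by gcongr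
      _ = _ := by
        simp only [Nat.descFactorial_one]
        push_cast
        ring

open scoped ENNReal in
-- A Hölder inequality with a lossy constant, obtained by integrating `a ^ 2 * b ≤ a ^ 3 + b ^ 3`
-- over the product measure.
theorem lintegral_sq_mul_lintegral_le {β : Type*} [MeasurableSpace β] {ν : Measure β}
    [IsProbabilityMeasure ν] {h : β → ℝ≥0∞} (hh : Measurable h) :
    (∫⁻ e, h e ^ 2 ∂ν) * ∫⁻ e, h e ∂ν ≤ 2 * ∫⁻ e, h e ^ 3 ∂ν := by
  rw [← lintegral_prod_mul (by fun_prop) (by fun_prop)]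
  have key : ∀ a b : ℝ≥0∞, a ^ 2 * b ≤ a ^ 3 + b ^ 3 := by
    intro a b
    rcases le_total a b with hab | hab
    · calc a ^ 2 * b ≤ b ^ 2 * b := by gcongr
        _ = b ^ 3 := by ring
        _ ≤ _ := le_add_self
    · calc a ^ 2 * b ≤ a ^ 2 * a := by gcongr
        _ = a ^ 3 := by ring
        _ ≤ _ := le_self_add
  refine (lintegral_mono fun (z : β × β) => key (h z.1) (h z.2)).trans (le_of_eq ?_)
  rw [lintegral_add_left (by fun_prop), lintegral_prod _ (by fun_prop),
    lintegral_prod _ (by fun_prop)]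
  simp [two_mul]

open scoped ENNReal in
theorem lintegral_pow_three_le {β : Type*} [MeasurableSpace β] {ν : Measure β}
    [IsProbabilityMeasure ν] {h : β → ℝ≥0∞} (hh : Measurable h) :
    (∫⁻ e, h e ∂ν) * ((∫⁻ e, h e ∂ν) * ∫⁻ e, h e ∂ν) ≤ 3 * ∫⁻ e, h e ^ 3 ∂ν := by
  rw [← lintegral_prod_mul (by fun_prop) (by fun_prop),
    ← lintegral_prod_mul (by fun_prop) (by fun_prop)]
  have key : ∀ a b c : ℝ≥0∞, a * (b * c) ≤ a ^ 3 + (b ^ 3 + c ^ 3) := by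
    intro a b c
    have h1 : a * (b * c) ≤ (max a (max b c)) ^ 3 := by
      calc a * (b * c) ≤ max a (max b c) * (max a (max b c) * max a (max b c)) := by
            gcongr <;> simp
        _ = _ := by ring
    refine h1.trans ?_
    rcases max_choice a (max b c) with h | h
    · rw [h]; exact le_self_add
    · rw [h]
      rcases max_choice b c with h | h
      · rw [h]; exact le_add_left le_self_add
      · rw [h]; exact le_add_left le_add_self
  refine (lintegral_mono fun (z : β × β × β) => key (h z.1) (h z.2.1) (h z.2.2)).trans (le_of_eq ?_)
  rw [lintegral_add_left (by fun_prop), lintegral_add_left (by fun_prop),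
    lintegral_prod _ (by fun_prop), lintegral_prod _ (by fun_prop), lintegral_prod _ (by fun_prop)]
  simp only [lintegral_const, measure_univ, mul_one]
  rw [lintegral_prod _ (by fun_prop), lintegral_prod _ (by fun_prop)]
  simp only [lintegral_const, measure_univ, mul_one]
  ring

open scoped ENNReal in
/-- Third moment of a sum over the measurements of one subject, for a summand dominated by a
product of a function of the time and a function of the trajectory and the noise. -/
theorem SubjectSample.lintegral_sum_cube_le {β δ : Type*} [MeasurableSpace β] [MeasurableSpace δ]
    {τ : Measure β} [IsProbabilityMeasure τ] {ν : Measure δ} [IsProbabilityMeasure ν]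
    [IsProbabilityMeasure Q] {U : ℕ → Ω → β × δ} (h : SubjectSample P Q (τ.prod ν) Z U)
    {g : E × β × δ → ℝ} {w : β → ℝ≥0∞} {H : E × δ → ℝ≥0∞} (hw : Measurable w)
    (hH : Measurable H) (hg : ∀ x s e, ‖g (x, s, e)‖ₑ ≤ w s * H (x, e)) (m : ℕ) :
    ∫⁻ ω, ‖∑ j ∈ Finset.range m, g (Z ω, U j ω)‖ₑ ^ 3 ∂P
      ≤ ((m.descFactorial 1 : ℝ≥0∞) * ∫⁻ s, w s ^ 3 ∂τ
          + 6 * (m.descFactorial 2 : ℝ≥0∞) * ((∫⁻ s, w s ^ 2 ∂τ) * ∫⁻ s, w s ∂τ)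
          + 3 * (m.descFactorial 3 : ℝ≥0∞) * (∫⁻ s, w s ∂τ) ^ 3)
        * ∫⁻ x, ∫⁻ e, H (x, e) ^ 3 ∂ν ∂Q := by
  have hU := h.measurable_right
  have hZ := h.measurable_left
  set a : ℕ → Ω → ℝ≥0∞ := fun j ω => w (U j ω).1 * H (Z ω, (U j ω).2) with ha
  have ham : ∀ j, Measurable (a j) := fun j => by fun_prop
  have hP : ∀ (p : ℕ) (x : E), ∫⁻ u, (w u.1 * H (x, u.2)) ^ p ∂(τ.prod ν)
      = (∫⁻ s, w s ^ p ∂τ) * ∫⁻ e, H (x, e) ^ p ∂ν := by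
    intro p x
    simp only [mul_pow]
    exact lintegral_prod_mul (f := fun s => w s ^ p) (g := fun e => H (x, e) ^ p)
      (by fun_prop) (by fun_prop)
  have hP1 : ∀ x : E, ∫⁻ u, w u.1 * H (x, u.2) ∂(τ.prod ν)
      = (∫⁻ s, w s ∂τ) * ∫⁻ e, H (x, e) ∂ν := fun x => by simpa using hP 1 x
  have hmeas3 : Measurable fun x => ∫⁻ e, H (x, e) ^ 3 ∂ν :=
    Measurable.lintegral_prod_right' (f := fun z : E × δ => H z ^ 3) (by fun_prop)
  have h1 : ∀ j, ∫⁻ ω, a j ω ^ 3 ∂P ≤ (∫⁻ s, w s ^ 3 ∂τ) * ∫⁻ x, ∫⁻ e, H (x, e) ^ 3 ∂ν ∂Q := by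
    intro j
    have e := lintegral_map (μ := P) (f := fun z : E × β × δ => (w z.2.1 * H (z.1, z.2.2)) ^ 3)
      (g := fun ω => (Z ω, U j ω)) (by fun_prop) (by fun_prop)
    rw [h.map_pair j, lintegral_prod _ (by fun_prop)] at e
    simp only [hP 3] at e
    rw [ha, ← e, lintegral_const_mul _ hmeas3]
  -- Given the trajectory, the measurements are independent and the time factor separates from the
  -- noise factor. The moments of `H` for fixed trajectory merge into the third one at the cost of a
  -- factor 2; with the 3 of the expansion of the cube this gives the 6 of the statement.
  have h2 : ∀ j l, j ≠ l → ∫⁻ ω, a j ω ^ 2 * a l ω ∂P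
      ≤ 2 * ((∫⁻ s, w s ^ 2 ∂τ) * ∫⁻ s, w s ∂τ) * ∫⁻ x, ∫⁻ e, H (x, e) ^ 3 ∂ν ∂Q := by
    intro j l hjl
    have e := lintegral_map (μ := P) (f := fun z : E × (β × δ) × (β × δ) =>
        (w z.2.1.1 * H (z.1, z.2.1.2)) ^ 2 * (w z.2.2.1 * H (z.1, z.2.2.2)))
      (g := fun ω => (Z ω, U j ω, U l ω)) (by fun_prop) (by fun_prop)
    rw [h.map_triple hjl, lintegral_prod _ (by fun_prop)] at e
    have e2 : ∀ x, ∫⁻ z, (w z.1.1 * H (x, z.1.2)) ^ 2 * (w z.2.1 * H (x, z.2.2))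
        ∂((τ.prod ν).prod (τ.prod ν))
        = ((∫⁻ s, w s ^ 2 ∂τ) * ∫⁻ e, H (x, e) ^ 2 ∂ν) * ((∫⁻ s, w s ∂τ) * ∫⁻ e, H (x, e) ∂ν) := by
      intro x
      rw [← hP 2 x, ← hP1 x]
      exact lintegral_prod_mul (f := fun u : β × δ => (w u.1 * H (x, u.2)) ^ 2)
        (g := fun u : β × δ => w u.1 * H (x, u.2)) (by fun_prop) (by fun_prop)
    simp only [e2] at e
    rw [ha, ← e, ← lintegral_const_mul _ hmeas3]
    refine lintegral_mono fun x => ?_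
    have := lintegral_sq_mul_lintegral_le (ν := ν) (h := fun e => H (x, e)) (by fun_prop)
    calc _ = ((∫⁻ s, w s ^ 2 ∂τ) * ∫⁻ s, w s ∂τ)
          * ((∫⁻ e, H (x, e) ^ 2 ∂ν) * ∫⁻ e, H (x, e) ∂ν) := by ring
      _ ≤ ((∫⁻ s, w s ^ 2 ∂τ) * ∫⁻ s, w s ∂τ) * (2 * ∫⁻ e, H (x, e) ^ 3 ∂ν) := by gcongr
      _ = _ := by ring
  have h3 : ∀ j l p, j ≠ l → j ≠ p → l ≠ p → ∫⁻ ω, a j ω * a l ω * a p ω ∂P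
      ≤ 3 * (∫⁻ s, w s ∂τ) ^ 3 * ∫⁻ x, ∫⁻ e, H (x, e) ^ 3 ∂ν ∂Q := by
    intro j l p hjl hjp hlp
    have e := lintegral_map (μ := P) (f := fun z : E × (β × δ) × (β × δ) × (β × δ) =>
        (w z.2.1.1 * H (z.1, z.2.1.2)) * ((w z.2.2.1.1 * H (z.1, z.2.2.1.2))
          * (w z.2.2.2.1 * H (z.1, z.2.2.2.2))))
      (g := fun ω => (Z ω, U j ω, U l ω, U p ω)) (by fun_prop) (by fun_prop)
    rw [h.map_quadruple hjl hjp hlp, lintegral_prod _ (by fun_prop)] at e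
    have e2 : ∀ x, ∫⁻ z, (w z.1.1 * H (x, z.1.2)) * ((w z.2.1.1 * H (x, z.2.1.2))
          * (w z.2.2.1 * H (x, z.2.2.2))) ∂((τ.prod ν).prod ((τ.prod ν).prod (τ.prod ν)))
        = ((∫⁻ s, w s ∂τ) * ∫⁻ e, H (x, e) ∂ν) * (((∫⁻ s, w s ∂τ) * ∫⁻ e, H (x, e) ∂ν)
          * ((∫⁻ s, w s ∂τ) * ∫⁻ e, H (x, e) ∂ν)) := by
      intro x
      rw [← hP1 x, lintegral_prod_mul (f := fun u : β × δ => w u.1 * H (x, u.2))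
        (g := fun z : (β × δ) × (β × δ) => (w z.1.1 * H (x, z.1.2)) * (w z.2.1 * H (x, z.2.2)))
        (by fun_prop) (by fun_prop), lintegral_prod_mul (f := fun u : β × δ => w u.1 * H (x, u.2))
        (g := fun u : β × δ => w u.1 * H (x, u.2)) (by fun_prop) (by fun_prop)]
    simp only [e2] at e
    simp only [ha, mul_assoc] at e ⊢
    rw [← e, ← lintegral_const_mul _ (hmeas3), ← lintegral_const_mul _ (by fun_prop)]
    refine lintegral_mono fun x => ?_
    have := lintegral_pow_three_le (ν := ν) (h := fun e => H (x, e)) (by fun_prop)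
    calc _ = (∫⁻ s, w s ∂τ) ^ 3
          * ((∫⁻ e, H (x, e) ∂ν) * ((∫⁻ e, H (x, e) ∂ν) * ∫⁻ e, H (x, e) ∂ν)) := by ring
      _ ≤ (∫⁻ s, w s ∂τ) ^ 3 * (3 * ∫⁻ e, H (x, e) ^ 3 ∂ν) := by gcongr
      _ = _ := by ring
  calc _ ≤ ∫⁻ ω, (∑ j ∈ Finset.range m, a j ω) ^ 3 ∂P := by
        refine lintegral_mono fun ω => ?_
        gcongr
        exact (enorm_sum_le _ _).trans (Finset.sum_le_sum fun j _ => hg _ _ _)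
    _ ≤ _ := OnlineFDA.lintegral_sum_cube_le ham h1 h2 h3 m
    _ = _ := by ring

end Subject

end

section

set_option linter.unusedSectionVars false

/-! ### Consequences of the sampling scheme -/

/-- The two hypotheses make the joint law a product of three laws, which may be bracketed in either
way. It is applied with trajectories `a`, times `b` and noises `c`. -/
theorem indepFun_prodMk_of_nested {Ω A B C : Type*} [MeasurableSpace Ω] [MeasurableSpace A]
    [MeasurableSpace B] [MeasurableSpace C] {P : Measure Ω} [IsProbabilityMeasure P]
    {a : Ω → A} {b : Ω → B} {c : Ω → C} (ha : Measurable a) (hb : Measurable b)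
    (hc : Measurable c) (hab : IndepFun a b P) (hc' : IndepFun c (fun ω => (a ω, b ω)) P) :
    IndepFun a (fun ω => (b ω, c ω)) P := by
  have i1 := Measure.isProbabilityMeasure_map (μ := P) ha.aemeasurable
  have i2 := Measure.isProbabilityMeasure_map (μ := P) hb.aemeasurable
  have i3 := Measure.isProbabilityMeasure_map (μ := P) hc.aemeasurable
  have hbc : IndepFun b c P := (hc'.comp measurable_id measurable_snd).symm
  rw [indepFun_iff_map_prod_eq_prod_map_map (by fun_prop) (by fun_prop),
    hbc.map_prod_eq_prod_map_map (by fun_prop) (by fun_prop), ← Measure.prodAssoc_prod,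
    ← hab.map_prod_eq_prod_map_map (by fun_prop) (by fun_prop),
    ← hc'.symm.map_prod_eq_prod_map_map (by fun_prop) (by fun_prop),
    Measure.map_map (by fun_prop) (by fun_prop)]
  rfl

/-- The law of an observation time with density `f` on `[0, 1]`. -/
def timeLaw (f : ℝ → ℝ) : Measure ℝ :=
  (volume.restrict (Icc (0 : ℝ) 1)).withDensity (fun x => ENNReal.ofReal (f x))

section Sampling

variable {Ω E : Type*} [MeasurableSpace Ω] [MeasurableSpace E]
  {P : Measure Ω} [IsProbabilityMeasure P] {Q : Measure E}
  {f : ℝ → ℝ} {ν : Measure ℝ}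
  {ζ : ℕ → ℕ → Ω → E} {T ε : ℕ → ℕ → ℕ → Ω → ℝ}

namespace SamplingCond

theorem isProbabilityMeasure_timeLaw (hs : SamplingCond P Q f ν ζ T ε) :
    IsProbabilityMeasure (timeLaw f) := by
  rw [timeLaw, ← hs.law_time 0 0 0]
  exact Measure.isProbabilityMeasure_map (hs.measurable_time 0 0 0).aemeasurable

theorem indep_time_noise (hs : SamplingCond P Q f ν ζ T ε) :
    IndepFun (fun ω (p : ℕ × ℕ × ℕ) => T p.1 p.2.1 p.2.2 ω)
      (fun ω (p : ℕ × ℕ × ℕ) => ε p.1 p.2.1 p.2.2 ω) P :=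
  (hs.indep_noise_rest.comp measurable_id measurable_snd).symm

/-- The pairs (time, noise) are i.i.d. -/
theorem indep_inputs (hs : SamplingCond P Q f ν ζ T ε) :
    iIndepFun (fun (p : ℕ × ℕ × ℕ) ω => (T p.1 p.2.1 p.2.2 ω, ε p.1 p.2.1 p.2.2 ω)) P :=
  iIndepFun_prodMk (fun _ => hs.measurable_time _ _ _) (fun _ => hs.measurable_noise _ _ _)
    hs.indep_time hs.indep_noise hs.indep_time_noise

theorem indep_traj_inputs (hs : SamplingCond P Q f ν ζ T ε) :
    IndepFun (fun ω (p : ℕ × ℕ) => ζ p.1 p.2 ω)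
      (fun ω (p : ℕ × ℕ × ℕ) => (T p.1 p.2.1 p.2.2 ω, ε p.1 p.2.1 p.2.2 ω)) P := by
  have h1 : Measurable (fun ω (p : ℕ × ℕ) => ζ p.1 p.2 ω) :=
    measurable_pi_lambda _ fun _ => hs.measurable_traj _ _
  have h2 : Measurable (fun ω (p : ℕ × ℕ × ℕ) => T p.1 p.2.1 p.2.2 ω) :=
    measurable_pi_lambda _ fun _ => hs.measurable_time _ _ _
  have h3 : Measurable (fun ω (p : ℕ × ℕ × ℕ) => ε p.1 p.2.1 p.2.2 ω) :=
    measurable_pi_lambda _ fun _ => hs.measurable_noise _ _ _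
  have h := indepFun_prodMk_of_nested h1 h2 h3 hs.indep_traj_time hs.indep_noise_rest
  exact h.comp (ψ := fun (z : (ℕ × ℕ × ℕ → ℝ) × (ℕ × ℕ × ℕ → ℝ)) p => (z.1 p, z.2 p))
    measurable_id (by fun_prop)

theorem map_input (hs : SamplingCond P Q f ν ζ T ε) (k i j : ℕ) :
    P.map (fun ω => (T k i j ω, ε k i j ω)) = (timeLaw f).prod ν := by
  have h : IndepFun (T k i j) (ε k i j) P :=
    hs.indep_time_noise.comp (measurable_pi_apply (k, i, j)) (measurable_pi_apply (k, i, j))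
  rw [h.map_prod_eq_prod_map_map (hs.measurable_time _ _ _).aemeasurable
    (hs.measurable_noise _ _ _).aemeasurable, hs.law_time, hs.law_noise, timeLaw]

theorem subjectSample (hs : SamplingCond P Q f ν ζ T ε) (k i : ℕ) :
    SubjectSample P Q ((timeLaw f).prod ν) (ζ k i) (fun j ω => (T k i j ω, ε k i j ω)) where
  measurable_left := hs.measurable_traj k i
  measurable_right j := (hs.measurable_time k i j).prodMk (hs.measurable_noise k i j)
  law_left := hs.law_traj k i
  law_right j := hs.map_input k i j
  indep_right := hs.indep_inputs.precomp (g := fun j => (k, i, j)) fun a b hab => by simpa using hab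
  indep := hs.indep_traj_inputs.comp (φ := fun z : ℕ × ℕ → E => z (k, i))
    (ψ := fun (u : ℕ × ℕ × ℕ → ℝ × ℝ) j => u (k, i, j)) (by fun_prop) (by fun_prop)

/-- The data of different subjects are independent. -/
theorem indep_subjects (hs : SamplingCond P Q f ν ζ T ε) :
    iIndepFun (fun (p : ℕ × ℕ) ω =>
      (ζ p.1 p.2 ω, fun j => (T p.1 p.2 j ω, ε p.1 p.2 j ω))) P := by
  have hm : ∀ k i j, Measurable fun ω => (T k i j ω, ε k i j ω) := fun k i j =>
    (hs.measurable_time k i j).prodMk (hs.measurable_noise k i j)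
  refine iIndepFun_prodMk (fun _ => hs.measurable_traj _ _)
    (fun p => measurable_pi_lambda _ fun j => hm p.1 p.2 j) hs.indep_traj ?_ ?_
  · refine iIndepFun_curry (X := fun (p : ℕ × ℕ) j ω => (T p.1 p.2 j ω, ε p.1 p.2 j ω))
      (fun p j => hm p.1 p.2 j) ?_
    refine hs.indep_inputs.precomp (g := fun p : (_ : ℕ × ℕ) × ℕ => (p.1.1, p.1.2, p.2)) ?_
    rintro ⟨⟨a, b⟩, c⟩ ⟨⟨a', b'⟩, c'⟩ hab
    simp only [Prod.mk.injEq] at hab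
    obtain ⟨rfl, rfl, rfl⟩ := hab
    rfl
  · exact hs.indep_traj_inputs.comp
      (ψ := fun u (p : ℕ × ℕ) j => u (p.1, p.2, j)) measurable_id (by fun_prop)

end SamplingCond

/-! ### Sums over blocks, subjects and measurements -/

/-- The contribution of one subject. -/
def subjectSum (m : ℕ → ℕ → ℕ) (ζ : ℕ → ℕ → Ω → E) (T ε : ℕ → ℕ → ℕ → Ω → ℝ)
    (g : ℕ → E × ℝ × ℝ → ℝ) (k i : ℕ) (ω : Ω) : ℝ :=
  ∑ j ∈ Finset.range (m k i), g k (ζ k i ω, T k i j ω, ε k i j ω)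

/-- `∑_{k ≤ K} ∑_i ∑_j g_k(ζ_{ki}, T_{kij}, ε_{kij})`. -/
def tripleSum (n : ℕ → ℕ) (m : ℕ → ℕ → ℕ) (ζ : ℕ → ℕ → Ω → E) (T ε : ℕ → ℕ → ℕ → Ω → ℝ)
    (g : ℕ → E × ℝ × ℝ → ℝ) (K : ℕ) (ω : Ω) : ℝ :=
  ∑ k ∈ Finset.Icc 1 K, ∑ i ∈ Finset.range (n k), subjectSum m ζ T ε g k i ω

/-- The index set of the subjects of the first `K` blocks. -/
def subjects (n : ℕ → ℕ) (K : ℕ) : Finset ((_ : ℕ) × ℕ) :=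
  (Finset.Icc 1 K).sigma fun k => Finset.range (n k)

variable {n : ℕ → ℕ} {m : ℕ → ℕ → ℕ}

theorem tripleSum_eq_sum_subjects (g : ℕ → E × ℝ × ℝ → ℝ) (K : ℕ) (ω : Ω) :
    tripleSum n m ζ T ε g K ω = ∑ p ∈ subjects n K, subjectSum m ζ T ε g p.1 p.2 ω := by
  rw [tripleSum, subjects, Finset.sum_sigma]

theorem sum_subjects_descFactorial (c : ℕ → ℝ) (j K : ℕ) :
    ∑ p ∈ subjects n K, ((m p.1 p.2).descFactorial j : ℝ) * c p.1
      = ∑ k ∈ Finset.Icc 1 K, blockSize n m j k * c k := by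
  rw [subjects, Finset.sum_sigma]
  refine Finset.sum_congr rfl fun k _ => ?_
  rw [blockSize, Finset.sum_mul]

theorem tripleSum_add (g g' : ℕ → E × ℝ × ℝ → ℝ) (K : ℕ) (ω : Ω) :
    tripleSum n m ζ T ε (fun k z => g k z + g' k z) K ω
      = tripleSum n m ζ T ε g K ω + tripleSum n m ζ T ε g' K ω := by
  simp only [tripleSum, subjectSum, Finset.sum_add_distrib]

theorem tripleSum_sub_const (g : ℕ → E × ℝ × ℝ → ℝ) (c : ℕ → ℝ) (K : ℕ) (ω : Ω) :
    tripleSum n m ζ T ε (fun k z => g k z - c k) K ω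
      = tripleSum n m ζ T ε g K ω - ∑ k ∈ Finset.Icc 1 K, blockSize n m 1 k * c k := by
  rw [← sum_subjects_descFactorial, tripleSum_eq_sum_subjects, tripleSum_eq_sum_subjects,
    ← Finset.sum_sub_distrib]
  refine Finset.sum_congr rfl fun p _ => ?_
  simp [subjectSum]

theorem tripleSum_const_mul (g : ℕ → E × ℝ × ℝ → ℝ) (c : ℝ) (K : ℕ) (ω : Ω) :
    tripleSum n m ζ T ε (fun k z => c * g k z) K ω = c * tripleSum n m ζ T ε g K ω := by
  simp only [tripleSum, subjectSum, Finset.mul_sum]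

theorem tripleSum_congr {g g' : ℕ → E × ℝ × ℝ → ℝ} {K : ℕ} {ω : Ω}
    (h : ∀ k ∈ Finset.Icc 1 K, ∀ i j, g k (ζ k i ω, T k i j ω, ε k i j ω)
      = g' k (ζ k i ω, T k i j ω, ε k i j ω)) :
    tripleSum n m ζ T ε g K ω = tripleSum n m ζ T ε g' K ω :=
  Finset.sum_congr rfl fun k hk => Finset.sum_congr rfl fun i _ =>
    Finset.sum_congr rfl fun j _ => h k hk i j

namespace SamplingCond

variable [IsProbabilityMeasure Q] [IsProbabilityMeasure ν]

theorem measurable_subjectSum (hs : SamplingCond P Q f ν ζ T ε) {g : ℕ → E × ℝ × ℝ → ℝ}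
    (hg : ∀ k, Measurable (g k)) (k i : ℕ) : Measurable (subjectSum m ζ T ε g k i) := by
  have h1 := hs.measurable_traj
  have h2 := hs.measurable_time
  have h3 := hs.measurable_noise
  unfold subjectSum
  fun_prop

theorem measurable_tripleSum (hs : SamplingCond P Q f ν ζ T ε) {g : ℕ → E × ℝ × ℝ → ℝ}
    (hg : ∀ k, Measurable (g k)) (K : ℕ) : Measurable (tripleSum n m ζ T ε g K) := by
  have h1 : ∀ k i, Measurable (subjectSum m ζ T ε g k i) := hs.measurable_subjectSum hg
  unfold tripleSum
  fun_prop

theorem indep_subjectSum (hs : SamplingCond P Q f ν ζ T ε) {g : ℕ → E × ℝ × ℝ → ℝ}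
    (hg : ∀ k, Measurable (g k)) :
    iIndepFun (fun (p : (_ : ℕ) × ℕ) ω => subjectSum m ζ T ε g p.1 p.2 ω) P := by
  have h := hs.indep_subjects.comp
    (g := fun (p : ℕ × ℕ) (z : E × (ℕ → ℝ × ℝ)) =>
      ∑ j ∈ Finset.range (m p.1 p.2), g p.1 (z.1, z.2 j)) (fun p => by fun_prop)
  refine h.precomp (g := fun p : (_ : ℕ) × ℕ => (p.1, p.2)) ?_
  rintro ⟨a, b⟩ ⟨a', b'⟩ hab
  simp only [Prod.mk.injEq] at hab
  obtain ⟨rfl, rfl⟩ := hab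
  rfl

theorem memLp_subjectSum (hs : SamplingCond P Q f ν ζ T ε) {g : ℕ → E × ℝ × ℝ → ℝ}
    {q : ENNReal} {k : ℕ} (hL : MemLp (g k) q (Q.prod ((timeLaw f).prod ν))) (i : ℕ) :
    MemLp (subjectSum m ζ T ε g k i) q P := by
  unfold subjectSum
  exact memLp_finsetSum _ fun j _ =>
    hL.comp_measurePreserving ((hs.subjectSample k i).measurePreserving j)

theorem integral_subjectSum (hs : SamplingCond P Q f ν ζ T ε) {g : ℕ → E × ℝ × ℝ → ℝ}
    {k : ℕ} (hg : Measurable (g k)) (hL : Integrable (g k) (Q.prod ((timeLaw f).prod ν))) (i : ℕ) :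
    ∫ ω, subjectSum m ζ T ε g k i ω ∂P
      = (m k i : ℝ) * ∫ z, g k z ∂(Q.prod ((timeLaw f).prod ν)) := by
  unfold subjectSum
  have hi : ∀ j, Integrable (fun ω => g k (ζ k i ω, T k i j ω, ε k i j ω)) P := fun j =>
    ((hs.subjectSample k i).measurePreserving j).integrable_comp_of_integrable hL
  rw [integral_finsetSum _ fun j _ => hi j]
  have e : ∀ j, ∫ ω, g k (ζ k i ω, T k i j ω, ε k i j ω) ∂P
      = ∫ z, g k z ∂(Q.prod ((timeLaw f).prod ν)) := by
    intro j
    rw [← (hs.subjectSample k i).map_pair j, integral_map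
      ((hs.subjectSample k i).measurePreserving j).measurable.aemeasurable hg.aestronglyMeasurable]
  simp [e]

theorem memLp_tripleSum (hs : SamplingCond P Q f ν ζ T ε) {g : ℕ → E × ℝ × ℝ → ℝ} {q : ENNReal}
    {K : ℕ} (hL : ∀ k ∈ Finset.Icc 1 K, MemLp (g k) q (Q.prod ((timeLaw f).prod ν))) :
    MemLp (tripleSum n m ζ T ε g K) q P := by
  unfold tripleSum
  exact memLp_finsetSum _ fun k hk => memLp_finsetSum _ fun i _ => hs.memLp_subjectSum (hL k hk) i

theorem integral_subjectSum_sq (hs : SamplingCond P Q f ν ζ T ε) {g : ℕ → E × ℝ × ℝ → ℝ}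
    {k : ℕ} (hg : Measurable (g k)) (hL : MemLp (g k) 2 (Q.prod ((timeLaw f).prod ν))) (i : ℕ) :
    ∫ ω, subjectSum m ζ T ε g k i ω ^ 2 ∂P
      = ((m k i).descFactorial 1 : ℝ) * ∫ z, g k z ^ 2 ∂(Q.prod ((timeLaw f).prod ν))
        + ((m k i).descFactorial 2 : ℝ)
          * ∫ x, (∫ u, g k (x, u) ∂((timeLaw f).prod ν)) ^ 2 ∂Q := by
  have := hs.isProbabilityMeasure_timeLaw
  exact (hs.subjectSample k i).integral_sum_sq hL hg (m k i)

/-- Second moment of a centred triple sum. -/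
theorem integral_tripleSum_sq (hs : SamplingCond P Q f ν ζ T ε) {g : ℕ → E × ℝ × ℝ → ℝ} {K : ℕ}
    (hg : ∀ k, Measurable (g k))
    (hL : ∀ k ∈ Finset.Icc 1 K, MemLp (g k) 2 (Q.prod ((timeLaw f).prod ν)))
    (h0 : ∀ k ∈ Finset.Icc 1 K, ∫ z, g k z ∂(Q.prod ((timeLaw f).prod ν)) = 0) :
    ∫ ω, tripleSum n m ζ T ε g K ω ^ 2 ∂P
      = ∑ k ∈ Finset.Icc 1 K, blockSize n m 1 k * ∫ z, g k z ^ 2 ∂(Q.prod ((timeLaw f).prod ν))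
        + ∑ k ∈ Finset.Icc 1 K, blockSize n m 2 k
          * ∫ x, (∫ u, g k (x, u) ∂((timeLaw f).prod ν)) ^ 2 ∂Q := by
  have := hs.isProbabilityMeasure_timeLaw
  have hk : ∀ p ∈ subjects n K, p.1 ∈ Finset.Icc 1 K := fun p hp => (Finset.mem_sigma.1 hp).1
  have hS : ∀ p ∈ subjects n K, MemLp (fun ω => subjectSum m ζ T ε g p.1 p.2 ω) 2 P := fun p hp =>
    hs.memLp_subjectSum (hL p.1 (hk p hp)) p.2
  have hS0 : ∀ p ∈ subjects n K, ∫ ω, subjectSum m ζ T ε g p.1 p.2 ω ∂P = 0 := by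
    intro p hp
    rw [hs.integral_subjectSum (hg _) ((hL p.1 (hk p hp)).integrable (by norm_num)),
      h0 _ (hk p hp), mul_zero]
  have hv := IndepFun.variance_sum (μ := P) (s := subjects n K)
    (X := fun p ω => subjectSum m ζ T ε g p.1 p.2 ω) hS
    (fun p _ q _ hpq => (hs.indep_subjectSum hg).indepFun hpq)
  have e1 : (fun ω => tripleSum n m ζ T ε g K ω)
      = ∑ p ∈ subjects n K, fun ω => subjectSum m ζ T ε g p.1 p.2 ω := by
    ext ω
    rw [tripleSum_eq_sum_subjects, Finset.sum_apply]
  have e2 : ∫ ω, tripleSum n m ζ T ε g K ω ∂P = 0 := by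
    simp only [tripleSum_eq_sum_subjects]
    rw [integral_finsetSum _ fun p hp => (hS p hp).integrable (by norm_num),
      Finset.sum_eq_zero hS0]
  rw [← e1, variance_of_integral_eq_zero (hs.measurable_tripleSum hg K).aemeasurable e2] at hv
  rw [hv, ← sum_subjects_descFactorial, ← sum_subjects_descFactorial, ← Finset.sum_add_distrib]
  refine Finset.sum_congr rfl fun p hp => ?_
  rw [variance_of_integral_eq_zero (hs.measurable_subjectSum hg _ _).aemeasurable (hS0 p hp)]
  exact hs.integral_subjectSum_sq (hg _) (hL _ (hk p hp)) _

theorem integral_time (hs : SamplingCond P Q f ν ζ T ε) (w : ℝ → ℝ) :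
    ∫ z : E × ℝ × ℝ, w z.2.1 ∂(Q.prod ((timeLaw f).prod ν)) = ∫ s, w s ∂(timeLaw f) := by
  have := hs.isProbabilityMeasure_timeLaw
  have h1 := integral_fun_snd (μ := Q) (ν := (timeLaw f).prod ν) (fun z : ℝ × ℝ => w z.1)
  have h2 := integral_fun_fst (μ := timeLaw f) (ν := ν) w
  simp only [probReal_univ, one_smul] at h1 h2
  rw [h1, h2]

theorem memLp_time (hs : SamplingCond P Q f ν ζ T ε) {w : ℝ → ℝ} {q : ENNReal}
    (hw : MemLp w q (timeLaw f)) :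
    MemLp (fun z : E × ℝ × ℝ => w z.2.1) q (Q.prod ((timeLaw f).prod ν)) := by
  have := hs.isProbabilityMeasure_timeLaw
  have h1 : MemLp (fun z : ℝ × ℝ => w z.1) q ((timeLaw f).prod ν) := hw.comp_fst ν
  exact h1.comp_snd Q

/-- Variance bound for a triple sum of functions of the observation times. -/
theorem integral_tripleSum_time_sub_sq_le (hs : SamplingCond P Q f ν ζ T ε) {w : ℕ → ℝ → ℝ} {K : ℕ}
    (hw : ∀ k, Measurable (w k)) (hL : ∀ k ∈ Finset.Icc 1 K, MemLp (w k) 2 (timeLaw f)) :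
    ∫ ω, (tripleSum n m ζ T ε (fun k z => w k z.2.1) K ω
        - ∑ k ∈ Finset.Icc 1 K, blockSize n m 1 k * ∫ s, w k s ∂(timeLaw f)) ^ 2 ∂P
      ≤ ∑ k ∈ Finset.Icc 1 K, blockSize n m 1 k * ∫ s, w k s ^ 2 ∂(timeLaw f) := by
  have := hs.isProbabilityMeasure_timeLaw
  simp only [← tripleSum_sub_const]
  set c : ℕ → ℝ := fun k => ∫ s, w k s ∂(timeLaw f) with hc
  have hL' : ∀ k ∈ Finset.Icc 1 K, MemLp (fun s => w k s - c k) 2 (timeLaw f) := fun k hk =>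
    (hL k hk).sub (memLp_const _)
  have h0 : ∀ k ∈ Finset.Icc 1 K, ∫ s, (w k s - c k) ∂(timeLaw f) = 0 := by
    intro k hk
    rw [integral_sub ((hL k hk).integrable (by norm_num)) (integrable_const _)]
    simp [hc]
  rw [hs.integral_tripleSum_sq (g := fun k z => w k z.2.1 - c k)
    (fun k => by have := hw k; fun_prop)
    (fun k hk => hs.memLp_time (hL' k hk))
    (fun k hk => by rw [hs.integral_time (fun s => w k s - c k), h0 k hk])]
  -- A function of the time alone has a conditional mean that does not depend on the trajectory.
  -- After centring it is zero, so distinct measurements of a subject are uncorrelated.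
  have e : ∑ k ∈ Finset.Icc 1 K, blockSize n m 2 k * ∫ x : E, (∫ u : ℝ × ℝ, (w k u.1 - c k)
      ∂((timeLaw f).prod ν)) ^ 2 ∂Q = 0 := by
    refine Finset.sum_eq_zero fun k hk => ?_
    have h2 := integral_fun_fst (μ := timeLaw f) (ν := ν) (fun s => w k s - c k)
    simp only [probReal_univ, one_smul] at h2
    rw [h2, h0 k hk]
    simp
  rw [e, add_zero]
  refine Finset.sum_le_sum fun k hk => ?_
  have hb : 0 ≤ blockSize n m 1 k := Finset.sum_nonneg fun _ _ => Nat.cast_nonneg _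
  refine mul_le_mul_of_nonneg_left ?_ hb
  rw [hs.integral_time (fun s => (w k s - c k) ^ 2)]
  have h1 := variance_eq_sub (hL k hk)
  have h2 := variance_eq_integral (hL k hk).aestronglyMeasurable.aemeasurable
  rw [h2] at h1
  simp only [hc]
  rw [h1]
  simp only [Pi.pow_apply]
  linarith [sq_nonneg (∫ s, w k s ∂(timeLaw f))]

end SamplingCond

end Sampling

end

section

set_option linter.unusedSectionVars false

/-! ### Central limit theorems for triple sums -/

section TripleCLT

variable {Ω E : Type*} [MeasurableSpace Ω] [MeasurableSpace E]
  {P : Measure Ω} [IsProbabilityMeasure P] {Q : Measure E} [IsProbabilityMeasure Q]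
  {f : ℝ → ℝ} {ν : Measure ℝ} [IsProbabilityMeasure ν]
  {ζ : ℕ → ℕ → Ω → E} {T ε : ℕ → ℕ → ℕ → Ω → ℝ} {n : ℕ → ℕ} {m : ℕ → ℕ → ℕ}

theorem lintegral_ofReal_pow {α : Type*} [MeasurableSpace α] {μ : Measure α} {w : α → ℝ} {p : ℕ}
    (hw : ∀ s, 0 ≤ w s) (hi : Integrable (fun s => w s ^ p) μ) :
    ∫⁻ s, ENNReal.ofReal (w s) ^ p ∂μ = ENNReal.ofReal (∫ s, w s ^ p ∂μ) := by
  rw [ofReal_integral_eq_lintegral_ofReal hi (Eventually.of_forall fun s => pow_nonneg (hw s) p)]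
  exact lintegral_congr fun s => (ENNReal.ofReal_pow (hw s) p).symm

theorem integrable_pow_of_memLp_three {α : Type*} [MeasurableSpace α] {μ : Measure α}
    [IsProbabilityMeasure μ] {w : α → ℝ} (hw : ∀ s, 0 ≤ w s) (hL : MemLp w 3 μ) {p : ℕ}
    (hp : p ≠ 0) (hp3 : p ≤ 3) : Integrable (fun s => w s ^ p) μ := by
  have h : MemLp w p μ := hL.mono_exponent (by exact_mod_cast hp3)
  have := h.integrable_norm_pow hp
  simpa [Real.norm_eq_abs, abs_of_nonneg (hw _)] using this

theorem memLp_three_of_lintegral {α : Type*} [MeasurableSpace α] {μ : Measure α} {g : α → ℝ}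
    (hg : Measurable g) (h : ∫⁻ a, ‖g a‖ₑ ^ 3 ∂μ < ⊤) : MemLp g 3 μ := by
  refine ⟨hg.aestronglyMeasurable, ?_⟩
  rw [eLpNorm_lt_top_iff_lintegral_rpow_enorm_lt_top (by norm_num) (by norm_num)]
  refine lt_of_eq_of_lt (lintegral_congr fun a => ?_) h
  rw [show (3 : ENNReal).toReal = ((3 : ℕ) : ℝ) by norm_num, ENNReal.rpow_natCast]

namespace SamplingCond

/-- A function dominated by a product of cube-integrable functions of the time and of the
trajectory and the noise. -/
theorem memLp_three_of_le (hs : SamplingCond P Q f ν ζ T ε) {g : E × ℝ × ℝ → ℝ} {w : ℝ → ℝ}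
    {H : E × ℝ → ℝ} (hg : Measurable g) (hw : Measurable w) (hH : Measurable H)
    (hw0 : ∀ s, 0 ≤ w s) (hH0 : ∀ z, 0 ≤ H z) (hwL : MemLp w 3 (timeLaw f))
    (hHL : MemLp H 3 (Q.prod ν)) (hb : ∀ x s e, |g (x, s, e)| ≤ w s * H (x, e)) :
    MemLp g 3 (Q.prod ((timeLaw f).prod ν)) := by
  have := hs.isProbabilityMeasure_timeLaw
  refine memLp_three_of_lintegral hg ?_
  have h1 : ∫⁻ z, ‖g z‖ₑ ^ 3 ∂(Q.prod ((timeLaw f).prod ν))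
      ≤ ∫⁻ z : E × ℝ × ℝ, ENNReal.ofReal (w z.2.1) ^ 3 * ENNReal.ofReal (H (z.1, z.2.2)) ^ 3
        ∂(Q.prod ((timeLaw f).prod ν)) := by
    refine lintegral_mono fun z => ?_
    rw [← mul_pow, ← ENNReal.ofReal_mul (hw0 _), Real.enorm_eq_ofReal_abs]
    gcongr
    exact hb _ _ _
  refine h1.trans_lt ?_
  rw [lintegral_prod _ (by fun_prop)]
  have e : ∀ x, ∫⁻ u : ℝ × ℝ, ENNReal.ofReal (w u.1) ^ 3 * ENNReal.ofReal (H (x, u.2)) ^ 3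
      ∂((timeLaw f).prod ν) = (∫⁻ s, ENNReal.ofReal (w s) ^ 3 ∂(timeLaw f))
        * ∫⁻ e, ENNReal.ofReal (H (x, e)) ^ 3 ∂ν := fun x =>
    lintegral_prod_mul (f := fun s => ENNReal.ofReal (w s) ^ 3)
      (g := fun e => ENNReal.ofReal (H (x, e)) ^ 3) (by fun_prop) (by fun_prop)
  simp only [e]
  rw [lintegral_const_mul _ (Measurable.lintegral_prod_right'
    (f := fun z : E × ℝ => ENNReal.ofReal (H z) ^ 3) (by fun_prop)),
    ← lintegral_prod (fun z : E × ℝ => ENNReal.ofReal (H z) ^ 3) (by fun_prop),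
    lintegral_ofReal_pow hw0 (integrable_pow_of_memLp_three hw0 hwL (by norm_num) le_rfl),
    lintegral_ofReal_pow hH0 (integrable_pow_of_memLp_three hH0 hHL (by norm_num) le_rfl)]
  exact ENNReal.mul_lt_top ENNReal.ofReal_lt_top ENNReal.ofReal_lt_top

theorem integral_abs_subjectSum_cube_le (hs : SamplingCond P Q f ν ζ T ε)
    {g : ℕ → E × ℝ × ℝ → ℝ} {k : ℕ} {w : ℝ → ℝ} {H : E × ℝ → ℝ} (hg : ∀ k, Measurable (g k))
    (hw : Measurable w) (hH : Measurable H)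
    (hw0 : ∀ s, 0 ≤ w s) (hH0 : ∀ z, 0 ≤ H z) (hwL : MemLp w 3 (timeLaw f))
    (hHL : MemLp H 3 (Q.prod ν)) (hb : ∀ x s e, |g k (x, s, e)| ≤ w s * H (x, e)) (i : ℕ) :
    ∫ ω, |subjectSum m ζ T ε g k i ω| ^ 3 ∂P
      ≤ ((m k i).descFactorial 1 : ℝ) * ((∫ s, w s ^ 3 ∂(timeLaw f)) * ∫ z, H z ^ 3 ∂(Q.prod ν))
        + ((m k i).descFactorial 2 : ℝ) * (6 * ((∫ s, w s ^ 2 ∂(timeLaw f))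
          * ∫ s, w s ∂(timeLaw f)) * ∫ z, H z ^ 3 ∂(Q.prod ν))
        + ((m k i).descFactorial 3 : ℝ) * (3 * (∫ s, w s ∂(timeLaw f)) ^ 3
          * ∫ z, H z ^ 3 ∂(Q.prod ν)) := by
  have := hs.isProbabilityMeasure_timeLaw
  have h := (hs.subjectSample k i).lintegral_sum_cube_le (g := g k)
    (w := fun s => ENNReal.ofReal (w s)) (H := fun z => ENNReal.ofReal (H z)) (by fun_prop)
    (by fun_prop) (fun x s e => by
      rw [← ENNReal.ofReal_mul (hw0 _), Real.enorm_eq_ofReal_abs]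
      gcongr
      exact hb _ _ _) (m k i)
  have w1 := lintegral_ofReal_pow hw0
    (integrable_pow_of_memLp_three hw0 hwL (p := 1) (by norm_num) (by norm_num))
  simp only [pow_one] at w1
  rw [← lintegral_prod (fun z : E × ℝ => ENNReal.ofReal (H z) ^ 3) (by fun_prop), w1,
    lintegral_ofReal_pow hw0 (integrable_pow_of_memLp_three hw0 hwL (by norm_num) le_rfl),
    lintegral_ofReal_pow hw0 (integrable_pow_of_memLp_three hw0 hwL (by norm_num) (by norm_num)),
    lintegral_ofReal_pow hH0 (integrable_pow_of_memLp_three hH0 hHL (by norm_num) le_rfl)] at h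
  have p1 : 0 ≤ ∫ s, w s ∂(timeLaw f) := integral_nonneg hw0
  have p2 : 0 ≤ ∫ s, w s ^ 2 ∂(timeLaw f) := integral_nonneg fun s => sq_nonneg _
  have p3 : 0 ≤ ∫ s, w s ^ 3 ∂(timeLaw f) := integral_nonneg fun s => pow_nonneg (hw0 s) 3
  have p4 : 0 ≤ ∫ z, H z ^ 3 ∂(Q.prod ν) := integral_nonneg fun s => pow_nonneg (hH0 s) 3
  rw [integral_eq_lintegral_of_nonneg_ae
    (Eventually.of_forall fun ω => pow_nonneg (abs_nonneg _) 3)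
    ((hs.measurable_subjectSum hg k i).abs.pow_const 3).aestronglyMeasurable]
  refine ENNReal.toReal_le_of_le_ofReal (by positivity) ?_
  refine le_trans (le_of_eq (lintegral_congr fun ω => ?_)) (h.trans (le_of_eq ?_))
  · rw [subjectSum, ENNReal.ofReal_pow (abs_nonneg _), Real.enorm_eq_ofReal_abs]
  · have c1 : ∀ a : ℕ, (a : ENNReal) = ENNReal.ofReal a := fun a => by simp
    have c2 : (6 : ENNReal) = ENNReal.ofReal 6 := by simp
    have c3 : (3 : ENNReal) = ENNReal.ofReal 3 := by simp
    rw [c1, c1, c1, c2, c3, ← ENNReal.ofReal_pow p1, ← ENNReal.ofReal_mul p2,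
      ← ENNReal.ofReal_mul (by positivity), ← ENNReal.ofReal_mul (by positivity),
      ← ENNReal.ofReal_mul (by positivity), ← ENNReal.ofReal_mul (by positivity),
      ← ENNReal.ofReal_mul (by positivity), ← ENNReal.ofReal_add (by positivity) (by positivity),
      ← ENNReal.ofReal_add (by positivity) (by positivity), ← ENNReal.ofReal_mul (by positivity)]
    congr 1
    ring

/-- Central limit theorem for triple sums with dependence within subjects. -/
theorem clt_subjects (hs : SamplingCond P Q f ν ζ T ε) {g : ℕ → ℕ → E × ℝ × ℝ → ℝ}
    {w : ℕ → ℕ → ℝ → ℝ} {H : E × ℝ → ℝ}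
    (hg : ∀ K k, Measurable (g K k)) (hw : ∀ K k, Measurable (w K k)) (hH : Measurable H)
    (hw0 : ∀ K k s, 0 ≤ w K k s) (hH0 : ∀ z, 0 ≤ H z)
    (hwL : ∀ K, ∀ k ∈ Finset.Icc 1 K, MemLp (w K k) 3 (timeLaw f))
    (hHL : MemLp H 3 (Q.prod ν))
    (hb : ∀ K k x s e, |g K k (x, s, e)| ≤ w K k s * H (x, e))
    (h0 : ∀ K, ∀ k ∈ Finset.Icc 1 K, ∫ z, g K k z ∂(Q.prod ((timeLaw f).prod ν)) = 0)
    {v : NNReal}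
    (hvar : Tendsto (fun K => ∑ k ∈ Finset.Icc 1 K, blockSize n m 1 k
          * ∫ z, g K k z ^ 2 ∂(Q.prod ((timeLaw f).prod ν))
        + ∑ k ∈ Finset.Icc 1 K, blockSize n m 2 k
          * ∫ x, (∫ u, g K k (x, u) ∂((timeLaw f).prod ν)) ^ 2 ∂Q) atTop (𝓝 v))
    (hthree : Tendsto (fun K => ∑ k ∈ Finset.Icc 1 K, blockSize n m 1 k
          * ∫ s, w K k s ^ 3 ∂(timeLaw f)
        + ∑ k ∈ Finset.Icc 1 K, blockSize n m 2 k
          * ((∫ s, w K k s ^ 2 ∂(timeLaw f)) * ∫ s, w K k s ∂(timeLaw f))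
        + ∑ k ∈ Finset.Icc 1 K, blockSize n m 3 k
          * (∫ s, w K k s ∂(timeLaw f)) ^ 3) atTop (𝓝 0)) :
    TendstoInDistribution (fun K => tripleSum n m ζ T ε (g K) K) atTop id (fun _ => P)
      (gaussianReal 0 v) := by
  have := hs.isProbabilityMeasure_timeLaw
  have hk : ∀ K, ∀ p ∈ subjects n K, p.1 ∈ Finset.Icc 1 K :=
    fun K p hp => (Finset.mem_sigma.1 hp).1
  have hL : ∀ K, ∀ k ∈ Finset.Icc 1 K, MemLp (g K k) 3 (Q.prod ((timeLaw f).prod ν)) :=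
    fun K k hk => hs.memLp_three_of_le (hg K k) (hw K k) hH (hw0 K k) hH0 (hwL K k hk) hHL (hb K k)
  have hL2 : ∀ K, ∀ k ∈ Finset.Icc 1 K, MemLp (g K k) 2 (Q.prod ((timeLaw f).prod ν)) :=
    fun K k hk => (hL K k hk).mono_exponent (by norm_num)
  have h := tendstoInDistribution_sum_of_lyapunov (P := P) (fun K => subjects n K)
    (fun K p ω => subjectSum m ζ T ε (g K) p.1 p.2 ω)
    (Eventually.of_forall fun K => hs.indep_subjectSum (hg K))
    (fun K p => (hs.measurable_subjectSum (hg K) _ _).aemeasurable)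
    (Eventually.of_forall fun K p hp => hs.memLp_subjectSum (hL K _ (hk K p hp)) _)
    (Eventually.of_forall fun K p hp => by
      rw [hs.integral_subjectSum (hg K _)
        ((hL K _ (hk K p hp)).integrable (by norm_num)), h0 K _ (hk K p hp), mul_zero])
    (v := v) ?_ ?_
  · simpa only [← tripleSum_eq_sum_subjects] using h
  · refine hvar.congr fun K => ?_
    rw [← sum_subjects_descFactorial, ← sum_subjects_descFactorial, ← Finset.sum_add_distrib]
    refine Finset.sum_congr rfl fun p hp => ?_
    exact (hs.integral_subjectSum_sq (hg K _) (hL2 K _ (hk K p hp)) _).symm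
  · set M := ∫ z, H z ^ 3 ∂(Q.prod ν) with hM
    have hM0 : 0 ≤ M := integral_nonneg fun s => pow_nonneg (hH0 s) 3
    -- The factor 6 is the largest of the constants 1, 6 and 3 in the bound for the third moment of
    -- one subject.
    refine squeeze_zero (fun K => Finset.sum_nonneg fun p _ => integral_nonneg fun ω =>
      pow_nonneg (abs_nonneg _) 3) (fun K => ?_) (by simpa using hthree.const_mul (6 * M))
    calc _ ≤ ∑ p ∈ subjects n K,
          (((m p.1 p.2).descFactorial 1 : ℝ) * ((∫ s, w K p.1 s ^ 3 ∂(timeLaw f)) * M)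
          + ((m p.1 p.2).descFactorial 2 : ℝ) * (6 * ((∫ s, w K p.1 s ^ 2 ∂(timeLaw f))
            * ∫ s, w K p.1 s ∂(timeLaw f)) * M)
          + ((m p.1 p.2).descFactorial 3 : ℝ) * (3 * (∫ s, w K p.1 s ∂(timeLaw f)) ^ 3 * M)) :=
          Finset.sum_le_sum fun p hp => hs.integral_abs_subjectSum_cube_le (hg K) (hw K _) hH
            (hw0 K _) hH0 (hwL K _ (hk K p hp)) hHL (hb K _) _
      _ ≤ _ := by
        simp only [Finset.sum_add_distrib]
        rw [sum_subjects_descFactorial (fun k => (∫ s, w K k s ^ 3 ∂(timeLaw f)) * M),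
          sum_subjects_descFactorial (fun k => 6 * ((∫ s, w K k s ^ 2 ∂(timeLaw f))
            * ∫ s, w K k s ∂(timeLaw f)) * M),
          sum_subjects_descFactorial (fun k => 3 * (∫ s, w K k s ∂(timeLaw f)) ^ 3 * M),
          mul_add, mul_add, Finset.mul_sum, Finset.mul_sum, Finset.mul_sum]
        have hbs : ∀ j k, 0 ≤ blockSize n m j k := fun j k =>
          Finset.sum_nonneg fun _ _ => Nat.cast_nonneg _
        have p1 : ∀ k, 0 ≤ ∫ s, w K k s ∂(timeLaw f) := fun k => integral_nonneg (hw0 K k)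
        have p3 : ∀ k, 0 ≤ ∫ s, w K k s ^ 3 ∂(timeLaw f) := fun k =>
          integral_nonneg fun s => pow_nonneg (hw0 K k s) 3
        refine add_le_add (add_le_add (Finset.sum_le_sum fun k _ => ?_)
          (Finset.sum_le_sum fun k _ => ?_)) (Finset.sum_le_sum fun k _ => ?_)
        · have := mul_nonneg (mul_nonneg (hbs 1 k) (p3 k)) hM0
          nlinarith
        · exact le_of_eq (by ring)
        · have := mul_nonneg (mul_nonneg (hbs 3 k) (pow_nonneg (p1 k) 3)) hM0
          nlinarith

/-- The index set of the measurements of the first `K` blocks. -/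
def measurements (n : ℕ → ℕ) (m : ℕ → ℕ → ℕ) (K : ℕ) : Finset ((_ : (_ : ℕ) × ℕ) × ℕ) :=
  (subjects n K).sigma fun p => Finset.range (m p.1 p.2)

theorem sum_measurements (c : ℕ → ℝ) (K : ℕ) :
    ∑ p ∈ measurements n m K, c p.1.1 = ∑ k ∈ Finset.Icc 1 K, blockSize n m 1 k * c k := by
  rw [← sum_subjects_descFactorial, measurements, Finset.sum_sigma]
  simp

/-- Central limit theorem for triple sums of functions of the times and the noises. -/
theorem clt_measurements (hs : SamplingCond P Q f ν ζ T ε) {g : ℕ → ℕ → ℝ × ℝ → ℝ}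
    (hg : ∀ K k, Measurable (g K k))
    (hL : ∀ K, ∀ k ∈ Finset.Icc 1 K, MemLp (g K k) 3 ((timeLaw f).prod ν))
    (h0 : ∀ K, ∀ k ∈ Finset.Icc 1 K, ∫ z, g K k z ∂((timeLaw f).prod ν) = 0)
    {v : NNReal}
    (hvar : Tendsto (fun K => ∑ k ∈ Finset.Icc 1 K, blockSize n m 1 k
          * ∫ z, g K k z ^ 2 ∂((timeLaw f).prod ν)) atTop (𝓝 v))
    (hthree : Tendsto (fun K => ∑ k ∈ Finset.Icc 1 K, blockSize n m 1 k
          * ∫ z, |g K k z| ^ 3 ∂((timeLaw f).prod ν)) atTop (𝓝 0)) :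
    TendstoInDistribution (fun K => tripleSum n m ζ T ε (fun k z => g K k z.2) K) atTop id
      (fun _ => P) (gaussianReal 0 v) := by
  have hm : ∀ k i j, Measurable fun ω => (T k i j ω, ε k i j ω) := fun k i j =>
    (hs.measurable_time k i j).prodMk (hs.measurable_noise k i j)
  have hk : ∀ K, ∀ p ∈ measurements n m K, p.1.1 ∈ Finset.Icc 1 K :=
    fun K p hp => (Finset.mem_sigma.1 (Finset.mem_sigma.1 hp).1).1
  have hmp : ∀ k i j, MeasurePreserving (fun ω => (T k i j ω, ε k i j ω)) P
      ((timeLaw f).prod ν) := fun k i j => ⟨hm k i j, hs.map_input k i j⟩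
  have hint : ∀ (k i j : ℕ) (φ : ℝ × ℝ → ℝ), Measurable φ →
      ∫ ω, φ (T k i j ω, ε k i j ω) ∂P = ∫ z, φ z ∂((timeLaw f).prod ν) := by
    intro k i j φ hφ
    rw [← hs.map_input k i j, integral_map (hm k i j).aemeasurable hφ.aestronglyMeasurable]
  -- Without the trajectories all measurements are independent, so they are the summands themselves
  -- and no sum over pairs or triples appears.
  have h := tendstoInDistribution_sum_of_lyapunov (P := P) (fun K => measurements n m K)
    (fun K p ω => g K p.1.1 (T p.1.1 p.1.2 p.2 ω, ε p.1.1 p.1.2 p.2 ω))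
    (Eventually.of_forall fun K => ?_)
    (fun K p => ((hg K _).comp (hm _ _ _)).aemeasurable)
    (Eventually.of_forall fun K p hp => (hL K _ (hk K p hp)).comp_measurePreserving (hmp _ _ _))
    (Eventually.of_forall fun K p hp => by rw [hint _ _ _ _ (hg K _), h0 K _ (hk K p hp)])
    (v := v) ?_ ?_
  · refine tendstoInDistribution_congr_law h aemeasurable_id rfl (fun K => ?_)
      (Eventually.of_forall fun K => Eventually.of_forall fun ω => ?_)
    · exact (hs.measurable_tripleSum (fun k => (hg K k).comp measurable_snd) K).aemeasurable
    · rw [tripleSum_eq_sum_subjects, measurements]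
      beta_reduce
      rw [Finset.sum_sigma]
      rfl
  · have h1 := hs.indep_inputs.precomp (g := fun p : (_ : (_ : ℕ) × ℕ) × ℕ => (p.1.1, p.1.2, p.2))
      (by
        rintro ⟨⟨a, b⟩, c⟩ ⟨⟨a', b'⟩, c'⟩ hab
        simp only [Prod.mk.injEq] at hab
        obtain ⟨rfl, rfl, rfl⟩ := hab
        rfl)
    exact h1.comp (g := fun p z => g K p.1.1 z) fun p => hg K _
  · refine hvar.congr fun K => ?_
    rw [← sum_measurements]
    exact Finset.sum_congr rfl fun p _ => (hint _ _ _ _ ((hg K _).pow_const 2)).symm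
  · refine hthree.congr fun K => ?_
    rw [← sum_measurements]
    exact Finset.sum_congr rfl fun p _ => (hint _ _ _ _ ((hg K _).abs.pow_const 3)).symm

end SamplingCond

end TripleCLT

end

section

/-! ### Sample sizes -/

section Sizes

variable {n : ℕ → ℕ} {m : ℕ → ℕ → ℕ}

theorem blockSize_nonneg (j k : ℕ) : 0 ≤ blockSize n m j k :=
  Finset.sum_nonneg fun _ _ => Nat.cast_nonneg _

theorem totalSize_nonneg (j K : ℕ) : 0 ≤ totalSize n m j K :=
  Finset.sum_nonneg fun _ _ => blockSize_nonneg _ _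

theorem totalSize_zero (j : ℕ) : totalSize n m j 0 = 0 := by simp [totalSize]

theorem totalSize_succ (j K : ℕ) :
    totalSize n m j (K + 1) = totalSize n m j K + blockSize n m j (K + 1) := by
  rw [totalSize, Finset.sum_Icc_succ_top (by omega), ← totalSize]

theorem totalSize_mono (j : ℕ) : Monotone (totalSize n m j) :=
  monotone_nat_of_le_succ fun K => by
    rw [totalSize_succ]
    linarith [blockSize_nonneg (n := n) (m := m) j (K + 1)]

theorem SizeCond.numSubjects_le (hs : SizeCond n m) (K : ℕ) :
    numSubjects n K ≤ totalSize n m 1 K := by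
  refine Finset.sum_le_sum fun k hk => ?_
  have hk1 := (Finset.mem_Icc.1 hk).1
  calc (n k : ℝ) = ∑ _i ∈ Finset.range (n k), (1 : ℝ) := by simp
    _ ≤ _ := Finset.sum_le_sum fun i hi => by
        rw [Nat.descFactorial_one]
        exact_mod_cast hs.measurements_pos k hk1 i (Finset.mem_range.1 hi)

theorem SizeCond.le_numSubjects (hs : SizeCond n m) (K : ℕ) : (K : ℝ) ≤ numSubjects n K := by
  calc (K : ℝ) = ∑ _k ∈ Finset.Icc 1 K, (1 : ℝ) := by simp
    _ ≤ _ := Finset.sum_le_sum fun k hk => by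
        exact_mod_cast hs.subjects_pos k (Finset.mem_Icc.1 hk).1

theorem SizeCond.numSubjects_pos (hs : SizeCond n m) {K : ℕ} (hK : 1 ≤ K) :
    0 < numSubjects n K :=
  lt_of_lt_of_le (by exact_mod_cast hK) (hs.le_numSubjects K)

theorem SizeCond.totalSize_pos (hs : SizeCond n m) {K : ℕ} (hK : 1 ≤ K) :
    0 < totalSize n m 1 K :=
  (hs.numSubjects_pos hK).trans_le (hs.numSubjects_le K)

theorem SizeCond.tendsto_numSubjects (hs : SizeCond n m) : Tendsto (numSubjects n) atTop atTop :=
  tendsto_atTop_mono hs.le_numSubjects tendsto_natCast_atTop_atTop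

theorem SizeCond.tendsto_totalSize (hs : SizeCond n m) :
    Tendsto (totalSize n m 1) atTop atTop :=
  tendsto_atTop_mono hs.numSubjects_le hs.tendsto_numSubjects

/-- The averages are quotients by `N_K`; clearing denominators leaves one factor `N_K`. -/
theorem SizeCond.exists_two_le (hs : SizeCond n m) : ∃ C : ℝ, 0 < C ∧ ∀ᶠ K in atTop,
    totalSize n m 2 K * numSubjects n K ≤ C * totalSize n m 1 K ^ 2 := by
  obtain ⟨C, hC⟩ := hs.limsup_two
  rw [eventually_map] at hC
  refine ⟨max C 1, by positivity, ?_⟩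
  filter_upwards [hC, eventually_ge_atTop 1] with K hK hK1
  have hN := hs.numSubjects_pos hK1
  have hS := hs.totalSize_pos hK1
  have e : avgSize n m 2 K / avgSize n m 1 K ^ 2
      = totalSize n m 2 K * numSubjects n K / totalSize n m 1 K ^ 2 := by
    unfold avgSize
    field_simp
  rw [e, div_le_iff₀ (by positivity)] at hK
  exact hK.trans (mul_le_mul_of_nonneg_right (le_max_left _ _) (by positivity))

/-- Without a pair of measurements in one subject there is no triple either. This covers the
convention `0 / 0 = 0` in the size condition. -/
theorem totalSize_three_eq_zero {K : ℕ} (h : totalSize n m 2 K = 0) : totalSize n m 3 K = 0 := by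
  have h1 := (Finset.sum_eq_zero_iff_of_nonneg fun k _ => blockSize_nonneg 2 k).1 h
  refine Finset.sum_eq_zero fun k hk => Finset.sum_eq_zero fun i hi => ?_
  have h2 := (Finset.sum_eq_zero_iff_of_nonneg fun i _ => Nat.cast_nonneg _).1 (h1 k hk) i hi
  have h3 : (m k i).descFactorial 2 = 0 := by exact_mod_cast h2
  rw [Nat.descFactorial_eq_zero_iff_lt] at h3
  exact_mod_cast (Nat.descFactorial_eq_zero_iff_lt.2 (by omega) : (m k i).descFactorial 3 = 0)

theorem SizeCond.exists_three_le (hs : SizeCond n m) : ∃ C : ℝ, 0 < C ∧ ∀ᶠ K in atTop,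
    totalSize n m 1 K * totalSize n m 3 K ≤ C * totalSize n m 2 K ^ 2 := by
  obtain ⟨C, hC⟩ := hs.limsup_three
  rw [eventually_map] at hC
  refine ⟨max C 1, by positivity, ?_⟩
  filter_upwards [hC, eventually_ge_atTop 1] with K hK hK1
  have hN := hs.numSubjects_pos hK1
  rcases (totalSize_nonneg (n := n) (m := m) 2 K).eq_or_lt with h0 | h0
  · rw [totalSize_three_eq_zero h0.symm, ← h0]
    simp
  · have e : avgSize n m 1 K * avgSize n m 3 K / avgSize n m 2 K ^ 2
        = totalSize n m 1 K * totalSize n m 3 K / totalSize n m 2 K ^ 2 := by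
      unfold avgSize
      field_simp
    rw [e, div_le_iff₀ (by positivity)] at hK
    exact hK.trans (mul_le_mul_of_nonneg_right (le_max_left _ _) (by positivity))

/-- Cauchy-Schwarz over the subjects, together with `m ^ 2 = m (m - 1) + m`. -/
theorem sq_totalSize_le (K : ℕ) :
    totalSize n m 1 K ^ 2 ≤ numSubjects n K * (totalSize n m 2 K + totalSize n m 1 K) := by
  have h1 : ∀ j, totalSize n m j K
      = ∑ p ∈ subjects n K, ((m p.1 p.2).descFactorial j : ℝ) := by
    intro j
    have := sum_subjects_descFactorial (n := n) (m := m) (fun _ => 1) j K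
    simpa [totalSize] using this.symm
  have h2 : numSubjects n K = ((subjects n K).card : ℝ) := by
    simp [numSubjects, subjects, Finset.card_sigma]
  have h3 : totalSize n m 2 K + totalSize n m 1 K = ∑ p ∈ subjects n K, (m p.1 p.2 : ℝ) ^ 2 := by
    rw [h1, h1, ← Finset.sum_add_distrib]
    refine Finset.sum_congr rfl fun p _ => ?_
    rcases m p.1 p.2 with _ | a
    · simp
    · rw [Nat.succ_descFactorial_succ, Nat.descFactorial_one, Nat.descFactorial_one]
      push_cast
      ring
  rw [h3, h2, h1]
  simp only [Nat.descFactorial_one]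
  exact sq_sum_le_card_mul_sum_sq

/-- `S_K^{1/5}`. -/
def fifthRoot (n : ℕ → ℕ) (m : ℕ → ℕ → ℕ) (K : ℕ) : ℝ := totalSize n m 1 K ^ (1 / 5 : ℝ)

theorem fifthRoot_nonneg (K : ℕ) : 0 ≤ fifthRoot n m K :=
  Real.rpow_nonneg (totalSize_nonneg _ _) _

theorem fifthRoot_pow (K : ℕ) : fifthRoot n m K ^ 5 = totalSize n m 1 K := by
  rw [fifthRoot, ← Real.rpow_natCast, ← Real.rpow_mul (totalSize_nonneg _ _)]
  norm_num

theorem fifthRoot_mono : Monotone (fifthRoot n m) := fun _ _ h =>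
  Real.rpow_le_rpow (totalSize_nonneg _ _) (totalSize_mono 1 h) (by norm_num)

theorem SizeCond.fifthRoot_pos (hs : SizeCond n m) {K : ℕ} (hK : 1 ≤ K) : 0 < fifthRoot n m K :=
  Real.rpow_pos_of_pos (hs.totalSize_pos hK) _

theorem SizeCond.tendsto_fifthRoot (hs : SizeCond n m) : Tendsto (fifthRoot n m) atTop atTop :=
  (tendsto_rpow_atTop (by norm_num : (0 : ℝ) < 1 / 5)).comp hs.tendsto_totalSize

theorem blockSize_eq_fifthRoot (K : ℕ) :
    blockSize n m 1 (K + 1) = fifthRoot n m (K + 1) ^ 5 - fifthRoot n m K ^ 5 := by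
  rw [fifthRoot_pow, fifthRoot_pow, totalSize_succ]
  ring

theorem fifthRoot_zero : fifthRoot n m 0 = 0 := by
  rw [fifthRoot, totalSize_zero]
  norm_num

/-- `∑_k s_k S_k^{-p/5}` is at most a multiple of `S_K^{1-p/5}` for `p = 1, 2, 3`. -/
theorem SizeCond.sum_blockSize_div_le (hs : SizeCond n m) {p : ℕ} (hp1 : 1 ≤ p) (hp3 : p ≤ 3)
    (K : ℕ) :
    ∑ k ∈ Finset.Icc 1 K, blockSize n m 1 k / fifthRoot n m k ^ p
      ≤ 5 / 2 * fifthRoot n m K ^ (5 - p) := by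
  induction K with
  | zero =>
    simp only [Finset.Icc_eq_empty (by norm_num : ¬ (1 ≤ 0)), Finset.sum_empty]
    exact mul_nonneg (by norm_num) (pow_nonneg (fifthRoot_nonneg _) _)
  | succ K ih =>
    rw [Finset.sum_Icc_succ_top (by omega)]
    have hy : 0 < fifthRoot n m (K + 1) := hs.fifthRoot_pos (by omega)
    have hx : 0 ≤ fifthRoot n m K := fifthRoot_nonneg K
    have hxy : fifthRoot n m K ≤ fifthRoot n m (K + 1) := fifthRoot_mono (by omega)
    -- With `x`, `y` consecutive fifth roots, the block size is `y ^ 5 - x ^ 5`. The sum is a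
    -- Riemann sum of the decreasing `u ^ (-p)` against `d(u ^ 5)` at right endpoints, hence below
    -- the integral `5 / (5 - p) u ^ (5 - p)`; the constant `5/2` is the case `p = 3`. The
    -- certificates below carry the factor `(y - x) ^ 2` because the inequality is tangent at `x =
    -- y`, except for a slack term when `p < 3`.
    have key : blockSize n m 1 (K + 1) / fifthRoot n m (K + 1) ^ p
        ≤ 5 / 2 * (fifthRoot n m (K + 1) ^ (5 - p) - fifthRoot n m K ^ (5 - p)) := by
      rw [blockSize_eq_fifthRoot]
      generalize fifthRoot n m (K + 1) = y at *
      generalize fifthRoot n m K = x at *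
      rw [div_le_iff₀ (by positivity)]
      have hsq := sq_nonneg (y - x)
      interval_cases p
      · have h1 : 0 ≤ (y - x) ^ 2 * (y ^ 3 + 2 * y ^ 2 * x + 3 * y * x ^ 2 + 4 * x ^ 3) := by
          positivity
        have h2 : 0 ≤ y * (y ^ 4 - x ^ 4) :=
          mul_nonneg hy.le (sub_nonneg.2 (pow_le_pow_left₀ hx hxy 4))
        norm_num
        nlinarith
      · have h1 : 0 ≤ (y - x) ^ 2 * (2 * y ^ 3 + 4 * y ^ 2 * x + 6 * y * x ^ 2 + 3 * x ^ 3) := by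
          positivity
        have h2 : 0 ≤ y ^ 2 * (y ^ 3 - x ^ 3) :=
          mul_nonneg (by positivity) (sub_nonneg.2 (pow_le_pow_left₀ hx hxy 3))
        norm_num
        nlinarith
      · have h1 : 0 ≤ (y - x) ^ 2 * (3 * y ^ 3 + 6 * y ^ 2 * x + 4 * y * x ^ 2 + 2 * x ^ 3) := by
          positivity
        norm_num
        nlinarith
    linarith

/-- The same Riemann sum for the increasing integrand `u`: right endpoints now give more than the
integral of `u d(u ^ 5)`, which is `5/6 u ^ 6`. -/
theorem le_sum_blockSize_mul_fifthRoot (K : ℕ) :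
    5 / 6 * fifthRoot n m K ^ 6 ≤ ∑ k ∈ Finset.Icc 1 K, blockSize n m 1 k * fifthRoot n m k := by
  induction K with
  | zero => simp [fifthRoot_zero]
  | succ K ih =>
    rw [Finset.sum_Icc_succ_top (by omega), blockSize_eq_fifthRoot]
    have hy : 0 ≤ fifthRoot n m (K + 1) := fifthRoot_nonneg _
    have hx : 0 ≤ fifthRoot n m K := fifthRoot_nonneg K
    generalize fifthRoot n m (K + 1) = y at *
    generalize fifthRoot n m K = x at *
    have hsq := sq_nonneg (y - x)
    have h1 : 0 ≤ (y - x) ^ 2 * (y ^ 4 + 2 * y ^ 3 * x + 3 * y ^ 2 * x ^ 2 + 4 * y * x ^ 3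
      + 5 * x ^ 4) := by positivity
    nlinarith

/-- Weighted averages of a null array are null. -/
theorem tendsto_weighted_average_zero {a : ℕ → ℝ} {δ : ℕ → ℕ → ℝ} {B : ℕ → ℝ} {A C : ℝ}
    (ha : ∀ k, 1 ≤ k → 0 ≤ a k) (hB : Tendsto B atTop atTop)
    (haB : ∀ᶠ K in atTop, ∑ k ∈ Finset.Icc 1 K, a k ≤ A * B K)
    (hδ : ∀ K, ∀ k ∈ Finset.Icc 1 K, |δ K k| ≤ C)
    (hδ0 : ∀ ε > 0, ∃ k₀, ∀ K, ∀ k ∈ Finset.Icc 1 K, k₀ ≤ k → |δ K k| ≤ ε) :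
    Tendsto (fun K => (∑ k ∈ Finset.Icc 1 K, a k * |δ K k|) / B K) atTop (𝓝 0) := by
  rw [Metric.tendsto_nhds]
  intro e he
  -- The sum is split at `k₀`. The early blocks have bounded total weight, negligible against `B`;
  -- on the late ones the tolerance is chosen so that total weight at most `A * B` gives at most `e
  -- / 2 * B`.
  obtain ⟨k₀, hk₀⟩ := hδ0 (e / (2 * (|A| + 1))) (by positivity)
  have h1 : Tendsto (fun K => (|C| * ∑ k ∈ Finset.Icc 1 k₀, a k) / B K) atTop (𝓝 0) :=
    hB.const_div_atTop _
  filter_upwards [haB, hB.eventually_gt_atTop 0,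
    h1.eventually (gt_mem_nhds (by positivity : (0 : ℝ) < e / 2))] with K hK hBK hK2
  have hnn : 0 ≤ ∑ k ∈ Finset.Icc 1 K, a k * |δ K k| := Finset.sum_nonneg fun k hk =>
    mul_nonneg (ha k (Finset.mem_Icc.1 hk).1) (abs_nonneg _)
  rw [Real.dist_eq, sub_zero, abs_of_nonneg (by positivity)]
  have h2 : ∑ k ∈ Finset.Icc 1 K, a k * |δ K k|
      ≤ |C| * ∑ k ∈ Finset.Icc 1 k₀, a k
        + e / (2 * (|A| + 1)) * ∑ k ∈ Finset.Icc 1 K, a k := by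
    rw [← Finset.sum_filter_add_sum_filter_not (Finset.Icc 1 K) (fun k => k ≤ k₀)]
    refine add_le_add ?_ ?_
    · rw [Finset.mul_sum]
      calc _ ≤ ∑ k ∈ Finset.Icc 1 K with k ≤ k₀, |C| * a k := by
            refine Finset.sum_le_sum fun k hk => ?_
            have hk' := (Finset.mem_filter.1 hk).1
            rw [mul_comm]
            exact mul_le_mul_of_nonneg_right ((hδ K k hk').trans (le_abs_self C))
              (ha k (Finset.mem_Icc.1 hk').1)
        _ ≤ _ := by
            refine Finset.sum_le_sum_of_subset_of_nonneg (fun k hk => ?_) fun k hk _ =>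
              mul_nonneg (abs_nonneg _) (ha k (Finset.mem_Icc.1 hk).1)
            simp only [Finset.mem_filter, Finset.mem_Icc] at hk ⊢
            omega
    · rw [Finset.mul_sum]
      calc _ ≤ ∑ k ∈ Finset.Icc 1 K with ¬ k ≤ k₀, e / (2 * (|A| + 1)) * a k := by
            refine Finset.sum_le_sum fun k hk => ?_
            have hk' := Finset.mem_filter.1 hk
            rw [mul_comm]
            exact mul_le_mul_of_nonneg_right (hk₀ K k hk'.1 (by omega))
              (ha k (Finset.mem_Icc.1 hk'.1).1)
        _ ≤ _ := Finset.sum_le_sum_of_subset_of_nonneg (Finset.filter_subset _ _)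
            fun k hk _ => mul_nonneg (by positivity) (ha k (Finset.mem_Icc.1 hk).1)
  have h3 : e / (2 * (|A| + 1)) * ∑ k ∈ Finset.Icc 1 K, a k ≤ e / 2 * B K := by
    calc _ ≤ e / (2 * (|A| + 1)) * ((|A| + 1) * B K) := by
          refine mul_le_mul_of_nonneg_left (hK.trans ?_) (by positivity)
          exact mul_le_mul_of_nonneg_right (by linarith [le_abs_self A]) hBK.le
      _ = _ := by field_simp
  rw [div_lt_iff₀ hBK] at hK2 ⊢
  linarith

/-- The size condition bounds the quotient by a multiple of `1 / N_K`: pairs within a subject are a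
vanishing share of all pairs. -/
theorem SizeCond.tendsto_two_div_sq (hs : SizeCond n m) :
    Tendsto (fun K => totalSize n m 2 K / totalSize n m 1 K ^ 2) atTop (𝓝 0) := by
  obtain ⟨C, hC, h⟩ := hs.exists_two_le
  refine squeeze_zero' (Eventually.of_forall fun K => div_nonneg (totalSize_nonneg _ _)
    (sq_nonneg _)) ?_ (hs.tendsto_numSubjects.const_div_atTop C)
  filter_upwards [h, eventually_ge_atTop 1] with K hK hK1
  have h1 := hs.numSubjects_pos hK1
  have h2 := hs.totalSize_pos hK1
  rw [div_le_div_iff₀ (by positivity) h1]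
  linarith

/-- `∑_k s_{k,2} S_k^{-4/5} = o(S_K^{6/5})`. -/
theorem SizeCond.tendsto_sum_two_div (hs : SizeCond n m) :
    Tendsto (fun K => (∑ k ∈ Finset.Icc 1 K, blockSize n m 2 k / fifthRoot n m k ^ 4)
      / fifthRoot n m K ^ 6) atTop (𝓝 0) := by
  set d : ℕ → ℝ := fun K => totalSize n m 2 K / totalSize n m 1 K ^ 2 with hd
  have hd0 : ∀ K, 0 ≤ d K := fun K => div_nonneg (totalSize_nonneg _ _) (sq_nonneg _)
  set a : ℕ → ℝ := fun k => fifthRoot n m k ^ 6 - fifthRoot n m (k - 1) ^ 6 with ha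
  have hdlim : Tendsto d atTop (𝓝 0) := hs.tendsto_two_div_sq
  have hS2 : ∀ K, 1 ≤ K → totalSize n m 2 K = d K * fifthRoot n m K ^ 10 := by
    intro K hK
    have := hs.totalSize_pos hK
    have hx := hs.fifthRoot_pos hK
    rw [hd]
    simp only
    rw [← fifthRoot_pow (n := n) (m := m) K] at this ⊢
    field_simp
  -- Summation by parts, with `S_{K,2} = d_K u_K ^ 10`. The increments of `u ^ (-4)` are traded for
  -- the weights `a`, which telescope to `u_K ^ 6`; what is left is a weighted average of the null
  -- sequence `d`.
  have habel : ∀ K, ∑ k ∈ Finset.Icc 1 K, blockSize n m 2 k / fifthRoot n m k ^ 4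
      ≤ totalSize n m 2 K / fifthRoot n m K ^ 4 + ∑ k ∈ Finset.Icc 1 K, a k * |d (k - 1)| := by
    intro K
    induction K with
    | zero => simp [totalSize_zero]
    | succ K ih =>
      rw [Finset.sum_Icc_succ_top (by omega), Finset.sum_Icc_succ_top (by omega), totalSize_succ,
        add_div]
      have hy : 0 < fifthRoot n m (K + 1) := hs.fifthRoot_pos (by omega)
      have key : totalSize n m 2 K / fifthRoot n m K ^ 4
          ≤ totalSize n m 2 K / fifthRoot n m (K + 1) ^ 4 + a (K + 1) * |d (K + 1 - 1)| := by
        simp only [Nat.add_sub_cancel, ha, abs_of_nonneg (hd0 _)]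
        rcases Nat.eq_zero_or_pos K with rfl | hK
        · simp [totalSize_zero, hd]
        · have hx : 0 < fifthRoot n m K := hs.fifthRoot_pos hK
          have hxy : fifthRoot n m K ≤ fifthRoot n m (K + 1) := fifthRoot_mono (by omega)
          rw [hS2 K hK]
          have hdK := hd0 K
          generalize d K = c at *
          generalize fifthRoot n m (K + 1) = y at *
          generalize fifthRoot n m K = x at *
          -- After multiplication by `y ^ 4` this is `2 x ^ 6 y ^ 4 ≤ x ^ 10 + y ^ 10`, which
          -- follows from `2 x ^ 5 y ^ 5 ≤ x ^ 10 + y ^ 10` and `x ≤ y`.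
          have h1 : x ^ 6 ≤ x ^ 10 / y ^ 4 + (y ^ 6 - x ^ 6) := by
            have : x ^ 10 / y ^ 4 + (y ^ 6 - x ^ 6) - x ^ 6
                = ((y ^ 5 - x ^ 5) ^ 2 + 2 * x ^ 5 * y ^ 4 * (y - x)) / y ^ 4 := by
              field_simp
              ring
            have h2 : 0 ≤ ((y ^ 5 - x ^ 5) ^ 2 + 2 * x ^ 5 * y ^ 4 * (y - x)) / y ^ 4 := by
              have := sub_nonneg.2 hxy
              positivity
            linarith
          calc c * x ^ 10 / x ^ 4 = c * x ^ 6 := by field_simp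
            _ ≤ c * (x ^ 10 / y ^ 4 + (y ^ 6 - x ^ 6)) := by gcongr
            _ = _ := by ring
      linarith
  have hmain := tendsto_weighted_average_zero (a := a) (δ := fun _ k => d (k - 1))
    (B := fun K => fifthRoot n m K ^ 6) (A := 1) (C := sSup (range d)) ?_ ?_ ?_ ?_ ?_
  · have h2 : Tendsto (fun K => d K + (∑ k ∈ Finset.Icc 1 K, a k * |d (k - 1)|)
        / fifthRoot n m K ^ 6) atTop (𝓝 0) := by simpa using hdlim.add hmain
    refine squeeze_zero' (Eventually.of_forall fun K => div_nonneg (Finset.sum_nonneg fun k _ =>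
      div_nonneg (blockSize_nonneg _ _) (pow_nonneg (fifthRoot_nonneg _) _))
      (pow_nonneg (fifthRoot_nonneg _) _)) ?_ h2
    filter_upwards [eventually_ge_atTop 1] with K hK
    have hx : 0 < fifthRoot n m K := hs.fifthRoot_pos hK
    rw [div_le_iff₀ (by positivity), add_mul, div_mul_cancel₀ _ (by positivity)]
    refine (habel K).trans (le_of_eq ?_)
    rw [hS2 K hK]
    field_simp
  · intro k hk
    exact sub_nonneg.2 (pow_le_pow_left₀ (fifthRoot_nonneg _) (fifthRoot_mono (Nat.sub_le _ _)) 6)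
  · exact (tendsto_pow_atTop (by norm_num)).comp hs.tendsto_fifthRoot
  · refine Eventually.of_forall fun K => le_of_eq ?_
    rw [one_mul]
    induction K with
    | zero => simp [fifthRoot_zero]
    | succ K ih =>
      rw [Finset.sum_Icc_succ_top (by omega), ih]
      simp [ha]
  · intro K k _
    rw [abs_of_nonneg (hd0 _)]
    exact le_csSup hdlim.bddAbove_range ⟨_, rfl⟩
  · intro ε hε
    obtain ⟨k₀, hk₀⟩ := eventually_atTop.1 (Metric.tendsto_nhds.1 hdlim ε hε)
    refine ⟨k₀ + 1, fun K k _ hk => ?_⟩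
    have := hk₀ (k - 1) (by omega)
    rw [Real.dist_eq, sub_zero] at this
    exact this.le

end Sizes

end

section

/-! ### Unrolling the recursion, and the order of the bandwidths -/

section Unroll

variable {Ω : Type*} {L : ℕ} {n : ℕ → ℕ} {m : ℕ → ℕ → ℕ}

/-- The pseudo-statistic is an ordinary sum over blocks along the chain of selected ancestors, so
the estimate can be analysed offline with bandwidths varying from block to block. -/
theorem onlineP_eq_sum (W : ℝ → ℝ) (T : ℕ → ℕ → ℕ → Ω → ℝ) (η : ℕ → Fin L → ℝ)
    (J : ℕ → Fin L → Fin L) (t : ℝ) (K : ℕ) (l : Fin L) (ω : Ω) :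
    onlineP n m W T η J t K l ω
      = ∑ k ∈ Finset.Icc 1 K, blockP n m W T t k (chainBandwidth η J K l k) ω := by
  induction K generalizing l with
  | zero => simp [onlineP]
  | succ K ih =>
    rw [onlineP, ih, Finset.sum_Icc_succ_top (by omega), add_comm]
    congr 1
    · refine Finset.sum_congr rfl fun k hk => ?_
      rw [chainBandwidth, if_neg (by have := (Finset.mem_Icc.1 hk).2; omega)]
    · rw [chainBandwidth, if_pos rfl]

theorem onlineQ_eq_sum (W : ℝ → ℝ) (T Y : ℕ → ℕ → ℕ → Ω → ℝ) (η : ℕ → Fin L → ℝ)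
    (J : ℕ → Fin L → Fin L) (t : ℝ) (K : ℕ) (l : Fin L) (ω : Ω) :
    onlineQ n m W T Y η J t K l ω
      = ∑ k ∈ Finset.Icc 1 K, blockQ n m W T Y t k (chainBandwidth η J K l k) ω := by
  induction K generalizing l with
  | zero => simp [onlineQ]
  | succ K ih =>
    rw [onlineQ, ih, Finset.sum_Icc_succ_top (by omega), add_comm]
    congr 1
    · refine Finset.sum_congr rfl fun k hk => ?_
      rw [chainBandwidth, if_neg (by have := (Finset.mem_Icc.1 hk).2; omega)]
    · rw [chainBandwidth, if_pos rfl]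

/-- Whichever ancestor is selected, it carries for block `k` a candidate of block `k`. This fixes
the order of the bandwidth. -/
theorem chainBandwidth_mem (η : ℕ → Fin L → ℝ) (J : ℕ → Fin L → Fin L) {K k : ℕ}
    (hk : k ∈ Finset.Icc 1 K) (l : Fin L) : ∃ i, chainBandwidth η J K l k = η k i := by
  induction K generalizing l with
  | zero => simp at hk
  | succ K ih =>
    rw [chainBandwidth]
    split_ifs with h
    · exact ⟨l, by rw [h]⟩
    · have := Finset.mem_Icc.1 hk
      exact ih (Finset.mem_Icc.2 ⟨this.1, by omega⟩) _

end Unroll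

/-- The bandwidth `b K k` that the estimate at block `K` uses in block `k` is of exact order
`S_k^{-1/5}`. -/
structure BandwidthBound (n : ℕ → ℕ) (m : ℕ → ℕ → ℕ) (b : ℕ → ℕ → ℝ) (c C : ℝ) : Prop where
  pos : 0 < c
  lower : ∀ K, ∀ k ∈ Finset.Icc 1 K, c ≤ b K k * fifthRoot n m k
  upper : ∀ K, ∀ k ∈ Finset.Icc 1 K, b K k * fifthRoot n m k ≤ C

/-- `∑_{k ≤ K} s_k b_k^r`. -/
def bandSum (n : ℕ → ℕ) (m : ℕ → ℕ → ℕ) (b : ℕ → ℕ → ℝ) (r : ℤ) (K : ℕ) : ℝ :=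
  ∑ k ∈ Finset.Icc 1 K, blockSize n m 1 k * b K k ^ r

variable {n : ℕ → ℕ} {m : ℕ → ℕ → ℕ} {b : ℕ → ℕ → ℝ} {c C : ℝ}

theorem rho_eq_bandSum_div {L : ℕ} [NeZero L] (η : ℕ → Fin L → ℝ) (J : ℕ → Fin L → Fin L) (r : ℤ)
    (K : ℕ) : rho n m η J r K
      = bandSum n m (fun K k => chainBandwidth η J K 0 k) r K / totalSize n m 1 K := by
  rw [rho, bandSum, Finset.sum_div]
  refine Finset.sum_congr rfl fun k _ => ?_
  rw [weight]
  ring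

theorem exists_bounds_of_tendsto {a : ℕ → ℝ} {l : ℝ} (ha : ∀ k, 1 ≤ k → 0 < a k) (hl : 0 < l)
    (h : Tendsto a atTop (𝓝 l)) :
    ∃ c C : ℝ, 0 < c ∧ 0 < C ∧ ∀ k, 1 ≤ k → c ≤ a k ∧ a k ≤ C := by
  obtain ⟨C, hC⟩ := h.bddAbove_range
  obtain ⟨D, hD⟩ := (h.inv₀ hl.ne').bddAbove_range
  have hC' : ∀ k, a k ≤ C := fun k => hC ⟨k, rfl⟩
  have hD' : ∀ k, (a k)⁻¹ ≤ D := fun k => hD ⟨k, rfl⟩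
  have h1 := ha 1 le_rfl
  have hC0 : 0 < C := h1.trans_le (hC' 1)
  have hD0 : 0 < D := (inv_pos.2 h1).trans_le (hD' 1)
  refine ⟨D⁻¹, C, inv_pos.2 hD0, hC0, fun k hk => ⟨?_, hC' k⟩⟩
  rw [inv_le_comm₀ hD0 (ha k hk)]
  exact hD' k

/-- All candidates of block `k` lie between `c₀ * h k` and `h k`, and `h k` is of exact order
`S_k^{-1/5}`. The bounds are uniform in `k` because a positive sequence with a positive limit is
bounded away from `0` and from infinity. -/
theorem exists_bandwidthBound {L : ℕ} [NeZero L] (hs : SizeCond n m) {h : ℕ → ℝ}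
    {η : ℕ → Fin L → ℝ} (J : ℕ → Fin L → Fin L)
    (h_pos : ∀ K, 1 ≤ K → 0 < h K)
    (h_rate : ∃ C : ℝ, 0 < C ∧
      Tendsto (fun K => h K / totalSize n m 1 K ^ (-(1 / 5) : ℝ)) atTop (𝓝 C))
    (η_first : ∀ K, 1 ≤ K → η K 0 = h K)
    (η_anti : ∀ K, 1 ≤ K → StrictAnti (η K))
    (η_lower : ∃ c : ℝ, 0 < c ∧ ∀ K, 1 ≤ K → ∀ l, c * h K ≤ η K l) :
    ∃ c C : ℝ, BandwidthBound n m (fun K k => chainBandwidth η J K 0 k) c C := by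
  obtain ⟨l, hl, hlim⟩ := h_rate
  obtain ⟨c₀, hc₀, hlow⟩ := η_lower
  have e : ∀ K, h K / totalSize n m 1 K ^ (-(1 / 5) : ℝ) = h K * fifthRoot n m K := by
    intro K
    rw [Real.rpow_neg (totalSize_nonneg _ _), div_inv_eq_mul, fifthRoot]
  simp only [e] at hlim
  obtain ⟨c, C, hc, hC, hb⟩ := exists_bounds_of_tendsto
    (fun k hk => mul_pos (h_pos k hk) (hs.fifthRoot_pos hk)) hl hlim
  refine ⟨c₀ * c, C, by positivity, fun K k hk => ?_, fun K k hk => ?_⟩ <;>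
  · have hk1 := (Finset.mem_Icc.1 hk).1
    have hu := hs.fifthRoot_pos hk1
    obtain ⟨i, hi⟩ := chainBandwidth_mem η J hk 0
    simp only [hi]
    have h1 := hlow k hk1 i
    have h2 : η k i ≤ h k := (η_first k hk1) ▸ (η_anti k hk1).antitone (Fin.zero_le i)
    have h3 := hb k hk1
    first
    | exact (mul_le_mul_of_nonneg_left h3.1 hc₀.le).trans
        (by rw [← mul_assoc]; exact mul_le_mul_of_nonneg_right h1 hu.le)
    | exact (mul_le_mul_of_nonneg_right h2 hu.le).trans h3.2

/-! ### Weighted sums of powers of the bandwidths -/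

namespace BandwidthBound

theorem band_pos (hb : BandwidthBound n m b c C) {K k : ℕ} (hk : k ∈ Finset.Icc 1 K) :
    0 < b K k :=
  pos_of_mul_pos_left (hb.pos.trans_le (hb.lower K k hk)) (fifthRoot_nonneg _)

theorem upper_pos (hb : BandwidthBound n m b c C) : 0 < C :=
  hb.pos.trans_le ((hb.lower 1 1 (by simp)).trans (hb.upper 1 1 (by simp)))

theorem band_le (hs : SizeCond n m) (hb : BandwidthBound n m b c C) {K k : ℕ}
    (hk : k ∈ Finset.Icc 1 K) : b K k ≤ C / fifthRoot n m k := by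
  rw [le_div_iff₀ (hs.fifthRoot_pos (Finset.mem_Icc.1 hk).1)]
  exact hb.upper K k hk

theorem le_band (hs : SizeCond n m) (hb : BandwidthBound n m b c C) {K k : ℕ}
    (hk : k ∈ Finset.Icc 1 K) : c / fifthRoot n m k ≤ b K k := by
  rw [div_le_iff₀ (hs.fifthRoot_pos (Finset.mem_Icc.1 hk).1)]
  exact hb.lower K k hk

theorem inv_band_le (hs : SizeCond n m) (hb : BandwidthBound n m b c C) {K k : ℕ}
    (hk : k ∈ Finset.Icc 1 K) : (b K k)⁻¹ ≤ fifthRoot n m k / c := by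
  have h1 := hs.fifthRoot_pos (Finset.mem_Icc.1 hk).1
  have := inv_anti₀ (div_pos hb.pos h1) (hb.le_band hs hk)
  rwa [inv_div] at this

/-- For each `e > 0` the bandwidths are at most `e` outside finitely many blocks. -/
theorem band_small (hs : SizeCond n m) (hb : BandwidthBound n m b c C) {e : ℝ} (he : 0 < e) :
    ∃ k₀, ∀ K, ∀ k ∈ Finset.Icc 1 K, k₀ ≤ k → b K k < e := by
  obtain ⟨k₀, h⟩ := ((hs.tendsto_fifthRoot.const_div_atTop C).eventually_lt_const he).exists_forall_of_atTop
  exact ⟨k₀, fun K k hk hkk => (hb.band_le hs hk).trans_lt (h k hkk)⟩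

theorem bandSum_nonneg (hb : BandwidthBound n m b c C) (r : ℤ) (K : ℕ) : 0 ≤ bandSum n m b r K :=
  Finset.sum_nonneg fun _ hk => mul_nonneg (blockSize_nonneg _ _) (zpow_nonneg (hb.band_pos hk).le _)

theorem bandSum_le (hs : SizeCond n m) (hb : BandwidthBound n m b c C) {p : ℕ} (hp1 : 1 ≤ p)
    (hp3 : p ≤ 3) (K : ℕ) :
    bandSum n m b p K ≤ C ^ p * (5 / 2) * fifthRoot n m K ^ (5 - p) := by
  have h := hs.sum_blockSize_div_le hp1 hp3 K
  calc _ ≤ ∑ k ∈ Finset.Icc 1 K, C ^ p * (blockSize n m 1 k / fifthRoot n m k ^ p) := by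
        refine Finset.sum_le_sum fun k hk => ?_
        rw [zpow_natCast]
        have := pow_le_pow_left₀ (hb.band_pos hk).le (hb.band_le hs hk) p
        refine (mul_le_mul_of_nonneg_left this (blockSize_nonneg _ _)).trans (le_of_eq ?_)
        rw [div_pow]
        ring
    _ ≤ _ := by
        rw [← Finset.mul_sum, mul_assoc]
        exact mul_le_mul_of_nonneg_left h (pow_nonneg hb.upper_pos.le _)

/-- For negative powers the latest blocks have the largest terms, so it suffices to bound every term
with the fifth root at `K`. -/
theorem bandSum_neg_le (hs : SizeCond n m) (hb : BandwidthBound n m b c C) (p : ℕ) (K : ℕ) :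
    bandSum n m b (-p) K ≤ (c⁻¹) ^ p * fifthRoot n m K ^ (5 + p) := by
  rcases Nat.eq_zero_or_pos K with rfl | hK
  · simp [bandSum, fifthRoot_zero]
  calc _ ≤ ∑ k ∈ Finset.Icc 1 K, blockSize n m 1 k * (fifthRoot n m K / c) ^ p := by
        refine Finset.sum_le_sum fun k hk => mul_le_mul_of_nonneg_left ?_ (blockSize_nonneg _ _)
        rw [zpow_neg, zpow_natCast, ← inv_pow]
        refine pow_le_pow_left₀ (inv_nonneg.2 (hb.band_pos hk).le)
          ((hb.inv_band_le hs hk).trans ?_) p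
        exact div_le_div_of_nonneg_right (fifthRoot_mono (Finset.mem_Icc.1 hk).2) hb.pos.le
    _ = _ := by
        rw [← Finset.sum_mul]
        change totalSize n m 1 K * _ = _
        rw [← fifthRoot_pow]
        field_simp
        ring

theorem le_bandSum_two (hs : SizeCond n m) (hb : BandwidthBound n m b c C) {K : ℕ} (hK : 1 ≤ K) :
    c ^ 2 * fifthRoot n m K ^ 3 ≤ bandSum n m b 2 K := by
  have hu := hs.fifthRoot_pos hK
  calc _ = ∑ k ∈ Finset.Icc 1 K, blockSize n m 1 k * (c / fifthRoot n m K) ^ 2 := by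
        rw [← Finset.sum_mul]
        change _ = totalSize n m 1 K * _
        rw [← fifthRoot_pow]
        field_simp
    _ ≤ _ := by
        refine Finset.sum_le_sum fun k hk => mul_le_mul_of_nonneg_left ?_ (blockSize_nonneg _ _)
        have hk' := Finset.mem_Icc.1 hk
        have : c / fifthRoot n m K ≤ b K k := le_trans
          (div_le_div_of_nonneg_left hb.pos.le (hs.fifthRoot_pos hk'.1) (fifthRoot_mono hk'.2))
          (hb.le_band hs hk)
        exact pow_le_pow_left₀ (div_nonneg hb.pos.le hu.le) this 2

/-- A termwise bound would lose the order here, since early blocks contribute less; the Riemann sum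
of the fifth roots retains it. -/
theorem le_bandSum_neg_one (hb : BandwidthBound n m b c C) (K : ℕ) :
    5 / (6 * C) * fifthRoot n m K ^ 6 ≤ bandSum n m b (-1) K := by
  have hC := hb.upper_pos
  have h := le_sum_blockSize_mul_fifthRoot (n := n) (m := m) K
  calc _ = C⁻¹ * (5 / 6 * fifthRoot n m K ^ 6) := by field_simp
    _ ≤ C⁻¹ * ∑ k ∈ Finset.Icc 1 K, blockSize n m 1 k * fifthRoot n m k := by gcongr
    _ ≤ _ := by
        rw [Finset.mul_sum]
        refine Finset.sum_le_sum fun k hk => ?_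
        rw [mul_left_comm]
        refine mul_le_mul_of_nonneg_left ?_ (blockSize_nonneg _ _)
        rw [zpow_neg_one, inv_mul_eq_div, div_le_iff₀ hC, inv_mul_eq_div,
          le_div_iff₀ (hb.band_pos hk), mul_comm]
        exact hb.upper K k hk

theorem bandSum_zero (K : ℕ) : bandSum n m b 0 K = totalSize n m 1 K := by
  simp [bandSum, totalSize]

theorem bandSum_two_pos (hs : SizeCond n m) (hb : BandwidthBound n m b c C) {K : ℕ} (hK : 1 ≤ K) :
    0 < bandSum n m b 2 K :=
  (mul_pos (pow_pos hb.pos 2) (pow_pos (hs.fifthRoot_pos hK) 3)).trans_le (hb.le_bandSum_two hs hK)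

theorem bandSum_neg_one_pos (hs : SizeCond n m) (hb : BandwidthBound n m b c C) {K : ℕ}
    (hK : 1 ≤ K) : 0 < bandSum n m b (-1) K :=
  (mul_pos (div_pos (by norm_num) (mul_pos (by norm_num) hb.upper_pos))
    (pow_pos (hs.fifthRoot_pos hK) 6)).trans_le (hb.le_bandSum_neg_one K)

/-- The pair-count sum with weights `b_k^4` is negligible. -/
theorem tendsto_sum_two_mul_pow (hs : SizeCond n m) (hb : BandwidthBound n m b c C) :
    Tendsto (fun K => (∑ k ∈ Finset.Icc 1 K, blockSize n m 2 k * b K k ^ 4)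
      / fifthRoot n m K ^ 6) atTop (𝓝 0) := by
  have h := hs.tendsto_sum_two_div.const_mul (C ^ 4)
  rw [mul_zero] at h
  refine squeeze_zero (fun K => div_nonneg (Finset.sum_nonneg fun k hk =>
    mul_nonneg (blockSize_nonneg _ _) (pow_nonneg (hb.band_pos hk).le _))
    (pow_nonneg (fifthRoot_nonneg _) _)) (fun K => ?_) h
  rw [← mul_div_assoc]
  refine div_le_div_of_nonneg_right ?_ (pow_nonneg (fifthRoot_nonneg _) _)
  rw [Finset.mul_sum]
  refine Finset.sum_le_sum fun k hk => ?_
  have := pow_le_pow_left₀ (hb.band_pos hk).le (hb.band_le hs hk) 4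
  refine (mul_le_mul_of_nonneg_left this (blockSize_nonneg _ _)).trans (le_of_eq ?_)
  rw [div_pow]
  ring

/-- If `G(b) / b^q → l` as `b → 0`, the weighted sums of `G` and of `l b^q` differ by a term that
is negligible against `B`. -/
theorem tendsto_sum_sub (hs : SizeCond n m) (hb : BandwidthBound n m b c C) {j : ℕ} {q : ℤ}
    {G : ℝ → ℝ} {l M A : ℝ} {B : ℕ → ℝ} (hB : Tendsto B atTop atTop)
    (hsum : ∀ᶠ K in atTop, ∑ k ∈ Finset.Icc 1 K, blockSize n m j k * fifthRoot n m k ^ (-q) ≤ A * B K)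
    (hG : Tendsto (fun r => G r / r ^ q) (𝓝[>] 0) (𝓝 l))
    (hM : ∀ r, 0 < r → |G r| ≤ M * r ^ q) :
    Tendsto (fun K => (∑ k ∈ Finset.Icc 1 K, blockSize n m j k * G (b K k)
      - l * ∑ k ∈ Finset.Icc 1 K, blockSize n m j k * b K k ^ q) / B K) atTop (𝓝 0) := by
  have hu : ∀ {K k}, k ∈ Finset.Icc 1 K → 0 < fifthRoot n m k := fun hk =>
    hs.fifthRoot_pos (Finset.mem_Icc.1 hk).1
  -- The bandwidth times the fifth root lies in `[c, C]`. Its power `q` is largest at `C` when `q ≥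
  -- 0` and at `c` when `q ≤ 0`; the maximum serves both signs.
  set D : ℝ := max (C ^ q) (c ^ q) with hD
  have hDpos : 0 < D := lt_max_of_lt_left (zpow_pos hb.upper_pos q)
  have hbq : ∀ K, ∀ k ∈ Finset.Icc 1 K, b K k ^ q * fifthRoot n m k ^ q ≤ D := by
    intro K k hk
    rw [← mul_zpow]
    have h0 := hb.lower K k hk
    have h1 := hb.upper K k hk
    have hp := hb.pos
    rcases le_total 0 q with hq | hq
    · exact le_max_of_le_left (zpow_le_zpow_left₀ hq (hp.le.trans h0) h1)
    · refine le_max_of_le_right ?_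
      have h2 := zpow_le_zpow_left₀ (neg_nonneg.2 hq) hp.le h0
      rw [zpow_neg, zpow_neg] at h2
      exact (inv_le_inv₀ (zpow_pos hp q) (zpow_pos (hp.trans_le h0) q)).1 h2
  -- The error is rescaled by the order `u_k ^ q` of `b ^ (-q)`. The weights then no longer depend
  -- on `K`, as averaging of null arrays requires; `δ` is small for late blocks because their
  -- bandwidths are small.
  set δ : ℕ → ℕ → ℝ := fun K k => (G (b K k) - l * b K k ^ q) * fifthRoot n m k ^ q with hδ
  have hδle : ∀ K, ∀ k ∈ Finset.Icc 1 K, ∀ e, 0 ≤ e →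
      |G (b K k) - l * b K k ^ q| ≤ e * b K k ^ q → |δ K k| ≤ e * D := by
    intro K k hk e he h
    rw [hδ]
    simp only
    rw [abs_mul, abs_of_pos (zpow_pos (hu hk) q)]
    calc _ ≤ e * b K k ^ q * fifthRoot n m k ^ q :=
          mul_le_mul_of_nonneg_right h (zpow_pos (hu hk) q).le
      _ = e * (b K k ^ q * fifthRoot n m k ^ q) := by ring
      _ ≤ _ := mul_le_mul_of_nonneg_left (hbq K k hk) he
  have hmain := tendsto_weighted_average_zero (A := A) (C := (|M| + |l|) * D) (δ := δ)
    (a := fun k => blockSize n m j k * fifthRoot n m k ^ (-q)) ?_ hB hsum ?_ ?_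
  · rw [tendsto_zero_iff_norm_tendsto_zero]
    refine squeeze_zero' (Eventually.of_forall fun _ => norm_nonneg _) ?_ hmain
    filter_upwards [hB.eventually_gt_atTop 0] with K hK
    rw [norm_div, Real.norm_eq_abs, Real.norm_eq_abs, abs_of_pos hK]
    refine div_le_div_of_nonneg_right ?_ hK.le
    rw [Finset.mul_sum, ← Finset.sum_sub_distrib]
    refine (Finset.abs_sum_le_sum_abs _ _).trans (Finset.sum_le_sum fun k hk => le_of_eq ?_)
    have := (hu hk).ne'
    rw [hδ]
    simp only
    rw [abs_mul _ (fifthRoot n m k ^ q), abs_of_pos (zpow_pos (hu hk) q),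
      show blockSize n m j k * G (b K k) - l * (blockSize n m j k * b K k ^ q)
        = blockSize n m j k * (G (b K k) - l * b K k ^ q) by ring, abs_mul,
      abs_of_nonneg (blockSize_nonneg _ _), zpow_neg]
    have := (zpow_pos (hu hk) q).ne'
    field_simp
  · exact fun k hk => mul_nonneg (blockSize_nonneg _ _) (zpow_nonneg (fifthRoot_nonneg _) _)
  · intro K k hk
    refine hδle K k hk _ (by positivity) ?_
    have hp := zpow_pos (hb.band_pos hk) q
    refine (abs_sub _ _).trans ?_
    rw [add_mul]
    refine add_le_add ((hM _ (hb.band_pos hk)).trans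
      (mul_le_mul_of_nonneg_right (le_abs_self M) hp.le)) ?_
    rw [abs_mul, abs_of_pos hp]
  · intro e he
    rw [Metric.tendsto_nhdsWithin_nhds] at hG
    obtain ⟨d, hd, hG⟩ := hG (e / D) (by positivity)
    obtain ⟨k₀, hk₀⟩ := hb.band_small hs hd
    refine ⟨k₀, fun K k hk hkk => ?_⟩
    have hbp := hb.band_pos hk
    have h1 := hG (mem_Ioi.2 hbp) (by
      rw [dist_zero_right, Real.norm_eq_abs, abs_of_pos hbp]
      exact hk₀ K k hk hkk)
    have hp := zpow_pos hbp q
    refine (hδle K k hk (e / D) (by positivity) ?_).trans (le_of_eq (by field_simp))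
    rw [Real.dist_eq, div_sub' hp.ne', abs_div, abs_of_pos hp, div_lt_iff₀ hp] at h1
    rw [mul_comm l]
    exact h1.le

/-- If `G(b) / b^q → l` as `b → 0`, then `∑ s_k G(b_k) / ∑ s_k b_k^q → l`, for `q = -1, 0, 2`. -/
theorem tendsto_sum_div_bandSum (hs : SizeCond n m) (hb : BandwidthBound n m b c C) {q : ℤ}
    (hq : q = -1 ∨ q = 0 ∨ q = 2) {G : ℝ → ℝ} {l M : ℝ}
    (hG : Tendsto (fun r => G r / r ^ q) (𝓝[>] 0) (𝓝 l))
    (hM : ∀ r, 0 < r → |G r| ≤ M * r ^ q) :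
    Tendsto (fun K => (∑ k ∈ Finset.Icc 1 K, blockSize n m 1 k * G (b K k)) / bandSum n m b q K)
      atTop (𝓝 l) := by
  have hpos : ∀ K, 1 ≤ K → 0 < bandSum n m b q K := by
    intro K hK
    rcases hq with rfl | rfl | rfl
    · exact hb.bandSum_neg_one_pos hs hK
    · rw [bandSum_zero]; exact hs.totalSize_pos hK
    · exact hb.bandSum_two_pos hs hK
  have hB : Tendsto (bandSum n m b q) atTop atTop := by
    rcases hq with rfl | rfl | rfl
    · refine tendsto_atTop_mono hb.le_bandSum_neg_one (Tendsto.const_mul_atTop ?_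
        ((tendsto_pow_atTop (by norm_num)).comp hs.tendsto_fifthRoot))
      have := hb.upper_pos
      positivity
    · exact hs.tendsto_totalSize.congr fun K => (bandSum_zero K).symm
    · refine tendsto_atTop_mono' _ ?_ (Tendsto.const_mul_atTop (pow_pos hb.pos 2)
        ((tendsto_pow_atTop (n := 3) (by norm_num)).comp hs.tendsto_fifthRoot))
      filter_upwards [eventually_ge_atTop 1] with K hK
      exact hb.le_bandSum_two hs hK
  have hsum : ∃ A, ∀ᶠ K in atTop,
      ∑ k ∈ Finset.Icc 1 K, blockSize n m 1 k * fifthRoot n m k ^ (-q) ≤ A * bandSum n m b q K := by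
    rcases hq with rfl | rfl | rfl
    · refine ⟨C, Eventually.of_forall fun K => ?_⟩
      rw [bandSum, Finset.mul_sum]
      refine Finset.sum_le_sum fun k hk => ?_
      rw [mul_left_comm]
      refine mul_le_mul_of_nonneg_left ?_ (blockSize_nonneg _ _)
      rw [zpow_neg_one, neg_neg, zpow_one, ← div_eq_mul_inv, le_div_iff₀ (hb.band_pos hk), mul_comm]
      exact hb.upper K k hk
    · exact ⟨1, Eventually.of_forall fun K => by simp [bandSum]⟩
    · refine ⟨(c ^ 2)⁻¹, Eventually.of_forall fun K => ?_⟩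
      rw [bandSum, Finset.mul_sum]
      refine Finset.sum_le_sum fun k hk => ?_
      have hu := hs.fifthRoot_pos (Finset.mem_Icc.1 hk).1
      have hc := hb.pos
      rw [mul_left_comm]
      refine mul_le_mul_of_nonneg_left ?_ (blockSize_nonneg _ _)
      rw [zpow_neg, inv_mul_eq_div, le_div_iff₀ (by positivity), inv_mul_eq_div,
        div_le_iff₀ (by positivity), ← mul_zpow]
      exact_mod_cast pow_le_pow_left₀ hc.le (hb.lower K k hk) 2
  obtain ⟨A, hA⟩ := hsum
  have h := (hb.tendsto_sum_sub hs hB hA hG hM).add_const l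
  rw [zero_add] at h
  refine h.congr' ?_
  filter_upwards [eventually_ge_atTop 1] with K hK
  have := hpos K hK
  change (_ - l * bandSum n m b q K) / bandSum n m b q K + l = _
  field_simp
  ring

end BandwidthBound

end

section

/-! ### Taylor expansions -/

theorem isLittleO_taylor_two {g : ℝ → ℝ} {u : Set ℝ} (hu : Convex ℝ u) (huo : IsOpen u) {t : ℝ}
    (ht : t ∈ u) (hg : ContDiffOn ℝ 2 g u) :
    (fun s => g s - g t - deriv g t * (s - t) - 1 / 2 * iteratedDeriv 2 g t * (s - t) ^ 2)
      =o[𝓝 t] fun s => (s - t) ^ 2 := by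
  have h := taylor_isLittleO (n := 2) hu ht (by exact_mod_cast hg)
  rw [huo.nhdsWithin_eq ht] at h
  refine h.congr_left fun s => ?_
  rw [taylorWithinEval_succ, taylorWithinEval_succ, taylor_within_zero_eval,
    iteratedDerivWithin_of_isOpen huo ht, iteratedDerivWithin_of_isOpen huo ht, iteratedDeriv_one]
  simp [Nat.factorial]
  ring

/-- The odd Taylor terms cancel in `q a + q (-a)`, so the first surviving term after the quadratic
one has order four. -/
theorem isBigO_symm_taylor_four {q : ℝ → ℝ} (hq : ContDiffAt ℝ 4 q 0) :
    (fun a => q a + q (-a) - 2 * q 0 - iteratedDeriv 2 q 0 * a ^ 2) =O[𝓝 0] fun a => a ^ 4 := by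
  obtain ⟨u, hu, hqu⟩ := hq.contDiffOn le_rfl (by simp)
  obtain ⟨d, hd, hdu⟩ := Metric.mem_nhds_iff.1 hu
  have h0 : (0 : ℝ) ∈ Metric.ball (0 : ℝ) d := Metric.mem_ball_self hd
  have h := taylor_isLittleO (n := 4) (convex_ball (0 : ℝ) d) h0 (by exact_mod_cast hqu.mono hdu)
  rw [Metric.isOpen_ball.nhdsWithin_eq h0] at h
  simp only [taylorWithinEval_succ, taylor_within_zero_eval,
    iteratedDerivWithin_of_isOpen Metric.isOpen_ball h0, sub_zero] at h
  have hneg : Tendsto (fun a : ℝ => -a) (𝓝 0) (𝓝 0) := by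
    simpa using (continuous_neg (G := ℝ)).tendsto 0
  have h' := h.comp_tendsto hneg
  have h2 : (fun a => iteratedDeriv 4 q 0 / 12 * a ^ 4) =O[𝓝 (0 : ℝ)] fun a => a ^ 4 :=
    (isBigO_refl _ _).const_mul_left _
  have h'' : ((fun x : ℝ => x ^ 4) ∘ fun a => -a) = fun a => a ^ 4 := by
    ext a
    simp only [Function.comp]
    ring
  rw [h''] at h'
  refine ((h.isBigO.add h'.isBigO).add h2).congr_left fun a => ?_
  simp [Nat.factorial]
  ring

/-- The linear Taylor term vanishes at a local minimum. -/
theorem isBigO_of_isLocalMin {h : ℝ → ℝ} (hh : ContDiffAt ℝ 2 h 0) (h0 : h 0 = 0)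
    (hmin : IsLocalMin h 0) : h =O[𝓝 0] fun a => a ^ 2 := by
  obtain ⟨u, hu, hqu⟩ := hh.contDiffOn le_rfl (by simp)
  obtain ⟨d, hd, hdu⟩ := Metric.mem_nhds_iff.1 hu
  have e := isLittleO_taylor_two (convex_ball (0 : ℝ) d) Metric.isOpen_ball
    (Metric.mem_ball_self hd) (hqu.mono hdu)
  simp only [h0, hmin.deriv_eq_zero, sub_zero, zero_mul] at e
  have h2 : (fun a => 1 / 2 * iteratedDeriv 2 h 0 * a ^ 2) =O[𝓝 (0 : ℝ)] fun a => a ^ 2 :=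
    (isBigO_refl _ _).const_mul_left _
  exact (e.isBigO.add h2).congr_left fun a => by ring

/-- First-order Taylor bound from a bound on the second derivative. -/
theorem abs_sub_deriv_le {g : ℝ → ℝ} {u : Set ℝ} (hu : Convex ℝ u) (huo : IsOpen u) {M : ℝ}
    (hg : ContDiffOn ℝ 2 g u) (hM : ∀ s ∈ u, |iteratedDeriv 2 g s| ≤ M) {s t : ℝ} (hs : s ∈ u)
    (ht : t ∈ u) : |g s - g t - deriv g t * (s - t)| ≤ M * (s - t) ^ 2 := by
  have hd : DifferentiableOn ℝ g u := hg.differentiableOn (by norm_num)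
  have hd1 : ContDiffOn ℝ 1 (deriv g) u := ((contDiffOn_succ_iff_deriv_of_isOpen (n := 1) huo).1
    (by rw [one_add_one_eq_two]; exact hg)).2.2
  have hd2 : DifferentiableOn ℝ (deriv g) u := hd1.differentiableOn (by norm_num)
  have hder : ∀ x ∈ u, |deriv g x - deriv g t| ≤ M * |x - t| := by
    intro x hx
    refine hu.norm_image_sub_le_of_norm_deriv_le (f := deriv g)
      (fun y hy => (hd2 y hy).differentiableAt (huo.mem_nhds hy)) (fun y hy => ?_) ht hx
    have := hM y hy
    rwa [iteratedDeriv_succ, iteratedDeriv_one] at this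
  have hM0 : 0 ≤ M := (abs_nonneg _).trans (hM t ht)
  have hseg : segment ℝ t s ⊆ u := hu.segment_subset ht hs
  have := (convex_segment t s).norm_image_sub_le_of_norm_hasDerivWithin_le (𝕜 := ℝ)
    (f := fun x => g x - deriv g t * x) (f' := fun x => deriv g x - deriv g t) (C := M * |s - t|)
    (x := t) (y := s) (fun x hx => ?_) (fun x hx => ?_) (left_mem_segment ℝ t s)
    (right_mem_segment ℝ t s)
  · rw [Real.norm_eq_abs, Real.norm_eq_abs, mul_assoc, ← sq, sq_abs] at this
    rwa [show g s - g t - deriv g t * (s - t) = g s - deriv g t * s - (g t - deriv g t * t) by ring]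
  · have h1 := ((hd x (hseg hx)).differentiableAt (huo.mem_nhds (hseg hx))).hasDerivAt
    have h2 := (hasDerivAt_id x).const_mul (deriv g t)
    rw [mul_one] at h2
    exact (h1.sub h2).hasDerivWithinAt
  · refine (hder x (hseg hx)).trans (mul_le_mul_of_nonneg_left ?_ hM0)
    rw [segment_eq_uIcc] at hx
    exact abs_sub_left_of_mem_uIcc hx

/-! ### Kernel -/

namespace KernelCond

variable {W : ℝ → ℝ}

/-- By symmetry and support the kernel is determined on `[0, 1]`, where it is Lipschitz;
measurability and boundedness follow from this representation. The kernel may jump at `±1`. -/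
theorem eq_indicator_abs (hW : KernelCond W) (u : ℝ) : W u = (Icc 0 1).indicator W |u| := by
  have h1 : W |u| = W u := by
    rcases abs_choice u with h | h <;> rw [h]
    exact hW.symm u
  by_cases h : |u| ≤ 1
  · rw [indicator_of_mem (show |u| ∈ Icc (0 : ℝ) 1 from ⟨abs_nonneg u, h⟩), h1]
  · rw [indicator_of_notMem (fun hm => h hm.2), hW.support u (not_le.1 h)]

theorem measurable (hW : KernelCond W) : Measurable W := by
  obtain ⟨C, hC⟩ := hW.lipschitz
  have h1 : Measurable ((Icc (0 : ℝ) 1).indicator W) := by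
    classical
    rw [← piecewise_eq_indicator]
    exact hC.continuousOn.measurable_piecewise continuousOn_const measurableSet_Icc
  have h2 : W = fun u => (Icc (0 : ℝ) 1).indicator W |u| := funext hW.eq_indicator_abs
  rw [h2]
  exact h1.comp measurable_norm

theorem exists_bound (hW : KernelCond W) : ∃ B : ℝ, 0 < B ∧ ∀ u, W u ≤ B := by
  obtain ⟨C, hC⟩ := hW.lipschitz
  refine ⟨|W 0| + C + 1, by positivity, fun u => ?_⟩
  rw [hW.eq_indicator_abs]
  refine indicator_apply_le' (fun h => ?_) fun _ => by positivity
  have h1 := hC.dist_le_mul _ h 0 (by simp)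
  rw [Real.dist_eq, Real.dist_eq, sub_zero, abs_abs] at h1
  have h2 : (C : ℝ) * |u| ≤ C := mul_le_of_le_one_right C.2 h.2
  have h3 := le_abs_self (W |u| - W 0)
  have h4 := le_abs_self (W 0)
  linarith

/-- `V` is a bounded measurable function supported in `[-1, 1]`. -/
theorem integrable_of_support {V : ℝ → ℝ} {B : ℝ} (hm : Measurable V) (hB : ∀ u, |V u| ≤ B)
    (hsupp : ∀ u, 1 < |u| → V u = 0) : Integrable V := by
  have h : IntegrableOn V (Icc (-1) 1) := Measure.integrableOn_of_bounded (M := B) (by simp)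
    hm.aestronglyMeasurable (Eventually.of_forall fun u => hB u)
  refine (integrableOn_iff_integrable_of_support_subset fun u hu => ?_).1 h
  by_contra hu'
  exact hu (hsupp u (not_le.1 fun h => hu' (abs_le.1 h)))

/-- A vanishing integral would make `V`, hence `W`, zero almost everywhere, against `∫ W = 1`. -/
theorem integral_pos_of_mul {V : ℝ → ℝ} (hW : KernelCond W) (hV : ∀ u, 0 ≤ V u)
    (hVi : Integrable V) (h : ∀ᵐ u, V u = 0 → W u = 0) : 0 < ∫ u, V u := by
  refine (integral_nonneg hV).lt_of_ne' fun h0 => ?_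
  have h1 := (integral_eq_zero_iff_of_nonneg hV hVi).1 h0
  have h2 : W =ᵐ[volume] 0 := by
    filter_upwards [h1, h] with u hu hu'
    exact hu' hu
  have := hW.integral_eq_one
  rw [integral_congr_ae h2] at this
  simp at this

theorem integrable_sq (hW : KernelCond W) : Integrable fun u => W u ^ 2 := by
  obtain ⟨B, hB, hWB⟩ := hW.exists_bound
  refine integrable_of_support (B := B ^ 2) (hW.measurable.pow_const 2) (fun u => ?_) fun u hu => ?_
  · rw [abs_of_nonneg (sq_nonneg _)]
    exact pow_le_pow_left₀ (hW.nonneg u) (hWB u) 2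
  · rw [hW.support u hu]
    norm_num

theorem integrable_sq_mul (hW : KernelCond W) : Integrable fun u => u ^ 2 * W u := by
  obtain ⟨B, hB, hWB⟩ := hW.exists_bound
  refine integrable_of_support (B := B) (by have := hW.measurable; fun_prop) (fun u => ?_)
    fun u hu => by rw [hW.support u hu, mul_zero]
  rcases le_or_gt |u| 1 with h | h
  · rw [abs_of_nonneg (mul_nonneg (sq_nonneg _) (hW.nonneg u))]
    have := (sq_le_one_iff_abs_le_one u).2 h
    exact (mul_le_of_le_one_left (hW.nonneg u) this).trans (hWB u)
  · rw [hW.support u h]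
    simpa using hB.le

theorem kernelR_pos (hW : KernelCond W) : 0 < kernelR W :=
  hW.integral_pos_of_mul (fun _ => sq_nonneg _) hW.integrable_sq
    (Eventually.of_forall fun _ hu => pow_eq_zero_iff (two_ne_zero) |>.1 hu)

theorem kernelAlpha_pos (hW : KernelCond W) : 0 < kernelAlpha W := by
  refine hW.integral_pos_of_mul (fun u => mul_nonneg (sq_nonneg _) (hW.nonneg u))
    hW.integrable_sq_mul ?_
  have : ∀ᵐ u : ℝ, u ≠ 0 := by simp [ae_iff]
  filter_upwards [this] with u hu h
  simpa [hu] using h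

theorem scaledKernel_nonneg (hW : KernelCond W) {b : ℝ} (hb : 0 < b) (u : ℝ) :
    0 ≤ scaledKernel W b u := div_nonneg (hW.nonneg _) hb.le

theorem scaledKernel_eq_zero (hW : KernelCond W) {b u : ℝ} (hb : 0 < b) (hu : b < |u|) :
    scaledKernel W b u = 0 := by
  rw [scaledKernel, hW.support, zero_div]
  rwa [abs_div, abs_of_pos hb, one_lt_div hb]

theorem measurable_scaledKernel (hW : KernelCond W) (b : ℝ) : Measurable (scaledKernel W b) := by
  have := hW.measurable
  unfold scaledKernel
  fun_prop

theorem scaledKernel_neg (hW : KernelCond W) (b u : ℝ) :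
    scaledKernel W b (-u) = scaledKernel W b u := by
  rw [scaledKernel, scaledKernel, neg_div, hW.symm]

theorem integral_scaledKernel (hW : KernelCond W) {b : ℝ} (hb : 0 < b) :
    ∫ u, scaledKernel W b u = 1 := by
  simp only [scaledKernel]
  rw [integral_div, Measure.integral_comp_div, hW.integral_eq_one, abs_of_pos hb]
  simp [hb.ne']

end KernelCond

/-! ### Law of the observation times -/

/-- The density of the observation times, cut off outside `(0, 1)`. -/
def cutDensity (f : ℝ → ℝ) : ℝ → ℝ := (Ioo (0 : ℝ) 1).indicator f

theorem cutDensity_of_mem {f : ℝ → ℝ} {s : ℝ} (hs : s ∈ Ioo (0 : ℝ) 1) : cutDensity f s = f s :=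
  indicator_of_mem hs f

theorem cutDensity_of_notMem {f : ℝ → ℝ} {s : ℝ} (hs : s ∉ Ioo (0 : ℝ) 1) : cutDensity f s = 0 :=
  indicator_of_notMem hs f

namespace DensityCond

variable {f : ℝ → ℝ}

theorem pos (hf : DensityCond f) {s : ℝ} (hs : s ∈ Ioo (0 : ℝ) 1) : 0 < f s := by
  obtain ⟨c, hc, h⟩ := hf.bdd_below
  exact hc.trans_le (h s hs)

theorem cutDensity_nonneg (hf : DensityCond f) (s : ℝ) : 0 ≤ cutDensity f s :=
  indicator_nonneg (fun _ h => (hf.pos h).le) s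

theorem measurable_cutDensity (hf : DensityCond f) : Measurable (cutDensity f) := by
  classical
  rw [cutDensity, ← piecewise_eq_indicator]
  exact hf.differentiable.continuousOn.measurable_piecewise continuousOn_const measurableSet_Ioo

/-- The mean value inequality, used twice from the midpoint: a bounded second derivative on a
bounded interval bounds the first derivative, and that bounds `f`. -/
theorem exists_bound (hf : DensityCond f) : ∃ F : ℝ, 0 < F ∧ ∀ s, cutDensity f s ≤ F := by
  obtain ⟨M, hM⟩ := hf.bdd_deriv_two
  have ho : IsOpen (Ioo (0 : ℝ) 1) := isOpen_Ioo
  have hc : Convex ℝ (Ioo (0 : ℝ) 1) := convex_Ioo 0 1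
  have hh : (1 / 2 : ℝ) ∈ Ioo (0 : ℝ) 1 := by constructor <;> norm_num
  have hM0 : 0 ≤ M := (abs_nonneg _).trans (hM _ hh)
  have hdist : ∀ s ∈ Ioo (0 : ℝ) 1, |s - 1 / 2| ≤ 1 := fun s hs =>
    abs_le.2 ⟨by linarith [hs.1], by linarith [hs.2]⟩
  have h1 : ∀ s ∈ Ioo (0 : ℝ) 1, |deriv f s| ≤ |deriv f (1 / 2)| + M := by
    intro s hs
    have := hc.norm_image_sub_le_of_norm_deriv_le (f := deriv f)
      (fun y hy => (hf.differentiable_deriv y hy).differentiableAt (ho.mem_nhds hy))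
      (fun y hy => hM y hy) hh hs
    rw [Real.norm_eq_abs, Real.norm_eq_abs] at this
    have h2 := abs_sub_abs_le_abs_sub (deriv f s) (deriv f (1 / 2))
    nlinarith [hdist s hs]
  have hD0 := (abs_nonneg _).trans (h1 _ hh)
  refine ⟨|f (1 / 2)| + (|deriv f (1 / 2)| + M) + 1, by positivity, fun s => ?_⟩
  refine indicator_apply_le' (fun hs => ?_) fun _ => by positivity
  have := hc.norm_image_sub_le_of_norm_deriv_le (f := f)
      (fun y hy => (hf.differentiable y hy).differentiableAt (ho.mem_nhds hy))
      (fun y hy => h1 y hy) hh hs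
  rw [Real.norm_eq_abs, Real.norm_eq_abs] at this
  have h2 := le_abs_self (f s - f (1 / 2))
  have h3 := le_abs_self (f (1 / 2))
  nlinarith [hdist s hs]

theorem hasDerivAt_cutDensity (hf : DensityCond f) {t : ℝ} (ht : t ∈ Ioo (0 : ℝ) 1) :
    HasDerivAt (cutDensity f) (deriv f t) t := by
  have h1 := ((hf.differentiable t ht).differentiableAt (isOpen_Ioo.mem_nhds ht)).hasDerivAt
  refine h1.congr_of_eventuallyEq ?_
  filter_upwards [isOpen_Ioo.mem_nhds ht] with s hs
  exact cutDensity_of_mem hs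

theorem tendsto_cutDensity (hf : DensityCond f) {t : ℝ} (ht : t ∈ Ioo (0 : ℝ) 1) :
    Tendsto (cutDensity f) (𝓝 t) (𝓝 (f t)) := by
  have := (hf.hasDerivAt_cutDensity ht).continuousAt.tendsto
  rwa [cutDensity_of_mem ht] at this

/-- The cut density is Lipschitz at `t`. -/
theorem exists_lipschitz_at (hf : DensityCond f) {t : ℝ} (ht : t ∈ Ioo (0 : ℝ) 1) :
    ∃ C : ℝ, 0 < C ∧ ∀ a, |cutDensity f (t + a) - cutDensity f t| ≤ C * |a| := by
  obtain ⟨F, hF, hfF⟩ := hf.exists_bound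
  obtain ⟨D, hD⟩ := (hf.hasDerivAt_cutDensity ht).differentiableAt.isBigO_sub.bound
  obtain ⟨d, hd, hball⟩ := Metric.eventually_nhds_iff.1 hD
  -- Within distance `d` of `t` differentiability gives slope `D`. Farther away the increment is at
  -- most `F`, as both values lie in `[0, F]`, and `|a| ≥ d`. The 1 only ensures positivity.
  refine ⟨max (max D 1) (F / d), by positivity, fun a => ?_⟩
  rcases lt_or_ge |a| d with h | h
  · have := hball (y := t + a) (by simpa using h)
    simp only [Real.norm_eq_abs, add_sub_cancel_left] at this
    exact this.trans (mul_le_mul_of_nonneg_right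
      ((le_max_left _ _).trans (le_max_left _ _)) (abs_nonneg a))
  · have h1 : |cutDensity f (t + a) - cutDensity f t| ≤ F := by
      rw [abs_le]
      constructor <;> linarith [hfF (t + a), hfF t, hf.cutDensity_nonneg (t + a),
        hf.cutDensity_nonneg t]
    calc _ ≤ F := h1
      _ = F / d * d := by field_simp
      _ ≤ max (max D 1) (F / d) * |a| := by gcongr; exact le_max_right _ _

/-- The assumptions say nothing about `f` at the endpoints or outside `[0, 1]`. The cut version
gives the same law, since the endpoints are null, and is measurable and bounded on the whole line.
-/
theorem timeLaw_eq : timeLaw f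
    = volume.withDensity (fun s => ENNReal.ofReal (cutDensity f s)) := by
  have h : (fun s => ENNReal.ofReal (cutDensity f s))
      = (Ioo (0 : ℝ) 1).indicator fun s => ENNReal.ofReal (f s) := by
    ext s
    by_cases hs : s ∈ Ioo (0 : ℝ) 1
    · rw [cutDensity_of_mem hs, indicator_of_mem hs]
    · rw [cutDensity_of_notMem hs, indicator_of_notMem hs, ENNReal.ofReal_zero]
  rw [h, withDensity_indicator measurableSet_Ioo, timeLaw, Measure.restrict_congr_set Ioo_ae_eq_Icc]

theorem integral_timeLaw (hf : DensityCond f) (g : ℝ → ℝ) :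
    ∫ s, g s ∂(timeLaw f) = ∫ s, cutDensity f s * g s := by
  rw [timeLaw_eq, integral_withDensity_eq_integral_toReal_smul
    hf.measurable_cutDensity.ennreal_ofReal (by simp)]
  refine integral_congr_ae (Eventually.of_forall fun s => ?_)
  simp [ENNReal.toReal_ofReal (hf.cutDensity_nonneg s)]

theorem integral_timeLaw_shift (hf : DensityCond f) (t : ℝ) (g : ℝ → ℝ) :
    ∫ s, g s ∂(timeLaw f) = ∫ a, cutDensity f (t + a) * g (t + a) := by
  rw [hf.integral_timeLaw, ← integral_add_left_eq_self _ t]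

theorem timeLaw_le {F : ℝ} (hF : ∀ s, cutDensity f s ≤ F) (A : Set ℝ) (hA : MeasurableSet A) :
    timeLaw f A ≤ ENNReal.ofReal F * volume A := by
  rw [timeLaw_eq, withDensity_apply _ hA]
  calc _ ≤ ∫⁻ _ in A, ENNReal.ofReal F :=
        lintegral_mono fun s => ENNReal.ofReal_le_ofReal (hF s)
    _ = _ := by simp

theorem ae_mem_timeLaw : ∀ᵐ s ∂(timeLaw f), s ∈ Ioo (0 : ℝ) 1 := by
  rw [timeLaw, Measure.restrict_congr_set Ioo_ae_eq_Icc.symm]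
  exact (withDensity_absolutelyContinuous _ _).ae_le (ae_restrict_mem measurableSet_Ioo)

/-- A bounded function supported in `[t - b, t + b]` has integral of order `b`. -/
theorem integral_timeLaw_le [IsFiniteMeasure (timeLaw f)] {F : ℝ} (hF0 : 0 ≤ F)
    (hF : ∀ s, cutDensity f s ≤ F) {g : ℝ → ℝ} {A b t : ℝ} (hb : 0 ≤ b)
    (hA : 0 ≤ A) (hg0 : ∀ s ∈ Ioo (0 : ℝ) 1, |g s| ≤ A) (hg : ∀ s, b < |s - t| → g s = 0) :
    |∫ s, g s ∂(timeLaw f)| ≤ 2 * F * A * b := by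
  have h1 : ∫ s, (Icc (t - b) (t + b)).indicator (fun _ => A) s ∂(timeLaw f) ≤ 2 * F * A * b := by
    rw [integral_indicator measurableSet_Icc, setIntegral_const, smul_eq_mul, Measure.real]
    have := timeLaw_le hF (Icc (t - b) (t + b)) measurableSet_Icc
    have h2 := ENNReal.toReal_mono (ENNReal.mul_ne_top ENNReal.ofReal_ne_top (by simp)) this
    rw [ENNReal.toReal_mul, ENNReal.toReal_ofReal hF0, Real.volume_Icc,
      ENNReal.toReal_ofReal (by linarith)] at h2
    nlinarith
  refine (abs_integral_le_integral_abs).trans (le_trans ?_ h1)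
  refine integral_mono_of_nonneg (Eventually.of_forall fun _ => abs_nonneg _)
    ((integrable_const A).indicator measurableSet_Icc) ?_
  filter_upwards [ae_mem_timeLaw] with s hs
  by_cases h : s ∈ Icc (t - b) (t + b)
  · rw [indicator_of_mem h]
    exact hg0 s hs
  · rw [indicator_of_notMem h, hg s, abs_zero]
    by_contra hn
    have := abs_le.1 (not_lt.1 hn)
    exact h ⟨by linarith [this.1], by linarith [this.2]⟩

end DensityCond

/-- Localization: `b⁻¹ ∫ V((s - t) / b) G(s) ds → G(t) ∫ V` as `b → 0`. -/
theorem tendsto_integral_scaled {V G : ℝ → ℝ} {B M g₀ t : ℝ} (hV : Measurable V)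
    (hVB : ∀ u, |V u| ≤ B) (hsupp : ∀ u, 1 < |u| → V u = 0) (hG : Measurable G)
    (hGM : ∀ s, |G s| ≤ M) (hlim : Tendsto G (𝓝[≠] t) (𝓝 g₀)) :
    Tendsto (fun b => (∫ a, G (t + a) * V (a / b)) / b) (𝓝[>] 0) (𝓝 (g₀ * ∫ u, V u)) := by
  have hVi := KernelCond.integrable_of_support hV hVB hsupp
  have e : ∀ b ∈ Ioi (0 : ℝ), (∫ u, G (t + b * u) * V u)
      = (∫ a, G (t + a) * V (a / b)) / b := by
    intro b hb
    have hb' : (0 : ℝ) < b := hb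
    have := Measure.integral_comp_div (fun u => G (t + b * u) * V u) b
    rw [abs_of_pos hb', smul_eq_mul] at this
    rw [eq_div_iff hb'.ne', mul_comm, ← this]
    refine integral_congr_ae (Eventually.of_forall fun a => ?_)
    simp only
    rw [mul_div_cancel₀ a hb'.ne']
  refine Tendsto.congr' (eventually_nhdsWithin_of_forall e) ?_
  rw [← integral_const_mul]
  refine tendsto_integral_filter_of_dominated_convergence (fun u => M * |V u|)
    (Eventually.of_forall fun b => by
      have : Measurable fun u => G (t + b * u) * V u := by fun_prop
      exact this.aestronglyMeasurable)
    (Eventually.of_forall fun b => Eventually.of_forall fun u => ?_) (hVi.abs.const_mul M) ?_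
  · rw [norm_mul]
    exact mul_le_mul_of_nonneg_right (hGM _) (norm_nonneg _)
  -- Since `u = 0` is null, the limit of `G` along the punctured neighbourhood suffices. So `G` may
  -- be a quotient such as `φ s / (s - t) ^ 2`, whose value at `t` is meaningless.
  · have : ∀ᵐ u : ℝ, u ≠ 0 := by simp [ae_iff]
    filter_upwards [this] with u hu
    refine Tendsto.mul_const _ (hlim.comp (tendsto_nhdsWithin_iff.2 ⟨?_, ?_⟩))
    · have : Tendsto (fun b : ℝ => t + b * u) (𝓝 0) (𝓝 (t + 0 * u)) := by
        apply Continuous.tendsto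
        fun_prop
      rw [zero_mul, add_zero] at this
      exact this.mono_left nhdsWithin_le_nhds
    · refine eventually_nhdsWithin_of_forall fun b hb => ?_
      have hb' : (0 : ℝ) < b := hb
      simp [hb'.ne', hu]

end

section

/-! ### Second-order differences of the covariance -/

theorem iteratedDeriv_two_comp_line {F : Type*} [NormedAddCommGroup F] [NormedSpace ℝ F]
    {g : F → ℝ} {z : F} (hg : ContDiffAt ℝ 2 g z) (v : F) :
    iteratedDeriv 2 (fun a : ℝ => g (z + a • v)) 0 = fderiv ℝ (fderiv ℝ g) z v v := by
  have hline : ∀ a : ℝ, HasDerivAt (fun a : ℝ => z + a • v) v a := fun a => by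
    simpa using ((hasDerivAt_id a).smul_const v).const_add z
  have h0 : z + (0 : ℝ) • v = z := by simp
  have hev : ∀ᶠ a : ℝ in 𝓝 0, DifferentiableAt ℝ g (z + a • v) := by
    have h1 : ∀ᶠ y in 𝓝 z, DifferentiableAt ℝ g y :=
      (hg.eventually (by simp)).mono fun y hy => hy.differentiableAt (by norm_num)
    have h2 := (hline 0).continuousAt.tendsto
    rw [h0] at h2
    exact h2.eventually h1
  have h1 : deriv (fun a : ℝ => g (z + a • v)) =ᶠ[𝓝 0] fun a => fderiv ℝ g (z + a • v) v := by
    filter_upwards [hev] with a ha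
    exact (ha.hasFDerivAt.comp_hasDerivAt a (hline a)).deriv
  rw [iteratedDeriv_succ, iteratedDeriv_one, h1.deriv_eq]
  have h2 : HasFDerivAt (fderiv ℝ g) (fderiv ℝ (fderiv ℝ g) z) (z + (0 : ℝ) • v) := by
    rw [h0]
    exact ((hg.fderiv_right (m := 1) (by norm_num)).differentiableAt (by norm_num)).hasFDerivAt
  have h3 := h2.comp_hasDerivAt (0 : ℝ) (hline 0)
  have h4 := h3.clm_apply (hasDerivAt_const (0 : ℝ) v)
  simpa using h4.deriv

/-- For a covariance `g` this expression is the mean square of `Φ(t+a) + Φ(t-a) - 2Φ(t)`. It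
combines symmetric differences along the diagonals and the axes. Odd terms cancel by symmetry and
the quadratic ones by the parallelogram law for the second derivative, so the order is four. -/
theorem isBigO_second_difference {g : ℝ × ℝ → ℝ} {t : ℝ} (hg : ContDiffAt ℝ 4 g (t, t)) :
    (fun a => g (t + a, t + a) + g (t - a, t - a) + g (t + a, t - a) + g (t - a, t + a)
      - 2 * g (t + a, t) - 2 * g (t - a, t) - 2 * g (t, t + a) - 2 * g (t, t - a) + 4 * g (t, t))
      =O[𝓝 0] fun a => a ^ 4 := by
  set p : ℝ × ℝ → ℝ → ℝ := fun v a => g ((t, t) + a • v) with hp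
  have hpc : ∀ v, ContDiffAt ℝ 4 (p v) 0 := by
    intro v
    have h1 : ContDiffAt ℝ 4 (fun a : ℝ => (t, t) + a • v) 0 := by fun_prop
    refine ContDiffAt.comp (0 : ℝ) ?_ h1
    simpa using hg
  have hp2 : ∀ v, iteratedDeriv 2 (p v) 0 = fderiv ℝ (fderiv ℝ g) (t, t) v v := fun v =>
    iteratedDeriv_two_comp_line (hg.of_le (by norm_num)) v
  set D := fderiv ℝ (fderiv ℝ g) (t, t) with hD
  have hb : ∀ v, (fun a => p v a + p v (-a) - 2 * p v 0 - D v v * a ^ 2)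
      =O[𝓝 0] fun a => a ^ 4 := fun v => by
    simpa [hp2 v] using isBigO_symm_taylor_four (hpc v)
  have key : D (1, 1) (1, 1) + D (1, -1) (1, -1) = 2 * D (1, 0) (1, 0) + 2 * D (0, 1) (0, 1) := by
    have e1 : ((1, 1) : ℝ × ℝ) = (1, 0) + (0, 1) := by simp
    have e2 : ((1, -1) : ℝ × ℝ) = (1, 0) - (0, 1) := by simp
    rw [e1, e2]
    simp only [map_add, map_sub, add_apply, sub_apply]
    ring
  refine (((hb (1, 1)).add (hb (1, -1))).sub
    (((hb (1, 0)).const_mul_left 2).add ((hb (0, 1)).const_mul_left 2))).congr_left fun a => ?_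
  have hk : D (1, 1) (1, 1) = 2 * D (1, 0) (1, 0) + 2 * D (0, 1) (0, 1) - D (1, -1) (1, -1) := by
    linarith
  rw [hk]
  simp only [hp, Prod.smul_mk, smul_eq_mul, mul_one, mul_zero, Prod.mk_add_mk, add_zero, mul_neg,
    neg_zero, neg_neg, ← sub_eq_add_neg]
  ring

/-- A bounded function that is `O(a^k)` at `0` is bounded by a multiple of `|a|^k`. -/
theorem exists_global_bound {g : ℝ → ℝ} {k : ℕ} {V : ℝ} (h : g =O[𝓝 0] fun a => a ^ k)
    (hV : ∀ a, |g a| ≤ V) : ∃ C : ℝ, 0 ≤ C ∧ ∀ a, |g a| ≤ C * |a| ^ k := by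
  obtain ⟨D, hD⟩ := h.bound
  obtain ⟨d, hd, hball⟩ := Metric.eventually_nhds_iff.1 hD
  have hV0 := (abs_nonneg _).trans (hV 0)
  refine ⟨max |D| (V / d ^ k), by positivity, fun a => ?_⟩
  rcases lt_or_ge |a| d with h | h
  · have := hball (y := a) (by simpa using h)
    simp only [Real.norm_eq_abs, abs_pow] at this
    refine this.trans (mul_le_mul_of_nonneg_right ?_ (by positivity))
    exact (le_abs_self D).trans (le_max_left _ _)
  · calc _ ≤ V := hV a
      _ = V / d ^ k * d ^ k := by field_simp
      _ ≤ max |D| (V / d ^ k) * |a| ^ k := by gcongr; exact le_max_right _ _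

/-! ### Fluctuations -/

section Fluct

variable {E : Type*} [MeasurableSpace E] {Q : Measure E} [IsProbabilityMeasure Q]
  {X : ℝ → E → ℝ}

/-- `Φ = X - μ`. -/
def fluct (Q : Measure E) (X : ℝ → E → ℝ) (s : ℝ) (x : E) : ℝ := X s x - meanFn Q X s

theorem integral_add_sq_le {A B : E → ℝ} (hA : MemLp A 2 Q) (hB : MemLp B 2 Q) :
    ∫ x, (A x + B x) ^ 2 ∂Q ≤ 2 * ∫ x, A x ^ 2 ∂Q + 2 * ∫ x, B x ^ 2 ∂Q := by
  rw [← integral_const_mul, ← integral_const_mul,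
    ← integral_add (hA.integrable_sq.const_mul 2) (hB.integrable_sq.const_mul 2)]
  refine integral_mono (hA.add hB).integrable_sq
    ((hA.integrable_sq.const_mul 2).add (hB.integrable_sq.const_mul 2)) fun x => ?_
  nlinarith [sq_nonneg (A x - B x)]

namespace ProcessCond

theorem measurable_meanFn (hX : ProcessCond Q X) : Measurable (meanFn Q X) :=
  (StronglyMeasurable.integral_prod_right hX.measurable.stronglyMeasurable).measurable

theorem measurable_fluct (hX : ProcessCond Q X) :
    Measurable (fun z : ℝ × E => fluct Q X z.1 z.2) :=
  hX.measurable.sub (hX.measurable_meanFn.comp measurable_fst)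

theorem memLp_fluct (hX : ProcessCond Q X) {s : ℝ} (hs : s ∈ Icc (0 : ℝ) 1) :
    MemLp (fluct Q X s) 3 Q := by
  obtain ⟨M, hM⟩ := hX.moment
  exact (hM s hs).1.sub (memLp_const _)

theorem memLp_two_fluct (hX : ProcessCond Q X) {s : ℝ} (hs : s ∈ Icc (0 : ℝ) 1) :
    MemLp (fluct Q X s) 2 Q := (hX.memLp_fluct hs).mono_exponent (by norm_num)

theorem integral_fluct (hX : ProcessCond Q X) {s : ℝ} (hs : s ∈ Icc (0 : ℝ) 1) :
    ∫ x, fluct Q X s x ∂Q = 0 := by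
  obtain ⟨M, hM⟩ := hX.moment
  simp only [fluct]
  rw [integral_sub ((hM s hs).1.integrable (by norm_num)) (integrable_const _)]
  simp [meanFn]

theorem integral_fluct_mul (s u : ℝ) :
    ∫ x, fluct Q X s x * fluct Q X u x ∂Q = covFn Q X s u := rfl

theorem exists_moment_bound (hX : ProcessCond Q X) : ∃ V : ℝ, 0 < V ∧ ∀ s ∈ Icc (0 : ℝ) 1,
    ∫ x, fluct Q X s x ^ 2 ∂Q ≤ V := by
  obtain ⟨M, hM⟩ := hX.moment
  refine ⟨|M| + 1, by positivity, fun s hs => ?_⟩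
  have h3 := hX.memLp_fluct hs
  have hi : Integrable (fun x => |fluct Q X s x| ^ 3) Q := by
    have := h3.integrable_norm_pow (by norm_num)
    simpa using this
  calc _ ≤ ∫ x, (|fluct Q X s x| ^ 3 + 1) ∂Q := by
        refine integral_mono (hX.memLp_two_fluct hs).integrable_sq (hi.add (integrable_const 1))
          fun x => ?_
        simp only
        rw [← sq_abs]
        have := abs_nonneg (fluct Q X s x)
        generalize |fluct Q X s x| = y at *
        nlinarith [mul_nonneg this (sq_nonneg (y - 1)), sq_nonneg (y - 1)]
    _ = ∫ x, |fluct Q X s x| ^ 3 ∂Q + 1 := by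
        rw [integral_add hi (integrable_const 1)]
        simp
    _ ≤ |M| + 1 := by
        have h1 : ∫ x, |fluct Q X s x| ^ 3 ∂Q ≤ M := (hM s hs).2
        linarith [le_abs_self M]

theorem integral_sum_fluct_sq (hX : ProcessCond Q X) {ι : Type*} [Fintype ι] (c s : ι → ℝ)
    (hs : ∀ i, s i ∈ Icc (0 : ℝ) 1) :
    ∫ x, (∑ i, c i * fluct Q X (s i) x) ^ 2 ∂Q = ∑ i, ∑ j, c i * c j * covFn Q X (s i) (s j) := by
  have hi : ∀ i j, Integrable (fun x => c i * c j * (fluct Q X (s i) x * fluct Q X (s j) x)) Q :=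
    fun i j => ((hX.memLp_two_fluct (hs i)).integrable_mul (hX.memLp_two_fluct (hs j))).const_mul _
  simp only [← integral_fluct_mul, ← integral_const_mul]
  rw [integral_congr_ae (g := fun x => ∑ i, ∑ j, c i * c j *
    (fluct Q X (s i) x * fluct Q X (s j) x)) (Eventually.of_forall fun x => ?_)]
  · rw [integral_finsetSum _ fun i _ => integrable_finsetSum _ fun j _ => hi i j]
    exact Finset.sum_congr rfl fun i _ => integral_finsetSum _ fun j _ => hi i j
  · simp only
    rw [sq, Finset.sum_mul_sum]
    exact Finset.sum_congr rfl fun i _ => Finset.sum_congr rfl fun j _ => by ring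

theorem covFn_comm (s u : ℝ) : covFn Q X s u = covFn Q X u s := covariance_comm _ _

theorem covFn_self_nonneg (s : ℝ) : 0 ≤ covFn Q X s s := by
  rw [← integral_fluct_mul]
  exact integral_nonneg fun x => mul_self_nonneg _

variable {t : ℝ}

theorem contDiffAt_cov (hX : ProcessCond Q X) (ht : t ∈ Ioo (0 : ℝ) 1) :
    ContDiffAt ℝ 4 (fun p : ℝ × ℝ => covFn Q X p.1 p.2) (t, t) :=
  hX.cov_smooth.contDiffAt ((isOpen_Ioo.prod isOpen_Ioo).mem_nhds ⟨ht, ht⟩)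

theorem eventually_mem (ht : t ∈ Ioo (0 : ℝ) 1) :
    ∀ᶠ a in 𝓝 (0 : ℝ), t + a ∈ Ioo (0 : ℝ) 1 ∧ t - a ∈ Ioo (0 : ℝ) 1 := by
  have h1 : Tendsto (fun a : ℝ => t + a) (𝓝 0) (𝓝 t) := by
    simpa using (continuous_const.add continuous_id).tendsto (0 : ℝ) (f := fun a : ℝ => t + a)
  have h2 : Tendsto (fun a : ℝ => t - a) (𝓝 0) (𝓝 t) := by
    simpa using (continuous_const.sub continuous_id).tendsto (0 : ℝ) (f := fun a : ℝ => t - a)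
  exact (h1.eventually (isOpen_Ioo.mem_nhds ht)).and (h2.eventually (isOpen_Ioo.mem_nhds ht))

/-- The smoothness is that of the covariance, not of the paths: the mean square is a quadratic form
in the values of the covariance at `t` and `t ± a`. -/
theorem isBigO_fluct_second_difference (hX : ProcessCond Q X) (ht : t ∈ Ioo (0 : ℝ) 1) :
    (fun a => ∫ x, (fluct Q X (t + a) x - fluct Q X t x + (fluct Q X (t - a) x - fluct Q X t x)) ^ 2
      ∂Q) =O[𝓝 0] fun a => a ^ 4 := by
  refine (isBigO_second_difference (hX.contDiffAt_cov ht)).congr' ?_ EventuallyEq.rfl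
  filter_upwards [eventually_mem ht] with a ha
  have h := hX.integral_sum_fluct_sq ![1, 1, -2] ![t + a, t - a, t] (by
    intro i
    fin_cases i
    exacts [Ioo_subset_Icc_self ha.1, Ioo_subset_Icc_self ha.2, Ioo_subset_Icc_self ht])
  simp only [Fin.sum_univ_three, Matrix.cons_val_zero, Matrix.cons_val_one, Matrix.cons_val] at h
  refine Eq.trans ?_ (h.symm.trans (integral_congr_ae (Eventually.of_forall fun x => ?_)))
  · ring
  · simp only
    ring

/-- As a function of `a` the mean square is twice differentiable, nonnegative and zero at `0`. Hence
it has a minimum there and no linear term. -/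
theorem isBigO_fluct_difference (hX : ProcessCond Q X) (ht : t ∈ Ioo (0 : ℝ) 1) :
    (fun a => ∫ x, (fluct Q X (t + a) x - fluct Q X t x) ^ 2 ∂Q) =O[𝓝 0] fun a => a ^ 2 := by
  have hev : (fun a => covFn Q X (t + a) (t + a) - 2 * covFn Q X (t + a) t + covFn Q X t t)
      =ᶠ[𝓝 0] fun a => ∫ x, (fluct Q X (t + a) x - fluct Q X t x) ^ 2 ∂Q := by
    filter_upwards [eventually_mem ht] with a ha
    have h := hX.integral_sum_fluct_sq ![1, -1] ![t + a, t] (by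
      intro i
      fin_cases i
      exacts [Ioo_subset_Icc_self ha.1, Ioo_subset_Icc_self ht])
    simp only [Fin.sum_univ_two, Matrix.cons_val_zero, Matrix.cons_val_one] at h
    refine Eq.trans ?_ (h.symm.trans (integral_congr_ae (Eventually.of_forall fun x => ?_)))
    · rw [covFn_comm t (t + a)]
      ring
    · simp only
      ring
  refine IsBigO.congr' (isBigO_of_isLocalMin ?_ ?_ ?_) hev EventuallyEq.rfl
  · have hc := (hX.contDiffAt_cov ht).of_le (m := 2) (by norm_num)
    have h1 : ContDiffAt ℝ 2 (fun a : ℝ => covFn Q X (t + a) (t + a)) 0 :=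
      ContDiffAt.comp (0 : ℝ) (f := fun a : ℝ => (t + a, t + a))
        (g := fun p : ℝ × ℝ => covFn Q X p.1 p.2) (by simpa using hc) (by fun_prop)
    have h2 : ContDiffAt ℝ 2 (fun a : ℝ => covFn Q X (t + a) t) 0 :=
      ContDiffAt.comp (0 : ℝ) (f := fun a : ℝ => (t + a, t))
        (g := fun p : ℝ × ℝ => covFn Q X p.1 p.2) (by simpa using hc) (by fun_prop)
    exact (h1.sub (contDiffAt_const.mul h2)).add contDiffAt_const
  · simp only [add_zero]
    ring
  · filter_upwards [hev] with a ha
    rw [ha]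
    simp only [add_zero]
    refine le_trans (le_of_eq ?_) (integral_nonneg fun x => sq_nonneg _)
    ring

variable {f : ℝ → ℝ}

theorem memLp_fluct_sub (hX : ProcessCond Q X) (ht : t ∈ Ioo (0 : ℝ) 1) {s : ℝ}
    (hs : s ∈ Ioo (0 : ℝ) 1) : MemLp (fun x => fluct Q X s x - fluct Q X t x) 2 Q :=
  (hX.memLp_two_fluct (Ioo_subset_Icc_self hs)).sub (hX.memLp_two_fluct (Ioo_subset_Icc_self ht))

/-- `E {Φ(s) - Φ(t)}² ≤ C (s - t)²`. -/
theorem exists_fluct_sub_sq_le (hX : ProcessCond Q X) (ht : t ∈ Ioo (0 : ℝ) 1) :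
    ∃ C : ℝ, 0 ≤ C ∧ ∀ s ∈ Ioo (0 : ℝ) 1,
      ∫ x, (fluct Q X s x - fluct Q X t x) ^ 2 ∂Q ≤ C * (s - t) ^ 2 := by
  obtain ⟨V, hV0, hV⟩ := hX.exists_moment_bound
  have hO : ((Ioo (0 : ℝ) 1).indicator
      (fun s => ∫ x, (fluct Q X s x - fluct Q X t x) ^ 2 ∂Q) ∘ fun a => t + a)
      =O[𝓝 0] fun a => a ^ 2 := by
    refine (hX.isBigO_fluct_difference ht).congr' ?_ EventuallyEq.rfl
    filter_upwards [eventually_mem ht] with a ha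
    rw [Function.comp_apply, indicator_of_mem ha.1]
  obtain ⟨C, hC, hb⟩ := exists_global_bound (V := 4 * V) hO (fun a => by
    rw [Function.comp_apply]
    by_cases h : t + a ∈ Ioo (0 : ℝ) 1
    · rw [indicator_of_mem h, abs_of_nonneg (integral_nonneg fun x => sq_nonneg _)]
      have := integral_add_sq_le (hX.memLp_two_fluct (Ioo_subset_Icc_self h))
        (hX.memLp_two_fluct (Ioo_subset_Icc_self ht)).neg
      simp only [Pi.neg_apply, ← sub_eq_add_neg, neg_sq] at this
      linarith [hV _ (Ioo_subset_Icc_self h), hV _ (Ioo_subset_Icc_self ht)]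
    · rw [indicator_of_notMem h, abs_zero]
      positivity)
  refine ⟨C, hC, fun s hs => ?_⟩
  have := hb (s - t)
  rw [Function.comp_apply, add_sub_cancel, indicator_of_mem hs, sq_abs] at this
  exact (le_abs_self _).trans this

theorem memLp_cut (hX : ProcessCond Q X) (ht : t ∈ Ioo (0 : ℝ) 1) (s : ℝ) :
    MemLp (fun x => cutDensity f s * (fluct Q X s x - fluct Q X t x)) 2 Q := by
  by_cases h : s ∈ Ioo (0 : ℝ) 1
  · exact (hX.memLp_fluct_sub ht h).const_mul _
  · simp [cutDensity_of_notMem h]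

theorem exists_cut_sq_le (hX : ProcessCond Q X) (hf : DensityCond f) (ht : t ∈ Ioo (0 : ℝ) 1) :
    ∃ C : ℝ, 0 ≤ C ∧ ∀ a,
      ∫ x, (cutDensity f (t + a) * (fluct Q X (t + a) x - fluct Q X t x)) ^ 2 ∂Q ≤ C * a ^ 2 := by
  obtain ⟨C, hC, h⟩ := hX.exists_fluct_sub_sq_le ht
  obtain ⟨F, hF, hfF⟩ := hf.exists_bound
  refine ⟨F ^ 2 * C, by positivity, fun a => ?_⟩
  by_cases hs : t + a ∈ Ioo (0 : ℝ) 1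
  · simp only [mul_pow]
    rw [integral_const_mul, mul_assoc]
    have := h _ hs
    rw [add_sub_cancel_left] at this
    exact mul_le_mul (pow_le_pow_left₀ (hf.cutDensity_nonneg _) (hfF _) 2) this
      (integral_nonneg fun x => sq_nonneg _) (by positivity)
  · simp only [cutDensity_of_notMem hs, zero_mul]
    simp only [ne_eq, OfNat.ofNat_ne_zero, not_false_eq_true, zero_pow, integral_zero]
    positivity

theorem abs_cutDensity_sub_le {C : ℝ}
    (hC : ∀ a, |cutDensity f (t + a) - cutDensity f t| ≤ C * |a|) (a : ℝ) :
    |cutDensity f (t + a) - cutDensity f (t - a)| ≤ 2 * C * |a| := by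
  have h1 := hC a
  have h2 := hC (-a)
  rw [abs_neg, ← sub_eq_add_neg] at h2
  have := abs_sub_le (cutDensity f (t + a)) (cutDensity f t) (cutDensity f (t - a))
  rw [abs_sub_comm (cutDensity f t)] at this
  linarith

/-- `E {f Φ̃(t + a) + f Φ̃(t - a)}² ≤ C a⁴`, where `Φ̃ = Φ - Φ(t)`. -/
theorem exists_symm_sq_le (hX : ProcessCond Q X) (hf : DensityCond f) (ht : t ∈ Ioo (0 : ℝ) 1) :
    ∃ C : ℝ, 0 ≤ C ∧ ∀ a, ∫ x, (cutDensity f (t + a) * (fluct Q X (t + a) x - fluct Q X t x)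
      + cutDensity f (t - a) * (fluct Q X (t - a) x - fluct Q X t x)) ^ 2 ∂Q ≤ C * a ^ 4 := by
  obtain ⟨Cp, hCp, hp⟩ := hf.exists_lipschitz_at ht
  obtain ⟨F, hF, hfF⟩ := hf.exists_bound
  obtain ⟨V, hV0, hV⟩ := hX.exists_moment_bound
  have hO1 := hX.isBigO_fluct_second_difference ht
  obtain ⟨C1, hC1⟩ := hO1.bound
  obtain ⟨C2, hC20, hC2⟩ := hX.exists_fluct_sub_sq_le ht
  have hO : (fun a => ∫ x, (cutDensity f (t + a) * (fluct Q X (t + a) x - fluct Q X t x)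
      + cutDensity f (t - a) * (fluct Q X (t - a) x - fluct Q X t x)) ^ 2 ∂Q)
      =O[𝓝 0] fun a => a ^ 4 := by
    refine IsBigO.of_bound (2 * F ^ 2 * C1 + 2 * Cp ^ 2 * (4 * C2)) ?_
    filter_upwards [eventually_mem ht, hC1] with a ha h1
    rw [Real.norm_eq_abs, Real.norm_eq_abs, abs_of_nonneg (integral_nonneg fun x => sq_nonneg _),
      abs_of_nonneg (by positivity)] at h1 ⊢
    have hA := hX.memLp_fluct_sub ht ha.1
    have hB := hX.memLp_fluct_sub ht ha.2
    set p := cutDensity f (t + a)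
    set q := cutDensity f (t - a)
    -- With increments `A`, `B` at `t ± a` and density values `p`, `q`, the sum `pA + qB` is
    -- `(p+q)(A+B)/2 + (p-q)(A-B)/2`. The first part contains a second difference. In the second,
    -- the increment of the density and that of the process give one factor `|a|` each, the latter
    -- in mean square.
    have e := integral_add_sq_le ((hA.add hB).const_mul (1 / 2 * (p + q)))
      ((hA.sub hB).const_mul (1 / 2 * (p - q)))
    simp only [Pi.add_apply, Pi.sub_apply, mul_pow _ _ 2] at e
    rw [integral_const_mul, integral_const_mul] at e
    have e2 := integral_add_sq_le hA hB.neg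
    simp only [Pi.neg_apply, ← sub_eq_add_neg, neg_sq] at e2
    have e3 := hC2 _ ha.1
    have e4 := hC2 _ ha.2
    have hpq : (1 / 2 * (p + q)) ^ 2 ≤ F ^ 2 := by
      refine pow_le_pow_left₀ ?_ ?_ 2
      · have := hf.cutDensity_nonneg (t + a)
        have := hf.cutDensity_nonneg (t - a)
        positivity
      · linarith [hfF (t + a), hfF (t - a)]
    have hpq' : (1 / 2 * (p - q)) ^ 2 ≤ Cp ^ 2 * a ^ 2 := by
      have h2 := abs_cutDensity_sub_le hp a
      rw [← mul_pow, sq_le_sq, abs_mul, abs_mul, abs_of_pos hCp, abs_of_pos one_half_pos]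
      linarith
    have hd : ∫ x, (fluct Q X (t + a) x - fluct Q X t x - (fluct Q X (t - a) x - fluct Q X t x)) ^ 2
        ∂Q ≤ 4 * C2 * a ^ 2 := by
      refine e2.trans ?_
      rw [add_sub_cancel_left] at e3
      rw [show t - a - t = -a by ring, neg_sq] at e4
      linarith
    have m1 := mul_le_mul hpq h1 (integral_nonneg fun x => sq_nonneg _) (by positivity)
    have m2 := mul_le_mul hpq' hd (integral_nonneg fun x => sq_nonneg _) (by positivity)
    calc _ = ∫ x, (1 / 2 * (p + q) * (fluct Q X (t + a) x - fluct Q X t x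
            + (fluct Q X (t - a) x - fluct Q X t x))
          + 1 / 2 * (p - q) * (fluct Q X (t + a) x - fluct Q X t x
            - (fluct Q X (t - a) x - fluct Q X t x))) ^ 2 ∂Q :=
          integral_congr_ae (Eventually.of_forall fun x => by simp only; ring)
      _ ≤ _ := e.trans (by nlinarith)
  obtain ⟨C, hC, hb⟩ := exists_global_bound (V := 2 * (F ^ 2 * (4 * V)) + 2 * (F ^ 2 * (4 * V)))
    hO (fun a => by
      rw [abs_of_nonneg (integral_nonneg fun x => sq_nonneg _)]
      have hbd : ∀ s, ∫ x, (cutDensity f s * (fluct Q X s x - fluct Q X t x)) ^ 2 ∂Q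
          ≤ F ^ 2 * (4 * V) := by
        intro s
        by_cases h : s ∈ Ioo (0 : ℝ) 1
        · simp only [mul_pow]
          rw [integral_const_mul]
          refine mul_le_mul (pow_le_pow_left₀ (hf.cutDensity_nonneg _) (hfF _) 2) ?_
            (integral_nonneg fun x => sq_nonneg _) (by positivity)
          have := integral_add_sq_le (hX.memLp_two_fluct (Ioo_subset_Icc_self h))
            (hX.memLp_two_fluct (Ioo_subset_Icc_self ht)).neg
          simp only [Pi.neg_apply, ← sub_eq_add_neg, neg_sq] at this
          linarith [hV _ (Ioo_subset_Icc_self h), hV _ (Ioo_subset_Icc_self ht)]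
        · simp only [cutDensity_of_notMem h, zero_mul]
          simp only [ne_eq, OfNat.ofNat_ne_zero, not_false_eq_true, zero_pow, integral_zero]
          positivity
      refine (integral_add_sq_le (hX.memLp_cut ht _) (hX.memLp_cut ht _)).trans ?_
      linarith [hbd (t + a), hbd (t - a)])
  refine ⟨C, hC, fun a => ?_⟩
  have := (le_abs_self _).trans (hb a)
  rwa [show |a| ^ 4 = a ^ 4 by rw [← abs_pow]; exact abs_of_nonneg (by positivity)] at this

theorem memLp_cut_fluct (hX : ProcessCond Q X) (s : ℝ) :
    MemLp (fun x => cutDensity f s * fluct Q X s x) 2 Q := by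
  by_cases h : s ∈ Ioo (0 : ℝ) 1
  · exact (hX.memLp_two_fluct (Ioo_subset_Icc_self h)).const_mul _
  · simp [cutDensity_of_notMem h]

/-- `E {a f Φ(t + a) - a f Φ(t - a)}² ≤ C a⁴`. -/
theorem exists_antisymm_sq_le (hX : ProcessCond Q X) (hf : DensityCond f)
    (ht : t ∈ Ioo (0 : ℝ) 1) :
    ∃ C : ℝ, 0 ≤ C ∧ ∀ a, ∫ x, (a * (cutDensity f (t + a) * fluct Q X (t + a) x)
      + -a * (cutDensity f (t - a) * fluct Q X (t - a) x)) ^ 2 ∂Q ≤ C * a ^ 4 := by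
  obtain ⟨Cp, hCp, hp⟩ := hf.exists_lipschitz_at ht
  obtain ⟨V, hV0, hV⟩ := hX.exists_moment_bound
  obtain ⟨C, hC0, hC⟩ := hX.exists_cut_sq_le hf ht
  refine ⟨8 * C + 8 * Cp ^ 2 * V, by positivity, fun a => ?_⟩
  have hA := hX.memLp_cut (f := f) ht (t + a)
  have hB := hX.memLp_cut (f := f) ht (t - a)
  have hT := hX.memLp_two_fluct (Ioo_subset_Icc_self ht)
  have h1 := hC a
  have h2 := hC (-a)
  rw [← sub_eq_add_neg, neg_sq] at h2
  have h3 := hV _ (Ioo_subset_Icc_self ht)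
  have h4 := abs_cutDensity_sub_le hp a
  set p := cutDensity f (t + a)
  set q := cutDensity f (t - a)
  have e1 := integral_add_sq_le hA hB.neg
  have e2 := integral_add_sq_le (hA.sub hB) (hT.const_mul (p - q))
  simp only [Pi.neg_apply, Pi.sub_apply, ← sub_eq_add_neg, neg_sq] at e1 e2
  simp only [mul_pow (p - q)] at e2
  rw [integral_const_mul] at e2
  have h5 : (p - q) ^ 2 ≤ 4 * Cp ^ 2 * a ^ 2 := by
    rw [show 4 * Cp ^ 2 * a ^ 2 = (2 * Cp * a) ^ 2 by ring, sq_le_sq, abs_mul (2 * Cp),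
      abs_of_pos (by positivity : 0 < 2 * Cp)]
    exact h4
  have h6 := mul_le_mul h5 h3 (integral_nonneg fun x => sq_nonneg _) (by positivity)
  -- Centring at `Φ(t)` leaves increments of `Φ` and the term `(p - q) Φ(t)`. Each has mean square
  -- of order `a ^ 2`, and the prefactor supplies the other `a ^ 2`.
  calc _ = ∫ x, a ^ 2 * (p * (fluct Q X (t + a) x - fluct Q X t x)
        - q * (fluct Q X (t - a) x - fluct Q X t x) + (p - q) * fluct Q X t x) ^ 2 ∂Q :=
        integral_congr_ae (Eventually.of_forall fun x => by simp only; ring)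
    _ = a ^ 2 * ∫ x, (p * (fluct Q X (t + a) x - fluct Q X t x)
        - q * (fluct Q X (t - a) x - fluct Q X t x) + (p - q) * fluct Q X t x) ^ 2 ∂Q :=
        integral_const_mul _ _
    _ ≤ a ^ 2 * ((8 * C + 8 * Cp ^ 2 * V) * a ^ 2) := by
        refine mul_le_mul_of_nonneg_left ?_ (sq_nonneg a)
        linarith
    _ = _ := by ring

end ProcessCond

/-! ### Symmetric averages -/

/-- Averages over a symmetric law of a process whose symmetrization is small in `L²`. -/
theorem integral_sq_symm_average_le {ρ : Measure ℝ} [IsProbabilityMeasure ρ]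
    (hρ : ρ.map (fun a => -a) = ρ) {H : ℝ → E → ℝ} (hH : Measurable (Function.uncurry H))
    (hL : ∀ a, MemLp (fun x => H a x + H (-a) x) 2 Q) {M b : ℝ} (hM0 : 0 ≤ M)
    (hb : ∀ᵐ a ∂ρ, |a| ≤ b) (hM : ∀ a, ∫ x, (H a x + H (-a) x) ^ 2 ∂Q ≤ M * a ^ 4) :
    ∫ x, (∫ a, H a x ∂ρ) ^ 2 ∂Q ≤ M * b ^ 4 := by
  have hHs : ∀ x, Measurable fun a => H a x := fun x => hH.comp measurable_prodMk_right
  have hg : Measurable (Function.uncurry fun x a => ‖H a x + H (-a) x‖ₑ ^ 2) := by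
    have h1 : Measurable fun z : E × ℝ => H z.2 z.1 := hH.comp measurable_swap
    have h2 : Measurable fun z : E × ℝ => H (-z.2) z.1 :=
      hH.comp (measurable_snd.neg.prodMk measurable_fst)
    exact (h1.add h2).enorm.pow_const 2
  -- By symmetry of `ρ`, twice the average of `H` is the average of its symmetrization. A section
  -- that is not integrable has integral zero by convention, so the bound holds for it too.
  have h1 : ∀ x, ‖∫ a, H a x ∂ρ‖ₑ ≤ ∫⁻ a, ‖H a x + H (-a) x‖ₑ ∂ρ := by
    intro x
    by_cases hi : Integrable (fun a => H a x) ρ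
    · have hmap : ∫ a, H (-a) x ∂ρ = ∫ a, H a x ∂ρ := by
        conv_rhs => rw [← hρ, integral_map measurable_neg.aemeasurable
          (hHs x).aestronglyMeasurable]
      have hi' : Integrable (fun a => H (-a) x) ρ := by
        have : Integrable (fun a => H a x) (ρ.map fun a => -a) := by rwa [hρ]
        exact this.comp_measurable measurable_neg
      have h2 : ∫ a, (H a x + H (-a) x) ∂ρ = 2 * ∫ a, H a x ∂ρ := by
        rw [integral_add hi hi', hmap, two_mul]
      refine le_trans ?_ (enorm_integral_le_lintegral_enorm _)
      rw [h2, enorm_mul]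
      refine le_mul_of_one_le_left zero_le ?_
      rw [Real.enorm_eq_ofReal (by norm_num)]
      exact ENNReal.one_le_ofReal.2 (by norm_num)
    · rw [integral_undef hi, enorm_zero]
      exact zero_le
  have h2 : ∀ x, (∫⁻ a, ‖H a x + H (-a) x‖ₑ ∂ρ) ^ 2 ≤ ∫⁻ a, ‖H a x + H (-a) x‖ₑ ^ 2 ∂ρ := by
    intro x
    have hm : Measurable fun a => ‖H a x + H (-a) x‖ₑ :=
      ((hHs x).add ((hHs x).comp measurable_neg)).enorm
    have := ENNReal.lintegral_mul_le_Lp_mul_Lq ρ Real.HolderConjugate.two_two hm.aemeasurable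
      (g := fun _ => 1) aemeasurable_const
    simp only [Pi.mul_apply, mul_one, lintegral_const, measure_univ, ENNReal.rpow_two, one_pow,
      ENNReal.one_rpow] at this
    refine (pow_le_pow_left₀ zero_le this 2).trans (le_of_eq ?_)
    rw [← ENNReal.rpow_natCast, ← ENNReal.rpow_mul]
    norm_num
  have hsq : ∀ y : ℝ, ‖y‖ₑ ^ 2 = ENNReal.ofReal (y ^ 2) := fun y => by
    rw [← ofReal_norm, ← ENNReal.ofReal_pow (norm_nonneg _), Real.norm_eq_abs, sq_abs]
  have h3 : ∫⁻ x, ‖∫ a, H a x ∂ρ‖ₑ ^ 2 ∂Q ≤ ENNReal.ofReal (M * b ^ 4) := by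
    calc _ ≤ ∫⁻ x, ∫⁻ a, ‖H a x + H (-a) x‖ₑ ^ 2 ∂ρ ∂Q :=
          lintegral_mono fun x => (pow_le_pow_left₀ zero_le (h1 x) 2).trans (h2 x)
      _ = ∫⁻ a, ∫⁻ x, ‖H a x + H (-a) x‖ₑ ^ 2 ∂Q ∂ρ := lintegral_lintegral_swap hg.aemeasurable
      _ ≤ ∫⁻ _, ENNReal.ofReal (M * b ^ 4) ∂ρ := by
          refine lintegral_mono_ae ?_
          filter_upwards [hb] with a ha
          simp only [hsq]
          rw [← ofReal_integral_eq_lintegral_ofReal (hL a).integrable_sq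
            (Eventually.of_forall fun x => sq_nonneg _)]
          refine ENNReal.ofReal_le_ofReal ((hM a).trans (mul_le_mul_of_nonneg_left ?_ hM0))
          rw [← Even.pow_abs (by decide : Even 4) a]
          exact pow_le_pow_left₀ (abs_nonneg a) ha 4
      _ = _ := by simp
  have hmeas : Measurable fun x => ∫ a, H a x ∂ρ :=
    (StronglyMeasurable.integral_prod_left (μ := ρ) hH.stronglyMeasurable).measurable
  rw [integral_eq_lintegral_of_nonneg_ae (Eventually.of_forall fun x => sq_nonneg _)
    (hmeas.pow_const 2).aestronglyMeasurable]
  simp only [hsq] at h3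
  exact ENNReal.toReal_le_of_le_ofReal (by positivity) h3

end Fluct

end

section

/-! ### Kernel integrals -/

section KernelIntegrals

variable {f W : ℝ → ℝ} {t : ℝ} [IsProbabilityMeasure (timeLaw f)]

theorem measurable_kernel (hW : KernelCond W) (b t : ℝ) :
    Measurable fun s => scaledKernel W b (s - t) :=
  (hW.measurable_scaledKernel b).comp (measurable_id.sub_const t)

theorem memLp_kernel_mul (hW : KernelCond W) {φ : ℝ → ℝ} (hφ : Measurable φ) {M : ℝ}
    (hM : ∀ s ∈ Ioo (0 : ℝ) 1, |φ s| ≤ M) {b : ℝ} (hb : 0 < b) (t : ℝ) (q : ENNReal) :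
    MemLp (fun s => scaledKernel W b (s - t) * φ s) q (timeLaw f) := by
  obtain ⟨B, hB, hWB⟩ := hW.exists_bound
  refine MemLp.of_bound ((measurable_kernel hW b t).mul hφ).aestronglyMeasurable (B / b * M) ?_
  filter_upwards [DensityCond.ae_mem_timeLaw] with s hs
  rw [norm_mul, Real.norm_eq_abs, Real.norm_eq_abs, abs_of_nonneg (hW.scaledKernel_nonneg hb _)]
  exact mul_le_mul (div_le_div_of_nonneg_right (hWB _) hb.le) (hM s hs) (abs_nonneg _)
    (by positivity)

theorem memLp_kernel (hW : KernelCond W) {b : ℝ} (hb : 0 < b) (t : ℝ) (q : ENNReal) :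
    MemLp (fun s => scaledKernel W b (s - t)) q (timeLaw f) := by
  simpa using memLp_kernel_mul hW (φ := fun _ => 1) measurable_const (M := 1) (by simp) hb t q

theorem abs_sub_le_one {s t : ℝ} (hs : s ∈ Ioo (0 : ℝ) 1) (ht : t ∈ Ioo (0 : ℝ) 1) :
    |s - t| ≤ 1 := abs_le.2 ⟨by linarith [hs.1, ht.2], by linarith [hs.2, ht.1]⟩

/-- `∫ W_b(s - t)^p |φ(s)| ≤ C b^{q + 1 - p}` for functions `φ` with `|φ(s)| ≤ M |s - t|^q`. -/
theorem exists_integral_kernel_le (hW : KernelCond W) (hf : DensityCond f) {φ : ℝ → ℝ} {M : ℝ}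
    {q : ℕ} (hM0 : 0 ≤ M) (hM : ∀ s ∈ Ioo (0 : ℝ) 1, |φ s| ≤ M * |s - t| ^ q) {p : ℕ}
    (hp : 1 ≤ p) : ∃ C : ℝ, 0 ≤ C ∧ ∀ b : ℝ, 0 < b →
      |∫ s, scaledKernel W b (s - t) ^ p * φ s ∂(timeLaw f)| ≤ C * b ^ ((q : ℤ) + 1 - p) := by
  obtain ⟨B, hB, hWB⟩ := hW.exists_bound
  obtain ⟨F, hF, hfF⟩ := hf.exists_bound
  refine ⟨2 * F * (B ^ p * M), by positivity, fun b hb => ?_⟩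
  have h := DensityCond.integral_timeLaw_le (f := f) hF.le hfF (t := t)
    (g := fun s => scaledKernel W b (s - t) ^ p * φ s) hb.le
    (A := (B / b) ^ p * (M * b ^ q)) (by positivity) ?_ ?_
  · refine h.trans (le_of_eq ?_)
    rw [zpow_sub₀ hb.ne', zpow_add₀ hb.ne', zpow_natCast, zpow_natCast, zpow_one, div_pow]
    field_simp
  · intro s hs
    rcases le_or_gt |s - t| b with h | h
    · rw [abs_mul, abs_pow, abs_of_nonneg (hW.scaledKernel_nonneg hb _)]
      refine mul_le_mul (pow_le_pow_left₀ (hW.scaledKernel_nonneg hb _)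
        (div_le_div_of_nonneg_right (hWB _) hb.le) p) ((hM s hs).trans ?_) (abs_nonneg _)
        (by positivity)
      exact mul_le_mul_of_nonneg_left (pow_le_pow_left₀ (abs_nonneg _) h q) hM0
    · rw [hW.scaledKernel_eq_zero hb h, zero_pow (by omega), zero_mul, abs_zero]
      positivity
  · intro s hs
    rw [hW.scaledKernel_eq_zero hb hs, zero_pow (by omega), zero_mul]

theorem tendsto_integral_timeLaw (hf : DensityCond f) (ht : t ∈ Ioo (0 : ℝ) 1) {V φ : ℝ → ℝ}
    {B M φ₀ : ℝ} (hV : Measurable V) (hVB : ∀ u, |V u| ≤ B) (hsupp : ∀ u, 1 < |u| → V u = 0)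
    (hφ : Measurable φ) (hφM : ∀ s ∈ Ioo (0 : ℝ) 1, |φ s| ≤ M)
    (hlim : Tendsto φ (𝓝[≠] t) (𝓝 φ₀)) :
    Tendsto (fun b => (∫ s, φ s * V ((s - t) / b) ∂(timeLaw f)) / b) (𝓝[>] 0)
      (𝓝 (φ₀ * f t * ∫ u, V u)) := by
  obtain ⟨F, hF, hfF⟩ := hf.exists_bound
  have hM0 : 0 ≤ M := (abs_nonneg _).trans (hφM t ht)
  have h := tendsto_integral_scaled hV hVB hsupp
    (G := fun s => φ s * cutDensity f s) (t := t) (M := M * F) (hφ.mul hf.measurable_cutDensity)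
    (fun s => ?_)
    (hlim.mul ((hf.tendsto_cutDensity ht).mono_left nhdsWithin_le_nhds))
  · refine h.congr fun b => ?_
    rw [hf.integral_timeLaw_shift t]
    congr 1
    refine integral_congr_ae (Eventually.of_forall fun a => ?_)
    simp only [add_sub_cancel_left]
    ring
  · by_cases hs : s ∈ Ioo (0 : ℝ) 1
    · rw [abs_mul, abs_of_nonneg (hf.cutDensity_nonneg s)]
      exact mul_le_mul (hφM s hs) (hfF s) (hf.cutDensity_nonneg s) hM0
    · rw [cutDensity_of_notMem hs, mul_zero, abs_zero]
      positivity

theorem KernelCond.abs_le (hW : KernelCond W) {B : ℝ} (hB : ∀ u, W u ≤ B) (u : ℝ) : |W u| ≤ B := by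
  rw [abs_of_nonneg (hW.nonneg u)]
  exact hB u

theorem tendsto_integral_kernel (hW : KernelCond W) (hf : DensityCond f)
    (ht : t ∈ Ioo (0 : ℝ) 1) :
    Tendsto (fun b => ∫ s, scaledKernel W b (s - t) ∂(timeLaw f)) (𝓝[>] 0) (𝓝 (f t)) := by
  obtain ⟨B, hB, hWB⟩ := hW.exists_bound
  have h := tendsto_integral_timeLaw hf ht (V := W) (φ := fun _ => 1) (M := 1) (φ₀ := 1)
    hW.measurable (hW.abs_le hWB) hW.support measurable_const (by simp) tendsto_const_nhds
  rw [hW.integral_eq_one, one_mul, mul_one] at h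
  refine h.congr fun b => ?_
  rw [← integral_div]
  simp [scaledKernel]

theorem tendsto_integral_kernel_sq (hW : KernelCond W) (hf : DensityCond f)
    (ht : t ∈ Ioo (0 : ℝ) 1) :
    Tendsto (fun b => (∫ s, scaledKernel W b (s - t) ^ 2 ∂(timeLaw f)) / b ^ (-1 : ℤ)) (𝓝[>] 0)
      (𝓝 (f t * kernelR W)) := by
  obtain ⟨B, hB, hWB⟩ := hW.exists_bound
  have h := tendsto_integral_timeLaw hf ht (V := fun u => W u ^ 2) (φ := fun _ => 1) (M := 1)
    (φ₀ := 1) (B := B ^ 2) (hW.measurable.pow_const 2)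
    (fun u => by
      rw [abs_pow]
      exact pow_le_pow_left₀ (abs_nonneg _) (hW.abs_le hWB u) 2)
    (fun u hu => by rw [hW.support u hu, zero_pow two_ne_zero]) measurable_const (by simp)
    tendsto_const_nhds
  rw [one_mul] at h
  refine h.congr' (eventually_nhdsWithin_of_forall fun b hb => ?_)
  have hb' : b ≠ 0 := (mem_Ioi.1 hb).ne'
  simp only [scaledKernel, div_pow, one_mul]
  rw [integral_div, zpow_neg_one]
  field_simp

/-- Second moments of the kernel against a function with a second-order zero. -/
theorem tendsto_integral_kernel_mul (hW : KernelCond W) (hf : DensityCond f)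
    (ht : t ∈ Ioo (0 : ℝ) 1) {φ : ℝ → ℝ} {M φ₀ : ℝ} (hφ : Measurable φ)
    (hM : ∀ s ∈ Ioo (0 : ℝ) 1, |φ s| ≤ M * (s - t) ^ 2)
    (hlim : Tendsto (fun s => φ s / (s - t) ^ 2) (𝓝[≠] t) (𝓝 φ₀)) :
    Tendsto (fun b => (∫ s, scaledKernel W b (s - t) * φ s ∂(timeLaw f)) / b ^ (2 : ℤ)) (𝓝[>] 0)
      (𝓝 (φ₀ * f t * kernelAlpha W)) := by
  obtain ⟨B, hB, hWB⟩ := hW.exists_bound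
  have h0 : φ t = 0 := by simpa using hM t ht
  have hbd : ∀ s ∈ Ioo (0 : ℝ) 1, |φ s / (s - t) ^ 2| ≤ |M| := by
    intro s hs
    rcases eq_or_ne s t with rfl | hne
    · simp
    · have : 0 < (s - t) ^ 2 := by have := sub_ne_zero.2 hne; positivity
      rw [abs_div, abs_of_pos this, div_le_iff₀ this]
      exact (hM s hs).trans (mul_le_mul_of_nonneg_right (le_abs_self M) this.le)
  have h := tendsto_integral_timeLaw hf ht (V := fun u => u ^ 2 * W u)
    (φ := fun s => φ s / (s - t) ^ 2) (M := |M|) (B := B)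
    ((measurable_id.pow_const 2).mul hW.measurable)
    (fun u => ?_)
    (fun u hu => by rw [hW.support u hu, mul_zero]) (by fun_prop) hbd hlim
  · refine h.congr' (eventually_nhdsWithin_of_forall fun b hb => ?_)
    have hb' : b ≠ 0 := (mem_Ioi.1 hb).ne'
    beta_reduce
    rw [← integral_div, ← integral_div]
    refine integral_congr_ae (Eventually.of_forall fun s => ?_)
    simp only [scaledKernel]
    rcases eq_or_ne s t with rfl | hne
    · simp [h0]
    · have := sub_ne_zero.2 hne
      rw [show (2 : ℤ) = ((2 : ℕ) : ℤ) from rfl, zpow_natCast]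
      field_simp
  · rcases le_or_gt |u| 1 with hu | hu
    · rw [abs_mul, abs_of_nonneg (sq_nonneg u)]
      have := (sq_le_one_iff_abs_le_one u).2 hu
      exact (mul_le_of_le_one_left (abs_nonneg _) this).trans (hW.abs_le hWB u)
    · rw [hW.support u hu, mul_zero, abs_zero]
      exact hB.le

/-- First moments of the kernel are of order `b²`. -/
theorem exists_integral_kernel_first_le (hW : KernelCond W) (hf : DensityCond f)
    (ht : t ∈ Ioo (0 : ℝ) 1) : ∃ C : ℝ, 0 ≤ C ∧ ∀ b : ℝ, 0 < b →
      |∫ s, scaledKernel W b (s - t) * (s - t) ∂(timeLaw f)| ≤ C * b ^ 2 := by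
  obtain ⟨B, hB, hWB⟩ := hW.exists_bound
  obtain ⟨C, hC, hlip⟩ := hf.exists_lipschitz_at ht
  refine ⟨C, hC.le, fun b hb => ?_⟩
  have hwi : Integrable (scaledKernel W b) := by
    by_contra h
    have := hW.integral_scaledKernel hb
    rw [integral_undef h] at this
    exact zero_ne_one this
  have hm := hW.measurable_scaledKernel b
  have hwa : Integrable fun a => scaledKernel W b a * a := by
    refine (hwi.const_mul b).mono (hm.mul measurable_id).aestronglyMeasurable
      (Eventually.of_forall fun a => ?_)
    rw [norm_mul, norm_mul, mul_comm, Real.norm_eq_abs, Real.norm_eq_abs b, abs_of_pos hb]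
    rcases le_or_gt |a| b with h | h
    · exact mul_le_mul_of_nonneg_right h (norm_nonneg _)
    · rw [hW.scaledKernel_eq_zero hb h]
      simp
  -- The even kernel has vanishing first moment, so the density may be replaced by its increment
  -- from `t`. The Lipschitz bound for that increment provides the second power of `b`.
  have hodd : ∫ a, scaledKernel W b a * a = 0 := by
    have := integral_neg_eq_self (fun a => scaledKernel W b a * a) volume
    simp only [hW.scaledKernel_neg, mul_neg, integral_neg] at this
    linarith
  have e : ∫ s, scaledKernel W b (s - t) * (s - t) ∂(timeLaw f)
      = ∫ a, (cutDensity f (t + a) - cutDensity f t) * (scaledKernel W b a * a) := by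
    rw [hf.integral_timeLaw_shift t]
    simp only [add_sub_cancel_left, sub_mul]
    rw [integral_sub _ (hwa.const_mul _), integral_const_mul, hodd, mul_zero, sub_zero]
    obtain ⟨F, hF, hfF⟩ := hf.exists_bound
    refine hwa.bdd_mul (c := F) ?_ (Eventually.of_forall fun a => ?_)
    · exact (hf.measurable_cutDensity.comp (measurable_const.add measurable_id)).aestronglyMeasurable
    · rw [Real.norm_eq_abs, abs_of_nonneg (hf.cutDensity_nonneg _)]
      exact hfF _
  rw [e]
  refine abs_integral_le_integral_abs.trans ?_
  calc _ ≤ ∫ a, C * b ^ 2 * scaledKernel W b a := by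
        refine integral_mono_of_nonneg (Eventually.of_forall fun _ => abs_nonneg _)
          (hwi.const_mul _) (Eventually.of_forall fun a => ?_)
        simp only
        rcases le_or_gt |a| b with h | h
        · rw [abs_mul, abs_mul, abs_of_nonneg (hW.scaledKernel_nonneg hb a)]
          have h1 := hW.scaledKernel_nonneg hb a
          have h2 : |a| * |a| ≤ b ^ 2 := by nlinarith [abs_nonneg a]
          calc _ ≤ C * |a| * (scaledKernel W b a * |a|) := by gcongr; exact hlip a
            _ = C * (|a| * |a|) * scaledKernel W b a := by ring
            _ ≤ _ := by gcongr
        · rw [hW.scaledKernel_eq_zero hb h]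
          simp
    _ = _ := by rw [integral_const_mul, hW.integral_scaledKernel hb, mul_one]

/-- The law with density `W_b`. -/
def kernelLaw (W : ℝ → ℝ) (b : ℝ) : Measure ℝ :=
  volume.withDensity fun a => ENNReal.ofReal (scaledKernel W b a)

theorem isProbabilityMeasure_kernelLaw (hW : KernelCond W) {b : ℝ} (hb : 0 < b) :
    IsProbabilityMeasure (kernelLaw W b) := by
  constructor
  rw [kernelLaw, withDensity_apply _ MeasurableSet.univ, Measure.restrict_univ,
    ← ofReal_integral_eq_lintegral_ofReal _ (Eventually.of_forall (hW.scaledKernel_nonneg hb)),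
    hW.integral_scaledKernel hb, ENNReal.ofReal_one]
  by_contra h
  have := hW.integral_scaledKernel hb
  rw [integral_undef h] at this
  exact zero_ne_one this

theorem map_neg_kernelLaw (hW : KernelCond W) (b : ℝ) :
    (kernelLaw W b).map (fun a => -a) = kernelLaw W b := by
  have hm := (hW.measurable_scaledKernel b).ennreal_ofReal
  refine Measure.ext_of_lintegral _ fun g hg => ?_
  rw [lintegral_map hg measurable_neg, kernelLaw,
    lintegral_withDensity_eq_lintegral_mul _ hm (g := fun a => g (-a)) (hg.comp measurable_neg),
    lintegral_withDensity_eq_lintegral_mul _ hm hg, ← lintegral_neg_eq_self]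
  refine lintegral_congr fun a => ?_
  simp [hW.scaledKernel_neg]

theorem ae_abs_le_kernelLaw (hW : KernelCond W) {b : ℝ} (hb : 0 < b) :
    ∀ᵐ a ∂(kernelLaw W b), |a| ≤ b := by
  rw [kernelLaw, ae_withDensity_iff (hW.measurable_scaledKernel b).ennreal_ofReal]
  refine Eventually.of_forall fun a ha => ?_
  by_contra h
  rw [hW.scaledKernel_eq_zero hb (not_le.1 h), ENNReal.ofReal_zero] at ha
  exact ha rfl

theorem integral_kernel_eq (hW : KernelCond W) (hf : DensityCond f) {b : ℝ} (hb : 0 < b)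
    (g : ℝ → ℝ) : ∫ s, scaledKernel W b (s - t) * g s ∂(timeLaw f)
      = ∫ a, cutDensity f (t + a) * g (t + a) ∂(kernelLaw W b) := by
  rw [hf.integral_timeLaw_shift t, kernelLaw, integral_withDensity_eq_integral_toReal_smul
    (hW.measurable_scaledKernel b).ennreal_ofReal (by simp)]
  refine integral_congr_ae (Eventually.of_forall fun a => ?_)
  simp only [add_sub_cancel_left, smul_eq_mul,
    ENNReal.toReal_ofReal (hW.scaledKernel_nonneg hb a)]
  ring

variable {E : Type*} [MeasurableSpace E] {Q : Measure E} [IsProbabilityMeasure Q] {X : ℝ → E → ℝ}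

/-- `E (∫ W_b(s - t) {Φ(s) - Φ(t)})² ≤ C b⁴`. -/
theorem exists_integral_smooth_sq_le (hW : KernelCond W) (hf : DensityCond f)
    (hX : ProcessCond Q X) (ht : t ∈ Ioo (0 : ℝ) 1) : ∃ C : ℝ, 0 ≤ C ∧ ∀ b : ℝ, 0 < b →
      ∫ x, (∫ s, scaledKernel W b (s - t) * (fluct Q X s x - fluct Q X t x) ∂(timeLaw f)) ^ 2 ∂Q
        ≤ C * b ^ 4 := by
  obtain ⟨C, hC, hsymm⟩ := hX.exists_symm_sq_le hf ht
  refine ⟨C, hC, fun b hb => ?_⟩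
  have := isProbabilityMeasure_kernelLaw hW hb
  simp only [integral_kernel_eq hW hf hb]
  have hm1 : Measurable fun z : ℝ × E => fluct Q X (t + z.1) z.2 :=
    hX.measurable_fluct.comp ((measurable_const.add measurable_fst).prodMk measurable_snd)
  have hm2 : Measurable fun z : ℝ × E => fluct Q X t z.2 :=
    hX.measurable_fluct.comp (measurable_const.prodMk measurable_snd)
  have hm3 : Measurable fun z : ℝ × E => cutDensity f (t + z.1) :=
    hf.measurable_cutDensity.comp (measurable_const.add measurable_fst)
  refine integral_sq_symm_average_le (map_neg_kernelLaw hW b)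
    (H := fun a x => cutDensity f (t + a) * (fluct Q X (t + a) x - fluct Q X t x))
    (hm3.mul (hm1.sub hm2)) (fun a => (hX.memLp_cut ht _).add (hX.memLp_cut ht _)) hC
    (ae_abs_le_kernelLaw hW hb) fun a => ?_
  simpa only [← sub_eq_add_neg] using hsymm a

/-- `E (∫ W_b(s - t) (s - t) Φ(s))² ≤ C b⁴`. -/
theorem exists_integral_slope_sq_le (hW : KernelCond W) (hf : DensityCond f)
    (hX : ProcessCond Q X) (ht : t ∈ Ioo (0 : ℝ) 1) : ∃ C : ℝ, 0 ≤ C ∧ ∀ b : ℝ, 0 < b →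
      ∫ x, (∫ s, scaledKernel W b (s - t) * ((s - t) * fluct Q X s x) ∂(timeLaw f)) ^ 2 ∂Q
        ≤ C * b ^ 4 := by
  obtain ⟨C, hC, hsymm⟩ := hX.exists_antisymm_sq_le hf ht
  refine ⟨C, hC, fun b hb => ?_⟩
  have := isProbabilityMeasure_kernelLaw hW hb
  simp only [integral_kernel_eq hW hf hb, add_sub_cancel_left]
  have hm1 : Measurable fun z : ℝ × E => fluct Q X (t + z.1) z.2 :=
    hX.measurable_fluct.comp ((measurable_const.add measurable_fst).prodMk measurable_snd)
  have hm3 : Measurable fun z : ℝ × E => cutDensity f (t + z.1) :=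
    hf.measurable_cutDensity.comp (measurable_const.add measurable_fst)
  have hL : ∀ a c : ℝ, MemLp (fun x => cutDensity f (t + a) * (c * fluct Q X (t + a) x)) 2 Q := by
    intro a c
    refine ((hX.memLp_cut_fluct (f := f) (t + a)).const_mul c).congr_norm ?_ ?_
    · exact (measurable_const.mul (measurable_const.mul
        (hX.measurable_fluct.comp measurable_prodMk_left))).aestronglyMeasurable
    · exact Eventually.of_forall fun x => by rw [mul_left_comm]
  refine integral_sq_symm_average_le (map_neg_kernelLaw hW b)
    (H := fun a x => cutDensity f (t + a) * (a * fluct Q X (t + a) x))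
    (hm3.mul (measurable_fst.mul hm1)) (fun a => (hL a a).add (hL (-a) (-a))) hC
    (ae_abs_le_kernelLaw hW hb) fun a => ?_
  refine le_trans (le_of_eq (integral_congr_ae (Eventually.of_forall fun x => ?_))) (hsymm a)
  simp only [← sub_eq_add_neg]
  ring

end KernelIntegrals

end

section

/-! ### Centred summands -/

section Noise

variable {ν : Measure ℝ} [IsProbabilityMeasure ν]

theorem NoiseCond.memLp_two (hν : NoiseCond ν) : MemLp (fun e : ℝ => e) 2 ν :=
  hν.moment.mono_exponent (by norm_num)

theorem NoiseCond.integral_sq (hν : NoiseCond ν) : ∫ e, e ^ 2 ∂ν = variance id ν := by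
  have := variance_of_integral_eq_zero (X := id) (μ := ν) aemeasurable_id (by simpa using hν.mean_zero)
  simpa using this.symm

variable {E : Type*} [MeasurableSpace E] {Q : Measure E} [IsProbabilityMeasure Q]

theorem memLp_add_noise (hν : NoiseCond ν) {Ψ : E → ℝ} {q : ENNReal} (hΨ : MemLp Ψ q Q)
    (hq : q ≤ 3) (κ : ℝ) : MemLp (fun y : E × ℝ => Ψ y.1 + κ * y.2) q (Q.prod ν) :=
  (hΨ.comp_fst ν).add ((MemLp.comp_snd (f := id) (hν.moment.mono_exponent hq) Q).const_mul κ)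

/-- The cross term vanishes because the noise is centred and independent of the trajectory. The
factor `κ` is 1 when noise is present and 0 for summands of the trajectory alone. -/
theorem integral_add_noise_sq (hν : NoiseCond ν) {Ψ : E → ℝ} (hΨ : MemLp Ψ 2 Q) (κ : ℝ) :
    ∫ y : E × ℝ, (Ψ y.1 + κ * y.2) ^ 2 ∂(Q.prod ν)
      = ∫ x, Ψ x ^ 2 ∂Q + κ ^ 2 * variance id ν := by
  have h1 : MemLp (fun y : E × ℝ => Ψ y.1) 2 (Q.prod ν) := hΨ.comp_fst ν
  have h2 : MemLp (fun y : E × ℝ => y.2) 2 (Q.prod ν) := hν.memLp_two.comp_snd Q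
  have e : ∀ y : E × ℝ, (Ψ y.1 + κ * y.2) ^ 2
      = Ψ y.1 ^ 2 + 2 * κ * (Ψ y.1 * y.2) + κ ^ 2 * y.2 ^ 2 := fun y => by ring
  have i12 : Integrable (fun y : E × ℝ => Ψ y.1 * y.2) (Q.prod ν) := h1.integrable_mul h2
  simp only [e]
  have i1 : Integrable (fun y : E × ℝ => Ψ y.1 ^ 2 + 2 * κ * (Ψ y.1 * y.2)) (Q.prod ν) :=
    h1.integrable_sq.add (i12.const_mul _)
  rw [integral_add i1 (h2.integrable_sq.const_mul _),
    integral_add h1.integrable_sq (i12.const_mul _), integral_const_mul, integral_const_mul,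
    integral_prod_mul (μ := Q) (ν := ν) Ψ (fun e => e), hν.mean_zero]
  have h3 := integral_fun_fst (μ := Q) (ν := ν) (fun x => Ψ x ^ 2)
  have h4 := integral_fun_snd (μ := Q) (ν := ν) (fun e : ℝ => e ^ 2)
  simp only [probReal_univ, one_smul] at h3 h4
  rw [h3, h4, hν.integral_sq]
  ring

variable {τ : Measure ℝ} [IsProbabilityMeasure τ]

theorem sq_enorm_eq_ofReal (y : ℝ) : ‖y‖ₑ ^ 2 = ENNReal.ofReal (y ^ 2) := by
  rw [← ofReal_norm, ← ENNReal.ofReal_pow (norm_nonneg _), Real.norm_eq_abs, sq_abs]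

/-- Moments of `c(T) {Ψ_T(ζ) + κ ε}`, where the variables `Ψ_s` are centred. -/
theorem centred_summand (hν : NoiseCond ν) {c : ℝ → ℝ} {Ψ : ℝ → E → ℝ} {κ : ℝ} {A : ℝ → ℝ}
    (hc : Measurable c) (hΨ : Measurable (Function.uncurry Ψ))
    (hL : ∀ᵐ s ∂τ, MemLp (Ψ s) 2 Q) (h0 : ∀ᵐ s ∂τ, ∫ x, Ψ s x ∂Q = 0)
    (hA : ∀ᵐ s ∂τ, ∫ x, Ψ s x ^ 2 ∂Q ≤ A s)
    (hi : Integrable (fun s => c s ^ 2 * (A s + κ ^ 2 * variance id ν)) τ) :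
    MemLp (fun z : E × ℝ × ℝ => c z.2.1 * (Ψ z.2.1 z.1 + κ * z.2.2)) 2 (Q.prod (τ.prod ν)) ∧
    ∫ z : E × ℝ × ℝ, c z.2.1 * (Ψ z.2.1 z.1 + κ * z.2.2) ∂(Q.prod (τ.prod ν)) = 0 ∧
    ∫ z : E × ℝ × ℝ, (c z.2.1 * (Ψ z.2.1 z.1 + κ * z.2.2)) ^ 2 ∂(Q.prod (τ.prod ν))
      ≤ ∫ s, c s ^ 2 * (A s + κ ^ 2 * variance id ν) ∂τ ∧
    ∀ᵐ x ∂Q, ∫ u : ℝ × ℝ, c u.1 * (Ψ u.1 x + κ * u.2) ∂(τ.prod ν) = ∫ s, c s * Ψ s x ∂τ := by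
  set g : E × ℝ × ℝ → ℝ := fun z => c z.2.1 * (Ψ z.2.1 z.1 + κ * z.2.2) with hg
  have hgm : Measurable g := by
    have h1 : Measurable fun z : E × ℝ × ℝ => Ψ z.2.1 z.1 :=
      hΨ.comp ((measurable_fst.comp measurable_snd).prodMk measurable_fst)
    fun_prop
  have hlint : ∫⁻ z, ‖g z‖ₑ ^ 2 ∂(Q.prod (τ.prod ν))
      ≤ ENNReal.ofReal (∫ s, c s ^ 2 * (A s + κ ^ 2 * variance id ν) ∂τ) := by
    have hm2 : Measurable fun z => ‖g z‖ₑ ^ 2 := hgm.enorm.pow_const 2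
    have hm3 : Measurable fun u : ℝ × ℝ => ∫⁻ x, ‖g (x, u)‖ₑ ^ 2 ∂Q := hm2.lintegral_prod_left'
    -- Tonelli with the trajectory integrated before the time, since the hypotheses on `Ψ` concern
    -- each time separately. The finite bound then yields square integrability of `g`.
    rw [lintegral_prod_symm' _ hm2, lintegral_prod _ hm3.aemeasurable]
    have hle : ∀ᵐ s ∂τ, ∫⁻ e, ∫⁻ x, ‖g (x, s, e)‖ₑ ^ 2 ∂Q ∂ν
        ≤ ENNReal.ofReal (c s ^ 2 * (A s + κ ^ 2 * variance id ν)) := by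
      filter_upwards [hL, hA] with s hLs hAs
      have hm4 : Measurable fun y : E × ℝ => ‖g (y.1, s, y.2)‖ₑ ^ 2 :=
        hm2.comp (measurable_fst.prodMk (measurable_const.prodMk measurable_snd))
      rw [← lintegral_prod_symm' (μ := Q) (ν := ν) (fun y : E × ℝ => ‖g (y.1, s, y.2)‖ₑ ^ 2) hm4]
      simp only [sq_enorm_eq_ofReal]
      have hLg : MemLp (fun y : E × ℝ => g (y.1, s, y.2)) 2 (Q.prod ν) :=
        (memLp_add_noise hν hLs (by norm_num) κ).const_mul (c s)
      rw [← ofReal_integral_eq_lintegral_ofReal hLg.integrable_sq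
        (Eventually.of_forall fun _ => sq_nonneg _)]
      refine ENNReal.ofReal_le_ofReal ?_
      simp only [hg, mul_pow (c s)]
      rw [integral_const_mul, integral_add_noise_sq hν hLs]
      exact mul_le_mul_of_nonneg_left (by linarith) (sq_nonneg _)
    refine (lintegral_mono_ae hle).trans (le_of_eq ?_)
    rw [ofReal_integral_eq_lintegral_ofReal hi]
    filter_upwards [hA] with s hAs
    have h1 : 0 ≤ ∫ x, Ψ s x ^ 2 ∂Q := integral_nonneg fun _ => sq_nonneg _
    have h2 := variance_nonneg id ν
    have : 0 ≤ A s := h1.trans hAs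
    simp only [Pi.zero_apply]
    positivity
  have hL2 : MemLp g 2 (Q.prod (τ.prod ν)) := by
    refine ⟨hgm.aestronglyMeasurable, ?_⟩
    rw [eLpNorm_lt_top_iff_lintegral_rpow_enorm_lt_top (by norm_num) (by norm_num)]
    simp only [ENNReal.toReal_ofNat, ENNReal.rpow_two]
    exact hlint.trans_lt ENNReal.ofReal_lt_top
  have hgi : Integrable g (Q.prod (τ.prod ν)) := hL2.integrable (by norm_num)
  refine ⟨hL2, ?_, ?_, ?_⟩
  · rw [integral_prod_symm _ hgi]
    have hae : ∀ᵐ u ∂(τ.prod ν), MemLp (Ψ u.1) 2 Q ∧ ∫ x, Ψ u.1 x ∂Q = 0 :=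
      Measure.quasiMeasurePreserving_fst.ae (hL.and h0)
    have e : (fun u : ℝ × ℝ => ∫ x, g (x, u) ∂Q) =ᵐ[τ.prod ν] fun u => c u.1 * (κ * u.2) := by
      filter_upwards [hae] with u hu
      simp only [hg]
      rw [integral_const_mul, integral_add (hu.1.integrable (by norm_num)) (integrable_const _),
        hu.2]
      simp
    rw [integral_congr_ae e, integral_prod_mul (μ := τ) (ν := ν) c fun e => κ * e,
      integral_const_mul, hν.mean_zero]
    simp
  · rw [integral_eq_lintegral_of_nonneg_ae (Eventually.of_forall fun _ => sq_nonneg _)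
      (hgm.pow_const 2).aestronglyMeasurable]
    simp only [sq_enorm_eq_ofReal] at hlint
    refine ENNReal.toReal_le_of_le_ofReal (integral_nonneg_of_ae ?_) hlint
    filter_upwards [hA] with s hAs
    have h1 : 0 ≤ ∫ x, Ψ s x ^ 2 ∂Q := integral_nonneg fun _ => sq_nonneg _
    have h2 := variance_nonneg id ν
    have : 0 ≤ A s := h1.trans hAs
    simp only [Pi.zero_apply]
    positivity
  · filter_upwards [hgi.prod_right_ae] with x hx
    rw [integral_prod _ hx]
    refine integral_congr_ae (Eventually.of_forall fun s => ?_)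
    simp only [hg]
    rw [integral_const_mul, integral_add (integrable_const _)
      ((hν.memLp_two.integrable (by norm_num)).const_mul κ), integral_const_mul, hν.mean_zero]
    simp

theorem integral_separable {a : ℝ → ℝ} {H : E × ℝ → ℝ} (ha : Integrable a τ)
    (hH : Integrable H (Q.prod ν)) :
    ∫ z : E × ℝ × ℝ, a z.2.1 * H (z.1, z.2.2) ∂(Q.prod (τ.prod ν))
      = (∫ s, a s ∂τ) * ∫ y, H y ∂(Q.prod ν) := by
  have hi : Integrable (fun z : E × ℝ × ℝ => a z.2.1 * H (z.1, z.2.2)) (Q.prod (τ.prod ν)) := by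
    have h1 := ha.mul_prod hH
    have h2 : MeasurePreserving (fun z : E × ℝ × ℝ => (z.2.1, (z.1, z.2.2)))
        (Q.prod (τ.prod ν)) (τ.prod (Q.prod ν)) := by
      have m1 : MeasurePreserving (MeasurableEquiv.prodAssoc (α := E) (β := ℝ) (γ := ℝ)).symm
          (Q.prod (τ.prod ν)) ((Q.prod τ).prod ν) :=
        (measurePreserving_prodAssoc Q τ ν).symm
      have m2 : MeasurePreserving (Prod.map (Prod.swap : E × ℝ → ℝ × E) (id : ℝ → ℝ))
          ((Q.prod τ).prod ν) ((τ.prod Q).prod ν) :=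
        Measure.measurePreserving_swap.prod (MeasurePreserving.id ν)
      have m3 : MeasurePreserving (MeasurableEquiv.prodAssoc (α := ℝ) (β := E) (γ := ℝ))
          ((τ.prod Q).prod ν) (τ.prod (Q.prod ν)) := measurePreserving_prodAssoc τ Q ν
      exact m3.comp (m2.comp m1)
    exact h2.integrable_comp_of_integrable h1
  rw [integral_prod _ hi]
  have e : ∀ x, ∫ u : ℝ × ℝ, a u.1 * H (x, u.2) ∂(τ.prod ν)
      = (∫ s, a s ∂τ) * ∫ e, H (x, e) ∂ν := fun x =>
    integral_prod_mul (μ := τ) (ν := ν) a fun e => H (x, e)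
  simp only [e]
  rw [integral_const_mul, integral_prod _ hH]

end Noise

end

section

variable {Ω E : Type*} [MeasurableSpace Ω] [MeasurableSpace E]
  {P : Measure Ω} [IsProbabilityMeasure P] {Q : Measure E} [IsProbabilityMeasure Q]
  {ν : Measure ℝ} [IsProbabilityMeasure ν]
  {n : ℕ → ℕ} {m : ℕ → ℕ → ℕ} {X : ℝ → E → ℝ} {f W : ℝ → ℝ}
  {ζ : ℕ → ℕ → Ω → E} {T ε : ℕ → ℕ → ℕ → Ω → ℝ} {t : ℝ} {b : ℕ → ℕ → ℝ} {c C : ℝ}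

/-! ### Algebra of the estimate -/

/-- `∑_{k,i,j} W_{b_k}(T_{kij} - t) φ(ζ_{ki}, T_{kij}, ε_{kij})`. -/
def kernelSum (n : ℕ → ℕ) (m : ℕ → ℕ → ℕ) (ζ : ℕ → ℕ → Ω → E) (T ε : ℕ → ℕ → ℕ → Ω → ℝ)
    (W : ℝ → ℝ) (t : ℝ) (b : ℕ → ℕ → ℝ) (φ : E × ℝ × ℝ → ℝ) (K : ℕ) (ω : Ω) : ℝ :=
  tripleSum n m ζ T ε (fun k z => scaledKernel W (b K k) (z.2.1 - t) * φ z) K ω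

theorem kernelSum_add (φ ψ : E × ℝ × ℝ → ℝ) (K : ℕ) (ω : Ω) :
    kernelSum n m ζ T ε W t b (fun z => φ z + ψ z) K ω
      = kernelSum n m ζ T ε W t b φ K ω + kernelSum n m ζ T ε W t b ψ K ω := by
  simp only [kernelSum, mul_add, tripleSum_add]

theorem kernelSum_const_mul (a : ℝ) (φ : E × ℝ × ℝ → ℝ) (K : ℕ) (ω : Ω) :
    kernelSum n m ζ T ε W t b (fun z => a * φ z) K ω
      = a * kernelSum n m ζ T ε W t b φ K ω := by
  rw [kernelSum, kernelSum, ← tripleSum_const_mul]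
  congr 1
  ext k z
  ring

theorem kernelSum_congr {φ ψ : E × ℝ × ℝ → ℝ} (h : ∀ z, φ z = ψ z) (K : ℕ) (ω : Ω) :
    kernelSum n m ζ T ε W t b φ K ω = kernelSum n m ζ T ε W t b ψ K ω := by
  rw [show φ = ψ from funext h]

/-- The remainder `μ(s) - μ(t) - μ'(t) (s - t)`. -/
def meanRemainder (Q : Measure E) (X : ℝ → E → ℝ) (t s : ℝ) : ℝ :=
  meanFn Q X s - meanFn Q X t - deriv (meanFn Q X) t * (s - t)

/-- The local-linear estimate in terms of kernel sums. -/
theorem onlineMean_eq {L : ℕ} [NeZero L] (η : ℕ → Fin L → ℝ) (J : ℕ → Fin L → Fin L) (K : ℕ)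
    (ω : Ω) {s : (E × ℝ × ℝ → ℝ) → ℝ}
    (hs : s = fun φ => kernelSum n m ζ T ε W t (fun K k => chainBandwidth η J K 0 k) φ K ω) :
    onlineMean n m W T (observation X ζ T ε) η J t K ω
      = (s (fun z => (z.2.1 - t) ^ 2) * s (fun z => X z.2.1 z.1 + z.2.2)
        - s (fun z => z.2.1 - t) * s (fun z => (z.2.1 - t) * (X z.2.1 z.1 + z.2.2)))
        / (s (fun _ => 1) * s (fun z => (z.2.1 - t) ^ 2) - s (fun z => z.2.1 - t) ^ 2) := by
  have hP : onlineP n m W T η J t K 0 ω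
      = !![s (fun _ => 1), s (fun z => z.2.1 - t);
          s (fun z => z.2.1 - t), s (fun z => (z.2.1 - t) ^ 2)] := by
    rw [onlineP_eq_sum, hs]
    ext i j
    simp only [blockP, kernelSum, tripleSum, subjectSum, Matrix.sum_apply, Matrix.smul_apply,
      Matrix.vecMulVec_apply, designVec, smul_eq_mul]
    fin_cases i <;> fin_cases j <;> simp [sq]
  have hQ : onlineQ n m W T (observation X ζ T ε) η J t K 0 ω
      = ![s (fun z => X z.2.1 z.1 + z.2.2), s (fun z => (z.2.1 - t) * (X z.2.1 z.1 + z.2.2))] := by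
    rw [onlineQ_eq_sum, hs]
    ext i
    simp only [blockQ, kernelSum, tripleSum, subjectSum, Finset.sum_apply, Pi.smul_apply,
      designVec, smul_eq_mul, observation]
    fin_cases i
    · simp
    · simp only [Fin.mk_one, Matrix.cons_val_one, Matrix.cons_val_fin_one]
      exact Finset.sum_congr rfl fun k _ => Finset.sum_congr rfl fun i _ =>
        Finset.sum_congr rfl fun j _ => by ring
  -- No invertibility is needed: for zero determinant both the inverse matrix and the quotient are
  -- zero by convention.
  rw [onlineMean, hP, hQ, Matrix.inv_def, Matrix.det_fin_two_of, Matrix.adjugate_fin_two_of,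
    Ring.inverse_eq_inv']
  rw [Matrix.smul_mulVec, Pi.smul_apply, smul_eq_mul]
  simp only [Matrix.mulVec, dotProduct, Fin.sum_univ_two, Matrix.of_apply, Matrix.cons_val_zero,
    Matrix.cons_val_one, Matrix.cons_val_fin_one, Matrix.cons_val']
  rw [← sq, inv_mul_eq_div]
  congr 1
  ring

/-- The error of the local-linear estimate in terms of kernel sums. -/
theorem estimate_sub_mean {L : ℕ} [NeZero L] (η : ℕ → Fin L → ℝ) (J : ℕ → Fin L → Fin L) (K : ℕ)
    (ω : Ω) {s : (E × ℝ × ℝ → ℝ) → ℝ}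
    (hs : s = fun φ => kernelSum n m ζ T ε W t (fun K k => chainBandwidth η J K 0 k) φ K ω)
    (hdet : s (fun _ => 1) * s (fun z => (z.2.1 - t) ^ 2) - s (fun z => z.2.1 - t) ^ 2 ≠ 0) :
    onlineMean n m W T (observation X ζ T ε) η J t K ω - meanFn Q X t
      = (s (fun z => (z.2.1 - t) ^ 2)
          * s (fun z => meanRemainder Q X t z.2.1 + (fluct Q X z.2.1 z.1 + z.2.2))
        - s (fun z => z.2.1 - t)
          * s (fun z => (z.2.1 - t)
            * (meanRemainder Q X t z.2.1 + (fluct Q X z.2.1 z.1 + z.2.2))))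
        / (s (fun _ => 1) * s (fun z => (z.2.1 - t) ^ 2) - s (fun z => z.2.1 - t) ^ 2) := by
  have hadd : ∀ φ ψ : E × ℝ × ℝ → ℝ, s (fun z => φ z + ψ z) = s φ + s ψ := fun φ ψ => by
    rw [hs]; exact kernelSum_add φ ψ K ω
  have hmul : ∀ (a : ℝ) (φ : E × ℝ × ℝ → ℝ), s (fun z => a * φ z) = a * s φ := fun a φ => by
    rw [hs]; exact kernelSum_const_mul a φ K ω
  -- The observations split into the tangent of the mean at `t` and the rest. In the quotient the
  -- tangent yields exactly its value at `t`, because its slope part cancels.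
  have e0 : s (fun z => X z.2.1 z.1 + z.2.2)
      = s (fun z => meanRemainder Q X t z.2.1 + (fluct Q X z.2.1 z.1 + z.2.2))
        + (meanFn Q X t * s (fun _ => 1) + deriv (meanFn Q X) t * s (fun z => z.2.1 - t)) := by
    rw [← hmul, ← hmul, ← hadd, ← hadd]
    congr 1
    ext z
    simp only [meanRemainder, fluct]
    ring
  have e1 : s (fun z => (z.2.1 - t) * (X z.2.1 z.1 + z.2.2))
      = s (fun z => (z.2.1 - t) * (meanRemainder Q X t z.2.1 + (fluct Q X z.2.1 z.1 + z.2.2)))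
        + (meanFn Q X t * s (fun z => z.2.1 - t)
          + deriv (meanFn Q X) t * s (fun z => (z.2.1 - t) ^ 2)) := by
    rw [← hmul, ← hmul, ← hadd, ← hadd]
    congr 1
    ext z
    simp only [meanRemainder, fluct]
    ring
  rw [onlineMean_eq η J K ω hs, e0, e1, div_sub' hdet]
  congr 1
  ring

/-! ### Convergence of the design averages -/

/-- The standing assumptions, with general bandwidths `b`. -/
structure Setting (P : Measure Ω) (Q : Measure E) (ν : Measure ℝ) (n : ℕ → ℕ) (m : ℕ → ℕ → ℕ)
    (X : ℝ → E → ℝ) (f W : ℝ → ℝ) (ζ : ℕ → ℕ → Ω → E) (T ε : ℕ → ℕ → ℕ → Ω → ℝ) (t : ℝ)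
    (b : ℕ → ℕ → ℝ) (c C : ℝ) : Prop where
  size : SizeCond n m
  process : ProcessCond Q X
  density : DensityCond f
  noise : NoiseCond ν
  kernel : KernelCond W
  sample : SamplingCond P Q f ν ζ T ε
  band : BandwidthBound n m b c C
  mem : t ∈ Ioo (0 : ℝ) 1

namespace Setting

/-- Sums of functions of the observation times concentrate around their means. -/
theorem tendsto_time_sub (h : Setting P Q ν n m X f W ζ T ε t b c C) {φ : ℝ → ℝ} {M : ℝ} {q : ℕ}
    (hφ : Measurable φ) (hM0 : 0 ≤ M) (hM : ∀ s ∈ Ioo (0 : ℝ) 1, |φ s| ≤ M * |s - t| ^ q)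
    {D : ℕ → ℝ} (hD : Tendsto (fun K => bandSum n m b (2 * q - 1) K / D K ^ 2) atTop (𝓝 0)) :
    TendstoInMeasure P (fun K ω => (kernelSum n m ζ T ε W t b (fun z => φ z.2.1) K ω
      - ∑ k ∈ Finset.Icc 1 K, blockSize n m 1 k
        * ∫ s, scaledKernel W (b K k) (s - t) * φ s ∂(timeLaw f)) / D K) atTop (fun _ => 0) := by
  have := h.sample.isProbabilityMeasure_timeLaw
  have hMq : ∀ s ∈ Ioo (0 : ℝ) 1, |φ s| ≤ M := fun s hs => (hM s hs).trans
    (mul_le_of_le_one_right hM0 (pow_le_one₀ (abs_nonneg _) (abs_sub_le_one hs h.mem)))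
  -- The variance involves squared kernel and squared `φ`, hence the order `b ^ (2q + 1 - 2)`. This
  -- is the exponent `2q - 1` of the hypothesis on `D`.
  obtain ⟨C', hC', hbd⟩ := exists_integral_kernel_le (t := t) h.kernel h.density (φ := fun s => φ s ^ 2)
    (M := M ^ 2) (q := 2 * q) (by positivity) (fun s hs => by
      rw [abs_pow, mul_comm 2 q, pow_mul, ← mul_pow]
      exact pow_le_pow_left₀ (abs_nonneg _) (hM s hs) 2) (p := 2) (by norm_num)
  have hw : ∀ K k, Measurable fun s => scaledKernel W (b K k) (s - t) * φ s := fun K k =>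
    (measurable_kernel h.kernel _ t).mul hφ
  have hL : ∀ K, ∀ k ∈ Finset.Icc 1 K,
      MemLp (fun s => scaledKernel W (b K k) (s - t) * φ s) 2 (timeLaw f) := fun K k hk =>
    memLp_kernel_mul h.kernel hφ hMq (h.band.band_pos hk) t 2
  refine tendstoInMeasure_of_integral_sq (Eventually.of_forall fun K => ?_) ?_
  · have h1 : MemLp (fun ω => kernelSum n m ζ T ε W t b (fun z => φ z.2.1) K ω
        - ∑ k ∈ Finset.Icc 1 K, blockSize n m 1 k
        * ∫ s, scaledKernel W (b K k) (s - t) * φ s ∂(timeLaw f)) 2 P :=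
      (h.sample.memLp_tripleSum (g := fun k z => scaledKernel W (b K k) (z.2.1 - t) * φ z.2.1)
        fun k hk => h.sample.memLp_time (hL K k hk)).sub (memLp_const _)
    simpa only [div_eq_mul_inv] using h1.mul_const _
  · have h2 := hD.const_mul C'
    rw [mul_zero] at h2
    refine squeeze_zero (fun K => integral_nonneg fun ω => sq_nonneg _) (fun K => ?_) h2
    simp only [div_pow]
    rw [integral_div, ← mul_div_assoc]
    refine div_le_div_of_nonneg_right ?_ (sq_nonneg _)
    refine (h.sample.integral_tripleSum_time_sub_sq_le (hw K) (hL K)).trans ?_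
    rw [bandSum, Finset.mul_sum]
    refine Finset.sum_le_sum fun k hk => ?_
    rw [mul_left_comm]
    refine mul_le_mul_of_nonneg_left ?_ (blockSize_nonneg _ _)
    have := (le_abs_self _).trans (hbd _ (h.band.band_pos hk))
    simp only [mul_pow]
    refine this.trans (le_of_eq ?_)
    congr 2
    push_cast
    ring

theorem tendsto_time_div (h : Setting P Q ν n m X f W ζ T ε t b c C) {φ : ℝ → ℝ} {M : ℝ} {q : ℕ}
    (hφ : Measurable φ) (hM0 : 0 ≤ M) (hM : ∀ s ∈ Ioo (0 : ℝ) 1, |φ s| ≤ M * |s - t| ^ q)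
    {D : ℕ → ℝ} {l : ℝ}
    (hD : Tendsto (fun K => bandSum n m b (2 * q - 1) K / D K ^ 2) atTop (𝓝 0))
    (hl : Tendsto (fun K => (∑ k ∈ Finset.Icc 1 K, blockSize n m 1 k
      * ∫ s, scaledKernel W (b K k) (s - t) * φ s ∂(timeLaw f)) / D K) atTop (𝓝 l)) :
    TendstoInMeasure P (fun K ω => kernelSum n m ζ T ε W t b (fun z => φ z.2.1) K ω / D K) atTop
      (fun _ => l) := by
  have := tendstoInMeasure_add (h.tendsto_time_sub hφ hM0 hM hD)
    (tendstoInMeasure_of_tendsto (P := P) hl)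
  simp only [zero_add] at this
  refine this.congr_left fun K => Eventually.of_forall fun ω => ?_
  simp only
  rw [sub_div, sub_add_cancel]

theorem tendsto_div_of_pow (h : Setting P Q ν n m X f W ζ T ε t b c C) {g D : ℕ → ℝ} {a d : ℝ}
    {p q : ℕ} (hpq : p < q) (hd : 0 < d) (hg0 : ∀ K, 0 ≤ g K)
    (hg : ∀ K, g K ≤ a * fifthRoot n m K ^ p)
    (hD : ∀ᶠ K in atTop, d * fifthRoot n m K ^ q ≤ D K) :
    Tendsto (fun K => g K / D K) atTop (𝓝 0) := by
  have h1 : Tendsto (fun K => a / d * (fifthRoot n m K ^ (q - p))⁻¹) atTop (𝓝 0) := by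
    have := (tendsto_pow_atTop (α := ℝ) (n := q - p) (by omega)).comp h.size.tendsto_fifthRoot
    simpa using this.inv_tendsto_atTop.const_mul (a / d)
  refine squeeze_zero' ?_ ?_ h1
  · filter_upwards [hD, eventually_ge_atTop 1] with K hK hK1
    have := h.size.fifthRoot_pos hK1
    exact div_nonneg (hg0 K) (le_trans (by positivity) hK)
  · filter_upwards [hD, eventually_ge_atTop 1] with K hK hK1
    have hu := h.size.fifthRoot_pos hK1
    calc g K / D K ≤ a * fifthRoot n m K ^ p / (d * fifthRoot n m K ^ q) :=
          div_le_div₀ ((hg0 K).trans (hg K)) (hg K) (by positivity) hK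
      _ = _ := by
          rw [show fifthRoot n m K ^ q = fifthRoot n m K ^ p * fifthRoot n m K ^ (q - p) by
            rw [← pow_add]; congr 1; omega]
          field_simp

theorem le_bandSum_two_sq (h : Setting P Q ν n m X f W ζ T ε t b c C) :
    ∀ᶠ K in atTop, c ^ 4 * fifthRoot n m K ^ 6 ≤ bandSum n m b 2 K ^ 2 := by
  filter_upwards [eventually_ge_atTop 1] with K hK
  have h1 := h.band.le_bandSum_two h.size hK
  have hc := h.band.pos
  have hu := h.size.fifthRoot_pos hK
  have := pow_le_pow_left₀ (by positivity) h1 2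
  refine le_trans (le_of_eq ?_) this
  ring

theorem tendsto_bandSum_div_sq (h : Setting P Q ν n m X f W ζ T ε t b c C) {p : ℕ} (hp1 : 1 ≤ p)
    (hp3 : p ≤ 3) : Tendsto (fun K => bandSum n m b p K / bandSum n m b 2 K ^ 2) atTop (𝓝 0) :=
  h.tendsto_div_of_pow (q := 6) (by omega) (pow_pos h.band.pos 4)
    (fun K => h.band.bandSum_nonneg _ K) (fun K => h.band.bandSum_le h.size hp1 hp3 K)
    h.le_bandSum_two_sq

theorem tendsto_rho_two (h : Setting P Q ν n m X f W ζ T ε t b c C) :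
    Tendsto (fun K => bandSum n m b 2 K / totalSize n m 1 K) atTop (𝓝 0) :=
  h.tendsto_div_of_pow (q := 5) (p := 3) (by omega) one_pos
    (fun K => h.band.bandSum_nonneg _ K)
    (fun K => h.band.bandSum_le h.size (p := 2) (by norm_num) (by norm_num) K)
    (Eventually.of_forall fun K => by rw [one_mul, fifthRoot_pow])

theorem tendsto_design_zero (h : Setting P Q ν n m X f W ζ T ε t b c C) :
    TendstoInMeasure P (fun K ω => kernelSum n m ζ T ε W t b (fun _ => 1) K ω
      / totalSize n m 1 K) atTop (fun _ => f t) := by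
  have := h.sample.isProbabilityMeasure_timeLaw
  obtain ⟨C', hC', hbd⟩ := exists_integral_kernel_le (t := t) h.kernel h.density (φ := fun _ => 1)
    (M := 1) (q := 0) (by norm_num) (by simp) (p := 1) le_rfl
  refine h.tendsto_time_div (φ := fun _ => 1) (q := 0) (M := 1) measurable_const zero_le_one
    (by simp) ?_ ?_
  · refine h.tendsto_div_of_pow (p := 6) (q := 10) (by omega) one_pos (a := (c⁻¹) ^ 1)
      (fun K => h.band.bandSum_nonneg _ K) (fun K => ?_) (Eventually.of_forall fun K => ?_)
    · simpa using h.band.bandSum_neg_le h.size 1 K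
    · rw [one_mul, ← fifthRoot_pow, ← pow_mul]
  · have h2 := h.band.tendsto_sum_div_bandSum h.size (q := 0) (M := C') (by norm_num)
      (G := fun r => ∫ s, scaledKernel W r (s - t) ∂(timeLaw f))
      (by simpa using tendsto_integral_kernel h.kernel h.density h.mem)
      (fun r hr => by simpa using hbd r hr)
    simpa only [BandwidthBound.bandSum_zero, mul_one] using h2

/-- One law of large numbers serves the second design moment, the Taylor remainder of the mean and
its product with `s - t`. The means are of order `∑ s_k b_k ^ 2` and the variance of order `∑ s_k
b_k ^ 3`, which is negligible against the square. -/
theorem tendsto_quadratic (h : Setting P Q ν n m X f W ζ T ε t b c C) {φ : ℝ → ℝ} {M φ₀ : ℝ}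
    (hφ : Measurable φ) (hM0 : 0 ≤ M)
    (hM : ∀ s ∈ Ioo (0 : ℝ) 1, |φ s| ≤ M * (s - t) ^ 2)
    (hlim : Tendsto (fun s => φ s / (s - t) ^ 2) (𝓝[≠] t) (𝓝 φ₀)) :
    TendstoInMeasure P (fun K ω => kernelSum n m ζ T ε W t b (fun z => φ z.2.1) K ω
      / bandSum n m b 2 K) atTop (fun _ => φ₀ * f t * kernelAlpha W) := by
  have := h.sample.isProbabilityMeasure_timeLaw
  have hM' : ∀ s ∈ Ioo (0 : ℝ) 1, |φ s| ≤ M * |s - t| ^ 2 := fun s hs => by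
    rw [sq_abs]; exact hM s hs
  obtain ⟨C', hC', hbd⟩ := exists_integral_kernel_le (t := t) h.kernel h.density (φ := φ)
    (M := M) (q := 2) hM0 hM' (p := 1) le_rfl
  refine h.tendsto_time_div hφ hM0 hM' ?_ ?_
  · exact_mod_cast h.tendsto_bandSum_div_sq (p := 3) (by norm_num) le_rfl
  · refine h.band.tendsto_sum_div_bandSum h.size (q := 2) (M := C') (by norm_num)
      (G := fun r => ∫ s, scaledKernel W r (s - t) * φ s ∂(timeLaw f))
      (tendsto_integral_kernel_mul h.kernel h.density h.mem hφ hM hlim) (fun r hr => ?_)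
    simpa using hbd r hr

theorem tendsto_design_two (h : Setting P Q ν n m X f W ζ T ε t b c C) :
    TendstoInMeasure P (fun K ω => kernelSum n m ζ T ε W t b (fun z => (z.2.1 - t) ^ 2) K ω
      / bandSum n m b 2 K) atTop (fun _ => f t * kernelAlpha W) := by
  have := h.tendsto_quadratic (φ := fun s => (s - t) ^ 2) (M := 1) (φ₀ := 1) (by fun_prop)
    zero_le_one (fun s hs => by rw [abs_of_nonneg (sq_nonneg _), one_mul]) ?_
  · simpa using this
  · refine tendsto_const_nhds.congr' (eventually_nhdsWithin_of_forall fun s hs => ?_)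
    have : s - t ≠ 0 := sub_ne_zero.2 hs
    simp [this]

theorem exists_meanRemainder_le (h : Setting P Q ν n m X f W ζ T ε t b c C) :
    ∃ M : ℝ, 0 ≤ M ∧ ∀ s ∈ Ioo (0 : ℝ) 1, |meanRemainder Q X t s| ≤ M * (s - t) ^ 2 := by
  obtain ⟨M, hM⟩ := h.process.mean_bdd
  exact ⟨M, (abs_nonneg _).trans (hM t h.mem), fun s hs =>
    abs_sub_deriv_le (convex_Ioo 0 1) isOpen_Ioo h.process.mean_smooth hM hs h.mem⟩

theorem measurable_meanRemainder (h : Setting P Q ν n m X f W ζ T ε t b c C) :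
    Measurable (meanRemainder Q X t) := by
  have := h.process.measurable_meanFn
  unfold meanRemainder
  fun_prop

theorem tendsto_bias (h : Setting P Q ν n m X f W ζ T ε t b c C) :
    TendstoInMeasure P (fun K ω => kernelSum n m ζ T ε W t b
      (fun z => meanRemainder Q X t z.2.1) K ω / bandSum n m b 2 K) atTop
      (fun _ => 1 / 2 * iteratedDeriv 2 (meanFn Q X) t * f t * kernelAlpha W) := by
  obtain ⟨M, hM0, hM⟩ := h.exists_meanRemainder_le
  refine h.tendsto_quadratic h.measurable_meanRemainder hM0 hM ?_
  have h1 := (isLittleO_taylor_two (convex_Ioo 0 1) isOpen_Ioo h.mem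
    h.process.mean_smooth).tendsto_div_nhds_zero
  have h2 := (h1.mono_left (nhdsWithin_le_nhds (s := {t}ᶜ))).add_const
    (1 / 2 * iteratedDeriv 2 (meanFn Q X) t)
  rw [zero_add] at h2
  refine h2.congr' (eventually_nhdsWithin_of_forall fun s hs => ?_)
  have : s - t ≠ 0 := sub_ne_zero.2 hs
  simp only [meanRemainder]
  field_simp
  ring

theorem tendsto_bias_slope (h : Setting P Q ν n m X f W ζ T ε t b c C) :
    TendstoInMeasure P (fun K ω => kernelSum n m ζ T ε W t b
      (fun z => (z.2.1 - t) * meanRemainder Q X t z.2.1) K ω / bandSum n m b 2 K) atTop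
      (fun _ => 0) := by
  obtain ⟨M, hM0, hM⟩ := h.exists_meanRemainder_le
  have hm := h.measurable_meanRemainder
  have := h.tendsto_quadratic (φ := fun s => (s - t) * meanRemainder Q X t s) (M := M) (φ₀ := 0)
    (by fun_prop) hM0 (fun s hs => ?_) ?_
  · simpa using this
  · rw [abs_mul]
    exact (mul_le_of_le_one_left (abs_nonneg _) (abs_sub_le_one hs h.mem)).trans (hM s hs)
  · have h1 : Tendsto (fun s => M * |s - t|) (𝓝[≠] t) (𝓝 0) := by
      have : Continuous fun s => M * |s - t| := by fun_prop
      have := this.tendsto t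
      simp only [sub_self, abs_zero, mul_zero] at this
      exact this.mono_left nhdsWithin_le_nhds
    refine squeeze_zero_norm' ?_ h1
    have hmem : ∀ᶠ s in 𝓝[≠] t, s ∈ Ioo (0 : ℝ) 1 := nhdsWithin_le_nhds (isOpen_Ioo.mem_nhds h.mem)
    filter_upwards [hmem, self_mem_nhdsWithin] with s hs hne
    have hpos : 0 < (s - t) ^ 2 := by
      have : s - t ≠ 0 := sub_ne_zero.2 hne
      positivity
    rw [norm_div, norm_mul, Real.norm_eq_abs, Real.norm_eq_abs, Real.norm_eq_abs,
      abs_of_pos hpos, div_le_iff₀ hpos]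
    have := mul_le_mul_of_nonneg_left (hM s hs) (abs_nonneg (s - t))
    linarith

/-- The first design moment, centred by a sequence of order `∑ s_k b_k²`. -/
theorem tendsto_design_one (h : Setting P Q ν n m X f W ζ T ε t b c C) :
    ∃ (e : ℕ → ℝ) (C' : ℝ), (∀ᶠ K in atTop, |e K| ≤ C') ∧
      TendstoInMeasure P (fun K ω => kernelSum n m ζ T ε W t b (fun z => z.2.1 - t) K ω
        / bandSum n m b 2 K - e K) atTop (fun _ => 0) := by
  have := h.sample.isProbabilityMeasure_timeLaw
  obtain ⟨C', hC', hbd⟩ := exists_integral_kernel_first_le (t := t) h.kernel h.density h.mem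
  have h1 := h.tendsto_time_sub (φ := fun s => s - t) (M := 1) (q := 1)
    (D := bandSum n m b 2) (by fun_prop) zero_le_one (fun s hs => by simp)
    (by simpa using h.tendsto_bandSum_div_sq (p := 1) le_rfl (by norm_num))
  simp only [sub_div] at h1
  -- The centring `e` is the exact mean divided by `∑ s_k b_k ^ 2`. Only its boundedness is
  -- established and only that is needed, because the first moment later occurs multiplied by null
  -- factors.
  refine ⟨fun K => (∑ k ∈ Finset.Icc 1 K, blockSize n m 1 k
    * ∫ s, scaledKernel W (b K k) (s - t) * (s - t) ∂(timeLaw f)) / bandSum n m b 2 K, C', ?_, h1⟩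
  · filter_upwards [eventually_ge_atTop 1] with K hK
    have hpos := h.band.bandSum_two_pos h.size hK
    rw [abs_div, abs_of_pos hpos, div_le_iff₀ hpos, bandSum, Finset.mul_sum]
    refine (Finset.abs_sum_le_sum_abs _ _).trans (Finset.sum_le_sum fun k hk => ?_)
    rw [abs_mul, abs_of_nonneg (blockSize_nonneg _ _), mul_left_comm]
    exact mul_le_mul_of_nonneg_left (by exact_mod_cast hbd _ (h.band.band_pos hk))
      (blockSize_nonneg _ _)

/-- The factor `T - t` stays outside `Ψ`: it lowers the second moment of the summand from order `1 /
r` to order `r`. -/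
theorem kernel_summand (h : Setting P Q ν n m X f W ζ T ε t b c C) {Ψ : ℝ → E → ℝ} {κ A : ℝ}
    (hΨ : Measurable (Function.uncurry Ψ)) (hL : ∀ s ∈ Ioo (0 : ℝ) 1, MemLp (Ψ s) 2 Q)
    (h0 : ∀ s ∈ Ioo (0 : ℝ) 1, ∫ x, Ψ s x ∂Q = 0)
    (hA : ∀ s ∈ Ioo (0 : ℝ) 1, ∫ x, Ψ s x ^ 2 ∂Q ≤ A) {r : ℝ} (hr : 0 < r)
    {g : E × ℝ × ℝ → ℝ} (hg : g = fun z => scaledKernel W r (z.2.1 - t) * (z.2.1 - t)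
      * (Ψ z.2.1 z.1 + κ * z.2.2)) :
    MemLp g 2 (Q.prod ((timeLaw f).prod ν)) ∧ ∫ z, g z ∂(Q.prod ((timeLaw f).prod ν)) = 0 ∧
    ∫ z, g z ^ 2 ∂(Q.prod ((timeLaw f).prod ν))
      ≤ (∫ s, (scaledKernel W r (s - t) * (s - t)) ^ 2 ∂(timeLaw f))
        * (A + κ ^ 2 * variance id ν) ∧
    ∀ᵐ x ∂Q, ∫ u, g (x, u) ∂((timeLaw f).prod ν)
      = ∫ s, scaledKernel W r (s - t) * ((s - t) * Ψ s x) ∂(timeLaw f) := by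
  have := h.sample.isProbabilityMeasure_timeLaw
  obtain ⟨h1, h2, h3, h4⟩ := centred_summand (Q := Q) (τ := timeLaw f) h.noise
    (c := fun s => scaledKernel W r (s - t) * (s - t)) (Ψ := Ψ) (κ := κ) (A := fun _ => A)
    ((measurable_kernel h.kernel r t).mul (measurable_id.sub_const t)) hΨ
    (DensityCond.ae_mem_timeLaw.mono hL) (DensityCond.ae_mem_timeLaw.mono h0)
    (DensityCond.ae_mem_timeLaw.mono hA)
    ((memLp_kernel_mul h.kernel (φ := fun s => s - t) (by fun_prop)
      (fun s hs => abs_sub_le_one hs h.mem) hr t 2).integrable_sq.mul_const _)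
  rw [integral_mul_const] at h3
  subst hg
  refine ⟨h1, h2, h3, ?_⟩
  simpa only [mul_assoc] using h4

/-- Negligible noise: the summands carry a factor `T - t`. -/
theorem tendsto_noise (h : Setting P Q ν n m X f W ζ T ε t b c C) {Ψ : ℝ → E → ℝ} {κ A B : ℝ}
    (hΨ : Measurable (Function.uncurry Ψ)) (hL : ∀ s ∈ Ioo (0 : ℝ) 1, MemLp (Ψ s) 2 Q)
    (h0 : ∀ s ∈ Ioo (0 : ℝ) 1, ∫ x, Ψ s x ∂Q = 0)
    (hA : ∀ s ∈ Ioo (0 : ℝ) 1, ∫ x, Ψ s x ^ 2 ∂Q ≤ A)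
    (hB : ∀ r : ℝ, 0 < r →
      ∫ x, (∫ s, scaledKernel W r (s - t) * ((s - t) * Ψ s x) ∂(timeLaw f)) ^ 2 ∂Q ≤ B * r ^ 4) :
    TendstoInMeasure P (fun K ω => kernelSum n m ζ T ε W t b
      (fun z => (z.2.1 - t) * (Ψ z.2.1 z.1 + κ * z.2.2)) K ω / bandSum n m b 2 K) atTop
      (fun _ => 0) := by
  have := h.sample.isProbabilityMeasure_timeLaw
  obtain ⟨C', hC', hbd⟩ := exists_integral_kernel_le (t := t) h.kernel h.density
    (φ := fun s => (s - t) ^ 2) (M := 1) (q := 2) zero_le_one (fun s hs => by simp) (p := 2)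
    (by norm_num)
  have hA0 : 0 ≤ A := (integral_nonneg fun _ => sq_nonneg _).trans (hA t h.mem)
  set A' := A + κ ^ 2 * variance id ν with hA'
  have hA'0 : 0 ≤ A' := add_nonneg hA0 (mul_nonneg (sq_nonneg _) (variance_nonneg _ _))
  set g : ℕ → ℕ → E × ℝ × ℝ → ℝ := fun K k z =>
    scaledKernel W (b K k) (z.2.1 - t) * (z.2.1 - t) * (Ψ z.2.1 z.1 + κ * z.2.2) with hg
  have hgm : ∀ K k, Measurable (g K k) := by
    intro K k
    have h1 : Measurable fun z : E × ℝ × ℝ => Ψ z.2.1 z.1 :=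
      hΨ.comp ((measurable_fst.comp measurable_snd).prodMk measurable_fst)
    have h2 : Measurable fun z : E × ℝ × ℝ => scaledKernel W (b K k) (z.2.1 - t) :=
      (measurable_kernel h.kernel _ t).comp (measurable_fst.comp measurable_snd)
    fun_prop
  have hsum : ∀ K, ∀ k ∈ Finset.Icc 1 K, _ := fun K k hk =>
    h.kernel_summand (κ := κ) hΨ hL h0 hA (h.band.band_pos hk) (g := g K k) rfl
  have e : ∀ K ω, kernelSum n m ζ T ε W t b
      (fun z => (z.2.1 - t) * (Ψ z.2.1 z.1 + κ * z.2.2)) K ω = tripleSum n m ζ T ε (g K) K ω := by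
    intro K ω
    simp only [kernelSum, hg, mul_assoc]
  simp only [e]
  have hb1 := h.tendsto_bandSum_div_sq (p := 1) le_rfl (by norm_num)
  -- The two parts of the variance are compared with the squared normalisation, which is at least of
  -- order `u ^ 6`: single measurements contribute `∑ s_k b_k`, pairs within subjects `∑ s_{k,2} b_k
  -- ^ 4`.
  have hb2 : Tendsto (fun K => (∑ k ∈ Finset.Icc 1 K, blockSize n m 2 k * b K k ^ 4)
      / bandSum n m b 2 K ^ 2) atTop (𝓝 0) := by
    have h1 := (h.band.tendsto_sum_two_mul_pow h.size).mul_const ((c ^ 4)⁻¹)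
    rw [zero_mul] at h1
    have hn : ∀ K, 0 ≤ ∑ k ∈ Finset.Icc 1 K, blockSize n m 2 k * b K k ^ 4 := fun K =>
      Finset.sum_nonneg fun k hk => mul_nonneg (blockSize_nonneg _ _)
        (pow_nonneg (h.band.band_pos hk).le _)
    refine squeeze_zero' (Eventually.of_forall fun K => div_nonneg (hn K) (sq_nonneg _)) ?_ h1
    filter_upwards [h.le_bandSum_two_sq, eventually_ge_atTop 1] with K hK hK1
    have hu := h.size.fifthRoot_pos hK1
    have hc := h.band.pos
    rw [← div_eq_mul_inv, div_div, mul_comm (_ ^ 6)]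
    exact div_le_div_of_nonneg_left (hn K) (by positivity) hK
  refine tendstoInMeasure_of_integral_sq (Eventually.of_forall fun K => ?_) ?_
  · simpa only [div_eq_mul_inv] using (h.sample.memLp_tripleSum (g := g K) fun k hk =>
      (hsum K k hk).1).mul_const _
  · have h2 := (hb1.const_mul (C' * A')).add (hb2.const_mul B)
    simp only [mul_zero, add_zero] at h2
    refine squeeze_zero (fun K => integral_nonneg fun ω => sq_nonneg _) (fun K => ?_) h2
    simp only [div_pow]
    rw [integral_div, ← mul_div_assoc, ← mul_div_assoc, ← add_div]
    refine div_le_div_of_nonneg_right ?_ (sq_nonneg _)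
    rw [h.sample.integral_tripleSum_sq (hgm K) (fun k hk => (hsum K k hk).1)
      (fun k hk => (hsum K k hk).2.1), bandSum, Finset.mul_sum, Finset.mul_sum]
    refine add_le_add (Finset.sum_le_sum fun k hk => ?_) (Finset.sum_le_sum fun k hk => ?_)
    · rw [mul_left_comm]
      refine mul_le_mul_of_nonneg_left ?_ (blockSize_nonneg _ _)
      refine (hsum K k hk).2.2.1.trans ?_
      have h3 := (le_abs_self _).trans (hbd _ (h.band.band_pos hk))
      simp only [mul_pow]
      calc _ ≤ C' * b K k ^ ((2 : ℕ) + 1 - (2 : ℕ) : ℤ) * A' := mul_le_mul_of_nonneg_right h3 hA'0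
        _ = _ := by
            rw [show ((2 : ℕ) + 1 - (2 : ℕ) : ℤ) = ((1 : ℕ) : ℤ) by norm_num]
            ring
    · rw [mul_left_comm]
      refine mul_le_mul_of_nonneg_left ?_ (blockSize_nonneg _ _)
      refine le_trans (le_of_eq (integral_congr_ae ?_)) (hB _ (h.band.band_pos hk))
      filter_upwards [(hsum K k hk).2.2.2] with x hx
      rw [hx]

theorem tendsto_noise_slope (h : Setting P Q ν n m X f W ζ T ε t b c C) :
    TendstoInMeasure P (fun K ω => kernelSum n m ζ T ε W t b
      (fun z => (z.2.1 - t) * (fluct Q X z.2.1 z.1 + z.2.2)) K ω / bandSum n m b 2 K) atTop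
      (fun _ => 0) := by
  have := h.sample.isProbabilityMeasure_timeLaw
  obtain ⟨V, hV0, hV⟩ := h.process.exists_moment_bound
  obtain ⟨B, hB0, hB⟩ := exists_integral_slope_sq_le h.kernel h.density h.process h.mem
  have := h.tendsto_noise (Ψ := fluct Q X) (κ := 1) h.process.measurable_fluct
    (fun s hs => h.process.memLp_two_fluct (Ioo_subset_Icc_self hs))
    (fun s hs => h.process.integral_fluct (Ioo_subset_Icc_self hs))
    (fun s hs => hV s (Ioo_subset_Icc_self hs)) hB
  simpa only [one_mul] using this

/-- The increment is written as `s - t` times a difference quotient, which is bounded in mean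
square. At `s = t` the quotient is zero by convention and the product is still the increment. There
is no noise, so `κ = 0`. -/
theorem tendsto_noise_smooth (h : Setting P Q ν n m X f W ζ T ε t b c C) :
    TendstoInMeasure P (fun K ω => kernelSum n m ζ T ε W t b
      (fun z => fluct Q X z.2.1 z.1 - fluct Q X t z.1) K ω / bandSum n m b 2 K) atTop
      (fun _ => 0) := by
  have := h.sample.isProbabilityMeasure_timeLaw
  obtain ⟨A, hA0, hA⟩ := h.process.exists_fluct_sub_sq_le h.mem
  obtain ⟨B, hB0, hB⟩ := exists_integral_smooth_sq_le h.kernel h.density h.process h.mem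
  have e : ∀ s x, (s - t) * ((fluct Q X s x - fluct Q X t x) / (s - t))
      = fluct Q X s x - fluct Q X t x := by
    intro s x
    rcases eq_or_ne s t with rfl | hne
    · simp
    · exact mul_div_cancel₀ _ (sub_ne_zero.2 hne)
  have h1 := h.tendsto_noise (Ψ := fun s x => (fluct Q X s x - fluct Q X t x) / (s - t)) (κ := 0)
    (A := A) (B := B) ?_ (fun s hs => ?_) (fun s hs => ?_) (fun s hs => ?_) (fun r hr => ?_)
  · simpa only [zero_mul, add_zero, e] using h1
  · have h2 : Measurable fun z : ℝ × E => fluct Q X t z.2 :=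
      h.process.measurable_fluct.comp (measurable_const.prodMk measurable_snd)
    exact (h.process.measurable_fluct.sub h2).div (measurable_fst.sub_const t)
  · simpa only [div_eq_mul_inv] using (h.process.memLp_fluct_sub h.mem hs).mul_const _
  · rw [integral_div, integral_sub
      ((h.process.memLp_two_fluct (Ioo_subset_Icc_self hs)).integrable (by norm_num))
      ((h.process.memLp_two_fluct (Ioo_subset_Icc_self h.mem)).integrable (by norm_num)),
      h.process.integral_fluct (Ioo_subset_Icc_self hs),
      h.process.integral_fluct (Ioo_subset_Icc_self h.mem)]
    simp
  · simp only [div_pow]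
    rw [integral_div]
    exact div_le_of_le_mul₀ (sq_nonneg _) hA0 (hA s hs)
  · simpa only [e] using hB r hr

end Setting

end

section

variable {Ω E : Type*} [MeasurableSpace Ω] [MeasurableSpace E]
  {P : Measure Ω} [IsProbabilityMeasure P] {Q : Measure E} [IsProbabilityMeasure Q]
  {ν : Measure ℝ} [IsProbabilityMeasure ν]
  {n : ℕ → ℕ} {m : ℕ → ℕ → ℕ} {X : ℝ → E → ℝ} {f W : ℝ → ℝ}
  {ζ : ℕ → ℕ → Ω → E} {T ε : ℕ → ℕ → ℕ → Ω → ℝ} {t : ℝ} {b : ℕ → ℕ → ℝ} {c C : ℝ}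

/-! ### Expansion of the estimate -/

/-- The normalised first design moment is only known to be close to a bounded sequence. This still
suffices to make its products with null variables null. -/
theorem tendstoInMeasure_mul_of_bounded {Y Z : ℕ → Ω → ℝ} {e : ℕ → ℝ} {B : ℝ}
    (he : ∀ᶠ K in atTop, |e K| ≤ B)
    (hY : TendstoInMeasure P (fun K ω => Y K ω - e K) atTop (fun _ => 0))
    (hZ : TendstoInMeasure P Z atTop (fun _ => 0)) :
    TendstoInMeasure P (fun K ω => Y K ω * Z K ω) atTop (fun _ => 0) := by
  refine tendstoInMeasure_of_forall_close (ι := Fin 2) (X := ![fun K ω => Y K ω - e K, Z])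
    (c := ![0, 0]) (by simpa [Fin.forall_fin_two] using ⟨hY, hZ⟩) fun r hr =>
      ⟨min 1 (r / (|B| + 2)), by positivity, ?_⟩
  filter_upwards [he] with K hK ω hω
  have h1 := (hω 0).trans_le (min_le_left _ _)
  have h2 := (hω 1).trans_le (min_le_right _ _)
  simp only [Matrix.cons_val_zero, Matrix.cons_val_one, sub_zero] at h1 h2
  rw [sub_zero, abs_mul]
  have h3 : |Y K ω| ≤ |B| + 1 := by
    have := abs_sub_abs_le_abs_sub (Y K ω) (e K)
    linarith [le_abs_self B]
  rw [lt_div_iff₀ (by positivity)] at h2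
  nlinarith [abs_nonneg (Z K ω), abs_nonneg (Y K ω), abs_nonneg B]

namespace Setting

theorem measurable_kernelSum (h : Setting P Q ν n m X f W ζ T ε t b c C) {φ : E × ℝ × ℝ → ℝ}
    (hφ : Measurable φ) (K : ℕ) : Measurable (kernelSum n m ζ T ε W t b φ K) :=
  h.sample.measurable_tripleSum (g := fun k z => scaledKernel W (b K k) (z.2.1 - t) * φ z)
    (fun k => ((measurable_kernel h.kernel (b K k) t).comp
      (measurable_fst.comp measurable_snd)).mul hφ) K

theorem tendsto_slope_sum (h : Setting P Q ν n m X f W ζ T ε t b c C) :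
    TendstoInMeasure P (fun K ω => kernelSum n m ζ T ε W t b
      (fun z => (z.2.1 - t) * (meanRemainder Q X t z.2.1 + (fluct Q X z.2.1 z.1 + z.2.2))) K ω
        / bandSum n m b 2 K) atTop (fun _ => 0) := by
  have := tendstoInMeasure_add h.tendsto_bias_slope h.tendsto_noise_slope
  simpa only [← add_div, ← kernelSum_add, ← mul_add, add_zero] using this

theorem tendsto_bias_sum (h : Setting P Q ν n m X f W ζ T ε t b c C) :
    TendstoInMeasure P (fun K ω => (kernelSum n m ζ T ε W t b
      (fun z => meanRemainder Q X t z.2.1 + (fluct Q X z.2.1 z.1 + z.2.2)) K ω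
        - kernelSum n m ζ T ε W t b (fun z => fluct Q X t z.1 + z.2.2) K ω)
        / bandSum n m b 2 K) atTop
      (fun _ => 1 / 2 * iteratedDeriv 2 (meanFn Q X) t * f t * kernelAlpha W) := by
  have := tendstoInMeasure_add h.tendsto_bias h.tendsto_noise_smooth
  simp only [add_zero] at this
  refine this.congr_left fun K => Eventually.of_forall fun ω => ?_
  simp only
  have e : kernelSum n m ζ T ε W t b
      (fun z => meanRemainder Q X t z.2.1 + (fluct Q X z.2.1 z.1 + z.2.2)) K ω
      = kernelSum n m ζ T ε W t b (fun z => meanRemainder Q X t z.2.1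
          + (fluct Q X z.2.1 z.1 - fluct Q X t z.1)) K ω
        + kernelSum n m ζ T ε W t b (fun z => fluct Q X t z.1 + z.2.2) K ω := by
    rw [← kernelSum_add]
    exact kernelSum_congr (fun z => by ring) K ω
  rw [e, add_sub_cancel_right, kernelSum_add, add_div]

/-- Up to a term negligible against `ρ₂`, the estimate minus its mean and its bias is a random
multiple of the noise average at `t`. -/
theorem exists_expansion {L : ℕ} [NeZero L] {η : ℕ → Fin L → ℝ} {J : ℕ → Fin L → Fin L}
    (h : Setting P Q ν n m X f W ζ T ε t (fun K k => chainBandwidth η J K 0 k) c C) :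
    ∃ c₀ : ℕ → Ω → ℝ, (∀ K, Measurable (c₀ K)) ∧
      TendstoInMeasure P c₀ atTop (fun _ => (f t)⁻¹) ∧
      TendstoInMeasure P (fun K ω =>
        (onlineMean n m W T (observation X ζ T ε) η J t K ω - meanFn Q X t
          - 1 / 2 * kernelAlpha W * iteratedDeriv 2 (meanFn Q X) t * rho n m η J 2 K
          - c₀ K ω * (kernelSum n m ζ T ε W t (fun K k => chainBandwidth η J K 0 k)
            (fun z => fluct Q X t z.1 + z.2.2) K ω / totalSize n m 1 K))
          / rho n m η J 2 K) atTop (fun _ => 0) := by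
  set b : ℕ → ℕ → ℝ := fun K k => chainBandwidth η J K 0 k with hb
  obtain ⟨e, B, he, hx⟩ := h.tendsto_design_one
  set S : ℕ → ℝ := totalSize n m 1 with hS
  set V : ℕ → ℝ := bandSum n m b 2 with hV
  set α₀ : ℕ → Ω → ℝ := fun K ω => kernelSum n m ζ T ε W t b (fun _ => 1) K ω / S K with hα₀
  set α₂ : ℕ → Ω → ℝ := fun K ω =>
    kernelSum n m ζ T ε W t b (fun z => (z.2.1 - t) ^ 2) K ω / V K with hα₂
  set x : ℕ → Ω → ℝ := fun K ω =>
    kernelSum n m ζ T ε W t b (fun z => z.2.1 - t) K ω / V K with hxdef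
  set N : ℕ → Ω → ℝ := kernelSum n m ζ T ε W t b (fun z => fluct Q X t z.1 + z.2.2) with hN
  set β : ℕ → Ω → ℝ := fun K ω => (kernelSum n m ζ T ε W t b
      (fun z => meanRemainder Q X t z.2.1 + (fluct Q X z.2.1 z.1 + z.2.2)) K ω - N K ω) / V K
    with hβ
  set y : ℕ → Ω → ℝ := fun K ω => kernelSum n m ζ T ε W t b
      (fun z => (z.2.1 - t) * (meanRemainder Q X t z.2.1 + (fluct Q X z.2.1 z.1 + z.2.2))) K ω
        / V K with hy
  have lim₀ : TendstoInMeasure P α₀ atTop (fun _ => f t) := h.tendsto_design_zero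
  have lim₂ : TendstoInMeasure P α₂ atTop (fun _ => f t * kernelAlpha W) := h.tendsto_design_two
  have limβ : TendstoInMeasure P β atTop
      (fun _ => 1 / 2 * iteratedDeriv 2 (meanFn Q X) t * f t * kernelAlpha W) := h.tendsto_bias_sum
  have limy : TendstoInMeasure P y atTop (fun _ => 0) := h.tendsto_slope_sum
  have limp : TendstoInMeasure P (fun K ω => x K ω * y K ω) atTop (fun _ => 0) :=
    tendstoInMeasure_mul_of_bounded he hx limy
  -- In the determinant divided by `S * V` the squared first moment becomes `x ^ 2 * (V / S)`. It is
  -- negligible because `V / S` is `ρ_2` and tends to zero.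
  have limκ : TendstoInMeasure P (fun K ω => x K ω * (x K ω * (V K / S K))) atTop (fun _ => 0) :=
    tendstoInMeasure_mul_of_bounded he hx
      (tendstoInMeasure_mul_of_bounded he hx (tendstoInMeasure_of_tendsto h.tendsto_rho_two))
  have hf := h.density.pos h.mem
  have hα := h.kernel.kernelAlpha_pos
  have hmeas : ∀ K, Measurable (α₀ K) ∧ Measurable (α₂ K) ∧ Measurable (x K) := fun K =>
    ⟨(h.measurable_kernelSum measurable_const K).div_const _,
      (h.measurable_kernelSum (by fun_prop) K).div_const _,
      (h.measurable_kernelSum (by fun_prop) K).div_const _⟩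
  -- This is the coefficient of the noise average in the error formula after normalising by `S` and
  -- `V`. The limits of `α₀` and `α₂` turn it into `1 / f t`.
  refine ⟨fun K ω => α₂ K ω / (α₀ K ω * α₂ K ω - x K ω * (x K ω * (V K / S K))), fun K => ?_, ?_, ?_⟩
  · obtain ⟨m0, m2, m1⟩ := hmeas K
    fun_prop
  · have hne : f t * (f t * kernelAlpha W) - 0 ≠ 0 := by
      rw [sub_zero]
      positivity
    have := tendstoInMeasure_of_continuousAt (P := P) (ι := Fin 3)
      (X := ![α₀, α₂, fun K ω => x K ω * (x K ω * (V K / S K))])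
      (c := ![f t, f t * kernelAlpha W, 0]) (F := fun v => v 1 / (v 0 * v 1 - v 2)) ?_ ?_
    · simp only [Matrix.cons_val_zero, Matrix.cons_val_one, Matrix.cons_val] at this
      rwa [show f t * kernelAlpha W / (f t * (f t * kernelAlpha W) - 0) = (f t)⁻¹ by
        rw [sub_zero]; field_simp] at this
    · intro i
      fin_cases i
      exacts [lim₀, lim₂, limκ]
    · refine ContinuousAt.div (f := fun v : Fin 3 → ℝ => v 1)
        (g := fun v : Fin 3 → ℝ => v 0 * v 1 - v 2)
        (continuous_apply 1).continuousAt (Continuous.continuousAt (by fun_prop)) ?_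
      simpa using hne
  -- `F` is the rest of the error divided by `ρ_2`, and `G` the normalised determinant. `F` at the
  -- limit point is the bias constant, so continuity there gives the claim; near that point `G` is
  -- nonzero and the error formula applies.
  · set F : (Fin 5 → ℝ) → ℝ := fun v => (v 1 * v 2 - v 3) / (v 0 * v 1 - v 4) with hF
    set G : (Fin 5 → ℝ) → ℝ := fun v => v 0 * v 1 - v 4 with hG
    set l : Fin 5 → ℝ := ![f t, f t * kernelAlpha W,
      1 / 2 * iteratedDeriv 2 (meanFn Q X) t * f t * kernelAlpha W, 0, 0] with hl
    have hGl : G l ≠ 0 := by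
      have : G l = f t * (f t * kernelAlpha W) := by simp [hG, hl]
      rw [this]
      positivity
    have hFl : F l = 1 / 2 * kernelAlpha W * iteratedDeriv 2 (meanFn Q X) t := by
      simp only [hF, hl, Matrix.cons_val_zero, Matrix.cons_val_one, Matrix.cons_val]
      rw [sub_zero, sub_zero]
      field_simp
    have hGc : ContinuousAt G l := Continuous.continuousAt (by fun_prop)
    have hFc : ContinuousAt F l := ContinuousAt.div
      (Continuous.continuousAt (by fun_prop)) hGc hGl
    refine tendstoInMeasure_of_forall_close (ι := Fin 5)
      (X := ![α₀, α₂, β, fun K ω => x K ω * y K ω, fun K ω => x K ω * (x K ω * (V K / S K))])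
      (c := l) (fun i => ?_) fun r hr => ?_
    · fin_cases i
      exacts [lim₀, lim₂, limβ, limp, limκ]
    · obtain ⟨d, hd, hball⟩ := Metric.eventually_nhds_iff.1
        ((hGc.eventually_ne hGl).and (Metric.tendsto_nhds.1 hFc r hr))
      refine ⟨d, hd, ?_⟩
      filter_upwards [eventually_ge_atTop 1] with K hK ω hω
      have hSK : 0 < S K := h.size.totalSize_pos hK
      have hVK : 0 < V K := h.band.bandSum_two_pos h.size hK
      set v : Fin 5 → ℝ := ![α₀ K ω, α₂ K ω, β K ω, x K ω * y K ω,
        x K ω * (x K ω * (V K / S K))] with hv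
      have hclose : dist v l < d := by
        refine (dist_pi_lt_iff hd).2 fun i => ?_
        have := hω i
        rw [Real.dist_eq]
        fin_cases i <;> exact this
      obtain ⟨hGv, hFv⟩ := hball hclose
      rw [Real.dist_eq, hFl] at hFv
      have eG : G v = α₀ K ω * α₂ K ω - x K ω * (x K ω * (V K / S K)) := rfl
      have eF : F v = (α₂ K ω * β K ω - x K ω * y K ω) / G v := rfl
      have e0 : kernelSum n m ζ T ε W t b (fun _ => 1) K ω = S K * α₀ K ω :=
        (mul_div_cancel₀ _ hSK.ne').symm
      have e2 : kernelSum n m ζ T ε W t b (fun z => (z.2.1 - t) ^ 2) K ω = V K * α₂ K ω :=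
        (mul_div_cancel₀ _ hVK.ne').symm
      have e1 : kernelSum n m ζ T ε W t b (fun z => z.2.1 - t) K ω = V K * x K ω :=
        (mul_div_cancel₀ _ hVK.ne').symm
      have e3 : kernelSum n m ζ T ε W t b
          (fun z => meanRemainder Q X t z.2.1 + (fluct Q X z.2.1 z.1 + z.2.2)) K ω
          = V K * β K ω + N K ω := by
        rw [hβ]
        simp only
        rw [mul_div_cancel₀ _ hVK.ne', sub_add_cancel]
      have e4 : kernelSum n m ζ T ε W t b (fun z => (z.2.1 - t) * (meanRemainder Q X t z.2.1
          + (fluct Q X z.2.1 z.1 + z.2.2))) K ω = V K * y K ω :=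
        (mul_div_cancel₀ _ hVK.ne').symm
      have hdet : S K * α₀ K ω * (V K * α₂ K ω) - (V K * x K ω) ^ 2 = S K * V K * G v := by
        rw [eG]
        field_simp
      have hmain := estimate_sub_mean (Q := Q) (X := X) (n := n) (m := m) (ζ := ζ) (T := T)
        (ε := ε) (W := W) (t := t) η J K ω rfl
        (by
          rw [e0, e1, e2, hdet]
          exact mul_ne_zero (mul_pos hSK hVK).ne' hGv)
      rw [e0, e1, e2, e3, e4, hdet] at hmain
      have hrho : rho n m η J 2 K = V K / S K := rho_eq_bandSum_div η J 2 K
      rw [hmain, hrho, sub_zero]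
      refine lt_of_eq_of_lt (congrArg abs ?_) hFv
      rw [eF, ← eG]
      generalize G v = g at *
      field_simp
      ring

end Setting

end

section

variable {Ω E : Type*} [MeasurableSpace Ω] [MeasurableSpace E]
  {P : Measure Ω} [IsProbabilityMeasure P] {Q : Measure E} [IsProbabilityMeasure Q]
  {ν : Measure ℝ} [IsProbabilityMeasure ν]
  {n : ℕ → ℕ} {m : ℕ → ℕ → ℕ} {X : ℝ → E → ℝ} {f W : ℝ → ℝ}
  {ζ : ℕ → ℕ → Ω → E} {T ε : ℕ → ℕ → ℕ → Ω → ℝ} {t : ℝ} {b : ℕ → ℕ → ℝ} {c C : ℝ}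

/-! ### Asymptotic normality of the noise average -/

theorem exists_integral_kernel_pow_le (hW : KernelCond W) (hf : DensityCond f)
    [IsProbabilityMeasure (timeLaw f)] (t : ℝ) {p : ℕ} (hp : 1 ≤ p) :
    ∃ A : ℝ, 0 ≤ A ∧ ∀ r : ℝ, 0 < r →
      |∫ s, scaledKernel W r (s - t) ^ p ∂(timeLaw f)| ≤ A * r ^ (1 - p : ℤ) := by
  obtain ⟨A, hA, h⟩ := exists_integral_kernel_le (t := t) hW hf (φ := fun _ => 1) (M := 1) (q := 0)
    zero_le_one (by simp) hp
  exact ⟨A, hA, fun r hr => by simpa using h r hr⟩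

namespace Setting

theorem integral_kernel_nonneg (h : Setting P Q ν n m X f W ζ T ε t b c C) {r : ℝ} (hr : 0 < r)
    (p : ℕ) : 0 ≤ ∫ s, scaledKernel W r (s - t) ^ p ∂(timeLaw f) :=
  integral_nonneg fun _ => pow_nonneg (h.kernel.scaledKernel_nonneg hr _) p

/-- The variance of the noise average, up to a negligible term. -/
theorem tendsto_variance_sub (h : Setting P Q ν n m X f W ζ T ε t b c C) :
    Tendsto (fun K => (∑ k ∈ Finset.Icc 1 K, blockSize n m 1 k
        * ∫ s, scaledKernel W (b K k) (s - t) ^ 2 ∂(timeLaw f)) / bandSum n m b (-1) K) atTop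
        (𝓝 (f t * kernelR W)) ∧
    Tendsto (fun K => (∑ k ∈ Finset.Icc 1 K, blockSize n m 2 k
        * (∫ s, scaledKernel W (b K k) (s - t) ∂(timeLaw f)) ^ 2 - f t ^ 2 * totalSize n m 2 K)
        / (fifthRoot n m K ^ 6 + totalSize n m 2 K)) atTop (𝓝 0) := by
  have := h.sample.isProbabilityMeasure_timeLaw
  obtain ⟨A₁, hA₁, h₁⟩ := exists_integral_kernel_pow_le h.kernel h.density t (p := 1) le_rfl
  obtain ⟨A₂, hA₂, h₂⟩ := exists_integral_kernel_pow_le h.kernel h.density t (p := 2) (by norm_num)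
  constructor
  · exact h.band.tendsto_sum_div_bandSum h.size (q := -1) (M := A₂) (l := f t * kernelR W)
      (G := fun r => ∫ s, scaledKernel W r (s - t) ^ 2 ∂(timeLaw f)) (Or.inl rfl)
      (tendsto_integral_kernel_sq h.kernel h.density h.mem)
      (fun r hr => le_of_le_of_eq (h₂ r hr) (by norm_num))
  -- The number of pairs alone need not diverge, and may even be zero. Adding `u ^ 6`, the order of
  -- the other part of the variance, makes the normalisation diverge.
  · have hu : Tendsto (fun K => fifthRoot n m K ^ 6 + totalSize n m 2 K) atTop atTop :=
      tendsto_atTop_mono (fun K => le_add_of_nonneg_right (totalSize_nonneg 2 K))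
        ((tendsto_pow_atTop (by norm_num)).comp h.size.tendsto_fifthRoot)
    have := h.band.tendsto_sum_sub h.size (j := 2) (q := 0) (A := 1) (l := f t ^ 2) (M := A₁ ^ 2)
      (G := fun r => (∫ s, scaledKernel W r (s - t) ∂(timeLaw f)) ^ 2) hu
      (Eventually.of_forall fun K => by
        have := pow_nonneg (fifthRoot_nonneg (n := n) (m := m) K) 6
        simpa [totalSize] using this)
      (by simpa using (tendsto_integral_kernel h.kernel h.density h.mem).pow 2)
      (fun r hr => by
        rw [abs_pow]
        simpa using pow_le_pow_left₀ (abs_nonneg _) (h₁ r hr) 2)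
    simpa [totalSize] using this

/-- Moments of a normalised summand of the noise average. -/
theorem noise_summand (h : Setting P Q ν n m X f W ζ T ε t b c C) {r : ℝ} (hr : 0 < r) (d : ℝ)
    {g : E × ℝ × ℝ → ℝ} (hg : g = fun z => scaledKernel W r (z.2.1 - t) / d
      * (fluct Q X t z.1 + z.2.2)) :
    ∫ z, g z ∂(Q.prod ((timeLaw f).prod ν)) = 0 ∧
    ∫ z, g z ^ 2 ∂(Q.prod ((timeLaw f).prod ν))
      = (∫ s, scaledKernel W r (s - t) ^ 2 ∂(timeLaw f)) / d ^ 2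
        * (covFn Q X t t + variance id ν) ∧
    ∫ x, (∫ u, g (x, u) ∂((timeLaw f).prod ν)) ^ 2 ∂Q
      = (∫ s, scaledKernel W r (s - t) ∂(timeLaw f)) ^ 2 / d ^ 2 * covFn Q X t t := by
  have := h.sample.isProbabilityMeasure_timeLaw
  have ht := Ioo_subset_Icc_self h.mem
  have hΦ := h.process.memLp_two_fluct ht
  have hcov : ∫ x, fluct Q X t x ^ 2 ∂Q = covFn Q X t t := by
    simp only [sq]
    exact ProcessCond.integral_fluct_mul t t
  have hm : Measurable (Function.uncurry fun (_ : ℝ) x => fluct Q X t x) :=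
    h.process.measurable_fluct.comp (measurable_const.prodMk measurable_snd)
  have hw2 := memLp_kernel (f := f) h.kernel hr t 2
  obtain ⟨-, h2, -, h4⟩ := centred_summand (Q := Q) (τ := timeLaw f) h.noise
    (c := fun s => scaledKernel W r (s - t) / d) (Ψ := fun _ => fluct Q X t) (κ := 1)
    (A := fun _ => covFn Q X t t) ((measurable_kernel h.kernel r t).div_const d) hm
    (Eventually.of_forall fun _ => hΦ)
    (Eventually.of_forall fun _ => h.process.integral_fluct ht)
    (Eventually.of_forall fun _ => hcov.le)
    (by simpa only [div_pow] using (hw2.integrable_sq.div_const (d ^ 2)).mul_const _)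
  simp only [one_mul] at h2 h4
  subst hg
  refine ⟨h2, ?_, ?_⟩
  · have hH := memLp_add_noise h.noise hΦ (by norm_num) 1
    have h5 := integral_separable (τ := timeLaw f)
      (a := fun s => scaledKernel W r (s - t) ^ 2 / d ^ 2) (hw2.integrable_sq.div_const (d ^ 2))
      hH.integrable_sq
    rw [integral_add_noise_sq h.noise hΦ 1, hcov, integral_div] at h5
    simp only [one_mul, one_pow] at h5
    rw [← h5]
    simp only [mul_pow, div_pow]
  · rw [integral_congr_ae (g := fun x => ((∫ s, scaledKernel W r (s - t) ∂(timeLaw f)) / d) ^ 2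
      * fluct Q X t x ^ 2), integral_const_mul, hcov, div_pow]
    filter_upwards [h4] with x hx
    simp only [hx, integral_mul_const, integral_div, mul_pow]

/-- The cubed kernel integrates to order `b ^ (-2)`, so the sum is `O(u ^ 7)` before normalisation,
against `D ^ 3` of order at least `u ^ 9`. -/
theorem tendsto_third_one (h : Setting P Q ν n m X f W ζ T ε t b c C) {D : ℕ → ℝ} {κ : ℝ}
    (hκ : 0 < κ) (hD : ∀ᶠ K in atTop, κ * fifthRoot n m K ^ 3 ≤ D K) :
    Tendsto (fun K => ∑ k ∈ Finset.Icc 1 K, blockSize n m 1 k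
      * ∫ s, (scaledKernel W (b K k) (s - t) / D K) ^ 3 ∂(timeLaw f)) atTop (𝓝 0) := by
  have := h.sample.isProbabilityMeasure_timeLaw
  obtain ⟨A, hA, hbd⟩ := exists_integral_kernel_pow_le h.kernel h.density t (p := 3) (by norm_num)
  have h1 := h.tendsto_div_of_pow (g := fun K => ∑ k ∈ Finset.Icc 1 K, blockSize n m 1 k
      * ∫ s, scaledKernel W (b K k) (s - t) ^ 3 ∂(timeLaw f)) (D := fun K => D K ^ 3)
    (a := A * c⁻¹ ^ 2) (d := κ ^ 3) (p := 7) (q := 9) (by norm_num) (by positivity)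
    (fun K => Finset.sum_nonneg fun k hk => mul_nonneg (blockSize_nonneg _ _)
      (h.integral_kernel_nonneg (h.band.band_pos hk) 3)) (fun K => ?_) ?_
  · refine h1.congr fun K => ?_
    simp only [div_pow, integral_div]
    rw [Finset.sum_div]
    exact Finset.sum_congr rfl fun k _ => mul_div_assoc _ _ _
  · refine le_trans ?_ (le_of_le_of_eq (mul_le_mul_of_nonneg_left
      (h.band.bandSum_neg_le h.size 2 K) hA) (by ring))
    rw [bandSum, Finset.mul_sum]
    refine Finset.sum_le_sum fun k hk => ?_
    rw [mul_left_comm]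
    exact mul_le_mul_of_nonneg_left ((le_abs_self _).trans
      (le_of_le_of_eq (hbd _ (h.band.band_pos hk)) (by norm_num))) (blockSize_nonneg _ _)
  · filter_upwards [hD, eventually_ge_atTop 1] with K hK hK1
    have hu := h.size.fifthRoot_pos hK1
    have := pow_le_pow_left₀ (by positivity) hK 3
    exact le_trans (le_of_eq (by ring)) this

/-- Before normalisation the sum is `O(S_{K,2} u)`. Of `D ^ 3`, two factors absorb `S_{K,2}` and the
third is at least of order `u ^ 3`, which leaves `u ^ (-2)`. -/
theorem tendsto_third_two (h : Setting P Q ν n m X f W ζ T ε t b c C) {D : ℕ → ℝ} {κ : ℝ}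
    (hκ : 0 < κ) (hD : ∀ᶠ K in atTop, κ * fifthRoot n m K ^ 3 ≤ D K)
    (hD2 : ∀ᶠ K in atTop, κ ^ 2 * totalSize n m 2 K ≤ D K ^ 2) :
    Tendsto (fun K => ∑ k ∈ Finset.Icc 1 K, blockSize n m 2 k
      * ((∫ s, (scaledKernel W (b K k) (s - t) / D K) ^ 2 ∂(timeLaw f))
        * ∫ s, scaledKernel W (b K k) (s - t) / D K ∂(timeLaw f))) atTop (𝓝 0) := by
  have := h.sample.isProbabilityMeasure_timeLaw
  obtain ⟨A₁, hA₁, h₁⟩ := exists_integral_kernel_pow_le h.kernel h.density t (p := 1) le_rfl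
  obtain ⟨A₂, hA₂, h₂⟩ := exists_integral_kernel_pow_le h.kernel h.density t (p := 2) (by norm_num)
  simp only [pow_one] at h₁
  have h0 : ∀ K, ∀ k ∈ Finset.Icc 1 K, 0 ≤ ∫ s, scaledKernel W (b K k) (s - t) ∂(timeLaw f) :=
    fun K k hk => by simpa using h.integral_kernel_nonneg (h.band.band_pos hk) 1
  have hc := h.band.pos
  have lim : Tendsto (fun K => A₂ * c⁻¹ * A₁ / κ ^ 3 * (fifthRoot n m K ^ 2)⁻¹) atTop (𝓝 0) := by
    have := ((tendsto_pow_atTop (α := ℝ) (n := 2) (by norm_num)).comp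
      h.size.tendsto_fifthRoot).inv_tendsto_atTop.const_mul (A₂ * c⁻¹ * A₁ / κ ^ 3)
    simpa using this
  refine squeeze_zero' ?_ ?_ lim
  · filter_upwards [hD, eventually_ge_atTop 1] with K hK hK1
    have hu := h.size.fifthRoot_pos hK1
    have hDK : 0 < D K := lt_of_lt_of_le (by positivity) hK
    refine Finset.sum_nonneg fun k hk => mul_nonneg (blockSize_nonneg _ _) (mul_nonneg
      (integral_nonneg fun _ => sq_nonneg _) ?_)
    rw [integral_div]
    exact div_nonneg (h0 K k hk) hDK.le
  · filter_upwards [hD, hD2, eventually_ge_atTop 1] with K hK hK2 hK1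
    have hu := h.size.fifthRoot_pos hK1
    have hDK : 0 < D K := lt_of_lt_of_le (by positivity) hK
    calc _ ≤ ∑ k ∈ Finset.Icc 1 K, blockSize n m 2 k
          * (A₂ * (c⁻¹ * fifthRoot n m K) * A₁ / D K ^ 3) := by
          refine Finset.sum_le_sum fun k hk => mul_le_mul_of_nonneg_left ?_ (blockSize_nonneg _ _)
          simp only [div_pow, integral_div]
          rw [div_mul_div_comm, ← pow_succ]
          refine div_le_div_of_nonneg_right ?_ (by positivity)
          have hb := h.band.band_pos hk
          have e1 := (le_abs_self _).trans (h₁ _ hb)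
          have e2 := (le_abs_self _).trans (h₂ _ hb)
          norm_num at e1 e2
          have e3 : (b K k)⁻¹ ≤ c⁻¹ * fifthRoot n m K := by
            refine (h.band.inv_band_le h.size hk).trans ?_
            rw [div_eq_inv_mul]
            exact mul_le_mul_of_nonneg_left (fifthRoot_mono (Finset.mem_Icc.1 hk).2)
              (inv_nonneg.2 hc.le)
          exact mul_le_mul (e2.trans (mul_le_mul_of_nonneg_left e3 hA₂)) e1 (h0 K k hk)
            (by positivity)
      _ = κ ^ 2 * totalSize n m 2 K
          * (A₂ * c⁻¹ * A₁ / κ ^ 2 * fifthRoot n m K) / D K ^ 3 := by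
          rw [← Finset.sum_mul]
          change totalSize n m 2 K * _ = _
          field_simp
      _ ≤ D K ^ 2 * (A₂ * c⁻¹ * A₁ / κ ^ 2 * fifthRoot n m K) / D K ^ 3 := by gcongr
      _ = (A₂ * c⁻¹ * A₁ / κ ^ 2 * fifthRoot n m K) / D K := by field_simp
      _ ≤ (A₂ * c⁻¹ * A₁ / κ ^ 2 * fifthRoot n m K) / (κ * fifthRoot n m K ^ 3) := by gcongr
      _ = _ := by field_simp

/-- Before normalisation the sum is `O(S_{K,3})`. The size condition bounds `S_{K,3}` by a multiple
of `S_{K,2} ^ 2 / S_{K,1}`, and `D ^ 3` is at least of order `S_{K,2} ^ (3/2)`; this leaves the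
square root of `S_{K,2} / S_{K,1} ^ 2`. -/
theorem tendsto_third_three (h : Setting P Q ν n m X f W ζ T ε t b c C) {D : ℕ → ℝ} {κ : ℝ}
    (hκ : 0 < κ) (hD : ∀ᶠ K in atTop, κ * fifthRoot n m K ^ 3 ≤ D K)
    (hD2 : ∀ᶠ K in atTop, κ ^ 2 * totalSize n m 2 K ≤ D K ^ 2) :
    Tendsto (fun K => ∑ k ∈ Finset.Icc 1 K, blockSize n m 3 k
      * (∫ s, scaledKernel W (b K k) (s - t) / D K ∂(timeLaw f)) ^ 3) atTop (𝓝 0) := by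
  have := h.sample.isProbabilityMeasure_timeLaw
  obtain ⟨A₁, hA₁, h₁⟩ := exists_integral_kernel_pow_le h.kernel h.density t (p := 1) le_rfl
  obtain ⟨C₃, hC₃, h₃⟩ := h.size.exists_three_le
  simp only [pow_one] at h₁
  have h0 : ∀ K, ∀ k ∈ Finset.Icc 1 K, 0 ≤ ∫ s, scaledKernel W (b K k) (s - t) ∂(timeLaw f) :=
    fun K k hk => by simpa using h.integral_kernel_nonneg (h.band.band_pos hk) 1
  have lim : Tendsto (fun K => A₁ ^ 3 * C₃ / κ ^ 3
      * √(totalSize n m 2 K / totalSize n m 1 K ^ 2)) atTop (𝓝 0) := by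
    have := (h.size.tendsto_two_div_sq.sqrt).const_mul (A₁ ^ 3 * C₃ / κ ^ 3)
    simpa using this
  refine squeeze_zero' ?_ ?_ lim
  · filter_upwards [hD, eventually_ge_atTop 1] with K hK hK1
    have hu := h.size.fifthRoot_pos hK1
    have hDK : 0 < D K := lt_of_lt_of_le (by positivity) hK
    refine Finset.sum_nonneg fun k hk => mul_nonneg (blockSize_nonneg _ _) (pow_nonneg ?_ 3)
    rw [integral_div]
    exact div_nonneg (h0 K k hk) hDK.le
  · filter_upwards [hD, hD2, h₃, eventually_ge_atTop 1] with K hK hK2 hK3 hK1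
    have hu := h.size.fifthRoot_pos hK1
    have hS := h.size.totalSize_pos hK1
    have hS2 := totalSize_nonneg (n := n) (m := m) 2 K
    have hDK : 0 < D K := lt_of_lt_of_le (by positivity) hK
    have hroot : κ * √(totalSize n m 2 K) ≤ D K := by
      refine abs_le_of_sq_le_sq' ?_ hDK.le |>.2
      rwa [mul_pow, Real.sq_sqrt hS2]
    set q := √(totalSize n m 2 K) with hq
    have hq0 : 0 ≤ q := Real.sqrt_nonneg _
    have hq2 : totalSize n m 2 K = q ^ 2 := (Real.sq_sqrt hS2).symm
    calc _ ≤ ∑ k ∈ Finset.Icc 1 K, blockSize n m 3 k * (A₁ ^ 3 / D K ^ 3) := by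
          refine Finset.sum_le_sum fun k hk => mul_le_mul_of_nonneg_left ?_ (blockSize_nonneg _ _)
          rw [integral_div, div_pow]
          refine div_le_div_of_nonneg_right ?_ (by positivity)
          have e1 := (le_abs_self _).trans (h₁ _ (h.band.band_pos hk))
          norm_num at e1
          exact pow_le_pow_left₀ (h0 K k hk) e1 3
      _ = A₁ ^ 3 * (totalSize n m 1 K * totalSize n m 3 K) / (totalSize n m 1 K * D K ^ 3) := by
          rw [← Finset.sum_mul]
          change totalSize n m 3 K * _ = _
          field_simp
      _ ≤ A₁ ^ 3 * (C₃ * totalSize n m 2 K ^ 2) / (totalSize n m 1 K * D K ^ 3) := by gcongr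
      _ = A₁ ^ 3 * C₃ / κ ^ 3 * (q / totalSize n m 1 K) * ((κ * q) ^ 3 / D K ^ 3) := by
          rw [hq2]
          field_simp
      _ ≤ A₁ ^ 3 * C₃ / κ ^ 3 * (q / totalSize n m 1 K) * 1 := by
          gcongr
          exact div_le_one_of_le₀ (by gcongr) (by positivity)
      _ = _ := by
          rw [mul_one, Real.sqrt_div hS2, Real.sqrt_sq hS.le]

end Setting

end

/-! ### The central limit theorem for the noise sum at the point -/

section

variable {Ω E : Type*} [MeasurableSpace Ω] [MeasurableSpace E]
  {P : Measure Ω} [IsProbabilityMeasure P] {Q : Measure E} [IsProbabilityMeasure Q]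
  {ν : Measure ℝ} [IsProbabilityMeasure ν]
  {n : ℕ → ℕ} {m : ℕ → ℕ → ℕ} {X : ℝ → E → ℝ} {f W : ℝ → ℝ}
  {ζ : ℕ → ℕ → Ω → E} {T ε : ℕ → ℕ → ℕ → Ω → ℝ} {t : ℝ} {b : ℕ → ℕ → ℝ} {c C : ℝ}

/-- The asymptotic variance of `∑ W_{b_k}(T_{kij} - t) {Φ_{ki}(t) + ε_{kij}}`. -/
def noiseVar (Q : Measure E) (ν : Measure ℝ) (n : ℕ → ℕ) (m : ℕ → ℕ → ℕ) (X : ℝ → E → ℝ)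
    (f W : ℝ → ℝ) (t : ℝ) (b : ℕ → ℕ → ℝ) (K : ℕ) : ℝ :=
  f t * kernelR W * (covFn Q X t t + variance id ν) * bandSum n m b (-1) K
    + covFn Q X t t * f t ^ 2 * totalSize n m 2 K

theorem tendsto_zero_of_abs_le_mul {x y : ℕ → ℝ} (B : ℝ) (hx : Tendsto x atTop (𝓝 0))
    (hy : ∀ᶠ K in atTop, |y K| ≤ B * |x K|) : Tendsto y atTop (𝓝 0) := by
  have h : Tendsto (fun K => B * |x K|) atTop (𝓝 0) := by
    simpa using hx.abs.const_mul B
  exact squeeze_zero_norm' hy h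

namespace Setting

theorem covFn_nonneg (_h : Setting P Q ν n m X f W ζ T ε t b c C) : 0 ≤ covFn Q X t t :=
  ProcessCond.covFn_self_nonneg t

/-- The part of the variance due to single measurements alone gives both bounds. -/
theorem exists_le_noiseVar (h : Setting P Q ν n m X f W ζ T ε t b c C)
    (hτ : 0 < covFn Q X t t + variance id ν) : ∃ κ : ℝ, 0 < κ ∧ ∀ K,
      κ * bandSum n m b (-1) K ≤ noiseVar Q ν n m X f W t b K ∧
      κ * fifthRoot n m K ^ 6 ≤ noiseVar Q ν n m X f W t b K := by
  have hf := h.density.pos h.mem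
  have hR := h.kernel.kernelR_pos
  have hC := h.band.upper_pos
  have hγ := h.covFn_nonneg
  set A := f t * kernelR W * (covFn Q X t t + variance id ν) with hA
  have hA0 : 0 < A := by positivity
  refine ⟨min A (A * (5 / (6 * C))), by positivity, fun K => ?_⟩
  have hV := h.band.bandSum_nonneg (-1) K
  have hS := totalSize_nonneg (n := n) (m := m) 2 K
  have hu := fifthRoot_nonneg (n := n) (m := m) K
  have h1 := h.band.le_bandSum_neg_one K
  have h2 : 0 ≤ covFn Q X t t * f t ^ 2 * totalSize n m 2 K := by positivity
  have h3 : A * bandSum n m b (-1) K ≤ noiseVar Q ν n m X f W t b K := by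
    rw [noiseVar]
    linarith
  constructor
  · exact (mul_le_mul_of_nonneg_right (min_le_left _ _) hV).trans h3
  · refine (mul_le_mul_of_nonneg_right (min_le_right _ _) (pow_nonneg hu 6)).trans ?_
    rw [mul_assoc]
    exact (mul_le_mul_of_nonneg_left h1 hA0.le).trans h3

theorem noiseVar_pos (h : Setting P Q ν n m X f W ζ T ε t b c C)
    (hτ : 0 < covFn Q X t t + variance id ν) {K : ℕ} (hK : 1 ≤ K) :
    0 < noiseVar Q ν n m X f W t b K := by
  obtain ⟨κ, hκ, hle⟩ := h.exists_le_noiseVar hτ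
  exact (mul_pos hκ (pow_pos (h.size.fifthRoot_pos hK) 6)).trans_le (hle K).2

theorem measurable_fluct_at (h : Setting P Q ν n m X f W ζ T ε t b c C) :
    Measurable (fluct Q X t) :=
  h.process.measurable_fluct.comp (measurable_const.prodMk measurable_id)

theorem kernelSum_div (φ : E × ℝ × ℝ → ℝ) (D : ℝ) (K : ℕ) (ω : Ω) :
    kernelSum n m ζ T ε W t b φ K ω / D
      = tripleSum n m ζ T ε (fun k z => scaledKernel W (b K k) (z.2.1 - t) / D * φ z) K ω := by
  rw [kernelSum, div_eq_inv_mul, ← tripleSum_const_mul]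
  congr 1
  ext k z
  ring

/-- A positive `γ(t,t)` makes the variance dominate `S_{K,2}` besides `u ^ 6`. The third moments of
sums over pairs and triples within a subject can then be absorbed. -/
theorem clt_noise_of_cov_pos (h : Setting P Q ν n m X f W ζ T ε t b c C)
    (hγ : 0 < covFn Q X t t) :
    TendstoInDistribution (fun K ω => kernelSum n m ζ T ε W t b
      (fun z => fluct Q X t z.1 + z.2.2) K ω / √(noiseVar Q ν n m X f W t b K)) atTop id
      (fun _ => P) (gaussianReal 0 1) := by
  have := h.sample.isProbabilityMeasure_timeLaw
  set v : ℕ → ℝ := noiseVar Q ν n m X f W t b with hv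
  have hτ : 0 < covFn Q X t t + variance id ν := add_pos_of_pos_of_nonneg hγ (variance_nonneg _ _)
  have hf := h.density.pos h.mem
  have hR := h.kernel.kernelR_pos
  obtain ⟨κ₁, hκ₁, hle⟩ := h.exists_le_noiseVar hτ
  set κ := min κ₁ (covFn Q X t t * f t ^ 2) with hκdef
  have hκ : 0 < κ := lt_min hκ₁ (by positivity)
  have hvu : ∀ K, κ * fifthRoot n m K ^ 6 ≤ v K := fun K =>
    (mul_le_mul_of_nonneg_right (min_le_left _ _) (pow_nonneg (fifthRoot_nonneg K) 6)).trans
      (hle K).2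
  have hvS : ∀ K, κ * totalSize n m 2 K ≤ v K := fun K => by
    refine (mul_le_mul_of_nonneg_right (min_le_right _ _) (totalSize_nonneg 2 K)).trans ?_
    have hV := h.band.bandSum_nonneg (-1) K
    have : 0 ≤ f t * kernelR W * (covFn Q X t t + variance id ν) * bandSum n m b (-1) K := by
      positivity
    rw [hv, noiseVar]
    linarith
  have hvpos : ∀ K, 1 ≤ K → 0 < v K := fun K hK => h.noiseVar_pos hτ hK
  have hv0 : ∀ K, 0 ≤ v K := fun K => (mul_nonneg hκ.le (pow_nonneg (fifthRoot_nonneg K) 6)).trans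
    (hvu K)
  have hD1 : ∀ᶠ K in atTop, √κ * fifthRoot n m K ^ 3 ≤ √(v K) := Eventually.of_forall fun K => by
    refine Real.le_sqrt_of_sq_le (le_of_eq_of_le ?_ (hvu K))
    rw [mul_pow, Real.sq_sqrt hκ.le]
    ring
  have hD2 : ∀ᶠ K in atTop, √κ ^ 2 * totalSize n m 2 K ≤ √(v K) ^ 2 :=
    Eventually.of_forall fun K => by
      rw [Real.sq_sqrt hκ.le, Real.sq_sqrt (hv0 K)]
      exact hvS K
  have hsq : 0 < √κ := Real.sqrt_pos.2 hκ
  set g : ℕ → ℕ → E × ℝ × ℝ → ℝ := fun K k z =>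
    scaledKernel W (b K k) (z.2.1 - t) / √(v K) * (fluct Q X t z.1 + z.2.2) with hg
  have hmΦ := h.measurable_fluct_at
  have hmW : ∀ K k, Measurable fun s => scaledKernel W (b K k) (s - t) := fun K k =>
    measurable_kernel h.kernel _ t
  have hsum : ∀ K, ∀ k ∈ Finset.Icc 1 K, _ := fun K k hk =>
    h.noise_summand (h.band.band_pos hk) (√(v K)) (g := g K k) rfl
  have habs : ∀ K, ∀ k ∈ Finset.Icc 1 K, ∀ s, |scaledKernel W (b K k) (s - t)|
      = scaledKernel W (b K k) (s - t) := fun K k hk s =>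
    abs_of_nonneg (h.kernel.scaledKernel_nonneg (h.band.band_pos hk) _)
  have key := h.sample.clt_subjects (n := n) (m := m) (g := g) (v := 1)
    (w := fun K k s => |scaledKernel W (b K k) (s - t)| / √(v K))
    (H := fun y => |fluct Q X t y.1| + |y.2|)
    (fun K k => by
      have := (hmW K k).comp (measurable_fst.comp measurable_snd : Measurable fun z : E × ℝ × ℝ =>
        z.2.1)
      exact (this.div_const _).mul ((hmΦ.comp measurable_fst).add
        (measurable_snd.comp measurable_snd)))
    (fun K k => (hmW K k).abs.div_const _)
    ((hmΦ.comp measurable_fst).abs.add measurable_snd.abs)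
    (fun K k s => by positivity) (fun y => by positivity)
    (fun K k hk => by
      simpa only [div_eq_mul_inv, Real.norm_eq_abs] using
        (memLp_kernel (f := f) h.kernel (h.band.band_pos hk) t 3).norm.mul_const (√(v K))⁻¹)
    (by
      have h1 := ((h.process.memLp_fluct (Ioo_subset_Icc_self h.mem)).comp_fst ν).norm
      have h2 := (MemLp.comp_snd (f := id) h.noise.moment Q).norm
      exact h1.add h2)
    (fun K k x s e => by
      simp only [hg]
      rw [abs_mul, abs_div, abs_of_nonneg (Real.sqrt_nonneg (v K))]
      exact mul_le_mul_of_nonneg_left (abs_add_le _ _) (by positivity))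
    (fun K k hk => (hsum K k hk).1) ?_ ?_
  · simpa only [kernelSum_div] using key
  · obtain ⟨lim1, lim2⟩ := h.tendsto_variance_sub
    set a : ℕ → ℝ := fun K => ∑ k ∈ Finset.Icc 1 K, blockSize n m 1 k
        * ∫ s, scaledKernel W (b K k) (s - t) ^ 2 ∂(timeLaw f) with ha
    set d : ℕ → ℝ := fun K => ∑ k ∈ Finset.Icc 1 K, blockSize n m 2 k
        * (∫ s, scaledKernel W (b K k) (s - t) ∂(timeLaw f)) ^ 2 with hd
    have lim1' := (lim1.sub_const (f t * kernelR W))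
    rw [sub_self] at lim1'
    have z1 : Tendsto (fun K => (a K - f t * kernelR W * bandSum n m b (-1) K) / v K) atTop
        (𝓝 0) := by
      refine tendsto_zero_of_abs_le_mul κ₁⁻¹ lim1' ?_
      filter_upwards [eventually_ge_atTop 1] with K hK
      have hV := h.band.bandSum_neg_one_pos h.size hK
      rw [div_sub' hV.ne', abs_div, abs_div, abs_of_pos hV, abs_of_pos (hvpos K hK),
        ← div_eq_inv_mul, div_div, mul_comm (bandSum n m b (-1) K) κ₁,
        mul_comm (bandSum n m b (-1) K) (f t * kernelR W)]
      exact div_le_div_of_nonneg_left (abs_nonneg _) (by positivity) (hle K).1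
    -- The variance is at least `κ u ^ 6` and at least `κ S_{K,2}`, hence at least `κ / 2` times
    -- their sum, the normalisation in `lim2`.
    have z2 : Tendsto (fun K => (d K - f t ^ 2 * totalSize n m 2 K) / v K) atTop (𝓝 0) := by
      refine tendsto_zero_of_abs_le_mul (κ / 2)⁻¹ lim2 ?_
      filter_upwards [eventually_ge_atTop 1] with K hK
      have hS := totalSize_nonneg (n := n) (m := m) 2 K
      have hu := h.size.fifthRoot_pos hK
      have hB : 0 < fifthRoot n m K ^ 6 + totalSize n m 2 K := by positivity
      rw [abs_div, abs_div, abs_of_pos hB, abs_of_pos (hvpos K hK), ← div_eq_inv_mul, div_div]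
      refine div_le_div_of_nonneg_left (abs_nonneg _) (by positivity) ?_
      have := hvu K
      have := hvS K
      linarith
    have z := ((z1.const_mul (covFn Q X t t + variance id ν)).add
      (z2.const_mul (covFn Q X t t))).add_const 1
    simp only [mul_zero, zero_add] at z
    refine Tendsto.congr' ?_ z
    filter_upwards [eventually_ge_atTop 1] with K hK
    have hvK := hvpos K hK
    have e1 : ∑ k ∈ Finset.Icc 1 K, blockSize n m 1 k
        * ∫ z, g K k z ^ 2 ∂(Q.prod ((timeLaw f).prod ν))
        = a K / v K * (covFn Q X t t + variance id ν) := by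
      rw [ha, Finset.sum_div, Finset.sum_mul]
      refine Finset.sum_congr rfl fun k hk => ?_
      rw [(hsum K k hk).2.1, Real.sq_sqrt hvK.le]
      ring
    have e2 : ∑ k ∈ Finset.Icc 1 K, blockSize n m 2 k
        * ∫ x, (∫ u, g K k (x, u) ∂((timeLaw f).prod ν)) ^ 2 ∂Q = d K / v K * covFn Q X t t := by
      rw [hd, Finset.sum_div, Finset.sum_mul]
      refine Finset.sum_congr rfl fun k hk => ?_
      rw [(hsum K k hk).2.2, Real.sq_sqrt hvK.le]
      ring
    rw [e1, e2]
    have ev : v K = f t * kernelR W * (covFn Q X t t + variance id ν) * bandSum n m b (-1) K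
      + covFn Q X t t * f t ^ 2 * totalSize n m 2 K := rfl
    rw [← sub_eq_zero]
    field_simp
    rw [ev]
    ring
  · have h1 := ((h.tendsto_third_one hsq hD1).add (h.tendsto_third_two hsq hD1 hD2)).add
      (h.tendsto_third_three hsq hD1 hD2)
    simp only [add_zero] at h1
    refine h1.congr fun K => ?_
    refine congrArg₂ _ (congrArg₂ _ ?_ ?_) ?_ <;>
      exact Finset.sum_congr rfl fun k hk => by simp only [habs K k hk]

/-- A centred variable of zero variance vanishes almost surely, simultaneously for the countably
many subjects. -/
theorem kernelSum_congr_ae (h : Setting P Q ν n m X f W ζ T ε t b c C)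
    (hγ : covFn Q X t t = 0) (K : ℕ) :
    ∀ᵐ ω ∂P, kernelSum n m ζ T ε W t b (fun z => fluct Q X t z.1 + z.2.2) K ω
      = kernelSum n m ζ T ε W t b (fun z => z.2.2) K ω := by
  have hΦ : ∀ᵐ x ∂Q, fluct Q X t x = 0 := by
    have h1 : ∫ x, fluct Q X t x ^ 2 ∂Q = 0 := by
      simp only [sq]
      exact (ProcessCond.integral_fluct_mul t t).trans hγ
    have h2 := (integral_eq_zero_iff_of_nonneg (fun _ => sq_nonneg _)
      (h.process.memLp_two_fluct (Ioo_subset_Icc_self h.mem)).integrable_sq).1 h1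
    filter_upwards [h2] with x hx
    simpa using hx
  have h3 : ∀ᵐ ω ∂P, ∀ k i, fluct Q X t (ζ k i ω) = 0 := by
    refine ae_all_iff.2 fun k => ae_all_iff.2 fun i => ?_
    have h4 : ∀ᵐ x ∂(P.map (ζ k i)), fluct Q X t x = 0 := by
      rw [h.sample.law_traj k i]
      exact hΦ
    exact ae_of_ae_map (h.sample.measurable_traj k i).aemeasurable h4
  filter_upwards [h3] with ω hω
  exact tripleSum_congr fun k _ i j => by simp only [hω, zero_add]

/-- The variance no longer controls `S_{K,2}`, so summing by subject is not viable. But only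
products of kernel and noise are left; they are independent over all measurements, and the diagonal
third moments suffice. -/
theorem clt_noise_of_cov_zero (h : Setting P Q ν n m X f W ζ T ε t b c C)
    (hγ : covFn Q X t t = 0) (hσ : 0 < variance id ν) :
    TendstoInDistribution (fun K ω => kernelSum n m ζ T ε W t b
      (fun z => fluct Q X t z.1 + z.2.2) K ω / √(noiseVar Q ν n m X f W t b K)) atTop id
      (fun _ => P) (gaussianReal 0 1) := by
  have := h.sample.isProbabilityMeasure_timeLaw
  have hmΦ := h.measurable_fluct_at
  set v : ℕ → ℝ := noiseVar Q ν n m X f W t b with hv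
  have hτ : 0 < covFn Q X t t + variance id ν := by rwa [hγ, zero_add]
  have hf := h.density.pos h.mem
  have hR := h.kernel.kernelR_pos
  obtain ⟨κ, hκ, hle⟩ := h.exists_le_noiseVar hτ
  have hvpos : ∀ K, 1 ≤ K → 0 < v K := fun K hK => h.noiseVar_pos hτ hK
  have hD1 : ∀ᶠ K in atTop, √κ * fifthRoot n m K ^ 3 ≤ √(v K) := Eventually.of_forall fun K => by
    refine Real.le_sqrt_of_sq_le (le_of_eq_of_le ?_ (hle K).2)
    rw [mul_pow, Real.sq_sqrt hκ.le]
    ring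
  have hsq : 0 < √κ := Real.sqrt_pos.2 hκ
  have hmom : ∀ p : ℕ, ∀ K k, ∫ z : ℝ × ℝ, |scaledKernel W (b K k) (z.1 - t) / √(v K) * z.2| ^ p
      ∂((timeLaw f).prod ν) = (∫ s, |scaledKernel W (b K k) (s - t) / √(v K)| ^ p ∂(timeLaw f))
        * ∫ e, |e| ^ p ∂ν := fun p K k => by
    simp only [abs_mul, mul_pow]
    exact integral_prod_mul (μ := timeLaw f) (ν := ν)
      (fun s => |scaledKernel W (b K k) (s - t) / √(v K)| ^ p) (fun e => |e| ^ p)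
  have key := h.sample.clt_measurements (n := n) (m := m) (v := 1)
    (g := fun K k z => scaledKernel W (b K k) (z.1 - t) / √(v K) * z.2)
    (fun K k => (((measurable_kernel h.kernel _ t).comp measurable_fst).div_const _).mul
      measurable_snd)
    (fun K k hk => ?_) (fun K k hk => ?_) ?_ ?_
  · refine tendstoInDistribution_congr_law key aemeasurable_id rfl (fun K => ?_)
      (Eventually.of_forall fun K => ?_)
    · exact ((h.measurable_kernelSum (by fun_prop) K).div_const _).aemeasurable
    · filter_upwards [h.kernelSum_congr_ae hγ K] with ω hω
      rw [hω, kernelSum_div]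
  · have h1 : MemLp (fun s => scaledKernel W (b K k) (s - t) / √(v K)) 3 (timeLaw f) := by
      simpa only [div_eq_mul_inv] using
        (memLp_kernel (f := f) h.kernel (h.band.band_pos hk) t 3).mul_const (√(v K))⁻¹
    obtain ⟨B, hB, hWB⟩ := h.kernel.exists_bound
    refine (MemLp.comp_snd (f := id) h.noise.moment (timeLaw f)).of_le_mul
      (c := B / b K k / √(v K))
      (((((measurable_kernel h.kernel _ t).comp measurable_fst).div_const _).mul
        measurable_snd).aestronglyMeasurable) (Eventually.of_forall fun z => ?_)
    rw [norm_mul, norm_div, Real.norm_eq_abs, Real.norm_eq_abs (√(v K)),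
      abs_of_nonneg (Real.sqrt_nonneg _),
      abs_of_nonneg (h.kernel.scaledKernel_nonneg (h.band.band_pos hk) _)]
    refine mul_le_mul_of_nonneg_right (div_le_div_of_nonneg_right ?_ (Real.sqrt_nonneg _))
      (norm_nonneg _)
    exact div_le_div_of_nonneg_right (hWB _) (h.band.band_pos hk).le
  · have := integral_prod_mul (μ := timeLaw f) (ν := ν)
      (fun s => scaledKernel W (b K k) (s - t) / √(v K)) (fun e => e)
    rw [this, h.noise.mean_zero, mul_zero]
  · have lim := h.tendsto_variance_sub.1.div_const (f t * kernelR W)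
    rw [div_self (by positivity)] at lim
    refine lim.congr' ?_
    filter_upwards [eventually_ge_atTop 1] with K hK
    have hV := h.band.bandSum_neg_one_pos h.size hK
    have ev : v K = f t * kernelR W * variance id ν * bandSum n m b (-1) K := by
      simp [hv, noiseVar, hγ]
    have hvK := hvpos K hK
    have e1 : ∀ k, ∫ z : ℝ × ℝ, (scaledKernel W (b K k) (z.1 - t) / √(v K) * z.2) ^ 2
        ∂((timeLaw f).prod ν)
        = (∫ s, scaledKernel W (b K k) (s - t) ^ 2 ∂(timeLaw f)) / v K * variance id ν := by
      intro k
      have := hmom 2 K k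
      simp only [sq_abs, div_pow, integral_div, h.noise.integral_sq] at this
      rw [this, Real.sq_sqrt hvK.le]
    simp only [e1]
    rw [div_div, Finset.sum_div]
    refine Finset.sum_congr rfl fun k _ => ?_
    rw [ev]
    field_simp
  · have h1 := (h.tendsto_third_one hsq hD1).mul_const (∫ e, |e| ^ 3 ∂ν)
    rw [zero_mul] at h1
    refine h1.congr fun K => ?_
    rw [Finset.sum_mul]
    refine Finset.sum_congr rfl fun k hk => ?_
    rw [hmom 3 K k, mul_assoc]
    have : ∀ s, |scaledKernel W (b K k) (s - t) / √(v K)|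
        = scaledKernel W (b K k) (s - t) / √(v K) := fun s => abs_of_nonneg
      (div_nonneg (h.kernel.scaledKernel_nonneg (h.band.band_pos hk) _) (Real.sqrt_nonneg _))
    simp only [this]

/-- The normalised noise average is asymptotically standard normal. -/
theorem clt_noise (h : Setting P Q ν n m X f W ζ T ε t b c C)
    (hτ : 0 < covFn Q X t t + variance id ν) :
    TendstoInDistribution (fun K ω => kernelSum n m ζ T ε W t b
      (fun z => fluct Q X t z.1 + z.2.2) K ω / √(noiseVar Q ν n m X f W t b K)) atTop id
      (fun _ => P) (gaussianReal 0 1) := by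
  rcases h.covFn_nonneg.eq_or_lt with h0 | h0
  · exact h.clt_noise_of_cov_zero h0.symm (by rwa [← h0, zero_add] at hτ)
  · exact h.clt_noise_of_cov_pos h0

theorem noise_eq_zero (h : Setting P Q ν n m X f W ζ T ε t b c C)
    (hτ : covFn Q X t t + variance id ν = 0) (K : ℕ) :
    ∀ᵐ ω ∂P, kernelSum n m ζ T ε W t b (fun z => fluct Q X t z.1 + z.2.2) K ω = 0 := by
  have hγ := h.covFn_nonneg
  have hσ := variance_nonneg id ν
  have h1 : ∀ᵐ e ∂ν, e = 0 := by
    have h2 : ∫ e, e ^ 2 ∂ν = 0 := by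
      rw [h.noise.integral_sq]
      linarith
    have h3 := (integral_eq_zero_iff_of_nonneg (fun _ => sq_nonneg _)
      h.noise.memLp_two.integrable_sq).1 h2
    filter_upwards [h3] with x hx
    simpa using hx
  have h3 : ∀ᵐ ω ∂P, ∀ k i j, ε k i j ω = 0 := by
    refine ae_all_iff.2 fun k => ae_all_iff.2 fun i => ae_all_iff.2 fun j => ?_
    have h4 := h.sample.law_noise k i j
    rw [← h4] at h1
    exact ae_of_ae_map (h.sample.measurable_noise k i j).aemeasurable h1
  filter_upwards [h3, h.kernelSum_congr_ae (by linarith) K] with ω hω hω'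
  rw [hω']
  simp only [kernelSum, tripleSum, subjectSum, hω, mul_zero, Finset.sum_const_zero]

end Setting

end

section

variable {Ω E : Type*} [MeasurableSpace Ω] [MeasurableSpace E]
  {P : Measure Ω} [IsProbabilityMeasure P] {Q : Measure E} [IsProbabilityMeasure Q]
  {ν : Measure ℝ} [IsProbabilityMeasure ν]
  {n : ℕ → ℕ} {m : ℕ → ℕ → ℕ} {X : ℝ → E → ℝ} {f W : ℝ → ℝ}
  {ζ : ℕ → ℕ → Ω → E} {T ε : ℕ → ℕ → ℕ → Ω → ℝ} {t : ℝ} {b : ℕ → ℕ → ℝ} {c C : ℝ}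

/-! ### Sampling regimes -/

/-- The quotient that defines the regimes is `S / N ^ (5/4)`; its power `4/5` is `S ^ (4/5) / N`,
the form in which the bounds on the variance ratio come out. -/
theorem SizeCond.rpow_avgSize_div (hs : SizeCond n m) {K : ℕ} (hK : 1 ≤ K) :
    (avgSize n m 1 K / numSubjects n K ^ (1 / 4 : ℝ)) ^ (4 / 5 : ℝ)
      = fifthRoot n m K ^ 4 / numSubjects n K := by
  have hN := hs.numSubjects_pos hK
  have hS := hs.totalSize_pos hK
  rw [avgSize, div_div, Real.div_rpow hS.le (by positivity),
    Real.mul_rpow hN.le (by positivity), ← Real.rpow_mul hN.le, ← Real.rpow_add hN, fifthRoot,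
    ← Real.rpow_natCast, ← Real.rpow_mul hS.le]
  norm_num

theorem SizeCond.tendsto_ratio_lower (hs : SizeCond n m) (c : ℝ) {y : ℝ}
    (hy : Tendsto (fun K => fifthRoot n m K ^ 4 / numSubjects n K) atTop (𝓝 y)) :
    Tendsto (fun K => c * (fifthRoot n m K ^ 4 / numSubjects n K - (fifthRoot n m K)⁻¹)) atTop
      (𝓝 (c * y)) := by
  simpa using (hy.sub hs.tendsto_fifthRoot.inv_tendsto_atTop).const_mul c

namespace BandwidthBound

/-- By the size condition the numerator is at most a multiple of `u ^ 10 / N`; the denominator is at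
least a multiple of `u ^ 6`. -/
theorem exists_ratio_le (hs : SizeCond n m) (hb : BandwidthBound n m b c C) :
    ∃ A : ℝ, 0 < A ∧ ∀ᶠ K in atTop, totalSize n m 2 K / bandSum n m b (-1) K
      ≤ A * (fifthRoot n m K ^ 4 / numSubjects n K) := by
  obtain ⟨A, hA, h⟩ := hs.exists_two_le
  have hC := hb.upper_pos
  refine ⟨A * (6 * C / 5), by positivity, ?_⟩
  filter_upwards [h, eventually_ge_atTop 1] with K hK hK1
  have hu := hs.fifthRoot_pos hK1
  have hN := hs.numSubjects_pos hK1
  rw [← fifthRoot_pow] at hK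
  calc _ ≤ A * (fifthRoot n m K ^ 5) ^ 2 / numSubjects n K
        / (5 / (6 * C) * fifthRoot n m K ^ 6) :=
        div_le_div₀ (by positivity) ((le_div_iff₀ hN).2 hK) (by positivity)
          (hb.le_bandSum_neg_one K)
    _ = _ := by field_simp

/-- By Cauchy-Schwarz the numerator is at least `u ^ 10 / N - u ^ 5`, and the denominator is at most
`u ^ 6 / c`. The correction `1 / u` tends to zero. -/
theorem le_ratio (hs : SizeCond n m) (hb : BandwidthBound n m b c C) {K : ℕ} (hK : 1 ≤ K) :
    c * (fifthRoot n m K ^ 4 / numSubjects n K - (fifthRoot n m K)⁻¹)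
      ≤ totalSize n m 2 K / bandSum n m b (-1) K := by
  have hu := hs.fifthRoot_pos hK
  have hN := hs.numSubjects_pos hK
  have hV := hb.bandSum_neg_one_pos hs hK
  have hc := hb.pos
  have h1 := sq_totalSize_le (n := n) (m := m) K
  rw [← fifthRoot_pow] at h1
  have h2 : bandSum n m b (-1) K ≤ c⁻¹ * fifthRoot n m K ^ 6 := by
    simpa using hb.bandSum_neg_le hs 1 K
  have h3 : (fifthRoot n m K ^ 5) ^ 2 / numSubjects n K - fifthRoot n m K ^ 5
      ≤ totalSize n m 2 K := by
    rw [sub_le_iff_le_add, div_le_iff₀ hN]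
    linarith
  calc _ = ((fifthRoot n m K ^ 5) ^ 2 / numSubjects n K - fifthRoot n m K ^ 5)
        / (c⁻¹ * fifthRoot n m K ^ 6) := by field_simp
    _ ≤ totalSize n m 2 K / (c⁻¹ * fifthRoot n m K ^ 6) :=
        div_le_div_of_nonneg_right h3 (by positivity)
    _ ≤ _ := div_le_div_of_nonneg_left (totalSize_nonneg 2 K) hV h2

theorem tendsto_ratio_zero (hs : SizeCond n m) (hb : BandwidthBound n m b c C)
    (hy : Tendsto (fun K => fifthRoot n m K ^ 4 / numSubjects n K) atTop (𝓝 0)) :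
    Tendsto (fun K => totalSize n m 2 K / bandSum n m b (-1) K) atTop (𝓝 0) := by
  obtain ⟨A, hA, h⟩ := hb.exists_ratio_le hs
  refine squeeze_zero' (Eventually.of_forall fun K => div_nonneg (totalSize_nonneg 2 K)
    (hb.bandSum_nonneg _ K)) h ?_
  simpa using hy.const_mul A

theorem isTheta_ratio (hs : SizeCond n m) (hb : BandwidthBound n m b c C) {y : ℝ} (hy0 : 0 < y)
    (hy : Tendsto (fun K => fifthRoot n m K ^ 4 / numSubjects n K) atTop (𝓝 y)) :
    (fun K => totalSize n m 2 K / bandSum n m b (-1) K) =Θ[atTop] fun _ => (1 : ℝ) := by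
  obtain ⟨A, hA, h⟩ := hb.exists_ratio_le hs
  have hc := hb.pos
  have h0 : ∀ K, 0 ≤ totalSize n m 2 K / bandSum n m b (-1) K := fun K =>
    div_nonneg (totalSize_nonneg 2 K) (hb.bandSum_nonneg _ K)
  constructor
  · refine IsBigO.of_bound (A * (y + 1)) ?_
    filter_upwards [h, hy.eventually (gt_mem_nhds (lt_add_one y))] with K hK hK2
    rw [Real.norm_of_nonneg (h0 K), norm_one, mul_one]
    exact hK.trans (mul_le_mul_of_nonneg_left hK2.le hA.le)
  · refine IsBigO.of_bound (c * y / 2)⁻¹ ?_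
    have hcy : 0 < c * y := by positivity
    filter_upwards [(hs.tendsto_ratio_lower c hy).eventually (lt_mem_nhds (half_lt_self hcy)),
      eventually_ge_atTop 1] with K hK hK1
    rw [Real.norm_of_nonneg (h0 K), norm_one, inv_mul_eq_div, one_le_div (by positivity)]
    exact hK.le.trans (hb.le_ratio hs hK1)

theorem ratio_limit_pos (hs : SizeCond n m) (hb : BandwidthBound n m b c C) {y r : ℝ} (hy0 : 0 < y)
    (hy : Tendsto (fun K => fifthRoot n m K ^ 4 / numSubjects n K) atTop (𝓝 y))
    (hr : Tendsto (fun K => totalSize n m 2 K / bandSum n m b (-1) K) atTop (𝓝 r)) : 0 < r := by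
  refine lt_of_lt_of_le (mul_pos hb.pos hy0)
    (le_of_tendsto_of_tendsto (hs.tendsto_ratio_lower c hy) hr ?_)
  filter_upwards [eventually_ge_atTop 1] with K hK using hb.le_ratio hs hK

theorem tendsto_ratio_atTop (hs : SizeCond n m) (hb : BandwidthBound n m b c C)
    (hy : Tendsto (fun K => fifthRoot n m K ^ 4 / numSubjects n K) atTop atTop) :
    Tendsto (fun K => totalSize n m 2 K / bandSum n m b (-1) K) atTop atTop := by
  have h1 : Tendsto (fun K => c * (fifthRoot n m K ^ 4 / numSubjects n K - (fifthRoot n m K)⁻¹))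
      atTop atTop := by
    refine Tendsto.const_mul_atTop hb.pos ?_
    have h2 : Tendsto (fun K => -(fifthRoot n m K)⁻¹) atTop (𝓝 (-0)) :=
      hs.tendsto_fifthRoot.inv_tendsto_atTop.neg
    simpa only [sub_eq_add_neg] using hy.atTop_add h2
  refine tendsto_atTop_mono' _ ?_ h1
  filter_upwards [eventually_ge_atTop 1] with K hK using hb.le_ratio hs hK

end BandwidthBound

/-- Divergence of `u ^ 4 / N` forces `2 N ≤ S_1`, so in the Cauchy-Schwarz bound `S_1 ^ 2 ≤ N (S_2 +
S_1)` the last term is at most half of the left side. -/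
theorem SizeCond.eventually_sq_totalSize_le (hs : SizeCond n m)
    (hy : Tendsto (fun K => fifthRoot n m K ^ 4 / numSubjects n K) atTop atTop) :
    ∀ᶠ K in atTop, 0 < totalSize n m 2 K ∧
      totalSize n m 1 K ^ 2 / totalSize n m 2 K ≤ 2 * numSubjects n K := by
  filter_upwards [hy.eventually_ge_atTop 2, hs.tendsto_fifthRoot.eventually_ge_atTop 1,
    eventually_ge_atTop 1] with K hK hu hK1
  have hN := hs.numSubjects_pos hK1
  have hS := hs.totalSize_pos hK1
  rw [le_div_iff₀ hN] at hK
  have h1 : 2 * numSubjects n K ≤ totalSize n m 1 K := by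
    rw [← fifthRoot_pow]
    exact hK.trans (pow_le_pow_right₀ hu (by norm_num))
  have h2 := sq_totalSize_le (n := n) (m := m) K
  have h3 : totalSize n m 1 K ≤ totalSize n m 2 K := by nlinarith
  have h4 : 0 < totalSize n m 2 K := hS.trans_le h3
  refine ⟨h4, ?_⟩
  rw [div_le_iff₀ h4]
  nlinarith

theorem SizeCond.isTheta_numSubjects (hs : SizeCond n m)
    (hy : Tendsto (fun K => fifthRoot n m K ^ 4 / numSubjects n K) atTop atTop) :
    (fun K => totalSize n m 1 K ^ 2 / totalSize n m 2 K) =Θ[atTop] numSubjects n := by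
  obtain ⟨A, hA, h⟩ := hs.exists_two_le
  have h0 : ∀ K, 0 ≤ totalSize n m 1 K ^ 2 / totalSize n m 2 K := fun K =>
    div_nonneg (sq_nonneg _) (totalSize_nonneg 2 K)
  constructor
  · refine IsBigO.of_bound 2 ?_
    filter_upwards [hs.eventually_sq_totalSize_le hy, eventually_ge_atTop 1] with K hK hK1
    rw [Real.norm_of_nonneg (h0 K), Real.norm_of_nonneg (hs.numSubjects_pos hK1).le]
    exact hK.2
  · refine IsBigO.of_bound A ?_
    filter_upwards [hs.eventually_sq_totalSize_le hy, h, eventually_ge_atTop 1] with K hK hK2 hK1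
    rw [Real.norm_of_nonneg (h0 K), Real.norm_of_nonneg (hs.numSubjects_pos hK1).le,
      ← mul_div_assoc, le_div_iff₀ hK.1, mul_comm]
    exact hK2

/-- In the ultra dense regime the smoothing bias is negligible. -/
theorem BandwidthBound.tendsto_sqrt_mul_rho_two (hs : SizeCond n m)
    (hb : BandwidthBound n m b c C)
    (hy : Tendsto (fun K => fifthRoot n m K ^ 4 / numSubjects n K) atTop atTop) :
    Tendsto (fun K => √(totalSize n m 1 K ^ 2 / totalSize n m 2 K)
      * (bandSum n m b 2 K / totalSize n m 1 K)) atTop (𝓝 0) := by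
  have h1 : Tendsto (fun K => √(2 * (C ^ 2 * (5 / 2)) ^ 2
      * (fifthRoot n m K ^ 4 / numSubjects n K)⁻¹)) atTop (𝓝 0) := by
    have := (hy.inv_tendsto_atTop.const_mul (2 * (C ^ 2 * (5 / 2)) ^ 2)).sqrt
    simpa using this
  refine squeeze_zero' (Eventually.of_forall fun K => mul_nonneg (Real.sqrt_nonneg _)
    (div_nonneg (hb.bandSum_nonneg _ K) (totalSize_nonneg 1 K))) ?_ h1
  filter_upwards [hs.eventually_sq_totalSize_le hy, eventually_ge_atTop 1] with K hK hK1
  have hN := hs.numSubjects_pos hK1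
  have hS := hs.totalSize_pos hK1
  have hu := hs.fifthRoot_pos hK1
  have hV := hb.bandSum_nonneg 2 K
  refine Real.le_sqrt_of_sq_le ?_
  rw [mul_pow, Real.sq_sqrt (div_nonneg (sq_nonneg _) hK.1.le)]
  -- The bias has order `u ^ (-2)` and the normalisation is at most `√(2 N)`, so the square of the
  -- product is at most a multiple of `N / u ^ 4`.
  have h2 : bandSum n m b 2 K / totalSize n m 1 K
      ≤ C ^ 2 * (5 / 2) * fifthRoot n m K ^ 3 / fifthRoot n m K ^ 5 := by
    rw [← fifthRoot_pow]
    exact div_le_div_of_nonneg_right (hb.bandSum_le hs (p := 2) (by norm_num) (by norm_num) K)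
      (by positivity)
  calc _ ≤ 2 * numSubjects n K
        * (C ^ 2 * (5 / 2) * fifthRoot n m K ^ 3 / fifthRoot n m K ^ 5) ^ 2 :=
        mul_le_mul hK.2 (pow_le_pow_left₀ (by positivity) h2 2) (by positivity) (by positivity)
    _ = _ := by field_simp

/-! ### Limits of the normalised estimate -/

namespace Setting

theorem measurable_onlineMean {L : ℕ} [NeZero L] {η : ℕ → Fin L → ℝ} {J : ℕ → Fin L → Fin L}
    (h : Setting P Q ν n m X f W ζ T ε t (fun K k => chainBandwidth η J K 0 k) c C) (K : ℕ) :
    Measurable (onlineMean n m W T (observation X ζ T ε) η J t K) := by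
  have hX : Measurable fun z : E × ℝ × ℝ => X z.2.1 z.1 :=
    h.process.measurable.comp ((measurable_fst.comp measurable_snd).prodMk measurable_fst)
  rw [show onlineMean n m W T (observation X ζ T ε) η J t K = _ from
    funext fun ω => onlineMean_eq (X := X) (ζ := ζ) (ε := ε) η J K ω rfl]
  have h1 := fun {φ : E × ℝ × ℝ → ℝ} (hφ : Measurable φ) => h.measurable_kernelSum hφ K
  have hY := hX.add (measurable_snd.comp measurable_snd : Measurable fun z : E × ℝ × ℝ => z.2.2)
  exact (((h1 (by fun_prop)).mul (h1 hY)).sub ((h1 (by fun_prop)).mul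
    (h1 (((measurable_fst.comp measurable_snd).sub_const t).mul hY)))).div
    (((h1 (by fun_prop)).mul (h1 (by fun_prop))).sub ((h1 (by fun_prop)).pow_const 2))

/-- Central limit theorem for multiples of the noise average with random coefficients. -/
theorem clt_scaled_noise (h : Setting P Q ν n m X f W ζ T ε t b c C) {c₀ : ℕ → Ω → ℝ}
    (hm : ∀ K, Measurable (c₀ K)) (hc : TendstoInMeasure P c₀ atTop (fun _ => (f t)⁻¹))
    {d : ℕ → ℝ} {w : ℝ} (hw : 0 ≤ w)
    (hd : Tendsto (fun K => d K * √(noiseVar Q ν n m X f W t b K)) atTop (𝓝 (f t * √w)))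
    {Y : ℕ → Ω → ℝ} (hYm : ∀ K, AEMeasurable (Y K) P)
    (hY : ∀ᶠ K in atTop, ∀ ω, Y K ω = d K * (c₀ K ω
      * kernelSum n m ζ T ε W t b (fun z => fluct Q X t z.1 + z.2.2) K ω)) :
    TendstoInDistribution Y atTop id (fun _ => P) (gaussianReal 0 w.toNNReal) := by
  have hf := h.density.pos h.mem
  -- In the degenerate case the noise sum is almost surely zero and the hypothesis on `d` forces `w
  -- = 0`. Otherwise Slutsky's theorem applies with coefficient limit `(1 / f t) * (f t * √w)`.
  rcases (add_nonneg h.covFn_nonneg (variance_nonneg id ν)).eq_or_lt with h0 | hτ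
  · have hγ : covFn Q X t t = 0 := by
      linarith [h.covFn_nonneg, variance_nonneg id ν]
    have hw0 : w = 0 := by
      have hz : (fun K => d K * √(noiseVar Q ν n m X f W t b K)) = fun _ => 0 := by
        ext K
        rw [noiseVar, ← h0, hγ]
        simp
      rw [hz] at hd
      have := tendsto_nhds_unique hd tendsto_const_nhds
      rcases mul_eq_zero.1 this with h1 | h1
      · exact absurd h1 hf.ne'
      · exact (Real.sqrt_eq_zero hw).1 h1
    subst hw0
    have hzero : TendstoInDistribution (fun (_ : ℕ) (_ : Ω) => (0 : ℝ)) atTop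
        (fun _ : Ω => (0 : ℝ)) (fun _ => P) P := tendstoInDistribution_const aemeasurable_const
    refine tendstoInDistribution_congr_law hzero aemeasurable_id ?_ hYm ?_
    · rw [Measure.map_id, Real.toNNReal_zero, gaussianReal_zero_var, Measure.map_const]
      simp
    · filter_upwards [hY] with K hK
      filter_upwards [h.noise_eq_zero h0.symm K] with ω hω
      rw [hK, hω]
      simp
  · have h1 := tendstoInDistribution_mul_gaussian (P := P) (v := 1) (a := (f t)⁻¹ * (f t * √w))
      (Y := Y) zero_le_one (by simpa using h.clt_noise hτ)
      (tendstoInMeasure_mul hc (tendstoInMeasure_of_tendsto hd))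
      (fun K => ((hm K).mul_const _).aemeasurable) hYm ?_
    · rwa [inv_mul_cancel_left₀ hf.ne', Real.sq_sqrt hw, mul_one] at h1
    · filter_upwards [hY, eventually_ge_atTop 1] with K hK hK1
      refine Eventually.of_forall fun ω => ?_
      have hv := Real.sqrt_pos.2 (h.noiseVar_pos hτ hK1)
      rw [hK]
      field_simp

/-- The second factor in the inner product is the variance `Γ` of the theorem; `f t ^ 2` cancels
against the limit of the random coefficient. -/
theorem noiseVar_eq (h : Setting P Q ν n m X f W ζ T ε t b c C) {K : ℕ} (hK : 1 ≤ K) :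
    noiseVar Q ν n m X f W t b K = f t ^ 2 * (bandSum n m b (-1) K
      * (kernelR W * ((covFn Q X t t + variance id ν) / f t)
        + covFn Q X t t * (totalSize n m 2 K / bandSum n m b (-1) K))) := by
  have hf := h.density.pos h.mem
  have hV := h.band.bandSum_neg_one_pos h.size hK
  rw [noiseVar]
  field_simp

end Setting

end

end OnlineFDA
end

/-! ### The limit theorem and its three regimes -/

theorem theorem1
    {Ω E : Type*} [MeasurableSpace Ω] [MeasurableSpace E]
    -- the underlying probability space, the law of a trajectory, the law of the noise
    (P : Measure Ω) [IsProbabilityMeasure P]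
    (Q : Measure E) [IsProbabilityMeasure Q]
    (ν : Measure ℝ) [IsProbabilityMeasure ν]
    -- sample sizes
    (n : ℕ → ℕ) (m : ℕ → ℕ → ℕ) (hsize : SizeCond n m)
    -- process, density, noise, kernel
    (X : ℝ → E → ℝ) (hX : ProcessCond Q X)
    (f : ℝ → ℝ) (hf : DensityCond f)
    (hν : NoiseCond ν)
    (W : ℝ → ℝ) (hW : KernelCond W)
    -- the sample
    (ζ : ℕ → ℕ → Ω → E) (T ε : ℕ → ℕ → ℕ → Ω → ℝ)
    (hsample : SamplingCond P Q f ν ζ T ε)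
    -- bandwidths, candidates, selection rule
    {L : ℕ} [NeZero L] (h : ℕ → ℝ) (η : ℕ → Fin L → ℝ) (J : ℕ → Fin L → Fin L)
    (h_pos : ∀ K, 1 ≤ K → 0 < h K)
    (h_rate : ∃ C : ℝ, 0 < C ∧
      Tendsto (fun K => h K / totalSize n m 1 K ^ (-(1 / 5) : ℝ)) atTop (𝓝 C))
    (η_first : ∀ K, 1 ≤ K → η K 0 = h K)
    (η_anti : ∀ K, 1 ≤ K → StrictAnti (η K))
    (η_lower : ∃ c : ℝ, 0 < c ∧ ∀ K, 1 ≤ K → ∀ l, c * h K ≤ η K l)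
    (hJ : IsClosestSelection n m η J)
    -- the interior point
    (t : ℝ) (ht : t ∈ Ioo (0 : ℝ) 1)
    -- abbreviations
    (est : ℕ → Ω → ℝ)
    (hest : est = onlineMean n m W T (observation X ζ T ε) η J t)
    (S₁ S₂ N mbar ρneg ρtwo : ℕ → ℝ)
    (hS₁ : S₁ = totalSize n m 1) (hS₂ : S₂ = totalSize n m 2)
    (hN : N = numSubjects n) (hmbar : mbar = avgSize n m 1)
    (hρneg : ρneg = rho n m η J (-1)) (hρtwo : ρtwo = rho n m η J 2)
    (γtt σsq Γ₀ : ℝ)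
    (hγtt : γtt = covFn Q X t t) (hσsq : σsq = variance id ν)
    (hΓ₀ : Γ₀ = kernelR W * ((γtt + σsq) / f t))
    (Γ : ℕ → ℝ) (hΓ : Γ = fun K => Γ₀ + γtt * (S₂ K / (S₁ K * ρneg K))) :
    -- a remainder that is `o_p(ρ_2)`
    ∃ R : ℕ → Ω → ℝ, TendstoInMeasure P (fun K ω => R K ω / ρtwo K) atTop (fun _ => 0) ∧
    ∃ Z : ℕ → Ω → ℝ,
      (∀ K ω, Z K ω = √(S₁ K / ρneg K) *
        (est K ω - meanFn Q X t
          - 1 / 2 * kernelAlpha W * iteratedDeriv 2 (meanFn Q X) t * ρtwo K + R K ω)) ∧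
      -- asymptotic normality with variance `Γ K`
      (0 < γtt + σsq →
        TendstoInDistribution (fun K ω => Z K ω / √(Γ K)) atTop id (fun _ => P)
          (gaussianReal 0 1)) ∧
      -- the degenerate case, in which `Γ K = 0`
      (γtt + σsq = 0 →
        TendstoInDistribution Z atTop id (fun _ => P) (gaussianReal 0 0)) ∧
      -- sparse regime
      (Tendsto (fun K => mbar K / N K ^ (1 / 4 : ℝ)) atTop (𝓝 0) →
        Tendsto Γ atTop (𝓝 Γ₀) ∧
        TendstoInDistribution Z atTop id (fun _ => P) (gaussianReal 0 Γ₀.toNNReal)) ∧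
      -- moderately dense regime
      (∀ C : ℝ, 0 < C → Tendsto (fun K => mbar K / N K ^ (1 / 4 : ℝ)) atTop (𝓝 C) →
        (fun K => S₂ K / (S₁ K * ρneg K)) =Θ[atTop] (fun _ => (1 : ℝ)) ∧
        ∀ C₁ : ℝ, Tendsto (fun K => S₂ K / (S₁ K * ρneg K)) atTop (𝓝 C₁) →
          0 < C₁ ∧ Tendsto Γ atTop (𝓝 (Γ₀ + C₁ * γtt)) ∧
          TendstoInDistribution Z atTop id (fun _ => P)
            (gaussianReal 0 (Γ₀ + C₁ * γtt).toNNReal)) ∧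
      -- ultra dense regime
      (Tendsto (fun K => mbar K / N K ^ (1 / 4 : ℝ)) atTop atTop →
        (fun K => S₁ K ^ 2 / S₂ K) =Θ[atTop] N ∧
        TendstoInDistribution (fun K ω => √(S₁ K ^ 2 / S₂ K) * (est K ω - meanFn Q X t))
          atTop id (fun _ => P) (gaussianReal 0 γtt.toNNReal)) := by
  subst hest hS₁ hS₂ hN hmbar hρneg hρtwo hΓ
  obtain ⟨c, C, hb⟩ := exists_bandwidthBound hsize J h_pos h_rate η_first η_anti η_lower
  have hS : Setting P Q ν n m X f W ζ T ε t (fun K k => chainBandwidth η J K 0 k) c C :=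
    ⟨hsize, hX, hf, hν, hW, hsample, hb, ht⟩
  obtain ⟨c₀, hm, hc, hrem⟩ := hS.exists_expansion
  set b : ℕ → ℕ → ℝ := fun K k => chainBandwidth η J K 0 k
  set noise : ℕ → Ω → ℝ := kernelSum n m ζ T ε W t b (fun z => fluct Q X t z.1 + z.2.2)
  set est : ℕ → Ω → ℝ := onlineMean n m W T (observation X ζ T ε) η J t
  have hρ : ∀ (r : ℤ) K, rho n m η J r K = bandSum n m b r K / totalSize n m 1 K :=
    fun r K => rho_eq_bandSum_div η J r K
  have hft := hf.pos ht
  have hγ0 : 0 ≤ γtt := hγtt ▸ hS.covFn_nonneg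
  have hσ0 : 0 ≤ σsq := hσsq ▸ variance_nonneg _ _
  have hΓ₀0 : 0 ≤ Γ₀ := by
    rw [hΓ₀]
    exact mul_nonneg hW.kernelR_pos.le (div_nonneg (add_nonneg hγ0 hσ0) hft.le)
  have hS1 : ∀ K, 1 ≤ K → 0 < totalSize n m 1 K := fun K hK => hsize.totalSize_pos hK
  have hV : ∀ K, 1 ≤ K → 0 < bandSum n m b (-1) K := fun K hK => hb.bandSum_neg_one_pos hsize hK
  have hratio : ∀ᶠ K in atTop, totalSize n m 2 K / bandSum n m b (-1) K
      = totalSize n m 2 K / (totalSize n m 1 K * rho n m η J (-1) K) := by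
    filter_upwards [eventually_ge_atTop 1] with K hK
    rw [hρ, mul_div_cancel₀ _ (hS1 K hK).ne']
  set Γ : ℕ → ℝ := fun K =>
    Γ₀ + γtt * (totalSize n m 2 K / (totalSize n m 1 K * rho n m η J (-1) K)) with hΓ
  have hΓ0 : ∀ K, 0 ≤ Γ K := fun K => add_nonneg hΓ₀0 (mul_nonneg hγ0 (div_nonneg
    (totalSize_nonneg 2 K) (mul_nonneg (totalSize_nonneg 1 K) (by
      rw [hρ]
      exact div_nonneg (hb.bandSum_nonneg _ K) (totalSize_nonneg 1 K)))))
  have hv : ∀ᶠ K in atTop, noiseVar Q ν n m X f W t b K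
      = f t ^ 2 * (bandSum n m b (-1) K * Γ K) := by
    filter_upwards [hratio, eventually_ge_atTop 1] with K hK hK1
    rw [hS.noiseVar_eq hK1, hK, ← hγtt, ← hσsq, ← hΓ₀]
  have hsqrt : ∀ᶠ K in atTop, √(noiseVar Q ν n m X f W t b K)
      = f t * (√(bandSum n m b (-1) K) * √(Γ K)) := by
    filter_upwards [hv, eventually_ge_atTop 1] with K hK hK1
    rw [hK, Real.sqrt_mul (sq_nonneg _), Real.sqrt_sq hft.le, Real.sqrt_mul (hV K hK1).le]
  have hpow : ∀ {l : Filter ℝ}, Tendsto (fun K => (avgSize n m 1 K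
      / numSubjects n K ^ (1 / 4 : ℝ)) ^ (4 / 5 : ℝ)) atTop l →
      Tendsto (fun K => fifthRoot n m K ^ 4 / numSubjects n K) atTop l := fun hl =>
    hl.congr' (by
      filter_upwards [eventually_ge_atTop 1] with K hK using hsize.rpow_avgSize_div hK)
  have hnoise : ∀ K, Measurable (noise K) := fun K =>
    hS.measurable_kernelSum ((hS.measurable_fluct_at.comp measurable_fst).add
      (measurable_snd.comp measurable_snd)) K
  set Z : ℕ → Ω → ℝ := fun K ω => √(totalSize n m 1 K / rho n m η J (-1) K)
    * (c₀ K ω * (noise K ω / totalSize n m 1 K)) with hZ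
  have hZm : ∀ K, Measurable (Z K) := fun K =>
    ((hm K).mul ((hnoise K).div_const _)).const_mul _
  -- Since `ρ_{-1}` is the band sum divided by `S_1`, the total size cancels and the normalisation
  -- of the noise sum is the root of the band sum.
  have hZeq : ∀ᶠ K in atTop, ∀ ω, Z K ω
      = (√(bandSum n m b (-1) K))⁻¹ * (c₀ K ω * noise K ω) := by
    filter_upwards [eventually_ge_atTop 1] with K hK ω
    have h1 := hS1 K hK
    have h2 := Real.sqrt_pos.2 (hV K hK)
    rw [hZ]
    simp only
    rw [hρ, div_div_eq_mul_div, ← sq, Real.sqrt_div (sq_nonneg _), Real.sqrt_sq h1.le]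
    field_simp
  have hZlim : ∀ w : ℝ, Tendsto Γ atTop (𝓝 w) →
      TendstoInDistribution Z atTop id (fun _ => P) (gaussianReal 0 w.toNNReal) := by
    intro w hw
    refine hS.clt_scaled_noise hm hc (ge_of_tendsto' hw hΓ0) ?_
      (fun K => (hZm K).aemeasurable) hZeq
    refine (hw.sqrt.const_mul (f t)).congr' ?_
    filter_upwards [hsqrt, eventually_ge_atTop 1] with K hK hK1
    have h2 := Real.sqrt_pos.2 (hV K hK1)
    rw [hK]
    field_simp
  have hΓlim : ∀ r : ℝ, Tendsto (fun K => totalSize n m 2 K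
      / (totalSize n m 1 K * rho n m η J (-1) K)) atTop (𝓝 r) →
      Tendsto Γ atTop (𝓝 (Γ₀ + r * γtt)) := fun r hr => by
    rw [mul_comm]
    exact (hr.const_mul γtt).const_add Γ₀
  -- The remainder is minus the error of the expansion, so that adding it leaves exactly the scaled
  -- noise average `Z`, for every `K` and `ω`.
  refine ⟨fun K ω => -(est K ω - meanFn Q X t
      - 1 / 2 * kernelAlpha W * iteratedDeriv 2 (meanFn Q X) t * rho n m η J 2 K
      - c₀ K ω * (noise K ω / totalSize n m 1 K)), ?_, Z, fun K ω => ?_, fun hτ => ?_, fun hτ => ?_,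
    fun hx => ?_, fun r hr hx => ?_, fun hx => ?_⟩
  · refine tendstoInMeasure_zero_of_close hrem 1 (Eventually.of_forall fun K ω => ?_)
    rw [neg_div, abs_neg, one_mul]
  · rw [hZ]
    ring
  · have hΓpos : ∀ K, 0 < Γ K := fun K => by
      have h1 : 0 < Γ₀ := by
        rw [hΓ₀]
        exact mul_pos hW.kernelR_pos (div_pos hτ hft)
      have h2 := hΓ0 K
      have h3 : 0 ≤ totalSize n m 2 K / (totalSize n m 1 K * rho n m η J (-1) K) := by
        rw [hρ]
        exact div_nonneg (totalSize_nonneg 2 K) (mul_nonneg (totalSize_nonneg 1 K)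
          (div_nonneg (hb.bandSum_nonneg _ K) (totalSize_nonneg 1 K)))
      exact add_pos_of_pos_of_nonneg h1 (mul_nonneg hγ0 h3)
    have h1 := hS.clt_scaled_noise (w := 1) hm hc
      (d := fun K => (√(bandSum n m b (-1) K))⁻¹ / √(Γ K)) zero_le_one ?_
      (Y := fun K ω => Z K ω / √(Γ K)) (fun K => ((hZm K).div_const _).aemeasurable) ?_
    · simpa using h1
    · rw [Real.sqrt_one, mul_one]
      refine tendsto_const_nhds.congr' ?_
      filter_upwards [hsqrt, eventually_ge_atTop 1] with K hK hK1
      have h2 := Real.sqrt_pos.2 (hV K hK1)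
      have h3 := Real.sqrt_pos.2 (hΓpos K)
      rw [hK]
      field_simp
    · filter_upwards [hZeq] with K hK ω
      rw [hK]
      ring
  · have h1 : Γ = fun _ => 0 := by
      have : γtt = 0 := by linarith
      ext K
      rw [hΓ]
      simp only
      rw [hΓ₀, hτ, this]
      simp
    have h2 := hZlim 0 (by rw [h1]; exact tendsto_const_nhds)
    rwa [Real.toNNReal_zero] at h2
  · have hy : Tendsto (fun K => fifthRoot n m K ^ 4 / numSubjects n K) atTop (𝓝 0) := hpow (by
      have := hx.rpow_const (p := (4 / 5 : ℝ)) (Or.inr (by norm_num))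
      rwa [Real.zero_rpow (by norm_num)] at this)
    have h1 := hΓlim 0 ((hb.tendsto_ratio_zero hsize hy).congr' hratio)
    rw [zero_mul, add_zero] at h1
    exact ⟨h1, hZlim _ h1⟩
  · have hy : Tendsto (fun K => fifthRoot n m K ^ 4 / numSubjects n K) atTop
        (𝓝 (r ^ (4 / 5 : ℝ))) := hpow (hx.rpow_const (Or.inr (by norm_num)))
    have hr' : 0 < r ^ (4 / 5 : ℝ) := Real.rpow_pos_of_pos hr _
    refine ⟨(EventuallyEq.isTheta (EventuallyEq.symm hratio)).trans (hb.isTheta_ratio hsize hr' hy),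
      fun C₁ hC₁ => ⟨hb.ratio_limit_pos hsize hr' hy (hC₁.congr' ?_), hΓlim C₁ hC₁,
      hZlim _ (hΓlim C₁ hC₁)⟩⟩
    filter_upwards [hratio] with K hK using hK.symm
  · have hy : Tendsto (fun K => fifthRoot n m K ^ 4 / numSubjects n K) atTop atTop :=
      hpow ((tendsto_rpow_atTop (by norm_num)).comp hx)
    refine ⟨hsize.isTheta_numSubjects hy, ?_⟩
    have hpos := hsize.eventually_sq_totalSize_le hy
    have hestm : ∀ K, Measurable (est K) := fun K => hS.measurable_onlineMean K
    set s : ℕ → ℝ := fun K => √(totalSize n m 1 K ^ 2 / totalSize n m 2 K) with hs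
    have h1 : TendstoInDistribution
        (fun K ω => s K * (c₀ K ω * (noise K ω / totalSize n m 1 K))) atTop id (fun _ => P)
        (gaussianReal 0 γtt.toNNReal) := by
      refine hS.clt_scaled_noise (d := fun K => (√(totalSize n m 2 K))⁻¹) hm hc hγ0 ?_
        (fun K => (((hm K).mul ((hnoise K).div_const _)).const_mul _).aemeasurable) ?_
      -- Relative to `S_2`, the variance due to single measurements carries the inverse ratio, which
      -- vanishes here. Only the variability between trajectories remains.
      · have h2 := ((hb.tendsto_ratio_atTop hsize hy).inv_tendsto_atTop.const_mul Γ₀).add_const γtt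
        rw [mul_zero, zero_add] at h2
        refine (h2.sqrt.const_mul (f t)).congr' ?_
        filter_upwards [hv, hratio, hpos, eventually_ge_atTop 1] with K hvK hrK hpK hK
        have h3 := hV K hK
        have h4 := hpK.1
        rw [hvK, ← Real.sqrt_inv, ← Real.sqrt_mul (inv_nonneg.2 h4.le)]
        rw [show (totalSize n m 2 K)⁻¹ * (f t ^ 2 * (bandSum n m b (-1) K * Γ K))
          = f t ^ 2 * (Γ₀ * (totalSize n m 2 K / bandSum n m b (-1) K)⁻¹ + γtt) by
            rw [hΓ]
            simp only
            rw [← hrK]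
            field_simp, Real.sqrt_mul (sq_nonneg _), Real.sqrt_sq hft.le]
        rfl
      · filter_upwards [hpos, eventually_ge_atTop 1] with K hpK hK ω
        have h3 := hS1 K hK
        have h4 := Real.sqrt_pos.2 hpK.1
        rw [hs]
        simp only
        rw [Real.sqrt_div (sq_nonneg _), Real.sqrt_sq h3.le]
        field_simp
        rfl
    -- Apart from the noise average, the error is `ρ_2` times a variable that converges in
    -- probability to the bias constant. In this regime the normalisation times `ρ_2` tends to zero,
    -- so no bias correction is needed.
    have h2 := tendstoInMeasure_mul (tendstoInMeasure_of_tendsto (P := P)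
      (hb.tendsto_sqrt_mul_rho_two hsize hy)) (tendstoInMeasure_add hrem
      (tendstoInMeasure_of_tendsto (P := P) (tendsto_const_nhds
        (x := 1 / 2 * kernelAlpha W * iteratedDeriv 2 (meanFn Q X) t))))
    rw [zero_mul] at h2
    refine tendstoInDistribution_add_zero h1 h2
      (fun K => (((hestm K).sub_const _).const_mul _).aemeasurable) ?_
    filter_upwards [eventually_ge_atTop 1] with K hK
    refine Eventually.of_forall fun ω => ?_
    have h3 := hS1 K hK
    have h4 := hb.bandSum_two_pos hsize hK
    rw [← hρ]
    have h5 : 0 < rho n m η J 2 K := by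
      rw [hρ]
      exact div_pos h4 h3
    field_simp
    ring
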